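/- **Notation.** For $f,g:\mathbb R^3\to\mathbb C$ put $\langle f,g\rangle=\mathrm{Re}\int_{\mathbb R^3} f\bar g\,dx$. Identify $\mathbb C=\mathbb R^2$, let $J$ denote multiplication by $-i$ (so $e^{J\theta}=e^{-i\theta}$), and put $\Diamond_a=J\partial_{x_a}$ for $a=1,2,3$, $\Diamond_4=1$, $\Pi_j(u)=\frac12\langle\Diamond_j u,u\rangle$, $\Pi=(\Pi_1,\dots,\Pi_4)$, $\langle t\rangle=(1+t^2)^{1/2}$. For $\tau=(D,-\vartheta)$ with $D\in\mathbb R^3$ let $e^{J\tau\cdot\Diamond}u(x)=e^{i\vartheta}u(x-D)$; here $\vartheta$ matters only modulo $2\pi$, and $\tau$ is regarded as an element of $\mathbb T:=\mathbb R^3\times(\mathbb R/2\pi\mathbb Z)$. Let $\|u\|_{\Sigma_n}^2=\sum_{|\alpha|\le n}(\|x^\alpha u\|_{L^2}^2+\|\partial_x^\alpha u\|_{L^2}^2)$, and let $B_X(x,r)$ be the open ball of radius $r$ about $x$ in $X$. **Assumptions.** (i) $V\in\mathcal S(\mathbb R^3,\mathbb R)$; the set of eigenvalues of $-\Delta+V$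 is $\{e_0\}$ with $e_0<0$; and $0$ is not a resonance, that is, if $u\in C^\infty$, $(-\Delta+V)u=0$ and $|u(x)|\le C|x|^{-1}$ for some $C$, then $u=0$. Let $\phi_0\in\ker(-\Delta+V-e_0)$ be positive with $\|\phi_0\|_{L^2}=1$. (ii) $\beta\in C^\infty(\mathbb R,\mathbb R)$, $\beta(0)=0$, and there is $r\in(1,5)$ such that for every $k\ge0$ there is $C_k$ with $|\frac{d^k}{ds^k}\beta(s^2)|\le C_k|s|^{r-k-1}$ for $|s|\ge1$. (iii) $\mathcal O\subset(0,\infty)$ is an open interval; for $\omega\in\mathcal O$, $\phi_\omega$ is a positive radial solution of $-\Delta\phi_\omega+\omega\phi_\omega+\beta(\phi_\omega^2)\phi_\omega=0$ on $\mathbb R^3$; $\omega\mapsto\phi_\omega$ is in $C^\infty(\mathcal O,\Sigma_n)$ for every $n$; and $\frac{d}{d\omega}\|\phi_\omega\|_{L^2}^2>0$ on $\mathcal O$. Let $\mathcal P\subset\mathbb R^4$ be the image of the (injective) map $(\omega,v)\mapsto p(\omega,v):=\Pi(e^{-\frac12Jv\cdot x}\phi_\omega)$ on $\mathcal O\times\mathbb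 R^3$, and let $\Phi_p=e^{-\frac12Jv\cdot x}\phi_\omega$ for $p=p(\omega,v)$. **Statement.** There are $a>0$ and a family of small bound states $(Q_w,E_w)$, $w=w_1+iw_2\in\mathbb C$, $|w|<a$, depending only on $V,\beta,\phi_0$, with $Q\in C^\infty(B_{\mathbb C}(0,a),H^2)$, $E\in C^\infty(B_{\mathbb C}(0,a),\mathbb R)$, $$(-\Delta+V)Q_w+\beta(|Q_w|^2)Q_w=E_wQ_w,\quad Q_w=w\phi_0+q_w,\quad \int q_w\,\phi_0\,dx=0,\quad iQ_w=-w_2\partial_{w_1}Q_w+w_1\partial_{w_2}Q_w,$$ $|E_w-e_0|\le C|w|^2$ and $\|q_w\|_{H^2}\le C|w|^3$, such that the following holds. Fix $\omega_1\in\mathcal O$, $\varepsilon_1>0$ and $M_0>0$, and let $\varkappa=p(\omega_1,0)$, so that $\Phi_\varkappa=\phi_{\omega_1}$. Then there are $\varepsilon_2>0$ and $\delta>0$ such that for all $\mathbf v,y_0\in\mathbb R^3$ with $|\mathbf v|>M_0$ and $$\sup_{e\in S^2,\ \mathrm{dist}_{S^2}(e,\mathbf v/|\mathbf v|)\le\varepsilon_1}\int_0^\infty\bigl(1+\bigl||\mathbf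 v|\,e\,t+y_0\bigr|^2\bigr)^{-1}dt<\varepsilon_2$$ the following is true, both for $c=1$ and for $c=J$. Let $$B(\varepsilon_2)=\{(t,u)\in[0,\infty)\times H^1:\ u\in e^{J\tau_0\cdot\Diamond}B_{H^1}(\Phi_\varkappa,\varepsilon_2)\ \text{for some}\ \tau_0\in B_{\mathbb R^3}(0,\varepsilon_2\langle t\rangle)\times\mathbb R/2\pi\mathbb Z\},$$ $$\tilde R(t,u,\tau,p,w)=u-e^{J\tau\cdot\Diamond}\Phi_p-e^{J(\frac12\mathbf v\cdot x+\frac t4|\mathbf v|^2)}Q_w(\cdot+t\mathbf v+y_0).$$ There is $(\tau,p,w)\in C^\infty(B(\varepsilon_2);\mathbb T\times\mathbb R^4\times\mathbb C)$, with $p\in\mathcal P$ and $|w|<a$, such that on $B(\varepsilon_2)$, with $\tau=\tau(t,u)$, $p=p(t,u)$, $w=w(t,u)$ and $\tilde R=\tilde R(t,u,\tau,p,w)$, $$\langle\tilde R,e^{J\tau\cdot\Diamond}J^{-1}\partial_{p_j}\Phi_p\rangle=\langle\tilde R,e^{J\tau\cdot\Diamond}\Diamond_j\Phi_p\rangle=0\quad(j=1,2,3,4),$$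 $$\bigl\langle\tilde R,\ c\,e^{J(\frac12\mathbf v\cdot x+\frac t4|\mathbf v|^2)}\partial_{w_j}Q_w(\cdot+t\mathbf v+y_0)\bigr\rangle=0\quad(j=1,2).$$ For all $t\ge0$ and $\tau_0\in B_{\mathbb R^3}(0,\varepsilon_2\langle t\rangle)\times\mathbb R/2\pi\mathbb Z$, at the point $(t,e^{J\tau_0\cdot\Diamond}\phi_{\omega_1})$ one has $\tau=\tau_0$, $p=\varkappa$, $w=0$. Finally, whenever $t\ge0$, $\tau_0\in B_{\mathbb R^3}(0,\varepsilon_2\langle t\rangle)\times\mathbb R/2\pi\mathbb Z$ and $u\in e^{J\tau_0\cdot\Diamond}B_{H^1}(\Phi_\varkappa,\varepsilon_2)$, the triple $(\tau,p,w)(t,u)$ lies within $\delta$ of $(\tau_0,\varkappa,0)$ in each of the components $D$, $e^{i\vartheta}$, $p$, $w$, and it is the only triple within $\delta$ of $(\tau_0,\varkappa,0)$ in this sense, with $p\in\mathcal P$ and $|w|<a$, that satisfies these ten equations. -/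

import Mathlib

open MeasureTheory Set
open scoped SchwartzMap ENNReal LineDeriv Laplacian ComplexConjugate

noncomputable section

namespace SolitonPotential

/-- Physical space `ℝ³`. -/
abbrev E3 : Type := EuclideanSpace ℝ (Fin 3)

/-- The space `ℝ⁴` of the parameters `p`. -/
abbrev E4 : Type := EuclideanSpace ℝ (Fin 4)

/-- `L²(ℝ³, ℂ)`. -/
abbrev L2 : Type := Lp ℂ 2 (volume : Measure E3)

/-- The `a`-th vector of the standard basis of `ℝ³`. -/
def stdVec (a : Fin 3) : E3 := EuclideanSpace.single a 1

/-! ### Function spaces -/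

/-- The multi-indices `α ∈ ℕ³` with `|α| ≤ n`. -/
abbrev MultiIdx (n : ℕ) : Type := {α : Fin 3 → Fin (n + 1) // ∑ i, (α i : ℕ) ≤ n}

/-- The multi-index `0`. -/
def MultiIdx.zero (n : ℕ) : MultiIdx n := ⟨fun _ => 0, by simp⟩

/-- The multi-index of the second derivative `∂_a²`. -/
def MultiIdx.double (a : Fin 3) : MultiIdx 2 :=
  ⟨Pi.single a 2, by fin_cases a <;> decide⟩

/-- `∂^α = ∂₁^{α₁} ∂₂^{α₂} ∂₃^{α₃}` on tempered distributions. -/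
def partialOp {n : ℕ} (α : MultiIdx n) : 𝓢'(E3, ℂ) →L[ℂ] 𝓢'(E3, ℂ) :=
  LineDeriv.lineDerivOpCLM ℂ 𝓢'(E3, ℂ) (stdVec 0) ^ (α.1 0 : ℕ) *
  LineDeriv.lineDerivOpCLM ℂ 𝓢'(E3, ℂ) (stdVec 1) ^ (α.1 1 : ℕ) *
  LineDeriv.lineDerivOpCLM ℂ 𝓢'(E3, ℂ) (stdVec 2) ^ (α.1 2 : ℕ)

/-- An element of `L²` as a tempered distribution. -/
def toTD : L2 →L[ℂ] 𝓢'(E3, ℂ) := Lp.toTemperedDistributionCLM ℂ (volume : Measure E3) 2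

/-- `g ∈ L²` is the weak derivative `∂^α u` of `u ∈ L²`. -/
def IsWeakDeriv {n : ℕ} (α : MultiIdx n) (u g : L2) : Prop := toTD g = partialOp α (toTD u)

lemma IsWeakDeriv.zero {n : ℕ} (α : MultiIdx n) : IsWeakDeriv α 0 0 := by
  simp [IsWeakDeriv]

lemma IsWeakDeriv.add {n : ℕ} {α : MultiIdx n} {u g u' g' : L2} (h : IsWeakDeriv α u g)
    (h' : IsWeakDeriv α u' g') : IsWeakDeriv α (u + u') (g + g') := by
  simp only [IsWeakDeriv, map_add] at *
  rw [h, h']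

lemma IsWeakDeriv.smul {n : ℕ} {α : MultiIdx n} {u g : L2} (c : ℂ) (h : IsWeakDeriv α u g) :
    IsWeakDeriv α (c • u) (c • g) := by
  simp only [IsWeakDeriv, map_smul] at *
  rw [h]

/-- The Sobolev space `H^n(ℝ³, ℂ)`. An element is the family `(∂^α u)_{|α| ≤ n}` of the weak
derivatives in `L²` of a function `u`; the norm inherited from the `ℓ²`-product is
`‖u‖² = ∑_{|α| ≤ n} ‖∂^α u‖²_{L²}`. -/
def Sob (n : ℕ) : Submodule ℂ (PiLp 2 fun _ : MultiIdx n => L2) where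
  carrier := {U | ∀ α, IsWeakDeriv α (U (MultiIdx.zero n)) (U α)}
  zero_mem' := fun α => IsWeakDeriv.zero α
  add_mem' := fun h h' α => (h α).add (h' α)
  smul_mem' := fun c _ h α => (h α).smul c

/-- The function `u` underlying an element of `H^n`. -/
def sobFn {n : ℕ} (U : Sob n) : E3 → ℂ := U.1 (MultiIdx.zero n)

/-- The Laplacian `Δu = ∑_a ∂_a² u ∈ L²` of `u ∈ H²`. -/
def sobLap (U : Sob 2) : L2 := ∑ a : Fin 3, U.1 (MultiIdx.double a)

/-- The monomial `x^α`. -/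
def monomial {n : ℕ} (α : MultiIdx n) (x : E3) : ℂ := ∏ i, (x i : ℂ) ^ (α.1 i : ℕ)

/-- The weighted space `Σ_n` with
`‖u‖² = ∑_{|α| ≤ n} (‖x^α u‖²_{L²} + ‖∂^α u‖²_{L²})`. An element is the family of all the
functions `x^α u` (index `(false, α)`) and `∂^α u` (index `(true, α)`), all in `L²`. -/
def Sig (n : ℕ) : Submodule ℂ (PiLp 2 fun _ : Bool × MultiIdx n => L2) where
  carrier := {U | (∀ α, ∀ᵐ x, U (false, α) x = monomial α x * U (true, MultiIdx.zero n) x) ∧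
    ∀ α, IsWeakDeriv α (U (true, MultiIdx.zero n)) (U (true, α))}
  zero_mem' := by
    refine ⟨fun α => ?_, fun α => IsWeakDeriv.zero α⟩
    filter_upwards [Lp.coeFn_zero ℂ 2 (volume : Measure E3)] with x hx
    simp
  add_mem' := by
    rintro U W ⟨h1, h2⟩ ⟨h1', h2'⟩
    refine ⟨fun α => ?_, fun α => (h2 α).add (h2' α)⟩
    filter_upwards [h1 α, h1' α, Lp.coeFn_add (U (false, α)) (W (false, α)),
      Lp.coeFn_add (U (true, MultiIdx.zero n)) (W (true, MultiIdx.zero n))] with x a b c d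
    simp only [PiLp.add_apply, c, d, Pi.add_apply, a, b]
    ring
  smul_mem' := by
    rintro c U ⟨h1, h2⟩
    refine ⟨fun α => ?_, fun α => (h2 α).smul c⟩
    filter_upwards [h1 α, Lp.coeFn_smul c (U (false, α)),
      Lp.coeFn_smul c (U (true, MultiIdx.zero n))] with x a b d
    simp only [PiLp.smul_apply, b, d, Pi.smul_apply, a, smul_eq_mul]
    ring

/-- The function `u` underlying an element of `Σ_n`. -/
def sigFn {n : ℕ} (U : Sig n) : E3 → ℂ := U.1 (true, MultiIdx.zero n)

/-- The class in `L²` of a square integrable function (and `0` for all other functions). -/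
def toL2 (f : E3 → ℂ) : L2 :=
  open Classical in if h : MemLp f 2 (volume : Measure E3) then h.toLp f else 0

/-- The real inner product `⟨f, g⟩ = Re ∫ f ḡ`. -/
def pair (f g : E3 → ℂ) : ℝ := (∫ x, f x * conj (g x)).re

/-! ### The potential, the nonlinearity and the small bound states -/

/-- `-Δu + V u = z u` for `u ∈ H²`. -/
def IsEigen (V : 𝓢(E3, ℝ)) (z : ℂ) (u : Sob 2) : Prop :=
  ∀ᵐ x, -(sobLap u x) + (V x : ℂ) * sobFn u x = z * sobFn u x

/-- The potential `V` is trapping with the single eigenvalue `e₀ < 0`, and `0` is not a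
resonance of `-Δ + V`. -/
structure TrappingPotential (V : 𝓢(E3, ℝ)) (e₀ : ℝ) : Prop where
  neg : e₀ < 0
  eigenvalue_iff : ∀ z : ℂ, (∃ u : Sob 2, u ≠ 0 ∧ IsEigen V z u) ↔ z = (e₀ : ℂ)
  not_resonance : ∀ u : E3 → ℂ, ContDiff ℝ (⊤ : ℕ∞) u → (∃ C : ℝ, ∀ x, ‖x‖ * ‖u x‖ ≤ C) →
    (∀ x, -(Δ u x) + (V x : ℂ) * u x = 0) → ∀ x, u x = 0

/-- `φ₀` is the positive, `L²`-normalized eigenfunction of `-Δ + V` for `e₀`. -/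
structure LinearGroundState (V : 𝓢(E3, ℝ)) (e₀ : ℝ) (φ₀ : Sob 2) : Prop where
  eigen : IsEigen V e₀ φ₀
  pos : ∀ᵐ x, 0 < (sobFn φ₀ x).re ∧ (sobFn φ₀ x).im = 0
  norm_eq : ∫ x, ‖sobFn φ₀ x‖ ^ 2 = 1

/-- The hypotheses on the nonlinearity `β`: smooth, `β(0) = 0`, energy subcritical growth. -/
structure Nonlinearity (β : ℝ → ℝ) : Prop where
  smooth : ContDiff ℝ (⊤ : ℕ∞) β
  zero : β 0 = 0
  growth : ∃ r : ℝ, 1 < r ∧ r < 5 ∧ ∀ k : ℕ, ∃ C : ℝ, ∀ v : ℝ, 1 ≤ |v| →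
    |iteratedDeriv k (fun s => β (s ^ 2)) v| ≤ C * |v| ^ (r - k - 1)

/-- `(Q_w, E_w)`, `|w| < a`, is the smooth family of small bound states
`(-Δ + V) Q_w + β(|Q_w|²) Q_w = E_w Q_w` bifurcating from the eigenfunction `φ₀`:
`Q_w = w φ₀ + q_w` with `q_w` orthogonal to `φ₀` over `ℂ`. -/
structure SmallBoundStates (V : 𝓢(E3, ℝ)) (β : ℝ → ℝ) (e₀ : ℝ) (φ₀ : Sob 2)
    (a : ℝ) (Q : ℂ → Sob 2) (E : ℂ → ℝ) : Prop where
  smooth : ContDiffOn ℝ (⊤ : ℕ∞) Q (Metric.ball 0 a)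
  smooth_energy : ContDiffOn ℝ (⊤ : ℕ∞) E (Metric.ball 0 a)
  equation : ∀ w : ℂ, ‖w‖ < a → ∀ᵐ x, -(sobLap (Q w) x) + (V x : ℂ) * sobFn (Q w) x +
    (β (‖sobFn (Q w) x‖ ^ 2) : ℂ) * sobFn (Q w) x = (E w : ℂ) * sobFn (Q w) x
  orthogonal : ∀ w : ℂ, ‖w‖ < a → ∫ x, (sobFn (Q w) x - w * sobFn φ₀ x) * conj (sobFn φ₀ x) = 0
  energy_bound : ∃ C : ℝ, ∀ w : ℂ, ‖w‖ < a → |E w - e₀| ≤ C * ‖w‖ ^ 2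
  remainder_bound : ∃ C : ℝ, ∀ w : ℂ, ‖w‖ < a → ‖Q w - w • φ₀‖ ≤ C * ‖w‖ ^ 3
  gauge : ∀ w : ℂ, ‖w‖ < a →
    Complex.I • Q w = -(w.im • fderiv ℝ Q w 1) + w.re • fderiv ℝ Q w Complex.I

/-! ### The family of ground states and the parameters `p` -/

/-- A family `φ_ω`, `ω ∈ O`, of positive radial solutions of
`-Δφ + ω φ + β(φ²) φ = 0` on an open interval `O`, smooth in `ω` with values in every `Σ_n`,
with `d/dω ‖φ_ω‖²_{L²} > 0`. -/
structure GroundStates (β : ℝ → ℝ) (O : Set ℝ) (φ : ℝ → E3 → ℝ) : Prop where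
  isOpen : IsOpen O
  interval : O.OrdConnected
  subset : O ⊆ Ioi 0
  contDiff : ∀ ω ∈ O, ContDiff ℝ 2 (φ ω)
  pos : ∀ ω ∈ O, ∀ x, 0 < φ ω x
  radial : ∀ ω ∈ O, ∀ x y, ‖x‖ = ‖y‖ → φ ω x = φ ω y
  equation : ∀ ω ∈ O, ∀ x, -(Δ (φ ω) x) + ω * φ ω x + β (φ ω x ^ 2) * φ ω x = 0
  smooth : ∀ n : ℕ, ∃ Ψ : ℝ → Sig n, ContDiffOn ℝ (⊤ : ℕ∞) Ψ O ∧
    ∀ ω ∈ O, ∀ᵐ x, sigFn (Ψ ω) x = (φ ω x : ℂ)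
  mass_deriv_pos : ∀ ω ∈ O, 0 < deriv (fun s => ∫ x, φ s x ^ 2) ω

/-- `◇_a = J ∂_a` for `a = 1, 2, 3` (multiplication by `J` is multiplication by `-i`) and
`◇_4 = 1`. The indices here are `0, 1, 2` and `3`. -/
def diamond (j : Fin 4) (f : E3 → ℂ) : E3 → ℂ :=
  if h : (j : ℕ) < 3 then fun x => -Complex.I * fderiv ℝ f x (stdVec ⟨j, h⟩) else f

/-- The boosted ground state `e^{-J v·x/2} φ_ω = e^{i v·x/2} φ_ω`, for the pair `(ω, v)`. -/
def boosted (φ : ℝ → E3 → ℝ) (z : ℝ × E3) : E3 → ℂ :=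
  fun x => Complex.exp (Complex.I * ((inner ℝ z.2 x / 2 : ℝ) : ℂ)) * (φ z.1 x : ℂ)

/-- The momenta and charge `Π_j(u) = ½ ⟨◇_j u, u⟩`, `j = 1, 2, 3, 4`. -/
def momenta (u : E3 → ℂ) : E4 := WithLp.toLp 2 fun j => (1 / 2) * pair (diamond j u) u

/-- The map `(ω, v) ↦ p = Π(e^{-J v·x/2} φ_ω)`. -/
def paramMap (φ : ℝ → E3 → ℝ) (z : ℝ × E3) : E4 := momenta (boosted φ z)

/-- The set `𝒫` of the parameters `p`. -/
def paramSet (O : Set ℝ) (φ : ℝ → E3 → ℝ) : Set E4 := paramMap φ '' (O ×ˢ univ)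

/-- `Φ_p = e^{-J v·x/2} φ_ω` for `p = p(ω, v) ∈ 𝒫`. -/
def solitonP (O : Set ℝ) (φ : ℝ → E3 → ℝ) (p : E4) : E3 → ℂ :=
  boosted φ (Function.invFunOn (paramMap φ) (O ×ˢ univ) p)

/-- `∂_{p_j} Φ_p`, where `p ↦ Φ_p` is differentiated as a map into `L²`. -/
def dSolitonP (O : Set ℝ) (φ : ℝ → E3 → ℝ) (p : E4) (j : Fin 4) : E3 → ℂ :=
  (fderiv ℝ (fun q => toL2 (solitonP O φ q)) p (EuclideanSpace.single j 1) : L2)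

/-! ### The modulation equations -/

/-- `e^{Jτ·◇} f (x) = e^{iϑ} f(x - D)` for `τ = (D, -ϑ)`. Since `e^{Jτ·◇}` depends on `ϑ` only
modulo `2π`, the phase is recorded as the point `ζ = e^{iϑ}` of the unit circle. -/
def act (D : E3) (ζ : Circle) (f : E3 → ℂ) : E3 → ℂ := fun x => (ζ : ℂ) * f (x - D)

/-- `e^{J(v·x/2 + t|v|²/4)} f(x + t v + y₀)`, where `e^{Jθ} = e^{-iθ}`. -/
def galilei (v y₀ : E3) (t : ℝ) (f : E3 → ℂ) : E3 → ℂ := fun x =>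
  Complex.exp (-Complex.I * ((inner ℝ v x / 2 + t / 4 * ‖v‖ ^ 2 : ℝ) : ℂ)) * f (x + t • v + y₀)

/-- `u ∈ e^{Jτ·◇} B_{H¹}(Φ, ε)`, for a function `Φ` in `H¹` and `τ` given by `(D, ζ)`. -/
def InMovedBall (Φ : E3 → ℂ) (ε : ℝ) (D : E3) (ζ : Circle) (u : Sob 1) : Prop :=
  ∃ Ψ b : Sob 1, (∀ᵐ x, sobFn Ψ x = Φ x) ∧ ‖b - Ψ‖ < ε ∧ ∀ᵐ x, sobFn u x = act D ζ (sobFn b) x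

/-- `⟨t⟩ = (1 + t²)^{1/2}`. -/
def japanese (t : ℝ) : ℝ := Real.sqrt (1 + t ^ 2)

/-- The set of the pairs `(t, u) ∈ [0, ∞) × H¹` with `u ∈ e^{Jτ·◇} B_{H¹}(Φ, ε)` for some
`τ ∈ B_{ℝ³}(0, ε⟨t⟩) × ℝ`. -/
def tube (Φ : E3 → ℂ) (ε : ℝ) : Set (ℝ × Sob 1) :=
  {z | 0 ≤ z.1 ∧ ∃ (D : E3) (ζ : Circle), ‖D‖ < ε * japanese z.1 ∧ InMovedBall Φ ε D ζ z.2}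

/-- The size of the interaction: the supremum of
`∫₀^∞ (1 + | |v| e t + y₀ |²)⁻¹ dt` over the unit vectors `e` at geodesic distance at most `ε₁`
from `v / |v|`. -/
def interaction (ε₁ : ℝ) (v y₀ : E3) : ℝ≥0∞ :=
  ⨆ e ∈ {e : E3 | ‖e‖ = 1 ∧ InnerProductGeometry.angle e (‖v‖⁻¹ • v) ≤ ε₁},
    ∫⁻ t in Ioi (0 : ℝ), ENNReal.ofReal ((1 + ‖(‖v‖ * t) • e + y₀‖ ^ 2)⁻¹)

/-- The remainder
`R̃ = u - e^{Jτ·◇} Φ_p - e^{J(v·x/2 + t|v|²/4)} Q_w(· + t v + y₀)`. -/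
def remainder (O : Set ℝ) (φ : ℝ → E3 → ℝ) (Q : ℂ → Sob 2) (v y₀ : E3) (t : ℝ) (u : Sob 1)
    (D : E3) (ζ : Circle) (p : E4) (w : ℂ) : E3 → ℂ :=
  fun x => sobFn u x - act D ζ (solitonP O φ p) x - galilei v y₀ t (sobFn (Q w)) x

/-- The ten equations `ℱ_j = 𝒢_j = 0` (`j = 1, 2, 3, 4`) and `ℒ_1 = ℒ_2 = 0`, where
`ℱ_j = ⟨R̃, e^{Jτ·◇} J⁻¹ ∂_{p_j} Φ_p⟩`, `𝒢_j = ⟨R̃, e^{Jτ·◇} ◇_j Φ_p⟩` and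
`ℒ_j = ⟨R̃, c e^{J(v·x/2 + t|v|²/4)} ∂_{w_j} Q_w(· + t v + y₀)⟩`. The factor `c` is `1`
or `J = -i`; in the second case `ℒ_j = 0` is symplectic orthogonality. -/
structure ModulationEqs (O : Set ℝ) (φ : ℝ → E3 → ℝ) (Q : ℂ → Sob 2) (c : ℂ) (v y₀ : E3)
    (t : ℝ) (u : Sob 1) (D : E3) (ζ : Circle) (p : E4) (w : ℂ) : Prop where
  F_eq : ∀ j : Fin 4, pair (remainder O φ Q v y₀ t u D ζ p w)
    (act D ζ fun x => Complex.I * dSolitonP O φ p j x) = 0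
  G_eq : ∀ j : Fin 4, pair (remainder O φ Q v y₀ t u D ζ p w)
    (act D ζ (diamond j (solitonP O φ p))) = 0
  L_eq : ∀ h ∈ ({1, Complex.I} : Set ℂ), pair (remainder O φ Q v y₀ t u D ζ p w)
    (fun x => c * galilei v y₀ t (sobFn (fderiv ℝ Q w h)) x) = 0

end SolitonPotential

end

open SolitonPotential

section
open MeasureTheory Set Filter Topology
open scoped SchwartzMap ENNReal LineDeriv Laplacian ComplexConjugate FourierTransform ContDiff BoundedContinuousFunction

noncomputable section

namespace SolitonPotential

/-! ### Bounded multiplication operators -/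

/-- Multiplication by an essentially bounded function on `L²`. -/
def mulOp (g : E3 → ℂ) (hg : MemLp g ∞ (volume : Measure E3)) : L2 →L[ℂ] L2 :=
  (ContinuousLinearMap.mul ℂ ℂ).holderL volume ∞ 2 2 (hg.toLp g)

lemma mulOp_coe (g : E3 → ℂ) (hg : MemLp g ∞ (volume : Measure E3)) (f : L2) :
    mulOp g hg f =ᵐ[volume] fun x => g x * f x := by
  have h := (ContinuousLinearMap.mul ℂ ℂ).coeFn_holder (r := 2) (hg.toLp g) f
  filter_upwards [h, hg.coeFn_toLp] with x h1 h2
  change ((ContinuousLinearMap.mul ℂ ℂ).holder 2 (hg.toLp g) f) x = _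
  rw [h1, h2]
  rfl

lemma memLp_top_of_continuous_bound {g : E3 → ℂ} (hc : Continuous g) (C : ℝ)
    (h : ∀ x, ‖g x‖ ≤ C) : MemLp g ∞ (volume : Measure E3) :=
  memLp_top_of_bound hc.aestronglyMeasurable C (.of_forall h)

/-! ### Distributions attached to locally integrable functions -/

lemma toTD_apply (f : L2) (h : 𝓢(E3, ℂ)) : toTD f h = ∫ x, h x * f x := by
  simp [toTD, Lp.toTemperedDistributionCLM_apply, Lp.toTemperedDistribution_apply]

lemma toTD_injective : Function.Injective toTD := by
  have := Lp.ker_toTemperedDistributionCLM_eq_bot (F := ℂ) (μ := (volume : Measure E3)) (p := 2)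
  exact LinearMap.ker_eq_bot.mp this

lemma l2_locallyIntegrable (f : L2) : LocallyIntegrable f (volume : Measure E3) :=
  (Lp.memLp f).locallyIntegrable (by norm_num)

/-- Locally integrable functions with the same integrals against test functions agree a.e. -/
lemma ae_eq_of_integral_test {f g : E3 → ℂ} (hf : LocallyIntegrable f (volume : Measure E3))
    (hg : LocallyIntegrable g (volume : Measure E3))
    (h : ∀ k : 𝓢(E3, ℂ), HasCompactSupport k → ∫ x, k x * f x = ∫ x, k x * g x) :
    f =ᵐ[volume] g := by
  have key : ∀ᵐ x, (f - g) x = 0 := by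
    apply ae_eq_zero_of_integral_contDiff_smul_eq_zero (hf.sub hg)
    intro k hk hkc
    have hg₁ : HasCompactSupport (Complex.ofRealCLM ∘ k) := hkc.comp_left rfl
    have hg₂ : ContDiff ℝ ∞ (Complex.ofRealCLM ∘ k) := by fun_prop
    have e := h (hg₁.toSchwartzMap hg₂) (by simpa using! hg₁)
    have c : Continuous fun x => (k x : ℂ) := by fun_prop
    have i1 : Integrable (fun x => (k x : ℂ) * f x) :=
      hf.integrable_smul_left_of_hasCompactSupport c hg₁
    have i2 : Integrable (fun x => (k x : ℂ) * g x) :=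
      hg.integrable_smul_left_of_hasCompactSupport c hg₁
    have : ∫ x, ((k x : ℂ) * f x - (k x : ℂ) * g x) = 0 := by
      rw [integral_sub i1 i2, sub_eq_zero]
      simpa using e
    rw [← this]
    congr 1
    ext x
    simp [mul_sub]
  filter_upwards [key] with x hx
  simpa [sub_eq_zero] using hx

lemma locallyIntegrable_mul_continuous {g : E3 → ℂ} (hg : Continuous g) (f : L2) :
    LocallyIntegrable (fun x => g x * f x) (volume : Measure E3) := by
  have := (l2_locallyIntegrable f).locallyIntegrableOn univ
  rw [← locallyIntegrableOn_univ]
  exact this.continuousOn_mul hg.continuousOn isOpen_univ.isLocallyClosed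

/-- `g u` as a distribution, for `g` of temperate growth. -/
lemma smulLeft_toTD_iff {s : E3 → ℂ} (hs : s.HasTemperateGrowth) (u g : L2) :
    toTD g = TemperedDistribution.smulLeftCLM ℂ s (toTD u) ↔ g =ᵐ[volume] fun x => s x * u x := by
  have e : ∀ k : 𝓢(E3, ℂ), TemperedDistribution.smulLeftCLM ℂ s (toTD u) k
      = ∫ x, k x * (s x * u x) := by
    intro k
    rw [TemperedDistribution.smulLeftCLM_apply_apply, toTD_apply]
    congr 1; ext x
    rw [SchwartzMap.smulLeftCLM_apply_apply hs]
    simp; ring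
  constructor
  · intro h
    refine ae_eq_of_integral_test (l2_locallyIntegrable g)
      (locallyIntegrable_mul_continuous hs.1.continuous u) fun k _ => ?_
    rw [← e, ← h, toTD_apply]
  · intro h
    ext k
    rw [e, toTD_apply]
    refine integral_congr_ae ?_
    filter_upwards [h] with x hx
    rw [hx]

/-! ### Weak derivatives on the Fourier side -/

/-- The symbol of `∂_{x_a}`. -/
def dsym (a : Fin 3) (ξ : E3) : ℂ := 2 * Real.pi * Complex.I * (ξ a : ℂ)

lemma dsym_temperate (a : Fin 3) : (dsym a).HasTemperateGrowth := by
  have : (fun ξ : E3 => ((inner ℝ ξ (stdVec a) : ℝ) : ℂ)).HasTemperateGrowth := by fun_prop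
  have h2 : dsym a = fun ξ => (2 * Real.pi * Complex.I) * ((inner ℝ ξ (stdVec a) : ℝ) : ℂ) := by
    ext ξ
    simp [dsym, stdVec, EuclideanSpace.inner_single_right]
  rw [h2]
  fun_prop

lemma fourier_toTD (u : L2) : 𝓕 (toTD u) = toTD (𝓕 u) := by
  simp only [toTD, Lp.toTemperedDistributionCLM_apply]
  exact Lp.fourier_toTemperedDistribution_eq u

lemma fourier_lineDeriv (a : Fin 3) (T : 𝓢'(E3, ℂ)) :
    𝓕 (∂_{stdVec a} T) = TemperedDistribution.smulLeftCLM ℂ (dsym a) (𝓕 T) := by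
  rw [TemperedDistribution.fourier_lineDerivOp_eq]
  have : dsym a = (2 * Real.pi * Complex.I) • fun ξ : E3 => ((inner ℝ ξ (stdVec a) : ℝ) : ℂ) := by
    ext ξ
    simp [dsym, stdVec, EuclideanSpace.inner_single_right]
  rw [this, TemperedDistribution.smulLeftCLM_smul (by fun_prop)]
  rfl

lemma fourier_lineDeriv_pow (a : Fin 3) (n : ℕ) (T : 𝓢'(E3, ℂ)) :
    𝓕 ((LineDeriv.lineDerivOpCLM ℂ 𝓢'(E3, ℂ) (stdVec a) ^ n) T) =
      TemperedDistribution.smulLeftCLM ℂ (dsym a ^ n) (𝓕 T) := by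
  have ht := dsym_temperate a
  induction n with
  | zero =>
    simp only [pow_zero, one_apply_eq_self]
    exact ((TemperedDistribution.smulLeftCLM_const 1 (𝓕 T)).trans (one_smul _ _)).symm
  | succ n ih =>
    rw [pow_succ', mul_apply_eq_comp, LineDeriv.lineDerivOpCLM_apply,
      fourier_lineDeriv, ih, TemperedDistribution.smulLeftCLM_smulLeftCLM_apply (ht.pow n) ht]
    congr 2

/-- The symbol of `∂^α`. -/
def msym {n : ℕ} (α : MultiIdx n) : E3 → ℂ :=
  dsym 0 ^ (α.1 0 : ℕ) * dsym 1 ^ (α.1 1 : ℕ) * dsym 2 ^ (α.1 2 : ℕ)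

lemma msym_temperate {n : ℕ} (α : MultiIdx n) : (msym α).HasTemperateGrowth :=
  (((dsym_temperate 0).pow _).mul ((dsym_temperate 1).pow _)).mul ((dsym_temperate 2).pow _)

lemma fourier_partialOp {n : ℕ} (α : MultiIdx n) (T : 𝓢'(E3, ℂ)) :
    𝓕 (partialOp α T) = TemperedDistribution.smulLeftCLM ℂ (msym α) (𝓕 T) := by
  have h0 := (dsym_temperate 0).pow (α.1 0 : ℕ)
  have h1 := (dsym_temperate 1).pow (α.1 1 : ℕ)
  have h2 := (dsym_temperate 2).pow (α.1 2 : ℕ)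
  rw [partialOp, mul_apply_eq_comp, mul_apply_eq_comp,
    fourier_lineDeriv_pow, fourier_lineDeriv_pow, fourier_lineDeriv_pow,
    TemperedDistribution.smulLeftCLM_smulLeftCLM_apply h2 h1,
    TemperedDistribution.smulLeftCLM_smulLeftCLM_apply (h2.mul h1) h0]
  congr 2
  rw [msym]; ring

lemma td_fourier_injective : Function.Injective (𝓕 : 𝓢'(E3, ℂ) → 𝓢'(E3, ℂ)) := by
  intro S T h
  have h' : (𝓕⁻ (𝓕 S) : 𝓢'(E3, ℂ)) = 𝓕⁻ (𝓕 T) := congrArg _ h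
  simpa using h'

lemma isWeakDeriv_iff_fourier {n : ℕ} (α : MultiIdx n) (u g : L2) :
    IsWeakDeriv α u g ↔ (𝓕 g : L2) =ᵐ[volume] fun ξ => msym α ξ * (𝓕 u : L2) ξ := by
  rw [← smulLeft_toTD_iff (msym_temperate α), IsWeakDeriv, ← td_fourier_injective.eq_iff,
    fourier_partialOp, fourier_toTD, fourier_toTD]

/-- `g ∈ L²` is the weak derivative `∂_a u` of `u ∈ L²`. -/
def WD (a : Fin 3) (u g : L2) : Prop := toTD g = ∂_{stdVec a} (toTD u)

lemma wd_iff_fourier (a : Fin 3) (u g : L2) :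
    WD a u g ↔ (𝓕 g : L2) =ᵐ[volume] fun ξ => dsym a ξ * (𝓕 u : L2) ξ := by
  rw [← smulLeft_toTD_iff (dsym_temperate a), WD, ← td_fourier_injective.eq_iff,
    fourier_lineDeriv, fourier_toTD, fourier_toTD]

/-! ### The spaces `H^n` -/

lemma IsWeakDeriv.unique {n : ℕ} {α : MultiIdx n} {u g g' : L2} (h : IsWeakDeriv α u g)
    (h' : IsWeakDeriv α u g') : g = g' :=
  toTD_injective (h.trans h'.symm)

/-- The class in `L²` of an element of `H^n`. -/
def sobL2 {n : ℕ} : Sob n →L[ℂ] L2 :=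
  (PiLp.proj 2 (fun _ : MultiIdx n => L2) (MultiIdx.zero n)).comp (Sob n).subtypeL

lemma sobL2_coe {n : ℕ} (U : Sob n) : (sobL2 U : E3 → ℂ) = sobFn U := rfl

lemma sobL2_injective {n : ℕ} : Function.Injective (sobL2 (n := n)) := by
  intro U W h
  apply Subtype.ext
  ext1 α
  have h' : U.1 (MultiIdx.zero n) = W.1 (MultiIdx.zero n) := h
  have := W.2 α
  rw [← h'] at this
  exact (U.2 α).unique this

lemma norm_sobL2_le {n : ℕ} (U : Sob n) : ‖sobL2 U‖ ≤ ‖U‖ :=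
  PiLp.norm_apply_le (p := 2) (U.1) (MultiIdx.zero n)

instance sobComplete (n : ℕ) : CompleteSpace (Sob n) := by
  have hc : IsClosed ((Sob n : Submodule ℂ _) : Set (PiLp 2 fun _ : MultiIdx n => L2)) := by
    have : ((Sob n : Submodule ℂ _) : Set (PiLp 2 fun _ : MultiIdx n => L2)) =
        ⋂ α, {U | toTD (U α) = partialOp α (toTD (U (MultiIdx.zero n)))} := by
      ext U
      simp [Sob, IsWeakDeriv]
    rw [this]
    refine isClosed_iInter fun α => isClosed_eq ?_ ?_
    · exact toTD.continuous.comp (PiLp.continuous_apply 2 _ α)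
    · exact (partialOp α).continuous.comp (toTD.continuous.comp (PiLp.continuous_apply 2 _ _))
  exact hc.completeSpace_coe

/-! ### The Fourier transform on `L²` -/

/-- The Fourier transform of `L²` as a linear isometry equivalence. -/
def FT : L2 ≃ₗᵢ[ℂ] L2 := Lp.fourierTransformₗᵢ E3 ℂ

lemma FT_apply (f : L2) : FT f = 𝓕 f := rfl

lemma isWeakDeriv_iff {n : ℕ} (α : MultiIdx n) (u g : L2) :
    IsWeakDeriv α u g ↔ (FT g : L2) =ᵐ[volume] fun ξ => msym α ξ * FT u ξ :=
  isWeakDeriv_iff_fourier α u g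

lemma wd_iff (a : Fin 3) (u g : L2) :
    WD a u g ↔ (FT g : L2) =ᵐ[volume] fun ξ => dsym a ξ * FT u ξ :=
  wd_iff_fourier a u g

/-- The symbol `4π²|ξ|²` of `-Δ`. -/
def lsym (ξ : E3) : ℝ := (2 * Real.pi) ^ 2 * ‖ξ‖ ^ 2

lemma lsym_nonneg (ξ : E3) : 0 ≤ lsym ξ := by unfold lsym; positivity

lemma lsym_continuous : Continuous lsym := by unfold lsym; fun_prop

lemma msym_zero (n : ℕ) (ξ : E3) : msym (MultiIdx.zero n) ξ = 1 := by
  simp [msym, MultiIdx.zero]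

lemma msym_double (a : Fin 3) (ξ : E3) : msym (MultiIdx.double a) ξ = dsym a ξ ^ 2 := by
  fin_cases a <;> simp [msym, MultiIdx.double]

lemma sum_dsym_sq (ξ : E3) : ∑ a : Fin 3, dsym a ξ ^ 2 = -(lsym ξ : ℂ) := by
  rw [lsym, EuclideanSpace.norm_sq_eq]
  simp only [Fin.sum_univ_three, dsym, Real.norm_eq_abs, sq_abs, mul_pow, Complex.I_sq]
  push_cast
  ring

/-- The Laplacian as a continuous linear map. -/
def lapL : Sob 2 →L[ℂ] L2 :=
  ∑ a : Fin 3, (PiLp.proj 2 (fun _ : MultiIdx 2 => L2) (MultiIdx.double a)).comp (Sob 2).subtypeL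

lemma lapL_apply (U : Sob 2) : lapL U = sobLap U := by
  simp [lapL, sobLap]

lemma FT_lapL (U : Sob 2) :
    (FT (lapL U) : L2) =ᵐ[volume] fun ξ => -(lsym ξ : ℂ) * FT (sobL2 U) ξ := by
  have h : ∀ a, (FT (U.1 (MultiIdx.double a)) : L2) =ᵐ[volume]
      fun ξ => dsym a ξ ^ 2 * FT (sobL2 U) ξ := by
    intro a
    filter_upwards [(isWeakDeriv_iff _ _ _).1 (U.2 (MultiIdx.double a))] with ξ hξ
    rw [hξ, msym_double]; rfl
  rw [lapL_apply, sobLap, map_sum, Fin.sum_univ_three]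
  filter_upwards [h 0, h 1, h 2, Lp.coeFn_add (FT (U.1 (MultiIdx.double 0)) +
    FT (U.1 (MultiIdx.double 1))) (FT (U.1 (MultiIdx.double 2))),
    Lp.coeFn_add (FT (U.1 (MultiIdx.double 0))) (FT (U.1 (MultiIdx.double 1)))]
    with ξ h0 h1 h2 e1 e2
  rw [e1, Pi.add_apply, e2, Pi.add_apply, h0, h1, h2, ← sum_dsym_sq, Fin.sum_univ_three]
  ring

/-! ### The free resolvent -/

/-- The symbol of `(κ - Δ)⁻¹`. -/
def rsym (κ : ℝ) (ξ : E3) : ℂ := ((κ + lsym ξ)⁻¹ : ℝ)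

lemma rsym_continuous {κ : ℝ} (hκ : 0 < κ) : Continuous (rsym κ) := by
  unfold rsym
  have : ∀ ξ, κ + lsym ξ ≠ 0 := fun ξ => by have := lsym_nonneg ξ; positivity
  exact Complex.continuous_ofReal.comp ((continuous_const.add lsym_continuous).inv₀ this)

lemma norm_dsym_le (a : Fin 3) (ξ : E3) : ‖dsym a ξ‖ ≤ 2 * Real.pi * ‖ξ‖ := by
  have := EuclideanSpace.norm_eq ξ ▸ PiLp.norm_apply_le (p := 2) ξ a
  have h2 := PiLp.norm_apply_le (p := 2) ξ a
  simp only [dsym, norm_mul, Complex.norm_I, Complex.norm_real, mul_one]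
  rw [show ‖(2 : ℂ)‖ = 2 by simp, Real.norm_of_nonneg Real.pi_pos.le]
  gcongr

lemma norm_msym_le {n : ℕ} (α : MultiIdx n) (ξ : E3) :
    ‖msym α ξ‖ ≤ (1 + 2 * Real.pi * ‖ξ‖) ^ n := by
  have hb : ∀ a, ‖dsym a ξ‖ ≤ 1 + 2 * Real.pi * ‖ξ‖ := fun a =>
    (norm_dsym_le a ξ).trans (by linarith)
  have h1 : (1 : ℝ) ≤ 1 + 2 * Real.pi * ‖ξ‖ := by
    have : 0 ≤ 2 * Real.pi * ‖ξ‖ := by positivity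
    linarith
  have hs := α.2
  rw [Fin.sum_univ_three] at hs
  simp only [msym, Pi.mul_apply, Pi.pow_apply, norm_mul, norm_pow]
  calc _ ≤ (1 + 2 * Real.pi * ‖ξ‖) ^ (α.1 0 : ℕ) * (1 + 2 * Real.pi * ‖ξ‖) ^ (α.1 1 : ℕ) *
      (1 + 2 * Real.pi * ‖ξ‖) ^ (α.1 2 : ℕ) := by
        gcongr <;> apply hb
    _ = (1 + 2 * Real.pi * ‖ξ‖) ^ ((α.1 0 : ℕ) + α.1 1 + α.1 2) := by ring
    _ ≤ _ := pow_le_pow_right₀ h1 hs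

lemma norm_rsym (κ : ℝ) (hκ : 0 < κ) (ξ : E3) : ‖rsym κ ξ‖ = (κ + lsym ξ)⁻¹ := by
  have := lsym_nonneg ξ
  rw [rsym, Complex.norm_real, Real.norm_of_nonneg (by positivity)]

lemma norm_msym_rsym_le (κ : ℝ) (hκ : 0 < κ) (α : MultiIdx 2) (ξ : E3) :
    ‖msym α ξ * rsym κ ξ‖ ≤ 2 * (κ⁻¹ + 1) := by
  have h0 := lsym_nonneg ξ
  rw [norm_mul, norm_rsym κ hκ, ← div_eq_mul_inv, div_le_iff₀ (by positivity)]
  refine (norm_msym_le α ξ).trans ?_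
  have h1 : (1 + 2 * Real.pi * ‖ξ‖) ^ 2 ≤ 2 * (1 + lsym ξ) := by
    unfold lsym
    nlinarith [sq_nonneg (1 - 2 * Real.pi * ‖ξ‖)]
  have h2 : (κ⁻¹ + 1) * (κ + lsym ξ) = 1 + lsym ξ + κ + κ⁻¹ * lsym ξ := by
    field_simp
    ring
  have h3 : 0 ≤ κ⁻¹ * lsym ξ := by positivity
  nlinarith

lemma memLp_msym_rsym {κ : ℝ} (hκ : 0 < κ) (α : MultiIdx 2) :
    MemLp (fun ξ => msym α ξ * rsym κ ξ) ∞ (volume : Measure E3) :=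
  memLp_top_of_continuous_bound ((msym_temperate α).1.continuous.mul (rsym_continuous hκ)) _
    (norm_msym_rsym_le κ hκ α)

/-- The Fourier multiplier with the bounded symbol `g`. -/
def fmul (g : E3 → ℂ) (hg : MemLp g ∞ (volume : Measure E3)) : L2 →L[ℂ] L2 :=
  (FT.symm.toContinuousLinearEquiv : L2 →L[ℂ] L2) ∘L mulOp g hg ∘L
    (FT.toContinuousLinearEquiv : L2 →L[ℂ] L2)

lemma FT_fmul (g : E3 → ℂ) (hg : MemLp g ∞ (volume : Measure E3)) (f : L2) :
    (FT (fmul g hg f) : L2) =ᵐ[volume] fun ξ => g ξ * FT f ξ := by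
  have : FT (fmul g hg f) = mulOp g hg (FT f) := FT.apply_symm_apply _
  rw [this]
  exact mulOp_coe g hg _

/-- The family of the `∂^α (κ - Δ)⁻¹`. -/
def resolventAux (κ : ℝ) (hκ : 0 < κ) : L2 →L[ℂ] PiLp 2 (fun _ : MultiIdx 2 => L2) :=
  ((PiLp.continuousLinearEquiv 2 ℂ (fun _ : MultiIdx 2 => L2)).symm :
    (MultiIdx 2 → L2) →L[ℂ] PiLp 2 (fun _ : MultiIdx 2 => L2)) ∘L
    ContinuousLinearMap.pi fun α => fmul _ (memLp_msym_rsym hκ α)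

lemma resolventAux_apply (κ : ℝ) (hκ : 0 < κ) (f : L2) (α : MultiIdx 2) :
    resolventAux κ hκ f α = fmul _ (memLp_msym_rsym hκ α) f := rfl

/-- The free resolvent `(κ - Δ)⁻¹ : L² → H²`. -/
def resolvent (κ : ℝ) (hκ : 0 < κ) : L2 →L[ℂ] Sob 2 :=
  (resolventAux κ hκ).codRestrict (Sob 2) fun f α => by
    rw [isWeakDeriv_iff, resolventAux_apply, resolventAux_apply]
    filter_upwards [FT_fmul _ (memLp_msym_rsym hκ α) f,
      FT_fmul _ (memLp_msym_rsym hκ (MultiIdx.zero 2)) f] with ξ h1 h2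
    rw [h1, h2, msym_zero]
    ring

lemma FT_resolvent (κ : ℝ) (hκ : 0 < κ) (f : L2) :
    (FT (sobL2 (resolvent κ hκ f)) : L2) =ᵐ[volume] fun ξ => rsym κ ξ * FT f ξ := by
  filter_upwards [FT_fmul _ (memLp_msym_rsym hκ (MultiIdx.zero 2)) f] with ξ h
  rw [msym_zero, one_mul] at h
  exact h

lemma rsym_mul {κ : ℝ} (hκ : 0 < κ) (ξ : E3) : rsym κ ξ * ((κ : ℂ) + lsym ξ) = 1 := by
  have h0 := lsym_nonneg ξ
  have : κ + lsym ξ ≠ 0 := by positivity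
  rw [rsym]
  norm_cast
  exact inv_mul_cancel₀ this

lemma FT_kappa_sub_lap (κ : ℝ) (U : Sob 2) :
    (FT ((κ : ℂ) • sobL2 U - lapL U) : L2) =ᵐ[volume]
      fun ξ => ((κ : ℂ) + lsym ξ) * FT (sobL2 U) ξ := by
  rw [map_sub, map_smul]
  filter_upwards [FT_lapL U, Lp.coeFn_sub ((κ : ℂ) • FT (sobL2 U)) (FT (lapL U)),
    Lp.coeFn_smul (κ : ℂ) (FT (sobL2 U))] with ξ h1 h2 h3
  rw [h2, Pi.sub_apply, h3, h1, Pi.smul_apply, smul_eq_mul]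
  ring

lemma resolvent_right_inv (κ : ℝ) (hκ : 0 < κ) (f : L2) :
    (κ : ℂ) • sobL2 (resolvent κ hκ f) - lapL (resolvent κ hκ f) = f := by
  apply FT.injective
  apply Lp.ext
  filter_upwards [FT_kappa_sub_lap κ (resolvent κ hκ f), FT_resolvent κ hκ f] with ξ h1 h2
  rw [h1, h2, ← mul_assoc, mul_comm (_ + _), rsym_mul hκ, one_mul]

lemma resolvent_left_inv (κ : ℝ) (hκ : 0 < κ) (U : Sob 2) :
    resolvent κ hκ ((κ : ℂ) • sobL2 U - lapL U) = U := by
  apply sobL2_injective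
  apply FT.injective
  apply Lp.ext
  filter_upwards [FT_kappa_sub_lap κ U, FT_resolvent κ hκ ((κ : ℂ) • sobL2 U - lapL U)]
    with ξ h1 h2
  rw [h2, h1, ← mul_assoc, rsym_mul hκ, one_mul]

/-! ### The embedding of `H²` into the bounded continuous functions -/

lemma rsym_memLp_two {κ : ℝ} (hκ : 0 < κ) : MemLp (rsym κ) 2 (volume : Measure E3) := by
  have hc := rsym_continuous hκ
  rw [memLp_two_iff_integrable_sq_norm hc.aestronglyMeasurable]
  have hi : Integrable (fun ξ : E3 => ((1 : ℝ) + ‖ξ‖ ^ 2) ^ (-(4 : ℝ) / 2)) :=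
    integrable_rpow_neg_one_add_norm_sq (by simp; norm_num)
  refine (hi.const_mul ((κ⁻¹ + 1) ^ 2)).mono' (by fun_prop) (.of_forall fun ξ => ?_)
  have h0 := lsym_nonneg ξ
  rw [Real.norm_of_nonneg (by positivity), norm_rsym κ hκ]
  rw [show (-(4 : ℝ) / 2) = -((2 : ℕ) : ℝ) by norm_num, Real.rpow_neg (by positivity),
    Real.rpow_natCast, ← inv_pow, ← mul_pow]
  gcongr
  rw [inv_le_comm₀ (by positivity) (by positivity), mul_inv, inv_inv, ← div_eq_inv_mul,
    div_le_iff₀ (by positivity)]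
  have hl : ‖ξ‖ ^ 2 ≤ lsym ξ := by
    unfold lsym
    have : (1 : ℝ) ≤ (2 * Real.pi) ^ 2 := by nlinarith [Real.pi_gt_three]
    nlinarith [sq_nonneg ‖ξ‖]
  have h2 : (κ + lsym ξ) * (κ⁻¹ + 1) = 1 + lsym ξ + κ + κ⁻¹ * lsym ξ := by
    field_simp
    ring
  have h3 : 0 ≤ κ⁻¹ * lsym ξ := by positivity
  rw [h2]; linarith

/-- The pointwise product of two elements of `L²`. -/
def mulL1 : L2 →L[ℂ] L2 →L[ℂ] Lp ℂ 1 (volume : Measure E3) :=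
  (ContinuousLinearMap.mul ℂ ℂ).holderL volume 2 2 1

lemma mulL1_coe (f g : L2) : mulL1 f g =ᵐ[volume] fun x => f x * g x := by
  filter_upwards [(ContinuousLinearMap.mul ℂ ℂ).coeFn_holder (r := 1) f g] with x h
  exact h

/-- Fourier inversion for functions in `L¹ ∩ L²`. -/
lemma fourierInv_L1_eq (f : L2) (g : Lp ℂ 1 (volume : Measure E3)) (h : f =ᵐ[volume] g) :
    (FT.symm f : L2) =ᵐ[volume] Real.Lp.fourierTransformInvCLM E3 ℂ g := by
  have hloc : LocallyIntegrable (Real.Lp.fourierTransformInvCLM E3 ℂ g : E3 → ℂ) volume :=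
    (BoundedContinuousFunction.continuous _).locallyIntegrable
  refine ae_eq_of_integral_test (l2_locallyIntegrable _) hloc fun k _ => ?_
  rw [← toTD_apply]
  have e1 : toTD (FT.symm f) k = toTD f (𝓕⁻ k) := by
    have := Lp.fourierInv_toTemperedDistribution_eq f
    have h2 : (𝓕⁻ (toTD f) : 𝓢'(E3, ℂ)) = toTD (FT.symm f) := by
      simp only [toTD, Lp.toTemperedDistributionCLM_apply]
      exact this
    rw [← h2]; rfl
  rw [e1, toTD_apply]
  have hg : Integrable g (volume : Measure E3) := L1.integrable_coeFn g
  have e2 : ∫ x, (𝓕⁻ k : 𝓢(E3, ℂ)) x * f x = ∫ x, (𝓕⁻ (k : E3 → ℂ)) x * g x := by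
    refine integral_congr_ae ?_
    filter_upwards [h] with x hx
    rw [hx, SchwartzMap.fourierInv_coe]
  rw [e2]
  have e3 := VectorFourier.integral_fourierIntegral_smul_eq_flip (𝕜 := ℝ) (e := Real.fourierChar)
    (L := -(innerₗ E3)) (μ := (volume : Measure E3)) (ν := (volume : Measure E3))
    Real.continuous_fourierChar (by simp only [LinearMap.neg_apply, innerₗ_apply_apply]; fun_prop)
    k.integrable hg
  have e4 : ∀ (F : E3 → ℂ), VectorFourier.fourierIntegral Real.fourierChar volume (-(innerₗ E3)) F
      = 𝓕⁻ F := by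
    intro F; ext w
    rw [Real.fourierInv_eq]
    simp [VectorFourier.fourierIntegral]
  have e5 : ∀ (F : E3 → ℂ), VectorFourier.fourierIntegral Real.fourierChar volume
      (-(innerₗ E3)).flip F = 𝓕⁻ F := by
    intro F; ext w
    rw [Real.fourierInv_eq]
    simp [VectorFourier.fourierIntegral, real_inner_comm]
  rw [e4, e5] at e3
  simp only [smul_eq_mul] at e3
  rw [e3]
  simp

/-- The continuous representative of an element of `H²`. -/
def sobBCF : Sob 2 →L[ℂ] (E3 →ᵇ ℂ) :=
  (Real.Lp.fourierTransformInvCLM E3 ℂ) ∘L mulL1 ((rsym_memLp_two one_pos).toLp _) ∘L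
    (FT.toContinuousLinearEquiv : L2 →L[ℂ] L2) ∘L ((1 : ℂ) • sobL2 - lapL)

lemma sobBCF_coe (U : Sob 2) : (sobL2 U : E3 → ℂ) =ᵐ[volume] sobBCF U := by
  have h1 := mulL1_coe ((rsym_memLp_two one_pos).toLp _) (FT ((1 : ℂ) • sobL2 U - lapL U))
  have h2 : (FT (sobL2 U) : E3 → ℂ) =ᵐ[volume]
      mulL1 ((rsym_memLp_two one_pos).toLp _) (FT ((1 : ℂ) • sobL2 U - lapL U)) := by
    have h3 := FT_resolvent 1 one_pos (((1 : ℝ) : ℂ) • sobL2 U - lapL U)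
    rw [resolvent_left_inv] at h3
    filter_upwards [h1, h3, (rsym_memLp_two one_pos).coeFn_toLp] with ξ a b c
    rw [a, b, c, Complex.ofReal_one]
  have := fourierInv_L1_eq _ _ h2
  rw [FT.symm_apply_apply] at this
  exact this

/-! ### Translations and modulations -/

/-- The translation `f ↦ f(· + s)`. -/
def trans (s : E3) : L2 →ₗᵢ[ℂ] L2 :=
  Lp.compMeasurePreservingₗᵢ ℂ (fun x : E3 => x + s) (measurePreserving_add_right volume s)

lemma trans_coe (s : E3) (f : L2) : (trans s f : E3 → ℂ) =ᵐ[volume] fun x => f (x + s) :=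
  Lp.coeFn_compMeasurePreserving f (measurePreserving_add_right volume s)

lemma ae_comp_add {p : E3 → Prop} (s : E3) (h : ∀ᵐ x, p x) : ∀ᵐ x, p (x + s) :=
  (measurePreserving_add_right (volume : Measure E3) s).quasiMeasurePreserving.ae h

lemma trans_add (s t : E3) (f : L2) : trans (s + t) f = trans s (trans t f) := by
  apply Lp.ext
  filter_upwards [trans_coe (s + t) f, trans_coe s (trans t f),
    ae_comp_add s (trans_coe t f)] with x h1 h2 h3
  rw [h1, h2, h3, add_assoc]

lemma trans_zero (f : L2) : trans 0 f = f := by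
  apply Lp.ext
  filter_upwards [trans_coe 0 f] with x h1
  rw [h1, add_zero]

lemma continuous_trans : Continuous fun z : E3 × L2 => trans z.1 z.2 := by
  let g : E3 × L2 → C(E3, E3) := fun z => ⟨fun x => x + z.1, by fun_prop⟩
  have hg : Continuous g := by
    apply ContinuousMap.continuous_of_continuous_uncurry
    change Continuous fun p : (E3 × L2) × E3 => p.2 + p.1.1
    fun_prop
  exact Continuous.compMeasurePreservingLp (f := fun z : E3 × L2 => z.2) continuous_snd hg
    (fun z => measurePreserving_add_right volume z.1) (by norm_num)

lemma exp_phase_contDiff (v : E3) :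
    ContDiff ℝ ∞ fun x : E3 => Complex.exp (Complex.I * ((inner ℝ v x : ℝ) : ℂ)) := by
  have : ContDiff ℝ ∞ fun x : E3 => ((inner ℝ v x : ℝ) : ℂ) :=
    Complex.ofRealCLM.contDiff.comp (contDiff_const.inner ℝ contDiff_id)
  exact (contDiff_const.mul this).cexp

lemma norm_exp_phase (r : ℝ) : ‖Complex.exp (Complex.I * (r : ℂ))‖ = 1 := by
  rw [mul_comm]; exact Complex.norm_exp_ofReal_mul_I r

lemma phase_memLp (v : E3) :
    MemLp (fun x : E3 => Complex.exp (Complex.I * ((inner ℝ v x : ℝ) : ℂ))) ∞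
      (volume : Measure E3) :=
  memLp_top_of_continuous_bound (exp_phase_contDiff v).continuous 1 fun _ =>
    (norm_exp_phase _).le

/-- The modulation `f ↦ e^{i v·x} f`. -/
def modul (v : E3) : L2 →L[ℂ] L2 := mulOp _ (phase_memLp v)

lemma modul_coe (v : E3) (f : L2) : (modul v f : E3 → ℂ) =ᵐ[volume]
    fun x => Complex.exp (Complex.I * ((inner ℝ v x : ℝ) : ℂ)) * f x :=
  mulOp_coe _ _ f

lemma toTD_FT (f : L2) (k : 𝓢(E3, ℂ)) : toTD (FT f) k = toTD f (𝓕 k) := by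
  have h := fourier_toTD f
  rw [FT_apply, ← h]; rfl

lemma FT_trans (s : E3) (f : L2) : FT (trans s f) = modul ((2 * Real.pi) • s) (FT f) := by
  apply Lp.ext
  refine (ae_eq_of_integral_test (l2_locallyIntegrable _) (l2_locallyIntegrable _)
    fun k hk => ?_)
  rw [← toTD_apply, toTD_FT, toTD_apply]
  set e : E3 → ℂ := fun x => Complex.exp (Complex.I * ((inner ℝ ((2 * Real.pi) • s) x : ℝ) : ℂ))
    with he
  have hc : HasCompactSupport (fun x => e x * k x) := hk.mul_left
  have hs : ContDiff ℝ ∞ (fun x => e x * k x) := (exp_phase_contDiff _).mul (k.smooth _)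
  set k' : 𝓢(E3, ℂ) := hc.toSchwartzMap hs with hk'
  have hk'a : ∀ x, k' x = e x * k x := fun x => rfl
  have hF : ∀ x, (𝓕 k' : 𝓢(E3, ℂ)) x = (𝓕 k : 𝓢(E3, ℂ)) (x - s) := by
    intro x
    rw [SchwartzMap.fourier_coe, SchwartzMap.fourier_coe, Real.fourier_eq', Real.fourier_eq']
    refine integral_congr_ae (.of_forall fun y => ?_)
    simp only [hk'a, he, smul_eq_mul]
    rw [← mul_assoc, ← Complex.exp_add]
    congr 2
    rw [inner_sub_right, inner_smul_left, real_inner_comm y s]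
    simp only [conj_trivial]
    push_cast
    ring
  have h1 : ∫ x, k x * (modul ((2 * Real.pi) • s) (FT f)) x = toTD (FT f) k' := by
    rw [toTD_apply]
    refine integral_congr_ae ?_
    filter_upwards [modul_coe ((2 * Real.pi) • s) (FT f)] with x hx
    rw [hx, hk'a]; ring
  rw [h1, toTD_FT, toTD_apply]
  rw [← integral_add_right_eq_self (fun x => (𝓕 k' : 𝓢(E3, ℂ)) x * f x) s]
  refine integral_congr_ae ?_
  filter_upwards [trans_coe s f] with x hx
  rw [hx, hF, add_sub_cancel_right]

lemma modul_eq (v : E3) (f : L2) :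
    modul v f = FT (trans ((2 * Real.pi)⁻¹ • v) (FT.symm f)) := by
  rw [FT_trans, smul_smul, mul_inv_cancel₀ (by positivity), one_smul, FT.apply_symm_apply]

lemma norm_modul (v : E3) (f : L2) : ‖modul v f‖ = ‖f‖ := by
  rw [modul_eq, FT.norm_map, LinearIsometry.norm_map, FT.symm.norm_map]

lemma continuous_modul : Continuous fun z : E3 × L2 => modul z.1 z.2 := by
  simp_rw [modul_eq]
  have h : Continuous fun z : E3 × L2 => ((2 * Real.pi)⁻¹ • z.1, FT.symm z.2) := by
    have := FT.symm.continuous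
    fun_prop
  have h2 : Continuous fun z : E3 × L2 => trans ((2 * Real.pi)⁻¹ • z.1) (FT.symm z.2) :=
    Continuous.comp (g := fun w : E3 × L2 => trans w.1 w.2)
      (f := fun z : E3 × L2 => ((2 * Real.pi)⁻¹ • z.1, FT.symm z.2)) continuous_trans h
  exact Continuous.comp (g := FT) FT.continuous h2

/-! ### Compactness -/

/-- The bilinear pairing `∫ f g` on `L²`. -/
def bil : L2 →L[ℂ] L2 →L[ℂ] ℂ := (ContinuousLinearMap.mul ℂ ℂ).lpPairing volume 2 2

lemma bil_apply (f g : L2) : bil f g = ∫ x, f x * g x :=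
  (ContinuousLinearMap.mul ℂ ℂ).lpPairing_eq_integral f g

/-- The integral operator with square integrable kernel, `(T_g f)(x) = ∫ g(x, y) f(y) dy`. -/
def kernelOp : Lp L2 2 (volume : Measure E3) →L[ℂ] L2 →L[ℂ] L2 :=
  (ContinuousLinearMap.compLpL₂ 2 volume bil.flip).flip

lemma kernelOp_coe (g : Lp L2 2 (volume : Measure E3)) (f : L2) :
    (kernelOp g f : E3 → ℂ) =ᵐ[volume] fun x => bil (g x) f :=
  ContinuousLinearMap.coeFn_compLp (bil.flip f) g

lemma kernelOp_compact (g : Lp L2 2 (volume : Measure E3)) : IsCompactOperator (kernelOp g) := by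
  refine Lp.induction (by norm_num) (fun g => IsCompactOperator (kernelOp g)) ?_ ?_ ?_ g
  · intro c s hs hμs
    have : (kernelOp (Lp.simpleFunc.indicatorConst 2 hs hμs.ne c : Lp L2 2 volume) : L2 → L2) =
        (ContinuousLinearMap.toSpanSingleton ℂ
          (indicatorConstLp 2 hs hμs.ne (1 : ℂ) : L2) ∘ bil c) := by
      funext f
      apply Lp.ext
      have hi : ((Lp.simpleFunc.indicatorConst 2 hs hμs.ne c : Lp L2 2 volume) : E3 → L2)
          =ᵐ[volume] s.indicator fun _ => c := by
        rw [Lp.simpleFunc.coe_indicatorConst]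
        exact indicatorConstLp_coeFn
      filter_upwards [kernelOp_coe (Lp.simpleFunc.indicatorConst 2 hs hμs.ne c : Lp L2 2 volume) f,
        hi, Lp.coeFn_smul (bil c f) (indicatorConstLp 2 hs hμs.ne (1 : ℂ) : L2),
        (indicatorConstLp_coeFn (p := 2) (hs := hs) (hμs := hμs.ne) (c := (1 : ℂ)))]
        with x h1 h2 h3 h4
      rw [h1, h2]
      simp only [Function.comp_apply, ContinuousLinearMap.toSpanSingleton_apply]
      rw [h3, Pi.smul_apply, h4]
      by_cases hx : x ∈ s <;> simp [hx]
    rw [this]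
    exact (isCompactOperator_of_locallyCompactSpace_dom (bil c)).clm_comp _
  · intro f g hf hg _ h1 h2
    rw [map_add]
    exact h1.add h2
  · exact isClosed_setOfPred_isCompactOperator.preimage kernelOp.continuous

lemma schwartz_memLp_top (V : 𝓢(E3, ℝ)) :
    MemLp (fun x => (V x : ℂ)) ∞ (volume : Measure E3) :=
  (V.memLp ∞ volume).ofReal

/-- Multiplication by the potential. -/
def potOp (V : 𝓢(E3, ℝ)) : L2 →L[ℂ] L2 := mulOp _ (schwartz_memLp_top V)

lemma potOp_coe (V : 𝓢(E3, ℝ)) (f : L2) :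
    (potOp V f : E3 → ℂ) =ᵐ[volume] fun x => (V x : ℂ) * f x := mulOp_coe _ _ f

lemma sobBCF_apply (U : Sob 2) (x : E3) :
    sobBCF U x = bil (modul ((2 * Real.pi) • x) ((rsym_memLp_two one_pos).toLp _))
      (FT ((1 : ℂ) • sobL2 U - lapL U)) := by
  rw [bil_apply]
  have : sobBCF U x = (𝓕⁻ (mulL1 ((rsym_memLp_two one_pos).toLp _)
      (FT ((1 : ℂ) • sobL2 U - lapL U)) : E3 → ℂ)) x := by
    change Real.Lp.fourierTransformInvCLM E3 ℂ _ x = _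
    rw [Real.Lp.fourierTransformInvCLM_apply, Real.Lp.fourierTransformInv_apply]
    rfl
  rw [this, Real.fourierInv_eq']
  refine integral_congr_ae ?_
  filter_upwards [mulL1_coe ((rsym_memLp_two one_pos).toLp _) (FT ((1 : ℂ) • sobL2 U - lapL U)),
    modul_coe ((2 * Real.pi) • x) ((rsym_memLp_two one_pos).toLp _)] with y h1 h2
  have he : Complex.exp (((2 * Real.pi * inner ℝ y x : ℝ) : ℂ) * Complex.I) =
      Complex.exp (Complex.I * ((inner ℝ ((2 * Real.pi) • x) y : ℝ) : ℂ)) := by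
    congr 1
    rw [inner_smul_left, real_inner_comm x y]
    simp only [conj_trivial]
    push_cast
    ring
  rw [h1, h2, smul_eq_mul, he]
  ring

lemma potOp_compact (V : 𝓢(E3, ℝ)) : IsCompactOperator (potOp V ∘L sobL2 (n := 2)) := by
  set m : L2 := (rsym_memLp_two one_pos).toLp _ with hm
  set G : E3 → L2 := fun x => (V x : ℂ) • modul ((2 * Real.pi) • x) m with hG
  have hc : Continuous G := by
    have h2 : Continuous fun x : E3 => modul ((2 * Real.pi) • x) m :=
      Continuous.comp (g := fun w : E3 × L2 => modul w.1 w.2)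
        (f := fun x : E3 => ((2 * Real.pi) • x, m)) continuous_modul (by fun_prop)
    exact (Complex.continuous_ofReal.comp V.continuous).smul h2
  have hG2 : MemLp G 2 (volume : Measure E3) := by
    have hb : MemLp (fun x => ‖m‖ * V x) 2 (volume : Measure E3) := (V.memLp 2 volume).const_mul _
    refine hb.mono hc.aestronglyMeasurable (.of_forall fun x => ?_)
    rw [hG, norm_smul, norm_modul, norm_mul, norm_norm, mul_comm, Complex.norm_real]
  have : potOp V ∘L sobL2 (n := 2) = (kernelOp (hG2.toLp G)) ∘L
      ((FT.toContinuousLinearEquiv : L2 →L[ℂ] L2) ∘L ((1 : ℂ) • sobL2 - lapL)) := by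
    ext1 U
    apply Lp.ext
    filter_upwards [potOp_coe V (sobL2 U), sobBCF_coe U,
      kernelOp_coe (hG2.toLp G) (FT ((1 : ℂ) • sobL2 U - lapL U)), hG2.coeFn_toLp] with x h1 h2 h3 h4
    have e1 : (potOp V ∘L sobL2 (n := 2)) U = potOp V (sobL2 U) := rfl
    have e2 : ((kernelOp (hG2.toLp G)) ∘L
      ((FT.toContinuousLinearEquiv : L2 →L[ℂ] L2) ∘L ((1 : ℂ) • sobL2 - lapL))) U =
        kernelOp (hG2.toLp G) (FT ((1 : ℂ) • sobL2 U - lapL U)) := rfl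
    rw [e1, e2, h1, h2, h3, h4, sobBCF_apply, ← hm, hG]
    simp only [map_smul, smul_apply, smul_eq_mul]
  rw [this]
  exact (kernelOp_compact _).comp_clm _

/-! ### Positivity of the free resolvent -/

lemma l2_inner_eq (f g : L2) : inner ℂ f g = ∫ x, g x * conj (f x) := by
  rw [L2.inner_def]
  rfl

lemma l2_norm_sq (f : L2) : ‖f‖ ^ 2 = ∫ x, ‖f x‖ ^ 2 := by
  have h := inner_self_eq_norm_sq_to_K (𝕜 := ℂ) f
  rw [l2_inner_eq] at h
  have h2 : ∫ x, f x * conj (f x) = ((∫ x, ‖f x‖ ^ 2 : ℝ) : ℂ) := by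
    rw [← integral_complex_ofReal]
    congr 1; ext x
    rw [Complex.mul_conj, Complex.normSq_eq_norm_sq]
  rw [h2] at h
  exact Complex.ofReal_injective (by push_cast; exact h.symm)

lemma l2_integrable_sq (f : L2) : Integrable (fun x => ‖f x‖ ^ 2) (volume : Measure E3) :=
  (memLp_two_iff_integrable_sq_norm (Lp.memLp f).1).1 (Lp.memLp f)

lemma l2_integrable_mul (f g : L2) :
    Integrable (fun x => f x * conj (g x)) (volume : Measure E3) :=
  L2.integrable_inner g f

/-- Nonnegative functions in `L²`. -/
def NN (f : L2) : Prop := ∀ᵐ x, 0 ≤ (f x).re ∧ (f x).im = 0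

lemma exists_l2_comp (φ : ℂ → ℂ) (hc : Continuous φ) (hb : ∀ z, ‖φ z‖ ≤ ‖z‖) (u : L2) :
    ∃ g : L2, g =ᵐ[volume] fun x => φ (u x) := by
  have h : MemLp (fun x => φ (u x)) 2 (volume : Measure E3) :=
    (Lp.memLp u).mono (hc.comp_aestronglyMeasurable (Lp.memLp u).1) (.of_forall fun x => hb _)
  exact ⟨h.toLp _, h.coeFn_toLp⟩

lemma fourier_L1_eq (f : L2) (hf : Integrable f (volume : Measure E3)) :
    (FT f : E3 → ℂ) =ᵐ[volume] 𝓕 (f : E3 → ℂ) := by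
  have hcont : Continuous (𝓕 (f : E3 → ℂ)) :=
    VectorFourier.fourierIntegral_continuous Real.continuous_fourierChar
      (by exact continuous_inner) hf
  refine ae_eq_of_integral_test (l2_locallyIntegrable _) hcont.locallyIntegrable fun k _ => ?_
  rw [← toTD_apply, toTD_FT, toTD_apply]
  have e3 := VectorFourier.integral_fourierIntegral_smul_eq_flip (𝕜 := ℝ) (e := Real.fourierChar)
    (L := innerₗ E3) (μ := (volume : Measure E3)) (ν := (volume : Measure E3))
    Real.continuous_fourierChar (by simp only [innerₗ_apply_apply]; fun_prop)
    k.integrable hf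
  simp only [flip_innerₗ] at e3
  simp_rw [SchwartzMap.fourier_coe]
  exact e3

/-- The resolvent as an operator on `L²`. -/
def res (κ : ℝ) (hκ : 0 < κ) : L2 →L[ℂ] L2 := sobL2 ∘L resolvent κ hκ

lemma FT_res (κ : ℝ) (hκ : 0 < κ) (f : L2) :
    (FT (res κ hκ f) : L2) =ᵐ[volume] fun ξ => rsym κ ξ * FT f ξ := FT_resolvent κ hκ f

lemma conj_rsym (κ : ℝ) (ξ : E3) : conj (rsym κ ξ) = rsym κ ξ := Complex.conj_ofReal _

lemma inner_res (κ : ℝ) (hκ : 0 < κ) (f g : L2) :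
    inner ℂ g (res κ hκ f) = ∫ ξ, rsym κ ξ * (FT f ξ * conj (FT g ξ)) := by
  rw [← FT.inner_map_map, l2_inner_eq]
  refine integral_congr_ae ?_
  filter_upwards [FT_res κ hκ f] with ξ h
  rw [h]; ring

lemma res_symm (κ : ℝ) (hκ : 0 < κ) (f g : L2) :
    inner ℂ (res κ hκ g) f = inner ℂ g (res κ hκ f) := by
  rw [← inner_conj_symm, inner_res, inner_res, ← integral_conj]
  congr 1; ext ξ
  simp only [map_mul, conj_rsym, Complex.conj_conj]
  ring

/-- The Gaussian with Fourier transform `e^{-4π²t|ξ|²}`. -/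
def heat (t : ℝ) (x : E3) : ℝ :=
  (Real.pi / ((2 * Real.pi) ^ 2 * t)) ^ ((3 : ℝ) / 2) *
    Real.exp (-Real.pi ^ 2 * ‖x‖ ^ 2 / ((2 * Real.pi) ^ 2 * t))

lemma heat_pos {t : ℝ} (ht : 0 < t) (x : E3) : 0 < heat t x := by
  have := Real.pi_pos
  unfold heat; positivity

lemma heat_le {t : ℝ} (ht : 0 < t) (x : E3) :
    heat t x ≤ (Real.pi / ((2 * Real.pi) ^ 2 * t)) ^ ((3 : ℝ) / 2) := by
  have := Real.pi_pos
  unfold heat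
  refine mul_le_of_le_one_right (by positivity) (Real.exp_le_one_iff.2 ?_)
  rw [neg_mul, neg_div]
  exact neg_nonpos.2 (by positivity)

lemma fourier_heat {t : ℝ} (ht : 0 < t) (x : E3) :
    𝓕 (fun ξ : E3 => Complex.exp (-(t * lsym ξ : ℝ))) x = heat t x := by
  have hp := Real.pi_pos
  have hb : 0 < (((2 * Real.pi) ^ 2 * t : ℝ) : ℂ).re := by
    rw [Complex.ofReal_re]; positivity
  have h := fourier_gaussian_innerProductSpace hb x
  have e : (fun ξ : E3 => Complex.exp (-(t * lsym ξ : ℝ))) =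
      fun v : E3 => Complex.exp (-(((2 * Real.pi) ^ 2 * t : ℝ) : ℂ) * (‖v‖ : ℂ) ^ 2) := by
    ext ξ
    congr 1
    simp only [lsym]
    push_cast
    ring
  rw [e, h, heat]
  push_cast
  rw [Complex.ofReal_cpow (by positivity)]
  simp

lemma heat_symbol_integrable {t : ℝ} (ht : 0 < t) :
    Integrable (fun ξ : E3 => Complex.exp (-(t * lsym ξ : ℝ))) := by
  have hp := Real.pi_pos
  have hb : 0 < (((2 * Real.pi) ^ 2 * t : ℝ) : ℂ).re := by
    rw [Complex.ofReal_re]; positivity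
  have := GaussianFourier.integrable_cexp_neg_mul_sq_norm_add hb 0 (0 : E3)
  refine this.congr (.of_forall fun ξ => ?_)
  simp only [lsym]
  congr 1
  push_cast
  simp
  ring_nf

lemma rsym_eq_integral {κ : ℝ} (hκ : 0 < κ) (ξ : E3) :
    ∫ t in Ioi (0 : ℝ), Complex.exp (-(t * (κ + lsym ξ) : ℝ)) = rsym κ ξ := by
  have h0 := lsym_nonneg ξ
  have hp : 0 < κ + lsym ξ := by positivity
  have h := integral_exp_mul_complex_Ioi (a := -((κ + lsym ξ : ℝ) : ℂ)) 
    (by rw [Complex.neg_re, Complex.ofReal_re]; linarith) 0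
  rw [rsym]
  have e : ∀ t : ℝ, Complex.exp (-(t * (κ + lsym ξ) : ℝ)) =
      Complex.exp (-((κ + lsym ξ : ℝ) : ℂ) * t) := fun t => by
    congr 1; push_cast; ring
  simp_rw [e]
  rw [h]
  simp only [Complex.ofReal_zero, mul_zero, Complex.exp_zero, neg_div_neg_eq, one_div,
    Complex.ofReal_inv]

/-- Pairing the resolvent with an integrable function `h ≥ 0`. -/
lemma integral_rsym_fourier {κ : ℝ} (hκ : 0 < κ) (h : E3 → ℂ) (hi : Integrable h)
    (hr : Integrable fun ξ => rsym κ ξ * 𝓕 h ξ) (hnn : ∀ᵐ x, 0 ≤ (h x).re ∧ (h x).im = 0) :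
    ∃ r : ℝ, ∫ ξ, rsym κ ξ * 𝓕 h ξ = r ∧ 0 ≤ r ∧ (r = 0 → ∫ x, h x = 0) := by
  have hcont : Continuous (𝓕 h) :=
    VectorFourier.fourierIntegral_continuous Real.continuous_fourierChar
      (by exact continuous_inner) hi
  set F : E3 × ℝ → ℂ := fun z => Complex.exp (-(z.2 * (κ + lsym z.1) : ℝ)) * 𝓕 h z.1 with hF
  have hFc : Continuous F := by
    have := lsym_continuous
    fun_prop
  have hFn : ∀ z, ‖F z‖ = Real.exp (-(z.2 * (κ + lsym z.1))) * ‖𝓕 h z.1‖ := by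
    intro z
    rw [hF, norm_mul, ← Complex.ofReal_neg, Complex.norm_exp_ofReal]
  have hexp : ∀ ξ : E3, IntegrableOn (fun t : ℝ => Real.exp (-(t * (κ + lsym ξ)))) (Ioi 0) := by
    intro ξ
    have h0 := lsym_nonneg ξ
    have := integrableOn_exp_mul_Ioi (a := -(κ + lsym ξ)) (by linarith) 0
    refine this.congr_fun (fun t _ => ?_) measurableSet_Ioi
    ring_nf
  have hexpv : ∀ ξ : E3, ∫ t in Ioi (0 : ℝ), Real.exp (-(t * (κ + lsym ξ))) = ‖rsym κ ξ‖ := by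
    intro ξ
    have h0 := lsym_nonneg ξ
    have := integral_exp_mul_Ioi (a := -(κ + lsym ξ)) (by linarith) 0
    rw [norm_rsym κ hκ]
    have e : ∀ t : ℝ, Real.exp (-(t * (κ + lsym ξ))) = Real.exp (-(κ + lsym ξ) * t) := fun t => by
      ring_nf
    simp_rw [e, this]
    simp only [mul_zero, Real.exp_zero, neg_div_neg_eq, one_div]
  have hFi : Integrable F (volume.prod (volume.restrict (Ioi 0))) := by
    rw [integrable_prod_iff hFc.aestronglyMeasurable]
    constructor
    · refine .of_forall fun ξ => ?_
      have hm : AEStronglyMeasurable (fun t => F (ξ, t)) (volume.restrict (Ioi 0)) :=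
        (hFc.comp (by fun_prop : Continuous fun t : ℝ => (ξ, t))).aestronglyMeasurable
      rw [← integrable_norm_iff hm]
      simp_rw [hFn]
      exact (hexp ξ).mul_const _
    · simp_rw [hFn, integral_mul_const, hexpv, ← norm_mul]
      exact hr.norm
  set J : ℝ → ℝ := fun t => Real.exp (-(t * κ)) * ∫ x, heat t x * (h x).re with hJ
  have hhi : ∀ t, 0 < t → Integrable (fun x => heat t x * (h x).re) := by
    intro t ht
    refine hi.re.bdd_mul (c := (Real.pi / ((2 * Real.pi) ^ 2 * t)) ^ ((3 : ℝ) / 2)) ?_ ?_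
    · exact Continuous.aestronglyMeasurable (by unfold heat; fun_prop)
    · refine .of_forall fun x => ?_
      rw [Real.norm_of_nonneg (heat_pos ht x).le]
      exact heat_le ht x
  have hJeq : ∀ t ∈ Ioi (0 : ℝ), ∫ ξ, F (ξ, t) = J t := by
    intro t ht
    have ht' : 0 < t := ht
    have e1 : ∫ ξ, F (ξ, t) = Complex.exp (-(t * κ : ℝ)) *
        ∫ ξ, Complex.exp (-(t * lsym ξ : ℝ)) * 𝓕 h ξ := by
      rw [← integral_const_mul]
      congr 1; ext ξ
      rw [hF, ← mul_assoc, ← Complex.exp_add]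
      push_cast; ring_nf
    have e3 := VectorFourier.integral_fourierIntegral_smul_eq_flip (𝕜 := ℝ)
      (e := Real.fourierChar)
      (L := innerₗ E3) (μ := (volume : Measure E3)) (ν := (volume : Measure E3))
      Real.continuous_fourierChar (by simp only [innerₗ_apply_apply]; fun_prop)
      (heat_symbol_integrable ht') hi
    simp only [flip_innerₗ, smul_eq_mul] at e3
    have e4 : ∀ G : E3 → ℂ, VectorFourier.fourierIntegral Real.fourierChar volume (innerₗ E3) G
      = 𝓕 G := fun G => rfl
    rw [e4, e4] at e3
    rw [e1, ← e3]
    change _ = ((Real.exp (-(t * κ)) * ∫ x, heat t x * (h x).re : ℝ) : ℂ)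
    have e5 : Complex.exp (-((t * κ : ℝ) : ℂ)) = ((Real.exp (-(t * κ)) : ℝ) : ℂ) := by
      push_cast; rfl
    rw [e5, Complex.ofReal_mul (Real.exp (-(t * κ)))]
    congr 1
    · rw [← integral_complex_ofReal]
      refine integral_congr_ae ?_
      filter_upwards [hnn] with x hx
      rw [fourier_heat ht']
      apply Complex.ext <;> simp [hx.2]
  have hJ0 : ∀ t ∈ Ioi (0 : ℝ), 0 ≤ J t := by
    intro t ht
    refine mul_nonneg (Real.exp_pos _).le (integral_nonneg_of_ae ?_)
    filter_upwards [hnn] with x hx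
    exact mul_nonneg (heat_pos ht x).le hx.1
  have hJi : IntegrableOn J (Ioi 0) := by
    have h2 : Integrable (fun t => ∫ ξ, F (ξ, t)) (volume.restrict (Ioi 0)) :=
      hFi.integral_prod_right
    have h3 := h2.re
    refine h3.congr ?_
    filter_upwards [ae_restrict_mem measurableSet_Ioi] with t ht
    rw [hJeq t ht]; simp
  refine ⟨∫ t in Ioi (0 : ℝ), J t, ?_, setIntegral_nonneg measurableSet_Ioi hJ0, ?_⟩
  · calc ∫ ξ, rsym κ ξ * 𝓕 h ξ = ∫ ξ, ∫ t in Ioi (0 : ℝ), F (ξ, t) := by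
          congr 1; ext ξ
          rw [← rsym_eq_integral hκ, ← integral_mul_const]
      _ = ∫ t in Ioi (0 : ℝ), ∫ ξ, F (ξ, t) := integral_integral_swap hFi
      _ = ∫ t in Ioi (0 : ℝ), (J t : ℂ) := setIntegral_congr_fun measurableSet_Ioi hJeq
      _ = _ := integral_complex_ofReal
  · intro hz
    have h1 : J =ᵐ[volume.restrict (Ioi 0)] 0 :=
      (setIntegral_eq_zero_iff_of_nonneg_ae
        ((ae_restrict_mem measurableSet_Ioi).mono hJ0) hJi).1 hz
    have h2 : ∃ t, 0 < t ∧ J t = 0 := by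
      have hne : (ae (volume.restrict (Ioi (0 : ℝ)))).NeBot := by
        rw [ae_neBot, Ne, Measure.restrict_eq_zero]
        simp
      obtain ⟨t, ht, ht'⟩ := (h1.and (ae_restrict_mem measurableSet_Ioi)).exists
      exact ⟨t, ht', ht⟩
    obtain ⟨t, ht, hJt⟩ := h2
    have h3 : ∫ x, heat t x * (h x).re = 0 := by
      rcases mul_eq_zero.1 hJt with h | h
      · exact absurd h (Real.exp_pos _).ne'
      · exact h
    rw [integral_eq_zero_iff_of_nonneg_ae _ (hhi t ht)] at h3
    · have : h =ᵐ[volume] 0 := by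
        filter_upwards [h3, hnn] with x hx hx'
        have := (mul_eq_zero.1 hx).resolve_left (heat_pos ht x).ne'
        exact Complex.ext this hx'.2
      rw [integral_congr_ae this]; simp
    · filter_upwards [hnn] with x hx
      exact mul_nonneg (heat_pos ht x).le hx.1

lemma res_pairing_of_integrable {κ : ℝ} (hκ : 0 < κ) {f g : L2} (hf : NN f) (hg : NN g)
    (hfi : Integrable f (volume : Measure E3)) (hgi : Integrable g (volume : Measure E3)) :
    ∃ r : ℝ, inner ℂ g (res κ hκ f) = r ∧ 0 ≤ r ∧ (r = 0 → f = 0 ∨ g = 0) := by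
  set g' : E3 → ℂ := fun x => g (-x) with hg'
  have hgi' : Integrable g' := hgi.comp_neg
  have hgn : ∀ᵐ x, 0 ≤ (g' x).re ∧ (g' x).im = 0 :=
    (Measure.measurePreserving_neg (volume : Measure E3)).quasiMeasurePreserving.ae hg
  set h : E3 → ℂ := convolution (f : E3 → ℂ) g' (ContinuousLinearMap.mul ℂ ℂ) volume with hh
  have hi : Integrable h := hfi.integrable_convolution _ hgi'
  have hF : ∀ ξ, 𝓕 h ξ = 𝓕 (f : E3 → ℂ) ξ * 𝓕 g' ξ := fun ξ =>
    Real.fourier_mul_convolution_eq hfi hgi' ξ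
  have hconj : ∀ ξ, 𝓕 g' ξ = conj (𝓕 (g : E3 → ℂ) ξ) := by
    intro ξ
    rw [Real.fourier_eq', Real.fourier_eq', ← integral_conj]
    rw [← integral_neg_eq_self]
    refine integral_congr_ae ?_
    filter_upwards [hg] with x hx
    simp only [hg', neg_neg, smul_eq_mul, map_mul, ← Complex.exp_conj, Complex.conj_I,
      Complex.conj_ofReal, inner_neg_left, Complex.conj_eq_iff_im.2 hx.2]
    congr 2
    push_cast
    ring
  have hsp : ∀ᵐ ξ, rsym κ ξ * (FT f ξ * conj (FT g ξ)) = rsym κ ξ * 𝓕 h ξ := by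
    filter_upwards [fourier_L1_eq f hfi, fourier_L1_eq g hgi] with ξ h1 h2
    rw [hF, hconj, h1, h2]
  have hr : Integrable fun ξ => rsym κ ξ * 𝓕 h ξ := by
    have h1 := l2_integrable_mul (FT (res κ hκ f)) (FT g)
    refine h1.congr ?_
    filter_upwards [FT_res κ hκ f, hsp] with ξ a b
    rw [a, ← b, mul_assoc]
  have hnn : ∀ x, 0 ≤ (h x).re ∧ (h x).im = 0 := by
    intro x
    have hpos : ∀ᵐ t, 0 ≤ (f t * g' (x - t)).re ∧ (f t * g' (x - t)).im = 0 := by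
      have hq : ∀ᵐ t, 0 ≤ (g' (x - t)).re ∧ (g' (x - t)).im = 0 :=
        (Measure.measurePreserving_sub_left (volume : Measure E3) x).quasiMeasurePreserving.ae hgn
      filter_upwards [hf, hq] with t h1 h2
      simp only [Complex.mul_re, Complex.mul_im, h1.2, h2.2]
      exact ⟨by have := mul_nonneg h1.1 h2.1; simpa, by simp⟩
    have e : h x = ((∫ t, (f t * g' (x - t)).re : ℝ) : ℂ) := by
      rw [← integral_complex_ofReal]
      refine integral_congr_ae ?_
      filter_upwards [hpos] with t ht
      exact Complex.ext (by simp) (by simpa using ht.2)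
    rw [e]
    refine ⟨?_, Complex.ofReal_im _⟩
    rw [Complex.ofReal_re]
    exact integral_nonneg_of_ae (hpos.mono fun t ht => ht.1)
  obtain ⟨r, hr1, hr2, hr3⟩ := integral_rsym_fourier hκ h hi hr (.of_forall hnn)
  refine ⟨r, ?_, hr2, fun h0 => ?_⟩
  · rw [inner_res, ← hr1]
    exact integral_congr_ae hsp
  · have h1 := hr3 h0
    rw [hh, integral_convolution _ hfi hgi'] at h1
    have zero_of : ∀ k : L2, NN k → Integrable k (volume : Measure E3) → ∫ x, k x = 0 → k = 0 := by
      intro k hk hki h0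
      have : ∫ x, (k x).re = 0 := by
        have := integral_re hki
        simp only [RCLike.re_eq_complex_re] at this
        rw [this, h0]; simp
      rw [integral_eq_zero_iff_of_nonneg_ae (hk.mono fun x hx => hx.1) hki.re] at this
      apply Lp.ext
      filter_upwards [this, hk, Lp.coeFn_zero ℂ 2 (volume : Measure E3)] with x a b c
      rw [c]
      exact Complex.ext a b.2
    rcases mul_eq_zero.1 h1 with h2 | h2
    · exact Or.inl (zero_of f hf hfi h2)
    · refine Or.inr (zero_of g hg hgi ?_)
      rw [← h2, hg', integral_neg_eq_self (fun x => g x)]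

/-- Truncation to the ball of radius `n`. -/
def trunc (n : ℕ) : L2 →L[ℂ] L2 :=
  mulOp ((Metric.ball (0 : E3) n).indicator fun _ => (1 : ℂ))
    (memLp_top_of_bound ((stronglyMeasurable_const.indicator
      Metric.isOpen_ball.measurableSet).aestronglyMeasurable) 1 (.of_forall fun x => by
      by_cases h : x ∈ Metric.ball (0 : E3) n <;> simp [h]))

lemma trunc_coe (n : ℕ) (f : L2) : (trunc n f : E3 → ℂ) =ᵐ[volume]
    fun x => (Metric.ball (0 : E3) n).indicator (fun _ => (1 : ℂ)) x * f x := mulOp_coe _ _ f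

lemma trunc_integrable (n : ℕ) (f : L2) : Integrable (trunc n f) (volume : Measure E3) := by
  have h1 : IntegrableOn f (Metric.ball (0 : E3) n) := by
    have : IsFiniteMeasure (volume.restrict (Metric.ball (0 : E3) n)) :=
      ⟨by simpa using (measure_ball_lt_top (μ := (volume : Measure E3)) (x := 0) (r := n))⟩
    exact ((Lp.memLp f).restrict _).integrable (by norm_num)
  rw [← integrable_indicator_iff Metric.isOpen_ball.measurableSet] at h1
  refine h1.congr ?_
  filter_upwards [trunc_coe n f] with x hx
  rw [hx]
  by_cases h : x ∈ Metric.ball (0 : E3) n <;> simp [h]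

lemma trunc_tendsto (f : L2) : Tendsto (fun n => trunc n f) atTop (𝓝 f) := by
  rw [tendsto_iff_norm_sub_tendsto_zero]
  have h : Tendsto (fun n => ‖trunc n f - f‖ ^ 2) atTop (𝓝 0) := by
    have h1 : ∀ n, ‖trunc n f - f‖ ^ 2 =
        ∫ x, ((Metric.ball (0 : E3) n)ᶜ).indicator (fun x => ‖f x‖ ^ 2) x := by
      intro n
      rw [l2_norm_sq]
      refine integral_congr_ae ?_
      filter_upwards [trunc_coe n f, Lp.coeFn_sub (trunc n f) f] with x h1 h2
      rw [h2, Pi.sub_apply, h1]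
      by_cases h : x ∈ Metric.ball (0 : E3) n <;> simp [h]
    simp_rw [h1]
    have h0 : ∫ x : E3, (0 : ℝ) = 0 := by simp
    rw [← h0]
    refine tendsto_integral_of_dominated_convergence (fun x => ‖f x‖ ^ 2) ?_ (l2_integrable_sq f)
      ?_ ?_
    · intro n
      exact (l2_integrable_sq f).1.indicator Metric.isOpen_ball.measurableSet.compl
    · refine fun n => .of_forall fun x => ?_
      refine (norm_indicator_le_norm_self _ _).trans ?_
      simp
    · refine .of_forall fun x => tendsto_const_nhds.congr' ?_
      obtain ⟨N, hN⟩ := exists_nat_gt ‖x‖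
      filter_upwards [eventually_ge_atTop N] with n hn
      have : x ∈ Metric.ball (0 : E3) n := by
        simp only [Metric.mem_ball, dist_zero_right]
        exact hN.trans_le (by exact_mod_cast hn)
      simp [this]
  have := h.sqrt
  simpa [Real.sqrt_sq (norm_nonneg _)] using this

lemma NN.trunc {f : L2} (hf : NN f) (n : ℕ) : NN (trunc n f) := by
  filter_upwards [hf, trunc_coe n f] with x h1 h2
  rw [h2]
  by_cases h : x ∈ Metric.ball (0 : E3) n <;> simp [h, h1]

lemma NN.sub_trunc {f : L2} (hf : NN f) (n : ℕ) : NN (f - SolitonPotential.trunc n f) := by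
  filter_upwards [hf, trunc_coe n f, Lp.coeFn_sub f (SolitonPotential.trunc n f)] with x h1 h2 h3
  rw [h3, Pi.sub_apply, h2]
  by_cases h : x ∈ Metric.ball (0 : E3) n <;> simp [h, h1]

lemma res_pairing_nonneg {κ : ℝ} (hκ : 0 < κ) {f g : L2} (hf : NN f) (hg : NN g) :
    0 ≤ (inner ℂ g (res κ hκ f)).re ∧ (inner ℂ g (res κ hκ f)).im = 0 := by
  have h : Tendsto (fun n => inner ℂ (trunc n g) (res κ hκ (trunc n f))) atTop
      (𝓝 (inner ℂ g (res κ hκ f))) :=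
    (trunc_tendsto g).inner (((res κ hκ).continuous.tendsto f).comp (trunc_tendsto f))
  have hn : ∀ n, 0 ≤ (inner ℂ (trunc n g) (res κ hκ (trunc n f))).re ∧
      (inner ℂ (trunc n g) (res κ hκ (trunc n f))).im = 0 := by
    intro n
    obtain ⟨r, h1, h2, -⟩ := res_pairing_of_integrable hκ (hf.trunc n) (hg.trunc n)
      (trunc_integrable n f) (trunc_integrable n g)
    rw [h1]; exact ⟨h2, Complex.ofReal_im r⟩
  constructor
  · exact ge_of_tendsto' ((Complex.continuous_re.tendsto _).comp h) fun n => (hn n).1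
  · refine tendsto_nhds_unique ((Complex.continuous_im.tendsto _).comp h) ?_
    exact tendsto_const_nhds.congr fun n => ((hn n).2).symm

lemma res_pairing_eq_zero {κ : ℝ} (hκ : 0 < κ) {f g : L2} (hf : NN f) (hg : NN g)
    (h0 : inner ℂ g (res κ hκ f) = 0) : f = 0 ∨ g = 0 := by
  have key : ∀ n, trunc n f = 0 ∨ trunc n g = 0 := by
    intro n
    obtain ⟨r, h1, h2, h3⟩ := res_pairing_of_integrable hκ (hf.trunc n) (hg.trunc n)
      (trunc_integrable n f) (trunc_integrable n g)
    apply h3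
    have a := (res_pairing_nonneg hκ (hf.sub_trunc n) hg).1
    have b := (res_pairing_nonneg hκ (hf.trunc n) (hg.sub_trunc n)).1
    rw [map_sub, inner_sub_right, h0] at a
    rw [inner_sub_left, h1] at b
    simp only [Complex.sub_re, Complex.zero_re, Complex.ofReal_re] at a b
    linarith
  by_contra hcon
  push Not at hcon
  have e1 := (trunc_tendsto f).eventually_ne hcon.1
  have e2 := (trunc_tendsto g).eventually_ne hcon.2
  obtain ⟨n, h1, h2⟩ := (e1.and e2).exists
  exact (key n).elim h1 h2

lemma NN.res {κ : ℝ} (hκ : 0 < κ) {f : L2} (hf : NN f) : NN (res κ hκ f) := by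
  set u := SolitonPotential.res κ hκ f with hu
  have main : ∀ φ : ℂ → ℝ, Continuous φ → (∀ z, |φ z| ≤ ‖z‖) → (∀ z, 0 ≤ φ z) →
      0 ≤ (∫ x, u x * (φ (u x) : ℂ)).re ∧ (∫ x, u x * (φ (u x) : ℂ)).im = 0 ∧
      Integrable (fun x => u x * (φ (u x) : ℂ)) := by
    intro φ hc hb hn
    obtain ⟨g, hg⟩ := exists_l2_comp (fun z => (φ z : ℂ)) (by fun_prop)
      (fun z => by simpa using hb z) u
    have hgn : NN g := by
      filter_upwards [hg] with x hx
      rw [hx]; exact ⟨by simpa using hn _, Complex.ofReal_im _⟩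
    have hp := res_pairing_nonneg hκ hf hgn
    have e : (fun x => u x * conj (g x)) =ᵐ[volume] fun x => u x * (φ (u x) : ℂ) := by
      filter_upwards [hg] with x hx
      rw [hx, Complex.conj_ofReal]
    rw [← hu, l2_inner_eq, integral_congr_ae e] at hp
    exact ⟨hp.1, hp.2, (l2_integrable_mul u g).congr e⟩
  have hre : ∀ (φ : ℂ → ℝ), Integrable (fun x => u x * (φ (u x) : ℂ)) →
      (∫ x, u x * (φ (u x) : ℂ)).re = ∫ x, (u x).re * φ (u x) := by
    intro φ hi
    have := integral_re hi
    simp only [RCLike.re_eq_complex_re] at this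
    rw [← this]; simp
  have him : ∀ (φ : ℂ → ℝ), Integrable (fun x => u x * (φ (u x) : ℂ)) →
      (∫ x, u x * (φ (u x) : ℂ)).im = ∫ x, (u x).im * φ (u x) := by
    intro φ hi
    have := integral_im hi
    simp only [RCLike.im_eq_complex_im] at this
    rw [← this]; simp
  have a1 : ∀ᵐ x, 0 ≤ (u x).re := by
    obtain ⟨h1, -, h3⟩ := main (fun z => max (-z.re) 0) (by fun_prop)
      (fun z => by
        rw [abs_of_nonneg (le_max_right _ _)]
        exact max_le ((neg_le_abs _).trans (Complex.abs_re_le_norm z)) (norm_nonneg _))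
      (fun z => le_max_right _ _)
    rw [hre (fun z => max (-z.re) 0) h3] at h1
    have hi : Integrable fun x => (u x).re * max (-(u x).re) 0 := by
      refine h3.re.congr (.of_forall fun x => ?_)
      simp
    have hle : ∀ x, 0 ≤ -((u x).re * max (-(u x).re) 0) := by
      intro x
      rcases le_total 0 (u x).re with h | h
      · rw [max_eq_right (by linarith)]; simp
      · rw [max_eq_left (by linarith)]; nlinarith
    have hz : ∫ x, -((u x).re * max (-(u x).re) 0) = 0 := by
      refine le_antisymm ?_ (integral_nonneg hle)
      rw [integral_neg]; linarith
    rw [integral_eq_zero_iff_of_nonneg hle hi.neg] at hz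
    filter_upwards [hz] with x hx
    by_contra hneg
    push Not at hneg
    have : -((u x).re * max (-(u x).re) 0) = 0 := hx
    rw [max_eq_left (by linarith)] at this
    nlinarith
  have a2 : ∀ s : ℝ, |s| = 1 → ∀ᵐ x, s * (u x).im ≤ 0 := by
    intro s hs
    obtain ⟨-, h1, h3⟩ := main (fun z => max (s * z.im) 0) (by fun_prop)
      (fun z => by
        rw [abs_of_nonneg (le_max_right _ _)]
        refine max_le ((le_abs_self _).trans ?_) (norm_nonneg _)
        rw [abs_mul, hs, one_mul]
        exact Complex.abs_im_le_norm z)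
      (fun z => le_max_right _ _)
    rw [him (fun z => max (s * z.im) 0) h3] at h1
    have hi : Integrable fun x => (u x).im * max (s * (u x).im) 0 := by
      refine h3.im.congr (.of_forall fun x => ?_)
      simp
    have hle : ∀ x, 0 ≤ s * ((u x).im * max (s * (u x).im) 0) := by
      intro x
      rcases le_total 0 (s * (u x).im) with h | h
      · rw [max_eq_left h]; nlinarith
      · rw [max_eq_right h]; simp
    have hz : ∫ x, s * ((u x).im * max (s * (u x).im) 0) = 0 := by
      rw [integral_const_mul, h1, mul_zero]
    rw [integral_eq_zero_iff_of_nonneg hle (hi.const_mul s)] at hz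
    filter_upwards [hz] with x hx
    by_contra hneg
    push Not at hneg
    have : s * ((u x).im * max (s * (u x).im) 0) = 0 := hx
    rw [max_eq_left hneg.le] at this
    nlinarith
  filter_upwards [a1, a2 1 (by simp), a2 (-1) (by simp)] with x h1 h2 h3
  exact ⟨h1, by linarith⟩

/-! ### The Schrödinger operator and the simplicity of the lowest eigenvalue -/

/-- Real valued functions in `L²`. -/
def RealL2 (f : L2) : Prop := ∀ᵐ x, (f x).im = 0

lemma NN.real {f : L2} (h : NN f) : RealL2 f := h.mono fun _ h => h.2

lemma RealL2.sub {f g : L2} (hf : RealL2 f) (hg : RealL2 g) : RealL2 (f - g) := by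
  filter_upwards [hf, hg, Lp.coeFn_sub f g] with x h1 h2 h3
  rw [h3, Pi.sub_apply, Complex.sub_im, h1, h2, sub_zero]

lemma RealL2.exists_sub {f : L2} (hf : RealL2 f) : ∃ p q, NN p ∧ NN q ∧ f = p - q := by
  obtain ⟨p, hp⟩ := exists_l2_comp (fun z => ((max z.re 0 : ℝ) : ℂ)) (by fun_prop) (fun z => by
    rw [Complex.norm_real, Real.norm_of_nonneg (le_max_right _ _)]
    exact max_le ((le_abs_self _).trans (Complex.abs_re_le_norm z)) (norm_nonneg _)) f
  obtain ⟨q, hq⟩ := exists_l2_comp (fun z => ((max (-z.re) 0 : ℝ) : ℂ)) (by fun_prop) (fun z => by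
    rw [Complex.norm_real, Real.norm_of_nonneg (le_max_right _ _)]
    exact max_le ((neg_le_abs _).trans (Complex.abs_re_le_norm z)) (norm_nonneg _)) f
  refine ⟨p, q, ?_, ?_, ?_⟩
  · filter_upwards [hp] with x hx
    rw [hx]; simp
  · filter_upwards [hq] with x hx
    rw [hx]; simp
  · apply Lp.ext
    filter_upwards [hf, hp, hq, Lp.coeFn_sub p q] with x h1 h2 h3 h4
    rw [h4, Pi.sub_apply, h2, h3]
    refine Complex.ext ?_ (by simpa using h1)
    simp only [Complex.sub_re, Complex.ofReal_re]
    rcases le_total 0 (f x).re with h | h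
    · rw [max_eq_left h, max_eq_right (by linarith), sub_zero]
    · rw [max_eq_right h, max_eq_left (by linarith)]; ring

lemma RealL2.res {κ : ℝ} (hκ : 0 < κ) {f : L2} (hf : RealL2 f) : RealL2 (res κ hκ f) := by
  obtain ⟨p, q, hp, hq, rfl⟩ := hf.exists_sub
  rw [map_sub]
  exact (hp.res hκ).real.sub (hq.res hκ).real

/-- The Schrödinger operator `-Δ + V : H² → L²`. -/
def Hop (V : 𝓢(E3, ℝ)) : Sob 2 →L[ℂ] L2 := -lapL + potOp V ∘L sobL2

lemma Hop_apply (V : 𝓢(E3, ℝ)) (u : Sob 2) : Hop V u = -lapL u + potOp V (sobL2 u) := rfl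

lemma isEigen_iff (V : 𝓢(E3, ℝ)) (z : ℂ) (u : Sob 2) :
    IsEigen V z u ↔ Hop V u = z • sobL2 u := by
  rw [Hop_apply, Lp.ext_iff, IsEigen]
  have h : ∀ᵐ x, (-(sobLap u x) + (V x : ℂ) * sobFn u x = z * sobFn u x) ↔
      (-lapL u + potOp V (sobL2 u)) x = (z • sobL2 u) x := by
    filter_upwards [Lp.coeFn_add (-lapL u) (potOp V (sobL2 u)), Lp.coeFn_neg (lapL u),
      potOp_coe V (sobL2 u), Lp.coeFn_smul z (sobL2 u)] with x h1 h2 h3 h4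
    rw [h1, Pi.add_apply, h2, Pi.neg_apply, h3, h4, Pi.smul_apply, lapL_apply, smul_eq_mul,
      sobL2_coe]
  constructor
  · intro hh
    filter_upwards [h, hh] with x h1 h2 using h1.1 h2
  · intro hh
    filter_upwards [h, hh] with x h1 h2 using h1.2 h2

lemma potOp_symm (V : 𝓢(E3, ℝ)) (f g : L2) :
    inner ℂ (potOp V f) g = inner ℂ f (potOp V g) := by
  rw [l2_inner_eq, l2_inner_eq]
  refine integral_congr_ae ?_
  filter_upwards [potOp_coe V f, potOp_coe V g] with x h1 h2
  rw [h1, h2, map_mul, Complex.conj_ofReal]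
  ring

lemma lapL_symm (u w : Sob 2) : inner ℂ (lapL u) (sobL2 w) = inner ℂ (sobL2 u) (lapL w) := by
  rw [← FT.inner_map_map, ← FT.inner_map_map (sobL2 u), l2_inner_eq, l2_inner_eq]
  refine integral_congr_ae ?_
  filter_upwards [FT_lapL u, FT_lapL w] with x h1 h2
  rw [h1, h2, map_mul, map_neg, Complex.conj_ofReal]
  ring

lemma Hop_symm (V : 𝓢(E3, ℝ)) (u w : Sob 2) :
    inner ℂ (Hop V u) (sobL2 w) = inner ℂ (sobL2 u) (Hop V w) := by
  simp only [Hop_apply, inner_add_left, inner_add_right, inner_neg_left, inner_neg_right,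
    potOp_symm, lapL_symm]

/-- A positive weight: multiplication by `c - V`. -/
def wOp (V : 𝓢(E3, ℝ)) (c : ℝ) : L2 →L[ℂ] L2 := (c : ℂ) • ContinuousLinearMap.id ℂ L2 - potOp V

lemma wOp_coe (V : 𝓢(E3, ℝ)) (c : ℝ) (f : L2) :
    (wOp V c f : E3 → ℂ) =ᵐ[volume] fun x => ((c - V x : ℝ) : ℂ) * f x := by
  have e : wOp V c f = (c : ℂ) • f - potOp V f := rfl
  rw [e]
  filter_upwards [Lp.coeFn_sub ((c : ℂ) • f) (potOp V f), Lp.coeFn_smul (c : ℂ) f,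
    potOp_coe V f] with x h1 h2 h3
  rw [h1, Pi.sub_apply, h2, h3, Pi.smul_apply, smul_eq_mul]
  push_cast; ring

lemma wOp_symm (V : 𝓢(E3, ℝ)) (c : ℝ) (f g : L2) :
    inner ℂ (wOp V c f) g = inner ℂ f (wOp V c g) := by
  have e : ∀ f, wOp V c f = (c : ℂ) • f - potOp V f := fun _ => rfl
  simp only [e, inner_sub_left, inner_sub_right, inner_smul_left, inner_smul_right,
    Complex.conj_ofReal, potOp_symm]

section positive

variable {V : 𝓢(E3, ℝ)} {c : ℝ} (hc : ∀ x, 1 ≤ c - V x)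
include hc

lemma NN.wOp {f : L2} (hf : NN f) : NN (wOp V c f) := by
  filter_upwards [hf, wOp_coe V c f] with x h1 h2
  rw [h2, Complex.re_ofReal_mul, Complex.im_ofReal_mul, h1.2, mul_zero]
  exact ⟨mul_nonneg (by linarith [hc x]) h1.1, rfl⟩

lemma wOp_eq_zero {f : L2} (h : wOp V c f = 0) : f = 0 := by
  apply Lp.ext
  filter_upwards [wOp_coe V c f, Lp.coeFn_zero ℂ 2 (volume : Measure E3)] with x h2 h3
  rw [h, h3] at h2
  rw [h3]
  refine (mul_eq_zero.1 h2.symm).resolve_left ?_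
  have := hc x
  exact Complex.ofReal_ne_zero.2 (by linarith)

omit hc in
/-- A nonnegative function orthogonal to a positive one vanishes. -/
lemma NN.eq_zero_of_inner {f g : L2} (hf : NN f) (hg : ∀ᵐ x, 0 < (g x).re ∧ (g x).im = 0)
    (h : inner ℂ g f = 0) : f = 0 := by
  rw [l2_inner_eq] at h
  have hi := l2_integrable_mul f g
  have hr : Integrable (fun x => (f x * conj (g x)).re) := hi.re
  have e := integral_re hi
  simp only [RCLike.re_eq_complex_re] at e
  rw [h, Complex.zero_re, integral_eq_zero_iff_of_nonneg_ae _ hr] at e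
  · apply Lp.ext
    filter_upwards [e, hf, hg, Lp.coeFn_zero ℂ 2 (volume : Measure E3)] with x h1 h2 h3 h4
    rw [h4]
    have : (f x * conj (g x)).re = 0 := h1
    rw [Complex.mul_re, Complex.conj_re, Complex.conj_im, h2.2, zero_mul, sub_zero] at this
    exact Complex.ext ((mul_eq_zero.1 this).resolve_right h3.1.ne') h2.2
  · filter_upwards [hf, hg] with x h2 h3
    simp only [Pi.zero_apply, Complex.mul_re, Complex.conj_re, Complex.conj_im, h2.2, zero_mul,
      sub_zero]
    exact mul_nonneg h2.1 h3.1.le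

lemma fixed_real_eq_zero {κ : ℝ} (hκ : 0 < κ) {φ a : L2}
    (hφ : ∀ᵐ x, 0 < (φ x).re ∧ (φ x).im = 0) (hAφ : SolitonPotential.res κ hκ (wOp V c φ) = φ)
    (ha : RealL2 a) (hAa : SolitonPotential.res κ hκ (wOp V c a) = a)
    (horth : inner ℂ φ a = 0) : a = 0 := by
  obtain ⟨b, hb⟩ := exists_l2_comp (fun z => (‖z‖ : ℂ)) (by fun_prop) (fun z => by simp) a
  have hbn : NN b := by
    filter_upwards [hb] with x hx
    rw [hx]; exact ⟨by simp, Complex.ofReal_im _⟩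
  have habs : ∀ᵐ x, (b x).re = |(a x).re| := by
    filter_upwards [hb, ha] with x hx h
    rw [hx, Complex.ofReal_re, Complex.norm_eq_sqrt_sq_add_sq, h]
    simp [Real.sqrt_sq_eq_abs]
  have hplus : NN (b + a) := by
    filter_upwards [hbn, habs, ha, Lp.coeFn_add b a] with x h1 h2 h3 h4
    rw [h4, Pi.add_apply, Complex.add_re, Complex.add_im, h1.2, h3, h2]
    exact ⟨by linarith [neg_abs_le (a x).re], by simp⟩
  have hminus : NN (b - a) := by
    filter_upwards [hbn, habs, ha, Lp.coeFn_sub b a] with x h1 h2 h3 h4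
    rw [h4, Pi.sub_apply, Complex.sub_re, Complex.sub_im, h1.2, h3, h2]
    exact ⟨by linarith [le_abs_self (a x).re], by simp⟩
  set A : L2 →L[ℂ] L2 := SolitonPotential.res κ hκ ∘L wOp V c with hA
  have hAa' : A a = a := hAa
  have hAφ' : A φ = φ := hAφ
  have A1 : NN (A b + a) := by
    have := (hplus.wOp hc).res hκ
    change NN (A (b + a)) at this
    rwa [map_add, hAa'] at this
  have A2 : NN (A b - a) := by
    have := (hminus.wOp hc).res hκ
    change NN (A (b - a)) at this
    rwa [map_sub, hAa'] at this
  have hd : NN (A b - b) := by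
    filter_upwards [A1, A2, hbn, habs, ha, Lp.coeFn_sub (A b) b, Lp.coeFn_sub (A b) a,
      Lp.coeFn_add (A b) a] with x h1 h2 h3 h4 h5 h6 h7 h8
    rw [h6, Pi.sub_apply, Complex.sub_re, Complex.sub_im]
    rw [h8, Pi.add_apply, Complex.add_re, Complex.add_im] at h1
    rw [h7, Pi.sub_apply, Complex.sub_re, Complex.sub_im] at h2
    refine ⟨?_, by linarith [h1.2, h3.2]⟩
    rw [h4]
    rcases abs_cases (a x).re with h | h <;> linarith [h1.1, h2.1]
  have hWφ : ∀ᵐ x, 0 < (wOp V c φ x).re ∧ (wOp V c φ x).im = 0 := by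
    filter_upwards [hφ, wOp_coe V c φ] with x h1 h2
    rw [h2, Complex.re_ofReal_mul, Complex.im_ofReal_mul, h1.2, mul_zero]
    exact ⟨mul_pos (by linarith [hc x]) h1.1, rfl⟩
  have hAb : A b = b := by
    refine sub_eq_zero.1 (hd.eq_zero_of_inner hWφ ?_)
    rw [inner_sub_right, sub_eq_zero]
    change inner ℂ (wOp V c φ) (SolitonPotential.res κ hκ (wOp V c b)) = _
    rw [← res_symm, hAφ, wOp_symm]
  have hpq : inner ℂ (b - a) (b + a) = 0 := by
    rw [l2_inner_eq]
    have : ∀ᵐ x, (b + a) x * conj ((b - a) x) = 0 := by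
      filter_upwards [hbn, habs, ha, Lp.coeFn_sub b a, Lp.coeFn_add b a] with x h1 h2 h3 h4 h5
      rw [h4, h5, Pi.add_apply, Pi.sub_apply, map_sub, Complex.conj_eq_iff_im.2 h1.2,
        Complex.conj_eq_iff_im.2 h3]
      have e1 : b x = ((|(a x).re| : ℝ) : ℂ) := Complex.ext h2 h1.2
      have e2 : a x = (((a x).re : ℝ) : ℂ) := Complex.ext rfl h3
      rw [e1, e2, Complex.ofReal_re]
      norm_cast
      rw [show (|(a x).re| + (a x).re) * (|(a x).re| - (a x).re) =
        |(a x).re| ^ 2 - (a x).re ^ 2 by ring, sq_abs, sub_self]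
    rw [integral_congr_ae this]; simp
  have hfix : SolitonPotential.res κ hκ (wOp V c (b + a)) = b + a := by
    change A (b + a) = _
    rw [map_add, hAb, hAa']
  have hbz : inner ℂ φ b = 0 := by
    rcases res_pairing_eq_zero hκ (hplus.wOp hc) hminus (by rw [hfix]; exact hpq) with h | h
    · have := wOp_eq_zero hc h
      rw [eq_neg_of_add_eq_zero_left this, inner_neg_right, horth, neg_zero]
    · rw [sub_eq_zero.1 h, horth]
  have hb0 := hbn.eq_zero_of_inner hφ hbz
  apply Lp.ext
  filter_upwards [hb, Lp.coeFn_zero ℂ 2 (volume : Measure E3)] with x h1 h2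
  rw [hb0, h2] at h1
  rw [h2]
  have : (‖a x‖ : ℂ) = 0 := h1.symm
  exact norm_eq_zero.1 (by exact_mod_cast this)

lemma fixed_eq_zero {κ : ℝ} (hκ : 0 < κ) {φ u : L2}
    (hφ : ∀ᵐ x, 0 < (φ x).re ∧ (φ x).im = 0) (hAφ : SolitonPotential.res κ hκ (wOp V c φ) = φ)
    (hAu : SolitonPotential.res κ hκ (wOp V c u) = u)
    (horth : inner ℂ φ u = 0) : u = 0 := by
  obtain ⟨a, ha⟩ := exists_l2_comp (fun z => (z.re : ℂ)) (by fun_prop)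
    (fun z => by simpa using Complex.abs_re_le_norm z) u
  obtain ⟨b, hb⟩ := exists_l2_comp (fun z => (z.im : ℂ)) (by fun_prop)
    (fun z => by simpa using Complex.abs_im_le_norm z) u
  have har : RealL2 a := by filter_upwards [ha] with x hx; rw [hx]; exact Complex.ofReal_im _
  have hbr : RealL2 b := by filter_upwards [hb] with x hx; rw [hx]; exact Complex.ofReal_im _
  have hu : u = a + Complex.I • b := by
    apply Lp.ext
    filter_upwards [ha, hb, Lp.coeFn_add a (Complex.I • b), Lp.coeFn_smul Complex.I b]
      with x h1 h2 h3 h4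
    rw [h3, Pi.add_apply, h4, Pi.smul_apply, h1, h2, smul_eq_mul, mul_comm Complex.I,
      Complex.re_add_im]
  have hwr : ∀ {f : L2}, RealL2 f → RealL2 (wOp V c f) := by
    intro f hf
    filter_upwards [hf, wOp_coe V c f] with x h1 h2
    rw [h2, Complex.im_ofReal_mul, h1, mul_zero]
  have split : ∀ {f g f' g' : L2}, RealL2 f → RealL2 g → RealL2 f' → RealL2 g' →
      f + Complex.I • g = f' + Complex.I • g' → f = f' ∧ g = g' := by
    intro f g f' g' h1 h2 h3 h4 he
    have key : ∀ᵐ x, f x = f' x ∧ g x = g' x := by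
      filter_upwards [h1, h2, h3, h4, Lp.coeFn_add f (Complex.I • g), Lp.coeFn_smul Complex.I g,
        Lp.coeFn_add f' (Complex.I • g'), Lp.coeFn_smul Complex.I g'] with x a1 a2 a3 a4 b1 b2 b3 b4
      rw [he, b3, Pi.add_apply, Pi.add_apply, b2, b4, Pi.smul_apply, Pi.smul_apply] at b1
      have r := congrArg Complex.re b1
      have i := congrArg Complex.im b1
      simp [a1, a2, a3, a4] at r i
      exact ⟨Complex.ext r.symm (a1.trans a3.symm), Complex.ext i.symm (a2.trans a4.symm)⟩
    exact ⟨Lp.ext (key.mono fun x h => h.1), Lp.ext (key.mono fun x h => h.2)⟩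
  have hAu' := hAu
  rw [hu, map_add, map_add, map_smul, map_smul] at hAu'
  obtain ⟨e1, e2⟩ := split ((hwr har).res hκ) ((hwr hbr).res hκ) har hbr hAu'
  have hφr : RealL2 φ := hφ.mono fun x h => h.2
  have hin : ∀ {f : L2}, RealL2 f → (inner ℂ φ f : ℂ).im = 0 := by
    intro f hf
    rw [l2_inner_eq]
    have := integral_im (l2_integrable_mul f φ)
    simp only [RCLike.im_eq_complex_im] at this
    rw [← this]
    have h0 : ∀ᵐ x, (f x * conj (φ x)).im = 0 := by
      filter_upwards [hf, hφr] with x h1 h2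
      simp [h1, h2]
    rw [integral_congr_ae h0]; simp
  rw [hu, inner_add_right, inner_smul_right] at horth
  have r := congrArg Complex.re horth
  have i := congrArg Complex.im horth
  simp [hin har, hin hbr] at r i
  rw [hu, fixed_real_eq_zero hc hκ hφ hAφ har e1 (Complex.ext r (hin har)),
    fixed_real_eq_zero hc hκ hφ hAφ hbr e2 (Complex.ext i (hin hbr))]
  simp

end positive

/-- The eigenspace of the eigenvalue with a positive eigenfunction is one dimensional. -/
lemma eigen_simple {V : 𝓢(E3, ℝ)} {e₀ : ℝ} {φ₀ u : Sob 2} (hφ : IsEigen V e₀ φ₀)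
    (hpos : ∀ᵐ x, 0 < (sobFn φ₀ x).re ∧ (sobFn φ₀ x).im = 0) (hu : IsEigen V e₀ u)
    (horth : inner ℂ (sobL2 φ₀) (sobL2 u) = 0) : u = 0 := by
  obtain ⟨C, hC⟩ : ∃ C : ℝ, ∀ x, V x ≤ C := by
    obtain ⟨C, hC⟩ := V.decay 0 0
    refine ⟨C, fun x => (le_abs_self _).trans ?_⟩
    have := hC.2 x
    simpa using this
  set κ : ℝ := |e₀| + |C| + 1 with hκd
  have hκ : 0 < κ := by positivity
  have hc : ∀ x, 1 ≤ (κ + e₀) - V x := fun x => by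
    have := hC x
    linarith [neg_abs_le e₀, le_abs_self C]
  have fix : ∀ w : Sob 2, IsEigen V e₀ w → res κ hκ (wOp V (κ + e₀) (sobL2 w)) = sobL2 w := by
    intro w hw
    rw [isEigen_iff, Hop_apply] at hw
    have e : wOp V (κ + e₀) (sobL2 w) = (κ : ℂ) • sobL2 w - lapL w := by
      change ((κ + e₀ : ℝ) : ℂ) • sobL2 w - potOp V (sobL2 w) = _
      rw [Complex.ofReal_add, add_smul, ← hw]
      abel
    rw [e]
    change sobL2 (resolvent κ hκ _) = _
    rw [resolvent_left_inv]
  apply sobL2_injective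
  rw [map_zero]
  exact fixed_eq_zero hc hκ hpos (fix _ hφ) (fix _ hu) horth

/-! ### Invertibility of the bordered linearized operator -/

/-- `u ↦ ⟨φ₀, u⟩` on `H²`. -/
def coordL (φ₀ : Sob 2) : Sob 2 →L[ℂ] ℂ := innerSL ℂ (sobL2 φ₀) ∘L sobL2

lemma coordL_apply (φ₀ u : Sob 2) : coordL φ₀ u = inner ℂ (sobL2 φ₀) (sobL2 u) := rfl

lemma LinearGroundState.inner_self {V : 𝓢(E3, ℝ)} {e₀ : ℝ} {φ₀ : Sob 2}
    (h : LinearGroundState V e₀ φ₀) : inner ℂ (sobL2 φ₀) (sobL2 φ₀) = (1 : ℂ) := by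
  have h1 := l2_norm_sq (sobL2 φ₀)
  rw [sobL2_coe, h.norm_eq] at h1
  rw [inner_self_eq_norm_sq_to_K]
  change ((‖sobL2 φ₀‖ : ℝ) : ℂ) ^ 2 = 1
  rw [← Complex.ofReal_pow, h1, Complex.ofReal_one]

lemma LinearGroundState.Hop_eq {V : 𝓢(E3, ℝ)} {e₀ : ℝ} {φ₀ : Sob 2}
    (h : LinearGroundState V e₀ φ₀) : Hop V φ₀ = (e₀ : ℂ) • sobL2 φ₀ :=
  (isEigen_iff _ _ _).1 h.eigen

lemma LinearGroundState.inner_Hop_sub {V : 𝓢(E3, ℝ)} {e₀ : ℝ} {φ₀ : Sob 2}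
    (h : LinearGroundState V e₀ φ₀) (u : Sob 2) :
    inner ℂ (sobL2 φ₀) (Hop V u - (e₀ : ℂ) • sobL2 u) = 0 := by
  rw [inner_sub_right, ← Hop_symm, h.Hop_eq, inner_smul_left, inner_smul_right,
    Complex.conj_ofReal, sub_self]

/-- `u ↦ (H - e₀) u + ⟨φ₀, u⟩ φ₀`. -/
def fredOp (V : 𝓢(E3, ℝ)) (e₀ : ℝ) (φ₀ : Sob 2) : Sob 2 →L[ℂ] L2 :=
  Hop V - (e₀ : ℂ) • sobL2 + (coordL φ₀).smulRight (sobL2 φ₀)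

lemma fredOp_apply (V : 𝓢(E3, ℝ)) (e₀ : ℝ) (φ₀ u : Sob 2) :
    fredOp V e₀ φ₀ u = Hop V u - (e₀ : ℂ) • sobL2 u + coordL φ₀ u • sobL2 φ₀ := rfl

lemma fredOp_injective {V : 𝓢(E3, ℝ)} {e₀ : ℝ} {φ₀ : Sob 2}
    (h : LinearGroundState V e₀ φ₀) : Function.Injective (fredOp V e₀ φ₀) := by
  rw [injective_iff_map_eq_zero]
  intro u hu
  have h1 : coordL φ₀ u = 0 := by
    have := congrArg (inner ℂ (sobL2 φ₀)) hu
    rw [fredOp_apply, inner_add_right, h.inner_Hop_sub, zero_add, inner_smul_right, h.inner_self,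
      mul_one, inner_zero_right] at this
    exact this
  rw [fredOp_apply, h1, zero_smul, add_zero, sub_eq_zero] at hu
  exact eigen_simple h.eigen h.pos ((isEigen_iff _ _ _).2 hu) h1

lemma fredOp_surjective {V : 𝓢(E3, ℝ)} {e₀ : ℝ} (he : e₀ < 0) {φ₀ : Sob 2}
    (h : LinearGroundState V e₀ φ₀) : Function.Surjective (fredOp V e₀ φ₀) := by
  have hκ : 0 < -e₀ := by linarith
  set R := resolvent (-e₀) hκ
  set K : L2 →L[ℂ] L2 := (potOp V ∘L sobL2) ∘L R + (coordL φ₀).smulRight (sobL2 φ₀) ∘L R with hK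
  have hKc : IsCompactOperator K := by
    refine IsCompactOperator.add ((potOp_compact V).comp_clm R) ?_
    have h1 : IsCompactOperator (ContinuousLinearMap.toSpanSingleton ℂ (sobL2 φ₀)) :=
      isCompactOperator_of_locallyCompactSpace_rng _
    exact h1.comp_clm (coordL φ₀ ∘L R)
  have hMR : ∀ f, fredOp V e₀ φ₀ (R f) = f + K f := by
    intro f
    have e : ((-e₀ : ℝ) : ℂ) • sobL2 (R f) - lapL (R f) = f := resolvent_right_inv (-e₀) hκ f
    have e' : K f = potOp V (sobL2 (R f)) + coordL φ₀ (R f) • sobL2 φ₀ := rfl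
    rw [fredOp_apply, Hop_apply, e']
    calc _ = (((-e₀ : ℝ) : ℂ) • sobL2 (R f) - lapL (R f)) +
          (potOp V (sobL2 (R f)) + coordL φ₀ (R f) • sobL2 φ₀) := by
          rw [Complex.ofReal_neg, neg_smul]; abel
      _ = _ := by rw [e]
  rcases hKc.hasEigenvalue_or_mem_resolventSet (μ := (-1 : ℂ)) (by simp) with h1 | h1
  · exfalso
    obtain ⟨f, hf⟩ := h1.exists_hasEigenvector
    have hf1 : K f = -f := by
      have := hf.apply_eq_smul
      simpa using this
    have h0 : R f = 0 := by
      apply fredOp_injective h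
      rw [hMR, hf1, map_zero, add_neg_cancel]
    have := resolvent_right_inv (-e₀) hκ f
    change ((-e₀ : ℝ) : ℂ) • sobL2 (R f) - lapL (R f) = f at this
    rw [h0] at this
    exact hf.2 (by simpa using this.symm)
  · rw [spectrum.mem_resolventSet_iff, ContinuousLinearMap.isUnit_iff_bijective] at h1
    intro g
    obtain ⟨f, hf⟩ := h1.2 (-g)
    refine ⟨R f, ?_⟩
    rw [hMR]
    have : (algebraMap ℂ (L2 →L[ℂ] L2) (-1) - K) f = -f - K f := by
      simp [Algebra.algebraMap_eq_smul_one]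
    rw [this] at hf
    rw [← neg_inj, ← hf]; abel

/-- `(ψ, η) ↦ ((H - e₀) ψ - η φ₀, ⟨φ₀, ψ⟩)`. -/
def borderOp (V : 𝓢(E3, ℝ)) (e₀ : ℝ) (φ₀ : Sob 2) : Sob 2 × ℂ →L[ℂ] L2 × ℂ :=
  ((Hop V - (e₀ : ℂ) • sobL2) ∘L .fst ℂ _ _ -
    (ContinuousLinearMap.toSpanSingleton ℂ (sobL2 φ₀)) ∘L .snd ℂ _ _).prod
    (coordL φ₀ ∘L .fst ℂ _ _)

lemma borderOp_apply (V : 𝓢(E3, ℝ)) (e₀ : ℝ) (φ₀ : Sob 2) (z : Sob 2 × ℂ) :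
    borderOp V e₀ φ₀ z = (Hop V z.1 - (e₀ : ℂ) • sobL2 z.1 - z.2 • sobL2 φ₀, coordL φ₀ z.1) := rfl

lemma borderOp_bijective {V : 𝓢(E3, ℝ)} {e₀ : ℝ} (he : e₀ < 0) {φ₀ : Sob 2}
    (h : LinearGroundState V e₀ φ₀) : Function.Bijective (borderOp V e₀ φ₀) := by
  constructor
  · rw [injective_iff_map_eq_zero]
    rintro ⟨u, η⟩ hu
    rw [borderOp_apply, Prod.mk_eq_zero] at hu
    obtain ⟨h1, h2⟩ := hu
    have h3 : η = 0 := by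
      have := congrArg (inner ℂ (sobL2 φ₀)) h1
      rw [inner_sub_right, h.inner_Hop_sub, zero_sub, inner_smul_right, h.inner_self,
        mul_one, inner_zero_right, neg_eq_zero] at this
      exact this
    subst h3
    simp only [zero_smul, sub_zero] at h1
    rw [sub_eq_zero] at h1
    rw [Prod.mk_eq_zero]
    exact ⟨eigen_simple h.eigen h.pos ((isEigen_iff _ _ _).2 h1) h2, rfl⟩
  · rintro ⟨f, s⟩
    obtain ⟨ψ, hψ⟩ := fredOp_surjective he h f
    rw [fredOp_apply] at hψ
    refine ⟨(ψ + (s - coordL φ₀ ψ) • φ₀, -coordL φ₀ ψ), ?_⟩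
    have hc : coordL φ₀ φ₀ = 1 := h.inner_self
    rw [borderOp_apply]
    ext1
    · simp only [map_add, map_smul, h.Hop_eq]
      rw [← hψ]
      module
    · simp [hc]

/-! ### Translations of `H²` -/

lemma IsWeakDeriv.trans {n : ℕ} {α : MultiIdx n} {u g : L2} (h : IsWeakDeriv α u g) (s : E3) :
    IsWeakDeriv α (trans s u) (SolitonPotential.trans s g) := by
  rw [isWeakDeriv_iff] at h ⊢
  rw [FT_trans, FT_trans]
  filter_upwards [h, modul_coe ((2 * Real.pi) • s) (FT g), modul_coe ((2 * Real.pi) • s) (FT u)]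
    with ξ h1 h2 h3
  rw [h2, h3, h1]; ring

/-- Translation on `H^n`. -/
def transSob {n : ℕ} (s : E3) : Sob n →ₗᵢ[ℂ] Sob n where
  toFun U := ⟨WithLp.toLp 2 fun α => trans s (U.1 α), fun α => (U.2 α).trans s⟩
  map_add' U W := by
    apply Subtype.ext; ext1 α
    exact map_add (trans s) (U.1 α) (W.1 α)
  map_smul' c U := by
    apply Subtype.ext; ext1 α
    exact map_smul (trans s) c (U.1 α)
  norm_map' U := by
    change ‖(WithLp.toLp 2 fun α => trans s (U.1 α) : PiLp 2 fun _ : MultiIdx n => L2)‖ = ‖U.1‖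
    rw [PiLp.norm_eq_of_L2, PiLp.norm_eq_of_L2]
    simp only [LinearIsometry.norm_map]

lemma transSob_apply {n : ℕ} (s : E3) (U : Sob n) (α : MultiIdx n) :
    (transSob s U).1 α = trans s (U.1 α) := rfl

lemma sobL2_transSob {n : ℕ} (s : E3) (U : Sob n) : sobL2 (transSob s U) = trans s (sobL2 U) := rfl

lemma lapL_transSob (s : E3) (U : Sob 2) : lapL (transSob s U) = trans s (lapL U) := by
  simp only [lapL_apply, sobLap, map_sum, transSob_apply]

lemma transSob_add {n : ℕ} (s t : E3) (U : Sob n) :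
    transSob (s + t) U = transSob s (transSob t U) :=
  sobL2_injective (by simp only [sobL2_transSob, trans_add])

lemma transSob_zero {n : ℕ} (U : Sob n) : transSob 0 U = U :=
  sobL2_injective (by simp only [sobL2_transSob, trans_zero])

lemma continuous_transSob {n : ℕ} : Continuous fun z : E3 × Sob n => transSob z.1 z.2 := by
  refine Continuous.subtype_mk ?_ _
  refine (PiLp.continuous_toLp 2 _).comp (continuous_pi fun α => ?_)
  have h : Continuous fun z : E3 × Sob n => (z.1, z.2.1 α) :=
    continuous_fst.prodMk ((PiLp.continuous_apply 2 _ α).comp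
      (continuous_subtype_val.comp continuous_snd))
  exact Continuous.comp (g := fun z : E3 × L2 => trans z.1 z.2) continuous_trans h

/-! ### Superposition operators -/

/-- Taylor's formula with a quadratic remainder. -/
lemma norm_taylor_le {X Y : Type*} [NormedAddCommGroup X] [NormedSpace ℝ X]
    [NormedAddCommGroup Y] [NormedSpace ℝ Y] {f : X → Y} {f' : X → X →L[ℝ] Y}
    {s : Set X} (hs : Convex ℝ s) {K : ℝ} (hK : 0 ≤ K)
    (h1 : ∀ z ∈ s, HasFDerivAt f (f' z) z) {x y : X} (hx : x ∈ s) (hy : y ∈ s)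
    (h2 : ∀ z ∈ s, ‖f' z - f' x‖ ≤ K * ‖z - x‖) :
    ‖f y - f x - f' x (y - x)‖ ≤ K * ‖y - x‖ ^ 2 := by
  have hseg : segment ℝ x y ⊆ s := hs.segment_subset hx hy
  have hb : ∀ z ∈ segment ℝ x y, ‖f' z - f' x‖ ≤ K * ‖y - x‖ := by
    intro z hz
    refine (h2 z (hseg hz)).trans (mul_le_mul_of_nonneg_left ?_ hK)
    rw [segment_eq_image'] at hz
    obtain ⟨θ, hθ, rfl⟩ := hz
    rw [add_sub_cancel_left, norm_smul, Real.norm_of_nonneg hθ.1]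
    exact mul_le_of_le_one_left (norm_nonneg _) hθ.2
  have := (convex_segment x y).norm_image_sub_le_of_norm_hasFDerivWithin_le'
    (fun z hz => (h1 z (hseg hz)).hasFDerivWithinAt) hb (left_mem_segment ℝ x y)
    (right_mem_segment ℝ x y)
  rwa [mul_assoc, ← pow_two] at this

lemma hasFDerivAt_of_quadratic {X Y : Type*} [NormedAddCommGroup X] [NormedSpace ℝ X]
    [NormedAddCommGroup Y] [NormedSpace ℝ Y] {f : X → Y} {f' : X →L[ℝ] Y} {x : X} {K ρ : ℝ}
    (hρ : 0 < ρ) (h : ∀ y, ‖y - x‖ ≤ ρ → ‖f y - f x - f' (y - x)‖ ≤ K * ‖y - x‖ ^ 2) :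
    HasFDerivAt f f' x := by
  rw [hasFDerivAt_iff_isLittleO]
  have h1 : (fun y => f y - f x - f' (y - x)) =O[𝓝 x] fun y => ‖y - x‖ ^ 2 := by
    refine Asymptotics.IsBigO.of_bound K ?_
    filter_upwards [Metric.closedBall_mem_nhds x hρ] with y hy
    rw [Metric.mem_closedBall, dist_eq_norm] at hy
    simpa using h y hy
  refine h1.trans_isLittleO ?_
  have h2 : Tendsto (fun y => ‖y - x‖) (𝓝 x) (𝓝 0) := tendsto_iff_norm_sub_tendsto_zero.1 tendsto_id
  have := (Asymptotics.isLittleO_pow_id one_lt_two (𝕜 := ℝ)).comp_tendsto h2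
  refine (this.trans_isBigO ?_)
  exact (Asymptotics.isBigO_refl _ _).norm_left

lemma bounded_on_range {β : ℝ → ℝ} (hβ : Continuous β) (f : E3 →ᵇ ℝ) :
    ∃ C, ∀ x, ‖β (f x)‖ ≤ C := by
  obtain ⟨C, hC⟩ := (isCompact_Icc (a := -‖f‖) (b := ‖f‖)).exists_bound_of_continuousOn
    hβ.continuousOn
  exact ⟨C, fun x => hC _ (abs_le.1 (f.norm_coe_le_norm x))⟩

/-- The superposition operator `f ↦ β ∘ f`. -/
def supOp (β : ℝ → ℝ) (hβ : Continuous β) (f : E3 →ᵇ ℝ) : E3 →ᵇ ℝ :=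
  BoundedContinuousFunction.ofNormedAddCommGroup (fun x => β (f x))
    (hβ.comp f.continuous) (bounded_on_range hβ f).choose (bounded_on_range hβ f).choose_spec

lemma supOp_apply (β : ℝ → ℝ) (hβ : Continuous β) (f : E3 →ᵇ ℝ) (x : E3) :
    supOp β hβ f x = β (f x) := rfl

/-- The product of bounded continuous functions. -/
def bcfMulBcf : (E3 →ᵇ ℝ) →L[ℝ] (E3 →ᵇ ℝ) →L[ℝ] (E3 →ᵇ ℝ) := ContinuousLinearMap.mul ℝ (E3 →ᵇ ℝ)

lemma supOp_hasFDerivAt {β : ℝ → ℝ} (hβ : ContDiff ℝ ∞ β) (f : E3 →ᵇ ℝ) :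
    HasFDerivAt (supOp β hβ.continuous) (bcfMulBcf
      (supOp (deriv β) (hβ.continuous_deriv (by simp)) f)) f := by
  have h1 : Differentiable ℝ β := hβ.differentiable (by simp)
  have hβ' : ContDiff ℝ ∞ (deriv β) := by
    have := (contDiff_infty_iff_deriv.1 hβ).2
    exact this
  have h2 : Differentiable ℝ (deriv β) := hβ'.differentiable (by simp)
  have hc : Continuous (deriv (deriv β)) := hβ'.continuous_deriv (by simp)
  obtain ⟨C, hC⟩ := (isCompact_Icc (a := -(‖f‖ + 1)) (b := ‖f‖ + 1)).exists_bound_of_continuousOn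
    hc.continuousOn
  have hC0 : 0 ≤ C := (norm_nonneg _).trans (hC 0 ⟨by linarith [norm_nonneg f], by positivity⟩)
  refine hasFDerivAt_of_quadratic (K := C) one_pos fun g hg => ?_
  refine (BoundedContinuousFunction.norm_le (by positivity)).2 fun x => ?_
  have hgf : ‖g x - f x‖ ≤ ‖g - f‖ := (g - f).norm_coe_le_norm x
  have hfx := f.norm_coe_le_norm x
  have hgx : ‖g x‖ ≤ ‖f‖ + 1 := by
    calc ‖g x‖ = ‖(g x - f x) + f x‖ := by ring_nf
      _ ≤ _ := (norm_add_le _ _).trans (by linarith)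
  have hfm : f x ∈ Icc (-(‖f‖ + 1)) (‖f‖ + 1) :=
    abs_le.1 (by rw [← Real.norm_eq_abs]; linarith)
  have := norm_taylor_le (convex_Icc (-(‖f‖ + 1)) (‖f‖ + 1)) (f := β)
    (f' := fun y => ContinuousLinearMap.toSpanSingleton ℝ (deriv β y))
    hC0 (fun z _ => (h1 z).hasDerivAt.hasFDerivAt) hfm (abs_le.1 hgx) (fun z hz => by
      have e : ContinuousLinearMap.toSpanSingleton ℝ (deriv β z) -
          ContinuousLinearMap.toSpanSingleton ℝ (deriv β (f x)) =
          ContinuousLinearMap.toSpanSingleton ℝ (deriv β z - deriv β (f x)) := by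
        ext; simp
      rw [e, ContinuousLinearMap.norm_toSpanSingleton]
      exact (convex_Icc _ _).norm_image_sub_le_of_norm_deriv_le (fun y _ => h2 y) hC hfm hz)
  have e : (supOp β hβ.continuous g - supOp β hβ.continuous f -
      bcfMulBcf (supOp (deriv β) (hβ.continuous_deriv (by simp)) f)
        (g - f)) x = β (g x) - β (f x) - deriv β (f x) * (g x - f x) := rfl
  rw [e]
  calc _ ≤ C * ‖g x - f x‖ ^ 2 := by
        rw [mul_comm (deriv β (f x))]
        exact this
    _ ≤ _ := by gcongr

lemma supOp_contDiff {β : ℝ → ℝ} (hβ : ContDiff ℝ ∞ β) :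
    ContDiff ℝ ∞ (supOp β hβ.continuous) := by
  rw [contDiff_infty]
  intro n
  induction n generalizing β with
  | zero =>
    rw [Nat.cast_zero, contDiff_zero]
    exact continuous_iff_continuousAt.2 fun f => (supOp_hasFDerivAt hβ f).continuousAt
  | succ n ih =>
    rw [Nat.cast_add, Nat.cast_one, contDiff_succ_iff_hasFDerivAt]
    refine ⟨_, ?_, fun f => supOp_hasFDerivAt hβ f⟩
    have hβ' : ContDiff ℝ ∞ (deriv β) := (contDiff_infty_iff_deriv.1 hβ).2
    exact (ContinuousLinearMap.contDiff (𝕜 := ℝ) (E := E3 →ᵇ ℝ)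
      (F := (E3 →ᵇ ℝ) →L[ℝ] (E3 →ᵇ ℝ)) bcfMulBcf).comp (ih hβ')

/-! ### Translates of Schwartz functions -/

section translates

variable {G : Type} [NormedAddCommGroup G] [NormedSpace ℝ G]

lemma schwartz_bounded (f : 𝓢(E3, G)) : ∃ C, ∀ x, ‖f x‖ ≤ C := by
  obtain ⟨C, hC⟩ := f.decay 0 0
  exact ⟨C, fun x => by simpa using hC.2 x⟩

/-- The translate `f(· + s)` as a bounded continuous function. -/
def schTrans (f : 𝓢(E3, G)) (s : E3) : E3 →ᵇ G :=
  BoundedContinuousFunction.ofNormedAddCommGroup (fun x => f (x + s)) (by fun_prop)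
    (schwartz_bounded f).choose fun x => (schwartz_bounded f).choose_spec (x + s)

lemma schTrans_apply (f : 𝓢(E3, G)) (s x : E3) : schTrans f s x = f (x + s) := rfl

/-- A bounded family of linear maps as a linear map to bounded functions. -/
def bcfFlip : (E3 →ᵇ (E3 →L[ℝ] G)) →L[ℝ] E3 →L[ℝ] (E3 →ᵇ G) :=
  LinearMap.mkContinuous₂ (LinearMap.mk₂ ℝ
    (fun (F : E3 →ᵇ (E3 →L[ℝ] G)) (h : E3) =>
      BoundedContinuousFunction.ofNormedAddCommGroup (fun x => F x h) (F.continuous.clm_apply continuous_const) (‖F‖ * ‖h‖)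
        fun x => (F x).le_of_opNorm_le (F.norm_coe_le_norm x) h)
    (fun _ _ _ => rfl) (fun _ _ _ => rfl)
    (fun F h h' => by ext x; exact (F x).map_add h h')
    (fun c F h => by ext x; exact (F x).map_smul c h)) 1 fun F h => by
      rw [one_mul]
      exact (BoundedContinuousFunction.norm_le (by positivity)).2
        fun x => (F x).le_of_opNorm_le (F.norm_coe_le_norm x) h

lemma schTrans_hasFDerivAt (f : 𝓢(E3, G)) (s : E3) :
    HasFDerivAt (schTrans f) (bcfFlip (schTrans (SchwartzMap.fderivCLM ℝ E3 G f) s)) s := by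
  obtain ⟨C, hC⟩ := schwartz_bounded (SchwartzMap.fderivCLM ℝ E3 _ (SchwartzMap.fderivCLM ℝ E3 G f))
  refine hasFDerivAt_of_quadratic (K := C) one_pos fun y _ => ?_
  have hC0 : 0 ≤ C := (norm_nonneg _).trans (hC 0)
  refine (BoundedContinuousFunction.norm_le (by positivity)).2 fun x => ?_
  have := norm_taylor_le (convex_univ (𝕜 := ℝ) (E := E3)) (f := f)
    (f' := SchwartzMap.fderivCLM ℝ E3 G f) hC0
    (fun z _ => f.differentiableAt.hasFDerivAt) (x := x + s) (y := x + y) (mem_univ _) (mem_univ _)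
    (fun z hz => convex_univ.norm_image_sub_le_of_norm_hasFDerivWithin_le
      (fun z _ => (SchwartzMap.fderivCLM ℝ E3 G f).differentiableAt.hasFDerivAt.hasFDerivWithinAt)
      (fun z _ => hC z) (mem_univ _) hz)
  rw [add_sub_add_left_eq_sub] at this
  exact this

lemma schTrans_contDiff (f : 𝓢(E3, G)) : ContDiff ℝ ∞ (schTrans f) := by
  rw [contDiff_infty]
  intro n
  induction n generalizing G with
  | zero =>
    rw [Nat.cast_zero, contDiff_zero]
    exact continuous_iff_continuousAt.2 fun s => (schTrans_hasFDerivAt f s).continuousAt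
  | succ n ih =>
    rw [Nat.cast_add, Nat.cast_one, contDiff_succ_iff_hasFDerivAt]
    refine ⟨_, ?_, fun s => schTrans_hasFDerivAt f s⟩
    exact (bcfFlip (G := G)).contDiff.comp (ih _)

end translates

/-! ### Multiplication by bounded continuous functions -/

lemma bcf_memLp (g : E3 →ᵇ ℂ) : MemLp g ∞ (volume : Measure E3) :=
  memLp_top_of_continuous_bound g.continuous ‖g‖ g.norm_coe_le_norm

lemma norm_mulOp_le {g : E3 → ℂ} (hg : MemLp g ∞ (volume : Measure E3)) {C : ℝ}
    (h : ∀ x, ‖g x‖ ≤ C) (f : L2) : ‖mulOp g hg f‖ ≤ C * ‖f‖ := by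
  refine Lp.norm_le_mul_norm_of_ae_le_mul ?_
  filter_upwards [mulOp_coe g hg f] with x hx
  rw [hx, norm_mul]
  gcongr
  exact h x

/-- Multiplication of `L²` functions by bounded continuous functions. -/
def bcfMul : (E3 →ᵇ ℂ) →L[ℂ] L2 →L[ℂ] L2 :=
  LinearMap.mkContinuous₂ (LinearMap.mk₂ ℂ (fun g f => mulOp g (bcf_memLp g) f)
    (fun g g' f => by
      apply Lp.ext
      filter_upwards [mulOp_coe _ (bcf_memLp g) f, mulOp_coe _ (bcf_memLp g') f,
        mulOp_coe _ (bcf_memLp (g + g')) f, Lp.coeFn_add (mulOp _ (bcf_memLp g) f)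
        (mulOp _ (bcf_memLp g') f)] with x h1 h2 h3 h4
      rw [h3, h4, Pi.add_apply, h1, h2, BoundedContinuousFunction.add_apply, add_mul])
    (fun c g f => by
      apply Lp.ext
      filter_upwards [mulOp_coe _ (bcf_memLp g) f, mulOp_coe _ (bcf_memLp (c • g)) f,
        Lp.coeFn_smul c (mulOp _ (bcf_memLp g) f)] with x h1 h2 h3
      rw [h2, h3, Pi.smul_apply, h1, BoundedContinuousFunction.smul_apply, smul_eq_mul,
        smul_eq_mul, mul_assoc])
    (fun g f f' => map_add _ f f') (fun c g f => map_smul _ c f)) 1 fun g f => by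
      rw [one_mul]
      exact norm_mulOp_le _ g.norm_coe_le_norm f

lemma bcfMul_coe (g : E3 →ᵇ ℂ) (f : L2) :
    (bcfMul g f : E3 → ℂ) =ᵐ[volume] fun x => g x * f x := mulOp_coe _ (bcf_memLp g) f

/-- Multiplication of `L²` functions by real bounded continuous functions. -/
def bcfMulR : (E3 →ᵇ ℝ) →L[ℝ] L2 →L[ℝ] L2 :=
  (ContinuousLinearMap.restrictScalarsL ℂ L2 L2 ℝ ℝ) ∘L (bcfMul.restrictScalars ℝ) ∘L
    (Complex.ofRealCLM.compLeftContinuousBounded E3)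

lemma bcfMulR_coe (g : E3 →ᵇ ℝ) (f : L2) :
    (bcfMulR g f : E3 → ℂ) =ᵐ[volume] fun x => (g x : ℂ) * f x :=
  bcfMul_coe (Complex.ofRealCLM.compLeftContinuousBounded E3 g) f

attribute [irreducible] bcfMul bcfMulR

/-! ### A form of the implicit function theorem -/

section implicit

variable {X Y Z : Type*} [NormedAddCommGroup X] [NormedSpace ℝ X] [CompleteSpace X]
  [NormedAddCommGroup Y] [NormedSpace ℝ Y] [CompleteSpace Y]
  [NormedAddCommGroup Z] [NormedSpace ℝ Z] [CompleteSpace Z]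

lemma exists_contDiffOn_implicit {f : X × Y → Z} {W : Set (X × Y)} (hW : IsOpen W)
    (hf : ContDiffOn ℝ ∞ f W) {u : X × Y} (hu : u ∈ W)
    (hi : (fderiv ℝ f u ∘L .inr ℝ X Y).IsInvertible) :
    ∃ (ψ : X → Y) (U : Set X), IsOpen U ∧ u.1 ∈ U ∧ ψ u.1 = u.2 ∧ ContDiffOn ℝ ∞ ψ U ∧
      (∀ x ∈ U, f (x, ψ x) = f u) ∧ ∀ᶠ v in 𝓝 u, f v = f u → v.2 = ψ v.1 := by
  have hfa : ∀ {v}, v ∈ W → ContDiffAt ℝ ∞ f v := fun hv => hf.contDiffAt (hW.mem_nhds hv)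
  have n0 : (∞ : ℕ∞ω) ≠ 0 := by simp
  have cdf := hfa hu
  set ψ := cdf.implicitFunction n0 hi with hψ
  have h0 : ψ u.1 = u.2 := cdf.implicitFunction_apply_self n0 hi
  have h1 : ContDiffAt ℝ ∞ ψ u.1 := cdf.contDiffAt_implicitFunction n0 hi
  have hc : ∀ᶠ x in 𝓝 u.1, ContinuousAt ψ x := by
    have : ContDiffAt ℝ 1 ψ u.1 := h1.of_le (by simp)
    exact (this.eventually (by simp)).mono fun x hx => hx.continuousAt
  have hpair : ContinuousAt (fun x => (x, ψ x)) u.1 := continuousAt_id.prodMk h1.continuousAt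
  have hpt : (u.1, ψ u.1) = u := by rw [h0]
  have hWe : ∀ᶠ x in 𝓝 u.1, (x, ψ x) ∈ W :=
    hpair.eventually (hW.mem_nhds (hpt.symm ▸ hu : (u.1, ψ u.1) ∈ W))
  have hinv : ∀ᶠ x in 𝓝 u.1, (fderiv ℝ f (x, ψ x) ∘L .inr ℝ X Y).IsInvertible := by
    have hcd : ContinuousAt (fun v => fderiv ℝ f v ∘L .inr ℝ X Y) u := by
      have : ContinuousAt (fderiv ℝ f) u := (cdf.fderiv_right (m := 0) (by simp)).continuousAt
      exact this.clm_comp continuousAt_const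
    have h3 : ContinuousAt (fun x => fderiv ℝ f (x, ψ x) ∘L .inr ℝ X Y) u.1 := by
      refine ContinuousAt.comp (g := fun v => fderiv ℝ f v ∘L .inr ℝ X Y) ?_ hpair
      rw [hpt]; exact hcd
    have hopen := ContinuousLinearEquiv.isOpen (𝕜 := ℝ) (E := Y) (F := Z)
    refine h3.eventually (hopen.mem_nhds ?_)
    change fderiv ℝ f (u.1, ψ u.1) ∘L _ ∈ _
    rw [hpt]
    obtain ⟨e, he⟩ := hi
    exact ⟨e, he⟩
  have heq : ∀ᶠ x in 𝓝 u.1, f (x, ψ x) = f u := cdf.eventually_apply_implicitFunction n0 hi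
  have hall := hc.and (hWe.and (hinv.and heq.eventually_nhds))
  obtain ⟨U, hU, hUo, hUu⟩ := eventually_nhds_iff.1 hall
  refine ⟨ψ, U, hUo, hUu, h0, ?_, fun x hx => (hU x hx).2.2.2.self_of_nhds, ?_⟩
  · intro x hx
    obtain ⟨c, w, i, e⟩ := hU x hx
    have cd := hfa w
    have h4 := cd.contDiffAt_implicitFunction n0 i
    have h5 : cd.implicitFunction n0 i =ᶠ[𝓝 x] ψ := by
      have h6 := cd.eventually_apply_eq_iff_implicitFunction n0 i
      have h7 : Tendsto (fun x => (x, ψ x)) (𝓝 x) (𝓝 (x, ψ x)) := continuousAt_id.prodMk c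
      filter_upwards [h7.eventually h6, e] with y hy hy'
      exact hy.1 (hy'.trans e.self_of_nhds.symm)
    exact (h4.congr_of_eventuallyEq h5.symm).contDiffWithinAt
  · exact (cdf.eventually_apply_eq_iff_implicitFunction n0 hi).mono fun v hv h => (hv.1 h).symm

end implicit

/-! ### The equation of the bound states -/

/-- `|u|²` for `u ∈ H²`. -/
def absSq (u : Sob 2) : E3 →ᵇ ℝ :=
  let re := Complex.reCLM.compLeftContinuousBounded E3 (sobBCF u)
  let im := Complex.imCLM.compLeftContinuousBounded E3 (sobBCF u)
  bcfMulBcf re re + bcfMulBcf im im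

lemma absSq_apply (u : Sob 2) (x : E3) : absSq u x = ‖sobBCF u x‖ ^ 2 := by
  rw [← Complex.normSq_eq_norm_sq, Complex.normSq_apply]
  rfl

lemma absSq_contDiff : ContDiff ℝ ∞ absSq := by
  have h1 : ContDiff ℝ ∞ (fun u : Sob 2 => Complex.reCLM.compLeftContinuousBounded E3 (sobBCF u)) :=
    (Complex.reCLM.compLeftContinuousBounded E3 ∘L sobBCF.restrictScalars ℝ).contDiff
  have h2 : ContDiff ℝ ∞ (fun u : Sob 2 => Complex.imCLM.compLeftContinuousBounded E3 (sobBCF u)) :=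
    (Complex.imCLM.compLeftContinuousBounded E3 ∘L sobBCF.restrictScalars ℝ).contDiff
  have hb := (bcfMulBcf).isBoundedBilinearMap.contDiff (n := ∞)
  exact (hb.comp (h1.prodMk h1)).add (hb.comp (h2.prodMk h2))

/-- The equation `(-Δ + V(· + s) - E) u + β(σ|u|²) u = 0` with the normalization `⟨g, u⟩ = 1`. -/
def bsMap (V : 𝓢(E3, ℝ)) (β : ℝ → ℝ) (hβ : Continuous β)
    (z : (E3 × ℝ × L2) × (Sob 2 × ℂ)) : L2 × ℂ :=
  (-lapL z.2.1 + bcfMulR (schTrans V z.1.1) (sobL2 z.2.1) - z.2.2 • sobL2 z.2.1 +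
    bcfMulR (supOp β hβ (z.1.2.1 • absSq z.2.1)) (sobL2 z.2.1),
    inner ℂ z.1.2.2 (sobL2 z.2.1) - 1)

lemma sobL2_contDiff {n : ℕ} : ContDiff ℝ ∞ (fun u : Sob n => sobL2 u) :=
  (sobL2.restrictScalars ℝ : Sob n →L[ℝ] L2).contDiff

lemma lapL_contDiff : ContDiff ℝ ∞ (fun u : Sob 2 => lapL u) :=
  (lapL.restrictScalars ℝ : Sob 2 →L[ℝ] L2).contDiff

lemma bcfMulR_contDiff : ContDiff ℝ ∞ (fun z : (E3 →ᵇ ℝ) × L2 => bcfMulR z.1 z.2) :=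
  bcfMulR.isBoundedBilinearMap.contDiff

lemma bsMap_contDiff_comp (V : 𝓢(E3, ℝ)) {β : ℝ → ℝ} (hβ : ContDiff ℝ ∞ β) {X : Type*}
    [NormedAddCommGroup X] [NormedSpace ℝ X] {s : X → E3} {σ : X → ℝ} {g : X → L2} {u : X → Sob 2}
    {E : X → ℂ} (hs : ContDiff ℝ ∞ s) (hσ : ContDiff ℝ ∞ σ) (hg : ContDiff ℝ ∞ g)
    (hu : ContDiff ℝ ∞ u) (hE : ContDiff ℝ ∞ E) :
    ContDiff ℝ ∞ fun x => bsMap V β hβ.continuous ((s x, σ x, g x), (u x, E x)) := by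
  have hl : ContDiff ℝ ∞ fun x => sobL2 (u x) := sobL2_contDiff.comp hu
  have hL : ContDiff ℝ ∞ fun x => lapL (u x) := lapL_contDiff.comp hu
  have h1 : ContDiff ℝ ∞ fun x => bcfMulR (schTrans V (s x)) (sobL2 (u x)) :=
    bcfMulR_contDiff.comp (((schTrans_contDiff V).comp hs).prodMk hl)
  have h2 : ContDiff ℝ ∞ fun x =>
      bcfMulR (supOp β hβ.continuous (σ x • absSq (u x))) (sobL2 (u x)) :=
    bcfMulR_contDiff.comp (((supOp_contDiff hβ).comp (hσ.smul (absSq_contDiff.comp hu))).prodMk hl)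
  have h3 : ContDiff ℝ ∞ fun x => E x • sobL2 (u x) := hE.smul hl
  have h4 : ContDiff ℝ ∞ fun x => (inner ℂ (g x) (sobL2 (u x)) : ℂ) := hg.inner ℂ hl
  exact (((hL.neg.add h1).sub h3).add h2).prodMk (h4.sub contDiff_const)

lemma bsMap_contDiff (V : 𝓢(E3, ℝ)) {β : ℝ → ℝ} (hβ : ContDiff ℝ ∞ β) :
    ContDiff ℝ ∞ (bsMap V β hβ.continuous) :=
  bsMap_contDiff_comp V hβ (s := fun z : (E3 × ℝ × L2) × (Sob 2 × ℂ) => z.1.1)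
    contDiff_fst.fst contDiff_fst.snd.fst contDiff_fst.snd.snd contDiff_snd.fst contDiff_snd.snd

lemma bcfMulR_schTrans_zero (V : 𝓢(E3, ℝ)) (f : L2) :
    bcfMulR (schTrans V 0) f = potOp V f := by
  apply Lp.ext
  filter_upwards [bcfMulR_coe (schTrans V 0) f, potOp_coe V f] with x h1 h2
  rw [h1, h2, schTrans_apply, add_zero]

lemma bsMap_base (V : 𝓢(E3, ℝ)) {β : ℝ → ℝ} (hβ : Continuous β) (h0 : β 0 = 0) (φ₀ : Sob 2)
    (y : Sob 2 × ℂ) : bsMap V β hβ ((0, 0, sobL2 φ₀), y) =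
      (Hop V y.1 - y.2 • sobL2 y.1, coordL φ₀ y.1 - 1) := by
  have hz : supOp β hβ ((0 : ℝ) • absSq y.1) = 0 := by
    ext x
    rw [supOp_apply, zero_smul]
    exact h0
  rw [bsMap]
  simp only
  rw [hz, bcfMulR_schTrans_zero, map_zero, Hop_apply]
  simp [coordL_apply]

lemma bsMap_fderiv {V : 𝓢(E3, ℝ)} {e₀ : ℝ} (he : e₀ < 0) {φ₀ : Sob 2}
    (h : LinearGroundState V e₀ φ₀) {β : ℝ → ℝ} (hβ : ContDiff ℝ ∞ β) (h0 : β 0 = 0) :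
    (fderiv ℝ (bsMap V β hβ.continuous) ((0, 0, sobL2 φ₀), (φ₀, (e₀ : ℂ))) ∘L
      .inr ℝ (E3 × ℝ × L2) (Sob 2 × ℂ)).IsInvertible := by
  have hd : HasFDerivAt (bsMap V β hβ.continuous) (fderiv ℝ (bsMap V β hβ.continuous)
      ((0, 0, sobL2 φ₀), (φ₀, (e₀ : ℂ)))) ((0, 0, sobL2 φ₀), (φ₀, (e₀ : ℂ))) :=
    ((bsMap_contDiff V hβ).differentiable (by simp) _).hasFDerivAt
  have h1 := hd.comp (φ₀, (e₀ : ℂ)) (hasFDerivAt_prodMk_right (𝕜 := ℝ)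
    ((0 : E3), (0 : ℝ), sobL2 φ₀) (φ₀, (e₀ : ℂ)))
  have h2 : HasFDerivAt (fun y : Sob 2 × ℂ => bsMap V β hβ.continuous ((0, 0, sobL2 φ₀), y))
      ((borderOp V e₀ φ₀).restrictScalars ℝ) (φ₀, (e₀ : ℂ)) := by
    have e : (fun y : Sob 2 × ℂ => bsMap V β hβ.continuous ((0, 0, sobL2 φ₀), y)) =
        fun y => (Hop V y.1 - y.2 • sobL2 y.1, coordL φ₀ y.1 - 1) :=
      funext fun y => bsMap_base V hβ.continuous h0 φ₀ y
    rw [e]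
    have a1 : HasFDerivAt (fun y : Sob 2 × ℂ => Hop V y.1)
        (((Hop V) ∘L .fst ℂ (Sob 2) ℂ)) (φ₀, (e₀ : ℂ)) :=
      ((Hop V) ∘L .fst ℂ (Sob 2) ℂ).hasFDerivAt
    have a2 : HasFDerivAt (fun y : Sob 2 × ℂ => sobL2 y.1)
        ((sobL2 ∘L .fst ℂ (Sob 2) ℂ)) (φ₀, (e₀ : ℂ)) :=
      (sobL2 ∘L .fst ℂ (Sob 2) ℂ).hasFDerivAt
    have a3 : HasFDerivAt (fun y : Sob 2 × ℂ => coordL φ₀ y.1 - 1)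
        ((coordL φ₀ ∘L .fst ℂ (Sob 2) ℂ)) (φ₀, (e₀ : ℂ)) :=
      (coordL φ₀ ∘L .fst ℂ (Sob 2) ℂ).hasFDerivAt.sub_const 1
    have a4 : HasFDerivAt (fun y : Sob 2 × ℂ => y.2) (.snd ℂ (Sob 2) ℂ) (φ₀, (e₀ : ℂ)) :=
      (ContinuousLinearMap.snd ℂ (Sob 2) ℂ).hasFDerivAt
    have a5 := ((a1.sub (a4.smul a2)).prodMk a3).restrictScalars ℝ
    refine a5.congr_fderiv ?_
    refine ContinuousLinearMap.ext fun z => ?_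
    rw [ContinuousLinearMap.coe_restrictScalars', ContinuousLinearMap.coe_restrictScalars',
      borderOp_apply]
    ext1
    · exact (sub_add_eq_sub_sub (Hop V z.1) ((e₀ : ℂ) • sobL2 z.1) (z.2 • sobL2 φ₀))
    · rfl
  have h3 := h1.unique h2
  refine ⟨ContinuousLinearEquiv.ofBijective ((borderOp V e₀ φ₀).restrictScalars ℝ) ?_ ?_, ?_⟩
  · exact LinearMap.ker_eq_bot.2 (borderOp_bijective he h).1
  · exact LinearMap.range_eq_top.2 (borderOp_bijective he h).2
  · rw [h3]
    exact ContinuousLinearMap.ext fun z => rfl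

/-! ### Translates of solutions -/

lemma sobBCF_transSob (r : E3) (u : Sob 2) (x : E3) : sobBCF (transSob r u) x = sobBCF u (x + r) := by
  have h : (sobBCF (transSob r u) : E3 → ℂ) =ᵐ[volume] fun x => sobBCF u (x + r) := by
    filter_upwards [sobBCF_coe (transSob r u), trans_coe r (sobL2 u),
      ae_comp_add r (sobBCF_coe u)] with x h1 h2 h3
    rw [← h1, sobL2_transSob, h2, h3]
  have h2 := Continuous.ae_eq_iff_eq (μ := (volume : Measure E3)) (sobBCF (transSob r u)).continuous
    ((sobBCF u).continuous.comp (continuous_add_const r)) |>.1 h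
  exact congrFun h2 x

lemma bcfMulR_trans {r : E3} {g g' : E3 →ᵇ ℝ} (h : ∀ x, g' x = g (x + r)) (f : L2) :
    bcfMulR g' (trans r f) = trans r (bcfMulR g f) := by
  apply Lp.ext
  filter_upwards [bcfMulR_coe g' (trans r f), trans_coe r f, trans_coe r (bcfMulR g f),
    ae_comp_add r (bcfMulR_coe g f)] with x h1 h2 h3 h4
  rw [h1, h2, h3, h4, h]

lemma bsMap_trans (V : 𝓢(E3, ℝ)) {β : ℝ → ℝ} (hβ : Continuous β) (r s : E3) (σ : ℝ) (g : L2)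
    (u : Sob 2) (E : ℂ) (h : bsMap V β hβ ((s, σ, g), (u, E)) = 0) :
    bsMap V β hβ ((s + r, σ, trans r g), (transSob r u, E)) = 0 := by
  rw [bsMap, Prod.mk_eq_zero] at h ⊢
  simp only at h ⊢
  obtain ⟨h1, h2⟩ := h
  rw [sobL2_transSob, LinearIsometry.inner_map_map]
  refine ⟨?_, h2⟩
  rw [lapL_transSob, bcfMulR_trans (g := schTrans V s), bcfMulR_trans (g := supOp β hβ (σ • absSq u)),
    ← map_smul, ← map_neg, ← map_add, ← map_sub, ← map_add, h1, map_zero]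
  · intro x
    simp only [supOp_apply, BoundedContinuousFunction.smul_apply, absSq_apply, sobBCF_transSob]
  · intro x
    simp only [schTrans_apply]
    congr 1; abel

lemma bsMap_zero_smul (V : 𝓢(E3, ℝ)) {β : ℝ → ℝ} (hβ : Continuous β) (h0 : β 0 = 0) {s : E3}
    {g g' : L2} {u : Sob 2} {E c : ℂ} (h : bsMap V β hβ ((s, 0, g), (u, E)) = 0)
    (hc : c * inner ℂ g' (sobL2 u) = 1) : bsMap V β hβ ((s, 0, g'), (c • u, E)) = 0 := by
  have hz : ∀ u : Sob 2, supOp β hβ ((0 : ℝ) • absSq u) = 0 := by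
    intro u
    ext x
    rw [supOp_apply, zero_smul]
    exact h0
  have hr : bcfMulR (schTrans V s) (c • sobL2 u) = c • bcfMulR (schTrans V s) (sobL2 u) := by
    apply Lp.ext
    filter_upwards [bcfMulR_coe (schTrans V s) (c • sobL2 u), Lp.coeFn_smul c (sobL2 u),
      Lp.coeFn_smul c (bcfMulR (schTrans V s) (sobL2 u)), bcfMulR_coe (schTrans V s) (sobL2 u)]
      with x h1 h2 h3 h4
    rw [h1, h2, h3, Pi.smul_apply, Pi.smul_apply, h4, smul_eq_mul, smul_eq_mul]
    ring
  rw [bsMap, Prod.mk_eq_zero] at h ⊢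
  simp only [hz, map_zero, zero_apply, add_zero] at h ⊢
  rw [map_smul, map_smul, inner_smul_right, hc, sub_self, hr, smul_comm E c, ← smul_neg, ← smul_add,
    ← smul_sub, h.1, smul_zero]
  exact ⟨rfl, rfl⟩

/-! ### The branch of bound states -/

section branch

variable {V : 𝓢(E3, ℝ)} {e₀ : ℝ} {φ₀ : Sob 2} {β : ℝ → ℝ}

lemma nn_inner {f g : L2} (hf : NN f) (hg : NN g) :
    ((‖inner ℂ f g‖ : ℝ) : ℂ) = inner ℂ f g := by
  have h : ∀ᵐ x, g x * conj (f x) = (((g x).re * (f x).re : ℝ) : ℂ) := by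
    filter_upwards [hf, hg] with x h1 h2
    apply Complex.ext <;> simp [h1.2, h2.2]
  have e : inner ℂ f g = ((∫ x, (g x).re * (f x).re : ℝ) : ℂ) := by
    rw [l2_inner_eq, integral_congr_ae h, integral_complex_ofReal]
  have hn : 0 ≤ ∫ x, (g x).re * (f x).re := by
    refine integral_nonneg_of_ae ?_
    filter_upwards [hf, hg] with x h1 h2 using mul_nonneg h2.1 h1.1
  rw [e, Complex.norm_real, Real.norm_of_nonneg hn]

lemma NN.trans {f : L2} (hf : NN f) (s : E3) : NN (trans s f) := by
  filter_upwards [ae_comp_add s hf, trans_coe s f] with x h1 h2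
  rw [h2]; exact h1

attribute [local irreducible] bsMap trans transSob lapL sobBCF in
lemma exists_branch (he : e₀ < 0) (h : LinearGroundState V e₀ φ₀) (hβ : ContDiff ℝ ∞ β)
    (h0 : β 0 = 0) :
    ∃ (u : ℝ → Sob 2) (E : ℝ → ℂ) (ρ : ℝ), 0 < ρ ∧ u 0 = φ₀ ∧ E 0 = e₀ ∧
      ContDiffOn ℝ ∞ E (Metric.ball 0 ρ) ∧
      ContDiffOn ℝ ∞ (fun z : E3 × ℝ => transSob z.1 (u z.2)) (univ ×ˢ Metric.ball 0 ρ) ∧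
      ∀ σ ∈ Metric.ball (0 : ℝ) ρ,
        bsMap V β hβ.continuous ((0, σ, sobL2 φ₀), (u σ, E σ)) = 0 := by
  set f := bsMap V β hβ.continuous with hf
  set g₀ := sobL2 φ₀ with hg₀
  set z₀ : (E3 × ℝ × L2) × (Sob 2 × ℂ) := ((0, 0, g₀), (φ₀, (e₀ : ℂ))) with hz₀
  have hfz : f z₀ = 0 := by
    rw [hf, hz₀, hg₀, bsMap_base V hβ.continuous h0, h.Hop_eq, coordL_apply, h.inner_self]
    simp
  obtain ⟨ψ, U, hUo, hU0, hψ0, hψc, hψs, hψu⟩ := exists_contDiffOn_implicit isOpen_univ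
    (bsMap_contDiff V hβ).contDiffOn (mem_univ z₀) (bsMap_fderiv he h hβ h0)
  rw [← hf, hfz] at hψs hψu
  have hψcont : ContinuousAt ψ z₀.1 := (hψc.contDiffAt (hUo.mem_nhds hU0)).continuousAt
  have hg1 : ‖g₀‖ = 1 := by
    have := h.inner_self
    rw [inner_self_eq_norm_sq_to_K] at this
    have h2 : ‖g₀‖ ^ 2 = 1 := by
      have h3 : (((‖g₀‖ ^ 2 : ℝ)) : ℂ) = 1 := by rw [Complex.ofReal_pow]; exact this
      exact_mod_cast h3
    exact (pow_eq_one_iff_of_nonneg (norm_nonneg _) two_ne_zero).1 h2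
  have hnn : NN g₀ := h.pos.mono fun x hx => ⟨hx.1.le, hx.2⟩
  have htc : Continuous fun s : E3 => trans s g₀ :=
    Continuous.comp (g := fun z : E3 × L2 => trans z.1 z.2) (f := fun s => (s, g₀)) continuous_trans
      (by fun_prop)
  have htSc : Continuous fun s : E3 => transSob s φ₀ :=
    Continuous.comp (g := fun z : E3 × Sob 2 => transSob z.1 z.2) (f := fun s => (s, φ₀))
      continuous_transSob (by fun_prop)
  -- smoothness of the translates of `φ₀` near `0`
  have hγ : ∃ B : Set E3, IsOpen B ∧ (0 : E3) ∈ B ∧ ContDiffOn ℝ ∞ (fun s => trans s g₀) B := by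
    set c : E3 → ℂ := fun s => inner ℂ g₀ (trans s g₀) with hc
    have hcc : Continuous c := by
      have := (continuous_const (y := g₀)).inner htc (𝕜 := ℂ)
      exact this
    have hc0 : c 0 = 1 := by rw [hc]; simp only [trans_zero]; exact h.inner_self
    have hce : ∀ᶠ s in 𝓝 (0 : E3), c s ≠ 0 := hcc.continuousAt.eventually_ne (by rw [hc0]; simp)
    have hlim : ContinuousAt (fun s => (((s, (0 : ℝ), g₀) : E3 × ℝ × L2),
        (((c s)⁻¹ • transSob s φ₀, (e₀ : ℂ)) : Sob 2 × ℂ))) 0 := by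
      refine ContinuousAt.prodMk (by fun_prop) (ContinuousAt.prodMk ?_ continuousAt_const)
      exact (hcc.continuousAt.inv₀ (by rw [hc0]; simp)).smul htSc.continuousAt
    have hpt : ((((0 : E3), (0 : ℝ), g₀) : E3 × ℝ × L2),
        (((c 0)⁻¹ • transSob 0 φ₀, (e₀ : ℂ)) : Sob 2 × ℂ)) = z₀ := by
      rw [hc0, inv_one, one_smul, transSob_zero]
    have hev : ∀ᶠ s in 𝓝 (0 : E3), (c s)⁻¹ • transSob s φ₀ = (ψ (s, 0, g₀)).1 := by
      have h1 := hlim.eventually (p := fun v => f v = 0 → v.2 = ψ v.1) (by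
        beta_reduce; rw [hpt]; exact hψu)
      filter_upwards [h1, hce] with s hs hcs
      have h2 := bsMap_trans V hβ.continuous s 0 0 g₀ φ₀ (e₀ : ℂ) hfz
      rw [zero_add] at h2
      have h3 := hs (bsMap_zero_smul V hβ.continuous h0 h2
        (by rw [sobL2_transSob]; exact inv_mul_cancel₀ hcs))
      exact congrArg Prod.fst h3
    have hin : ∀ᶠ s in 𝓝 (0 : E3), (s, (0 : ℝ), g₀) ∈ U := by
      have : ContinuousAt (fun s : E3 => (s, (0 : ℝ), g₀)) 0 := by fun_prop
      exact this.eventually (hUo.mem_nhds hU0)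
    obtain ⟨B, hB, hBo, hB0⟩ := eventually_nhds_iff.1 (hev.and (hin.and hce))
    refine ⟨B, hBo, hB0, ?_⟩
    set κ : E3 → L2 := fun s => sobL2 (ψ (s, 0, g₀)).1 with hκ
    have hκs : ContDiffOn ℝ ∞ κ B := by
      have h1 : ContDiffOn ℝ ∞ (fun s => ψ (s, (0 : ℝ), g₀)) B :=
        hψc.comp (by fun_prop) fun s hs => (hB s hs).2.1
      exact sobL2_contDiff.comp_contDiffOn h1.fst
    have hκe : ∀ s ∈ B, trans s g₀ = c s • κ s := by
      intro s hs
      have h1 := (hB s hs).1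
      have h2 : κ s = (c s)⁻¹ • trans s g₀ := by
        rw [hκ]; simp only [← h1]; rw [map_smul, sobL2_transSob]
      rw [h2, smul_smul, mul_inv_cancel₀ (hB s hs).2.2, one_smul]
    have hκn : ∀ s ∈ B, c s = ((‖κ s‖⁻¹ : ℝ) : ℂ) := by
      intro s hs
      have h1 : ‖c s‖ * ‖κ s‖ = 1 := by
        rw [← norm_smul, ← hκe s hs, LinearIsometry.norm_map, hg1]
      have h2 : ((‖c s‖ : ℝ) : ℂ) = c s := nn_inner hnn (hnn.trans s)
      rw [← h2]
      rw [eq_inv_of_mul_eq_one_left h1]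
    have hκ0 : ∀ s ∈ B, κ s ≠ 0 := by
      intro s hs h1
      have h2 := hκe s hs
      rw [h1, smul_zero] at h2
      have h3 := (trans s).norm_map g₀
      rw [h2, norm_zero, hg1] at h3
      exact zero_ne_one h3
    have h2 : ContDiffOn ℝ ∞ (fun s => (‖κ s‖⁻¹ : ℝ) • κ s) B :=
      ((hκs.norm ℂ hκ0).inv fun s hs => norm_ne_zero_iff.2 (hκ0 s hs)).smul hκs
    refine h2.congr fun s hs => ?_
    rw [hκe s hs]
    conv_lhs => rw [hκn s hs]
    rfl
  obtain ⟨B, hBo, hB0, hγs⟩ := hγ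
  set u : ℝ → Sob 2 := fun σ => (ψ (0, σ, g₀)).1 with hu
  set E : ℝ → ℂ := fun σ => (ψ (0, σ, g₀)).2 with hE
  have hψ0' : ψ (0, 0, g₀) = (φ₀, (e₀ : ℂ)) := hψ0
  have hu0 : u 0 = φ₀ := by rw [hu]; simp only [hψ0']
  have hE0 : E 0 = e₀ := by rw [hE]; simp only [hψ0']
  have hσc : ContinuousAt (fun σ : ℝ => ψ (0, σ, g₀)) 0 :=
    ContinuousAt.comp (g := ψ) (f := fun σ : ℝ => ((0 : E3), σ, g₀)) hψcont (by fun_prop)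
  have huc : ContinuousAt u 0 := continuous_fst.continuousAt.comp hσc
  have hEc : ContinuousAt E 0 := continuous_snd.continuousAt.comp hσc
  have hσU : ∀ᶠ σ in 𝓝 (0 : ℝ), ((0 : E3), σ, g₀) ∈ U := by
    have : ContinuousAt (fun σ : ℝ => ((0 : E3), σ, g₀)) 0 := by fun_prop
    exact this.eventually (hUo.mem_nhds hU0)
  have hsol : ∀ σ, ((0 : E3), σ, g₀) ∈ U → f ((0, σ, g₀), (u σ, E σ)) = 0 := fun σ hσ => hψs _ hσ
  -- joint smoothness near the origin
  have hjoint : ∀ᶠ z in 𝓝 ((0 : E3), (0 : ℝ)), z.1 ∈ B ∧ (z.1, z.2, trans z.1 g₀) ∈ U ∧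
      transSob z.1 (u z.2) = (ψ (z.1, z.2, trans z.1 g₀)).1 := by
    have c1 : ContinuousAt (fun z : E3 × ℝ => (z.1, z.2, trans z.1 g₀)) (0, 0) := by
      refine continuousAt_fst.prodMk (continuousAt_snd.prodMk ?_)
      exact (htc.comp continuous_fst).continuousAt
    have p1 : ((0 : E3), (0 : ℝ), trans 0 g₀) = z₀.1 := by rw [trans_zero]
    have c2 : ContinuousAt (fun z : E3 × ℝ => transSob z.1 (u z.2)) (0, 0) := by
      refine ContinuousAt.comp (g := fun z : E3 × Sob 2 => transSob z.1 z.2)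
        (f := fun z : E3 × ℝ => (z.1, u z.2)) continuous_transSob.continuousAt ?_
      exact continuousAt_fst.prodMk (ContinuousAt.comp (g := u) huc continuousAt_snd)
    have c3 : ContinuousAt (fun z : E3 × ℝ => (((z.1, z.2, trans z.1 g₀) : E3 × ℝ × L2),
        ((transSob z.1 (u z.2), E z.2) : Sob 2 × ℂ))) (0, 0) :=
      c1.prodMk (c2.prodMk (ContinuousAt.comp (g := E) hEc continuousAt_snd))
    have p3 : ((((0 : E3), (0 : ℝ), trans 0 g₀) : E3 × ℝ × L2),
        ((transSob 0 (u 0), E 0) : Sob 2 × ℂ)) = z₀ := by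
      rw [trans_zero, transSob_zero, hu0, hE0]
    have e1 := c3.eventually (p := fun v => f v = 0 → v.2 = ψ v.1) (by
      simp only; rw [p3]; exact hψu)
    have e2 : ∀ᶠ z in 𝓝 ((0 : E3), (0 : ℝ)), ((0 : E3), z.2, g₀) ∈ U :=
      (continuousAt_snd (p := ((0 : E3), (0 : ℝ)))).eventually hσU
    have e3 : ∀ᶠ z in 𝓝 ((0 : E3), (0 : ℝ)), z.1 ∈ B :=
      (continuousAt_fst (p := ((0 : E3), (0 : ℝ)))).eventually (hBo.mem_nhds hB0)
    have e4 : ∀ᶠ z in 𝓝 ((0 : E3), (0 : ℝ)), (z.1, z.2, trans z.1 g₀) ∈ U :=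
      c1.eventually (hUo.mem_nhds (by simp only; rw [p1]; exact hU0))
    filter_upwards [e1, e2, e3, e4] with z h1 h2 h3 h4
    refine ⟨h3, h4, ?_⟩
    have h5 := bsMap_trans V hβ.continuous z.1 0 z.2 g₀ (u z.2) (E z.2) (hsol _ h2)
    rw [zero_add] at h5
    exact congrArg Prod.fst (h1 h5)
  obtain ⟨ρ, hρ, hball⟩ := Metric.eventually_nhds_iff_ball.1 (hjoint.and
    ((continuousAt_snd (p := ((0 : E3), (0 : ℝ)))).eventually hσU))
  have hmem : ∀ s σ, s ∈ Metric.ball (0 : E3) ρ → σ ∈ Metric.ball (0 : ℝ) ρ →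
      (s, σ) ∈ Metric.ball ((0 : E3), (0 : ℝ)) ρ := by
    intro s σ hs hσ
    rw [← ball_prod_same]
    exact ⟨hs, hσ⟩
  have hσU' : ∀ σ ∈ Metric.ball (0 : ℝ) ρ, ((0 : E3), σ, g₀) ∈ U := fun σ hσ =>
    (hball (0, σ) (hmem 0 σ (Metric.mem_ball_self hρ) hσ)).2
  have hloc : ContDiffOn ℝ ∞ (fun z : E3 × ℝ => transSob z.1 (u z.2))
      (Metric.ball ((0 : E3), (0 : ℝ)) ρ) := by
    have h1 : ContDiffOn ℝ ∞ (fun z : E3 × ℝ => ψ (z.1, z.2, trans z.1 g₀))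
        (Metric.ball ((0 : E3), (0 : ℝ)) ρ) := by
      refine hψc.comp (contDiff_fst.contDiffOn.prodMk (contDiff_snd.contDiffOn.prodMk ?_))
        fun z hz => (hball z hz).1.2.1
      exact hγs.comp contDiff_fst.contDiffOn fun z hz => (hball z hz).1.1
    exact h1.fst.congr fun z hz => (hball z hz).1.2.2
  refine ⟨u, E, ρ, hρ, hu0, hE0, ?_, ?_, fun σ hσ => hsol σ (hσU' σ hσ)⟩
  · have h1 : ContDiffOn ℝ ∞ (fun σ => ψ ((0 : E3), σ, g₀)) (Metric.ball 0 ρ) :=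
      hψc.comp (by fun_prop) hσU'
    exact h1.snd
  · rintro ⟨s₁, σ₁⟩ ⟨-, hσ₁⟩
    refine ContDiffAt.contDiffWithinAt ?_
    have h1 : ContDiffAt ℝ ∞ (fun z : E3 × ℝ => transSob (z.1 - s₁) (u z.2)) (s₁, σ₁) := by
      refine ContDiffAt.comp (g := fun z : E3 × ℝ => transSob z.1 (u z.2))
        (f := fun z : E3 × ℝ => (z.1 - s₁, z.2)) (s₁, σ₁) ?_ (by fun_prop)
      refine hloc.contDiffAt (Metric.isOpen_ball.mem_nhds ?_)
      simp only [sub_self]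
      exact hmem 0 σ₁ (Metric.mem_ball_self hρ) hσ₁
    have h2 : (fun z : E3 × ℝ => transSob z.1 (u z.2)) =
        fun z => transSob s₁ (transSob (z.1 - s₁) (u z.2)) := by
      ext1 z
      rw [← transSob_add, add_sub_cancel]
    rw [h2]
    exact (((transSob (n := 2) s₁).toContinuousLinearMap.restrictScalars ℝ :
      Sob 2 →L[ℝ] Sob 2).contDiff).contDiffAt.comp (s₁, σ₁) h1

end branch

/-! ### The family of small bound states -/

lemma bcfMulR_symm (g : E3 →ᵇ ℝ) (f k : L2) :
    inner ℂ (bcfMulR g f) k = inner ℂ f (bcfMulR g k) := by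
  rw [l2_inner_eq, l2_inner_eq]
  refine integral_congr_ae ?_
  filter_upwards [bcfMulR_coe g f, bcfMulR_coe g k] with x h1 h2
  rw [h1, h2, map_mul, Complex.conj_ofReal]
  ring

lemma conj_inner_of_symm {f k : L2} (h : inner ℂ k f = inner ℂ f k) :
    conj (inner ℂ f k) = inner ℂ f k := by
  rw [inner_conj_symm, h]

/-- The eigenvalue parameter of a bound state is real. -/
lemma bsMap_energy_real {V : 𝓢(E3, ℝ)} {β : ℝ → ℝ} {hβ : Continuous β} {σ : ℝ} {φ₀ u : Sob 2}
    {E : ℂ} (h : bsMap V β hβ ((0, σ, sobL2 φ₀), (u, E)) = 0) : ((E.re : ℝ) : ℂ) = E := by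
  rw [bsMap, Prod.mk_eq_zero] at h
  simp only [bcfMulR_schTrans_zero] at h
  obtain ⟨h1, h2⟩ := h
  have hu0 : sobL2 u ≠ 0 := by
    intro h0
    rw [h0, inner_zero_right] at h2
    simp at h2
  have h3 := congrArg (inner ℂ (sobL2 u)) h1
  rw [inner_add_right, inner_sub_right, inner_smul_right, inner_zero_right,
    ← Hop_apply] at h3
  have c1 : conj (inner ℂ (sobL2 u) (Hop V u)) = inner ℂ (sobL2 u) (Hop V u) :=
    conj_inner_of_symm (Hop_symm V u u)
  have c2 := conj_inner_of_symm (bcfMulR_symm (supOp β hβ (σ • absSq u)) (sobL2 u) (sobL2 u))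
  have c3 : conj (inner ℂ (sobL2 u) (sobL2 u)) = inner ℂ (sobL2 u) (sobL2 u) :=
    inner_conj_symm _ _
  have c4 : (inner ℂ (sobL2 u) (sobL2 u) : ℂ) ≠ 0 := inner_self_ne_zero.2 hu0
  have h4 := congrArg conj h3
  simp only [map_add, map_sub, map_mul, c1, c2, c3, map_zero] at h4
  have h5 : (conj E - E) * inner ℂ (sobL2 u) (sobL2 u) = 0 := by
    linear_combination h3 - h4
  have h6 : conj E = E := sub_eq_zero.1 ((mul_eq_zero.1 h5).resolve_right c4)
  exact (Complex.conj_eq_iff_re.1 h6)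

lemma bsMap_ae {V : 𝓢(E3, ℝ)} {β : ℝ → ℝ} {hβ : Continuous β} {σ : ℝ} {φ₀ u : Sob 2}
    {E : ℂ} (h : bsMap V β hβ ((0, σ, sobL2 φ₀), (u, E)) = 0) :
    ∀ᵐ x, -(sobLap u x) + (V x : ℂ) * sobFn u x + (β (σ * ‖sobFn u x‖ ^ 2) : ℂ) * sobFn u x
      = E * sobFn u x := by
  rw [bsMap, Prod.mk_eq_zero] at h
  simp only [bcfMulR_schTrans_zero] at h
  obtain ⟨h1, h2⟩ := h
  have h3 := Lp.ext_iff.1 h1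
  filter_upwards [h3, Lp.coeFn_zero ℂ 2 (volume : Measure E3),
    Lp.coeFn_add (-lapL u + potOp V (sobL2 u) - E • sobL2 u)
      (bcfMulR (supOp β hβ (σ • absSq u)) (sobL2 u)),
    Lp.coeFn_sub (-lapL u + potOp V (sobL2 u)) (E • sobL2 u),
    Lp.coeFn_add (-lapL u) (potOp V (sobL2 u)), Lp.coeFn_neg (lapL u), potOp_coe V (sobL2 u),
    Lp.coeFn_smul E (sobL2 u), bcfMulR_coe (supOp β hβ (σ • absSq u)) (sobL2 u), sobBCF_coe u]
    with x a1 a2 a3 a4 a5 a6 a7 a8 a9 a10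
  rw [a2, a3, Pi.add_apply, a4, Pi.sub_apply, a5, Pi.add_apply, a6, Pi.neg_apply, a7, a8, a9,
    Pi.smul_apply, smul_eq_mul, supOp_apply, BoundedContinuousFunction.smul_apply, absSq_apply,
    ← a10, lapL_apply, smul_eq_mul, sobL2_coe] at a1
  simp only [Pi.zero_apply] at a1
  linear_combination a1

lemma sobFn_smul {n : ℕ} (c : ℂ) (u : Sob n) : ∀ᵐ x, sobFn (c • u) x = c * sobFn u x := by
  filter_upwards [Lp.coeFn_smul c (sobL2 u)] with x hx
  exact hx

theorem exists_smallBoundStates {V : 𝓢(E3, ℝ)} {e₀ : ℝ} (he : e₀ < 0) {φ₀ : Sob 2}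
    (h : LinearGroundState V e₀ φ₀) {β : ℝ → ℝ} (hβ : ContDiff ℝ ∞ β) (h0 : β 0 = 0) :
    ∃ (a : ℝ) (Q : ℂ → Sob 2) (E : ℂ → ℝ), 0 < a ∧ SmallBoundStates V β e₀ φ₀ a Q E ∧
      ContDiffOn ℝ ∞ (fun z : E3 × ℂ => transSob z.1 (Q z.2)) (univ ×ˢ Metric.ball 0 a) := by
  obtain ⟨u, E, ρ, hρ, hu0, hE0, hEs, hus, hsol⟩ := exists_branch he h hβ h0
  have hus0 : ContDiffOn ℝ ∞ u (Metric.ball 0 ρ) := by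
    have h1 : ContDiffOn ℝ ∞ (fun σ : ℝ => transSob (0 : E3) (u σ)) (Metric.ball 0 ρ) :=
      hus.comp (f := fun σ : ℝ => ((0 : E3), σ)) (by fun_prop) fun σ hσ => ⟨mem_univ _, hσ⟩
    exact h1.congr fun σ _ => (transSob_zero _).symm
  obtain ⟨K, s, hs, hK⟩ := ((hus0.contDiffAt (Metric.ball_mem_nhds 0 hρ)).of_le
    (m := 1) (by simp)).exists_lipschitzOnWith
  obtain ⟨K', s', hs', hK'⟩ := ((hEs.contDiffAt (Metric.ball_mem_nhds 0 hρ)).of_le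
    (m := 1) (by simp)).exists_lipschitzOnWith
  obtain ⟨ρ', hρ', hsub⟩ := Metric.mem_nhds_iff.1 (inter_mem hs hs')
  set a := min 1 (min ρ ρ') with ha
  have ha0 : 0 < a := lt_min one_pos (lt_min hρ hρ')
  have hsq : ∀ w : ℂ, ‖w‖ < a → ‖w‖ ^ 2 < a := by
    intro w hw
    have : a ≤ 1 := min_le_left _ _
    nlinarith [norm_nonneg w]
  have hmem : ∀ w : ℂ, ‖w‖ < a → ‖w‖ ^ 2 ∈ Metric.ball (0 : ℝ) ρ := by
    intro w hw
    rw [Metric.mem_ball, dist_zero_right, Real.norm_of_nonneg (sq_nonneg _)]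
    exact (hsq w hw).trans_le ((min_le_right _ _).trans (min_le_left _ _))
  have hmem' : ∀ w : ℂ, ‖w‖ < a → ‖w‖ ^ 2 ∈ s ∩ s' := by
    intro w hw
    apply hsub
    rw [Metric.mem_ball, dist_zero_right, Real.norm_of_nonneg (sq_nonneg _)]
    exact (hsq w hw).trans_le ((min_le_right _ _).trans (min_le_right _ _))
  have hball : ∀ w : ℂ, w ∈ Metric.ball (0 : ℂ) a → ‖w‖ < a := fun w hw => by
    rwa [Metric.mem_ball, dist_zero_right] at hw
  have hnsq : ContDiff ℝ ∞ fun w : ℂ => ‖w‖ ^ 2 := contDiff_norm_sq ℝ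
  set Q : ℂ → Sob 2 := fun w => w • u (‖w‖ ^ 2) with hQ
  have hjoint : ContDiffOn ℝ ∞ (fun z : E3 × ℂ => transSob z.1 (Q z.2))
      (univ ×ˢ Metric.ball 0 a) := by
    have h1 : ContDiffOn ℝ ∞ (fun z : E3 × ℂ => transSob z.1 (u (‖z.2‖ ^ 2)))
        (univ ×ˢ Metric.ball 0 a) :=
      hus.comp (f := fun z : E3 × ℂ => (z.1, ‖z.2‖ ^ 2))
        (contDiff_fst.prodMk (hnsq.comp contDiff_snd)).contDiffOn
        fun z hz => ⟨mem_univ _, hmem _ (hball _ hz.2)⟩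
    have h2 : ContDiffOn ℝ ∞ (fun z : E3 × ℂ => z.2 • transSob z.1 (u (‖z.2‖ ^ 2)))
        (univ ×ˢ Metric.ball 0 a) := contDiff_snd.contDiffOn.smul h1
    exact h2.congr fun z _ => map_smul (transSob z.1) _ _
  have hQs : ContDiffOn ℝ ∞ Q (Metric.ball 0 a) := by
    have h1 : ContDiffOn ℝ ∞ (fun w : ℂ => transSob (0 : E3) (Q w)) (Metric.ball 0 a) :=
      hjoint.comp (f := fun w : ℂ => ((0 : E3), w)) (by fun_prop) fun w hw => ⟨mem_univ _, hw⟩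
    exact h1.congr fun w _ => (transSob_zero _).symm
  refine ⟨a, Q, fun w => (E (‖w‖ ^ 2)).re, ha0, ?_, hjoint⟩
  refine ⟨hQs, ?_, ?_, ?_, ⟨K', ?_⟩, ⟨K, ?_⟩, ?_⟩
  · have h1 : ContDiffOn ℝ ∞ (fun w : ℂ => E (‖w‖ ^ 2)) (Metric.ball 0 a) :=
      hEs.comp hnsq.contDiffOn fun w hw => hmem w (hball w hw)
    exact Complex.reCLM.contDiff.comp_contDiffOn h1
  · intro w hw
    have h1 := hsol _ (hmem w hw)
    have h2 := bsMap_ae h1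
    have hr := bsMap_energy_real h1
    have hl : ∀ᵐ x, sobLap (Q w) x = w * sobLap (u (‖w‖ ^ 2)) x := by
      have e : sobLap (Q w) = w • sobLap (u (‖w‖ ^ 2)) := by
        rw [← lapL_apply, ← lapL_apply, ← map_smul]
      rw [e]
      filter_upwards [Lp.coeFn_smul w (sobLap (u (‖w‖ ^ 2)))] with x hx
      rw [hx]; rfl
    filter_upwards [h2, hl, sobFn_smul w (u (‖w‖ ^ 2))] with x a1 a2 a3
    change sobFn (Q w) x = _ at a3
    rw [a2, a3, hr, norm_mul, mul_pow]
    linear_combination w * a1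
  · intro w hw
    have h1 := hsol _ (hmem w hw)
    rw [bsMap, Prod.mk_eq_zero] at h1
    have h2 : inner ℂ (sobL2 φ₀) (sobL2 (Q w) - w • sobL2 φ₀) = 0 := by
      rw [inner_sub_right, inner_smul_right, h.inner_self, hQ]
      simp only
      rw [map_smul, inner_smul_right, sub_eq_zero.1 h1.2, sub_self]
    rw [← h2, l2_inner_eq]
    refine integral_congr_ae ?_
    filter_upwards [Lp.coeFn_sub (sobL2 (Q w)) (w • sobL2 φ₀), Lp.coeFn_smul w (sobL2 φ₀)]
      with x b1 b2
    rw [b1, Pi.sub_apply, b2]; rfl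
  · intro w hw
    have h1 := hK'.dist_le_mul _ (hmem' w hw).2 0 (mem_of_mem_nhds hs')
    rw [dist_eq_norm, dist_zero_right, Real.norm_of_nonneg (sq_nonneg ‖w‖), hE0] at h1
    refine le_trans ?_ h1
    have h2 := Complex.abs_re_le_norm (E (‖w‖ ^ 2) - e₀)
    simpa using h2
  · intro w hw
    have h1 := hK.dist_le_mul _ (hmem' w hw).1 0 (mem_of_mem_nhds hs)
    rw [dist_eq_norm, dist_zero_right, Real.norm_of_nonneg (sq_nonneg ‖w‖), hu0] at h1
    have h2 : Q w - w • φ₀ = w • (u (‖w‖ ^ 2) - φ₀) := by rw [smul_sub]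
    rw [h2, norm_smul]
    calc ‖w‖ * ‖u (‖w‖ ^ 2) - φ₀‖ ≤ ‖w‖ * (K * ‖w‖ ^ 2) := by gcongr
      _ = K * ‖w‖ ^ 3 := by ring
  · intro w hw
    have hd : HasFDerivAt Q (fderiv ℝ Q w) w :=
      ((hQs.contDiffAt (Metric.isOpen_ball.mem_nhds (by simpa using hw))).differentiableAt
        (by simp)).hasFDerivAt
    have hrot : HasDerivAt (fun θ : ℝ => Complex.exp (θ * Complex.I)) Complex.I 0 := by
      have h1 : HasDerivAt (fun θ : ℝ => (θ : ℂ) * Complex.I) (1 * Complex.I) 0 :=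
        (Complex.ofRealCLM.hasDerivAt (x := (0 : ℝ))).mul_const Complex.I
      have h2 := h1.cexp
      simpa using h2
    have hc1 : HasDerivAt (fun θ : ℝ => Complex.exp (θ * Complex.I) * w) (Complex.I * w) 0 :=
      hrot.mul_const w
    have hd' : HasFDerivAt Q (fderiv ℝ Q w) (Complex.exp (((0 : ℝ) : ℂ) * Complex.I) * w) := by
      simpa using hd
    have h1 : HasDerivAt (fun θ : ℝ => Q (Complex.exp (θ * Complex.I) * w))
        (fderiv ℝ Q w (Complex.I * w)) 0 := hd'.comp_hasDerivAt (0 : ℝ) hc1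
    have h2 : HasDerivAt (fun θ : ℝ => Complex.exp (θ * Complex.I) • Q w) (Complex.I • Q w) 0 :=
      hrot.smul_const (Q w)
    have h3 : (fun θ : ℝ => Q (Complex.exp (θ * Complex.I) * w)) =
        fun θ : ℝ => Complex.exp (θ * Complex.I) • Q w := by
      ext1 θ
      rw [hQ]
      simp only [norm_mul, Complex.norm_exp_ofReal_mul_I, one_mul, smul_smul]
    rw [h3] at h1
    rw [h2.unique h1]
    have h4 : Complex.I * w = (-w.im) • (1 : ℂ) + w.re • Complex.I := by
      apply Complex.ext <;> simp
    rw [h4, map_add, map_smul, map_smul, neg_smul]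

/-! ### Differential operators with coefficients of temperate growth -/

lemma hasTemperateGrowth_lineDeriv {p : E3 → ℂ} (hp : p.HasTemperateGrowth) (m : E3) :
    Function.HasTemperateGrowth fun x => fderiv ℝ p x m := by
  have h1 : (fderiv ℝ p).HasTemperateGrowth := by
    refine ⟨hp.1.fderiv_right (by simp), fun n => ?_⟩
    obtain ⟨k, C, h⟩ := hp.2 (n + 1)
    exact ⟨k, C, fun x => by rw [norm_iteratedFDeriv_fderiv]; exact h x⟩
  exact (ContinuousLinearMap.apply ℝ ℂ m).hasTemperateGrowth.comp h1

/-- Leibniz' rule for the product of a function of temperate growth and a distribution. -/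
lemma lineDeriv_smulLeft {p : E3 → ℂ} (hp : p.HasTemperateGrowth) (m : E3) (T : 𝓢'(E3, ℂ)) :
    ∂_{m} (TemperedDistribution.smulLeftCLM ℂ p T) =
      TemperedDistribution.smulLeftCLM ℂ (fun x => fderiv ℝ p x m) T +
      TemperedDistribution.smulLeftCLM ℂ p (∂_{m} T) := by
  have hp' := hasTemperateGrowth_lineDeriv hp m
  ext k
  simp only [TemperedDistribution.lineDerivOp_apply_apply,
    TemperedDistribution.smulLeftCLM_apply_apply, add_apply]
  rw [← map_add]
  congr 1
  ext x
  simp only [add_apply, neg_apply, SchwartzMap.lineDerivOp_apply_eq_fderiv,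
    SchwartzMap.smulLeftCLM_apply_apply hp, SchwartzMap.smulLeftCLM_apply_apply hp', smul_eq_mul]
  have e : (SchwartzMap.smulLeftCLM ℂ p k : E3 → ℂ) = fun x => p x * k x := by
    ext x; simp [SchwartzMap.smulLeftCLM_apply_apply hp]
  have hd : DifferentiableAt ℝ p x := hp.1.differentiable (by simp) x
  rw [e, fderiv_fun_mul hd k.differentiableAt]
  simp
  ring

/-- `∂_{a₁} ⋯ ∂_{a_n}` on tempered distributions. -/
def iterD : List (Fin 3) → 𝓢'(E3, ℂ) →L[ℂ] 𝓢'(E3, ℂ)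
  | [] => ContinuousLinearMap.id ℂ _
  | a :: l => LineDeriv.lineDerivOpCLM ℂ 𝓢'(E3, ℂ) (stdVec a) ∘L iterD l

/-- Differential operators with coefficients of temperate growth. -/
def diffOps : Submodule ℂ (𝓢'(E3, ℂ) →L[ℂ] 𝓢'(E3, ℂ)) :=
  Submodule.span ℂ {A | ∃ (p : E3 → ℂ) (l : List (Fin 3)), p.HasTemperateGrowth ∧
    A = TemperedDistribution.smulLeftCLM ℂ p ∘L iterD l}

lemma lineDeriv_comp_mem_diffOps (a : Fin 3) {A : 𝓢'(E3, ℂ) →L[ℂ] 𝓢'(E3, ℂ)}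
    (hA : A ∈ diffOps) : LineDeriv.lineDerivOpCLM ℂ 𝓢'(E3, ℂ) (stdVec a) ∘L A ∈ diffOps := by
  induction hA using Submodule.span_induction with
  | mem A h =>
    obtain ⟨p, l, hp, rfl⟩ := h
    have e : LineDeriv.lineDerivOpCLM ℂ 𝓢'(E3, ℂ) (stdVec a) ∘L
        (TemperedDistribution.smulLeftCLM ℂ p ∘L iterD l) =
        TemperedDistribution.smulLeftCLM ℂ (fun x => fderiv ℝ p x (stdVec a)) ∘L iterD l +
        TemperedDistribution.smulLeftCLM ℂ p ∘L iterD (a :: l) := by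
      refine ContinuousLinearMap.ext fun T => ?_
      exact lineDeriv_smulLeft hp _ _
    rw [e]
    exact Submodule.add_mem _
      (Submodule.subset_span ⟨_, l, hasTemperateGrowth_lineDeriv hp _, rfl⟩)
      (Submodule.subset_span ⟨p, a :: l, hp, rfl⟩)
  | zero => simp
  | add A B _ _ hA hB => rw [ContinuousLinearMap.comp_add]; exact Submodule.add_mem _ hA hB
  | smul c A _ hA => rw [ContinuousLinearMap.comp_smul]; exact Submodule.smul_mem _ c hA

lemma smulLeft_comp_mem_diffOps {q : E3 → ℂ} (hq : q.HasTemperateGrowth)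
    {A : 𝓢'(E3, ℂ) →L[ℂ] 𝓢'(E3, ℂ)}
    (hA : A ∈ diffOps) : TemperedDistribution.smulLeftCLM ℂ q ∘L A ∈ diffOps := by
  induction hA using Submodule.span_induction with
  | mem A h =>
    obtain ⟨p, l, hp, rfl⟩ := h
    refine Submodule.subset_span ⟨p * q, l, hp.mul hq, ?_⟩
    refine ContinuousLinearMap.ext fun T => ?_
    exact TemperedDistribution.smulLeftCLM_smulLeftCLM_apply hp hq _
  | zero => simp
  | add A B _ _ hA hB => rw [ContinuousLinearMap.comp_add]; exact Submodule.add_mem _ hA hB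
  | smul c A _ hA => rw [ContinuousLinearMap.comp_smul]; exact Submodule.smul_mem _ c hA

lemma id_mem_diffOps : ContinuousLinearMap.id ℂ 𝓢'(E3, ℂ) ∈ diffOps := by
  refine Submodule.subset_span ⟨fun _ => 1, [], by fun_prop, ?_⟩
  refine ContinuousLinearMap.ext fun T => ?_
  simp [iterD]

/-! ### Mixed regularity and decay -/

lemma wd_antisymm {a : Fin 3} {u u' k k' : L2} (hu : WD a u u') (hk : WD a k k') :
    inner ℂ k u' = -inner ℂ k' u := by
  rw [← FT.inner_map_map k, ← FT.inner_map_map k', l2_inner_eq, l2_inner_eq, ← integral_neg]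
  refine integral_congr_ae ?_
  filter_upwards [(wd_iff a u u').1 hu, (wd_iff a k k').1 hk] with ξ h1 h2
  rw [h1, h2]
  simp only [dsym, map_mul, Complex.conj_ofReal, Complex.conj_I, map_ofNat]
  ring

lemma wd_mul {a : Fin 3} {p : E3 → ℂ} (hp : p.HasTemperateGrowth) {u u' w z : L2}
    (h : WD a u u') (hw : w =ᵐ[volume] fun x => p x * u x)
    (hz : z =ᵐ[volume] fun x => fderiv ℝ p x (stdVec a) * u x + p x * u' x)
    (y : L2) (hy : y =ᵐ[volume] fun x => p x * u' x) : WD a w z := by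
  have h1 := (smulLeft_toTD_iff hp u w).2 hw
  have h2 := (smulLeft_toTD_iff hp u' y).2 hy
  have h3 := (smulLeft_toTD_iff (hasTemperateGrowth_lineDeriv hp (stdVec a)) u (z - y)).2 (by
    filter_upwards [hz, hy, Lp.coeFn_sub z y] with x a b c
    rw [c, Pi.sub_apply, a, b]; ring)
  have e : toTD z = toTD (z - y) + toTD y := by rw [← map_add, sub_add_cancel]
  rw [WD, h1, lineDeriv_smulLeft hp, e, h3, h2, h]

/-- A bounded approximation of `1 + |x|²`. -/
def cutWeight (ε : ℝ) (x : E3) : ℝ := (1 + ‖x‖ ^ 2) * (1 + ε * ‖x‖ ^ 2)⁻¹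

lemma cutWeight_temperate {ε : ℝ} (hε : 0 < ε) : (cutWeight ε).HasTemperateGrowth := by
  have h1 : Function.HasTemperateGrowth fun x : E3 => (1 + ‖x‖ ^ 2) := by fun_prop
  have h2 := (Function.hasTemperateGrowth_one_add_norm_sq_rpow E3 (-1)).comp
    ((Real.sqrt ε • ContinuousLinearMap.id ℝ E3).hasTemperateGrowth)
  have e : cutWeight ε = (fun x : E3 => (1 + ‖x‖ ^ 2)) * ((fun x : E3 => (1 + ‖x‖ ^ 2) ^ (-1 : ℝ)) ∘
      (Real.sqrt ε • ContinuousLinearMap.id ℝ E3)) := by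
    ext x
    simp [cutWeight, norm_smul, mul_pow, Real.sq_sqrt hε.le, Real.rpow_neg_one,
      abs_of_nonneg (Real.sqrt_nonneg ε)]
  rw [e]
  exact h1.mul h2

lemma cutWeight_nonneg {ε : ℝ} (hε : 0 < ε) (x : E3) : 0 ≤ cutWeight ε x := by
  unfold cutWeight; positivity

lemma cutWeight_le {ε : ℝ} (hε : 0 < ε) (x : E3) : cutWeight ε x ≤ 1 + ‖x‖ ^ 2 := by
  unfold cutWeight
  refine mul_le_of_le_one_right (by positivity) (inv_le_one_of_one_le₀ ?_)
  have : 0 ≤ ε * ‖x‖ ^ 2 := by positivity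
  linarith

lemma cutWeight_le_inv {ε : ℝ} (hε : 0 < ε) (hε1 : ε ≤ 1) (x : E3) : cutWeight ε x ≤ ε⁻¹ := by
  unfold cutWeight
  have : 0 < 1 + ε * ‖x‖ ^ 2 := by positivity
  rw [← div_eq_mul_inv, div_le_iff₀ this, mul_add, ← mul_assoc, inv_mul_cancel₀ hε.ne', one_mul,
    mul_one]
  gcongr
  exact one_le_inv_iff₀.2 ⟨hε, hε1⟩

lemma norm_fderiv_cutWeight_pow_le {ε : ℝ} (hε : 0 < ε) (hε1 : ε ≤ 1) (n : ℕ) (x : E3)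
    (a : Fin 3) :
    ‖fderiv ℝ (fun x => ((cutWeight ε x : ℂ)) ^ n) x (stdVec a)‖ ≤ n * cutWeight ε x ^ n := by
  have h1 : HasFDerivAt (fun x : E3 => ‖x‖ ^ 2) (2 • innerSL ℝ x) x :=
    (hasStrictFDerivAt_norm_sq x).hasFDerivAt
  have hpos : (0 : ℝ) < 1 + ε * ‖x‖ ^ 2 := by positivity
  have h2 : HasDerivAt (fun s : ℝ => (1 + s) * (1 + ε * s)⁻¹)
      ((1 - ε) * ((1 + ε * ‖x‖ ^ 2) ^ 2)⁻¹) (‖x‖ ^ 2) := by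
    have a1 : HasDerivAt (fun s : ℝ => 1 + s) 1 (‖x‖ ^ 2) := (hasDerivAt_id _).const_add 1
    have a2 : HasDerivAt (fun s : ℝ => 1 + ε * s) ε (‖x‖ ^ 2) := by
      simpa using ((hasDerivAt_id (‖x‖ ^ 2)).const_mul ε).const_add 1
    convert! a1.mul (a2.inv hpos.ne') using 1
    simp only [Pi.inv_apply]
    field_simp
    ring
  have h3 := ((h2.comp_hasFDerivAt x h1).pow n)
  have h4 := Complex.ofRealCLM.hasFDerivAt.comp x h3
  have e0 : (fun x => ((cutWeight ε x : ℂ)) ^ n) = Complex.ofRealCLM ∘ fun x =>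
      ((fun s : ℝ => (1 + s) * (1 + ε * s)⁻¹) ∘ fun x : E3 => ‖x‖ ^ 2) x ^ n := by
    ext x; simp [cutWeight]
  rw [e0, h4.fderiv]
  have hin : |inner ℝ x (stdVec a)| ≤ ‖x‖ := by
    refine (abs_real_inner_le_norm _ _).trans ?_
    simp [stdVec]
  have hc0 := cutWeight_nonneg hε x
  have hq : (|1 - ε| * ((1 + ε * ‖x‖ ^ 2) ^ 2)⁻¹) * (2 * |inner ℝ x (stdVec a)|) ≤
      cutWeight ε x := by
    have b1 : |1 - ε| ≤ 1 := by rw [abs_of_nonneg (by linarith)]; linarith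
    have b2 : ((1 + ε * ‖x‖ ^ 2) ^ 2)⁻¹ ≤ (1 + ε * ‖x‖ ^ 2)⁻¹ := by
      apply inv_anti₀ hpos
      have : 0 ≤ ε * ‖x‖ ^ 2 := by positivity
      nlinarith
    have b3 : 2 * |inner ℝ x (stdVec a)| ≤ 1 + ‖x‖ ^ 2 := by nlinarith [sq_nonneg (‖x‖ - 1)]
    calc _ ≤ (1 * (1 + ε * ‖x‖ ^ 2)⁻¹) * (1 + ‖x‖ ^ 2) := by gcongr
      _ = _ := by rw [cutWeight]; ring
  rcases n with _ | n
  · simp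
  have e : ‖(Complex.ofRealCLM ∘L (((n + 1 : ℕ) • (cutWeight ε x) ^ n) •
      ((1 - ε) * ((1 + ε * ‖x‖ ^ 2) ^ 2)⁻¹) • 2 • innerSL ℝ x)) (stdVec a)‖ =
      (n + 1 : ℕ) * (cutWeight ε x) ^ n * ((|1 - ε| * ((1 + ε * ‖x‖ ^ 2) ^ 2)⁻¹) *
        (2 * |inner ℝ x (stdVec a)|)) := by
    simp only [ContinuousLinearMap.comp_apply, Complex.ofRealCLM_apply, Complex.norm_real,
      smul_apply, innerSL_apply_apply, nsmul_eq_mul, smul_eq_mul, norm_mul, Real.norm_eq_abs,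
      abs_pow, abs_of_nonneg hc0]
    rw [abs_of_nonneg (show (0 : ℝ) ≤ ((n + 1 : ℕ) : ℝ) by positivity),
      abs_of_nonneg (show (0 : ℝ) ≤ ((1 + ε * ‖x‖ ^ 2) ^ 2)⁻¹ by positivity)]
    simp
  refine le_trans (le_of_eq ?_) (e.le.trans ?_)
  · simp [cutWeight]
  · rw [pow_succ _ n, mul_assoc]
    gcongr

lemma l2_of_bound {w : E3 → ℂ} (hw : Continuous w) {C : ℝ} (h : ∀ x, ‖w x‖ ≤ C) (f : L2) :
    ∃ g : L2, (g =ᵐ[volume] fun x => w x * f x) ∧ ‖g‖ ≤ C * ‖f‖ :=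
  ⟨mulOp w (memLp_top_of_continuous_bound hw C h) f, mulOp_coe _ _ _, norm_mulOp_le _ h _⟩

lemma integral_cutWeight_le {a : Fin 3} {u g h U : L2} (h1 : WD a u g) (h2 : WD a g h) (n : ℕ)
    (hU : U =ᵐ[volume] fun x => ((1 + ‖x‖ ^ 2 : ℝ) : ℂ) ^ n * u x) {ε : ℝ} (hε : 0 < ε)
    (hε1 : ε ≤ 1) :
    ∫⁻ x, ENNReal.ofReal (cutWeight ε x ^ n * ‖g x‖ ^ 2) ≤
      ENNReal.ofReal ((n * ‖g‖ + ‖h‖) * ‖U‖) := by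
  have hp : Function.HasTemperateGrowth fun x => ((cutWeight ε x : ℂ)) ^ n :=
    (Complex.ofRealCLM.hasTemperateGrowth.comp (cutWeight_temperate hε)).pow n
  have hp' := hasTemperateGrowth_lineDeriv hp (stdVec a)
  have hc0 := cutWeight_nonneg hε
  have hb : ∀ x, ‖((cutWeight ε x : ℂ)) ^ n‖ ≤ ε⁻¹ ^ n := fun x => by
    rw [norm_pow, Complex.norm_real, Real.norm_of_nonneg (hc0 x)]
    exact pow_le_pow_left₀ (hc0 x) (cutWeight_le_inv hε hε1 x) n
  have hb' : ∀ x, ‖fderiv ℝ (fun x => ((cutWeight ε x : ℂ)) ^ n) x (stdVec a)‖ ≤ n * ε⁻¹ ^ n :=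
    fun x => (norm_fderiv_cutWeight_pow_le hε hε1 n x a).trans (by
      have := pow_le_pow_left₀ (hc0 x) (cutWeight_le_inv hε hε1 x) n
      gcongr)
  obtain ⟨w, hw, -⟩ := l2_of_bound hp.1.continuous hb g
  obtain ⟨y, hy, -⟩ := l2_of_bound hp.1.continuous hb h
  obtain ⟨y', hy', -⟩ := l2_of_bound hp'.1.continuous hb' g
  have hz : WD a w (y' + y) := wd_mul hp h2 hw (by
    filter_upwards [hy, hy', Lp.coeFn_add y' y] with x a b c
    rw [c, Pi.add_apply, a, b]) y hy
  have hsc : Continuous fun x : E3 => (((1 + ‖x‖ ^ 2 : ℝ) : ℂ) ^ n)⁻¹ := by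
    refine Continuous.inv₀ (by fun_prop) fun x => ?_
    have : (0 : ℝ) < 1 + ‖x‖ ^ 2 := by positivity
    exact pow_ne_zero _ (by exact_mod_cast this.ne')
  have hsn : ∀ x : E3, ‖(((1 + ‖x‖ ^ 2 : ℝ) : ℂ) ^ n)⁻¹‖ = ((1 + ‖x‖ ^ 2) ^ n)⁻¹ := fun x => by
    rw [norm_inv, norm_pow, Complex.norm_real, Real.norm_of_nonneg (by positivity)]
  have hcn : ∀ x : E3, cutWeight ε x ^ n * ((1 + ‖x‖ ^ 2) ^ n)⁻¹ ≤ 1 := fun x => by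
    rw [← div_eq_mul_inv, div_le_one (by positivity)]
    exact pow_le_pow_left₀ (hc0 x) (cutWeight_le hε x) n
  obtain ⟨G, hG, hGn⟩ := l2_of_bound (C := n)
    (w := fun x => fderiv ℝ (fun x => ((cutWeight ε x : ℂ)) ^ n) x (stdVec a) *
      (((1 + ‖x‖ ^ 2 : ℝ) : ℂ) ^ n)⁻¹) (hp'.1.continuous.mul hsc) (fun x => by
    rw [norm_mul, hsn]
    have i1 := norm_fderiv_cutWeight_pow_le hε hε1 n x a
    have i2 := hcn x
    have i3 : (0 : ℝ) ≤ ((1 + ‖x‖ ^ 2) ^ n)⁻¹ := by positivity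
    calc _ ≤ (n * cutWeight ε x ^ n) * ((1 + ‖x‖ ^ 2) ^ n)⁻¹ := by gcongr
      _ = n * (cutWeight ε x ^ n * ((1 + ‖x‖ ^ 2) ^ n)⁻¹) := by ring
      _ ≤ n * 1 := by gcongr
      _ = n := mul_one _) g
  obtain ⟨H, hH, hHn⟩ := l2_of_bound (C := 1)
    (w := fun x => (cutWeight ε x : ℂ) ^ n * (((1 + ‖x‖ ^ 2 : ℝ) : ℂ) ^ n)⁻¹)
    (hp.1.continuous.mul hsc) (fun x => by
    rw [norm_mul, hsn, norm_pow, Complex.norm_real, Real.norm_of_nonneg (hc0 x)]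
    exact hcn x) h
  have key : inner ℂ w g = -inner ℂ (G + H) U := by
    rw [wd_antisymm h1 hz, l2_inner_eq, l2_inner_eq]
    congr 1
    refine integral_congr_ae ?_
    filter_upwards [hy, hy', Lp.coeFn_add y' y, hG, hH, Lp.coeFn_add G H, hU] with x a b c d e f i
    rw [c, f, Pi.add_apply, Pi.add_apply, a, b, d, e, i]
    have h0 : (((1 + ‖x‖ ^ 2 : ℝ) : ℂ) ^ n) ≠ 0 := by
      have : (0 : ℝ) < 1 + ‖x‖ ^ 2 := by positivity
      exact pow_ne_zero _ (by exact_mod_cast this.ne')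
    simp only [map_add, map_mul, map_inv₀, map_pow, Complex.conj_ofReal]
    field_simp
  have hint : Integrable (fun x => cutWeight ε x ^ n * ‖g x‖ ^ 2) := by
    have := (l2_integrable_mul g w).norm
    refine this.congr ?_
    filter_upwards [hw] with x hx
    rw [hx, norm_mul, RCLike.norm_conj, norm_mul, norm_pow, Complex.norm_real,
      Real.norm_of_nonneg (hc0 x)]
    ring
  rw [← ofReal_integral_eq_lintegral_ofReal hint
    (.of_forall fun x => mul_nonneg (pow_nonneg (hc0 x) n) (sq_nonneg _))]
  refine ENNReal.ofReal_le_ofReal ?_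
  have e : inner ℂ w g = ((∫ x, cutWeight ε x ^ n * ‖g x‖ ^ 2 : ℝ) : ℂ) := by
    rw [l2_inner_eq, ← integral_complex_ofReal]
    refine integral_congr_ae ?_
    filter_upwards [hw] with x hx
    rw [hx, map_mul, map_pow, Complex.conj_ofReal, mul_left_comm, Complex.mul_conj,
      Complex.normSq_eq_norm_sq]
    push_cast; ring
  calc _ ≤ ‖inner ℂ w g‖ := by rw [e, Complex.norm_real]; exact le_abs_self _
    _ ≤ ‖G + H‖ * ‖U‖ := by rw [key, norm_neg]; exact norm_inner_le_norm _ _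
    _ ≤ _ := by
      gcongr
      exact (norm_add_le _ _).trans (by linarith)

/-- Decay of `u` and regularity of `u` yield decay of a derivative of `u`. -/
lemma memLp_weight_deriv {a : Fin 3} {u g h U : L2} (h1 : WD a u g) (h2 : WD a g h) (m : ℕ)
    (hU : U =ᵐ[volume] fun x => ((1 + ‖x‖ ^ 2 : ℝ) : ℂ) ^ (2 * m) * u x) :
    MemLp (fun x => ((1 + ‖x‖ ^ 2 : ℝ) : ℂ) ^ m * g x) 2 (volume : Measure E3) := by
  have hm : AEStronglyMeasurable (fun x => ((1 + ‖x‖ ^ 2 : ℝ) : ℂ) ^ m * g x) volume :=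
    (by fun_prop : Continuous fun x : E3 => ((1 + ‖x‖ ^ 2 : ℝ) : ℂ) ^ m).aestronglyMeasurable.mul
      (Lp.aestronglyMeasurable g)
  rw [memLp_two_iff_integrable_sq_norm hm]
  have hn : ∀ x, ‖((1 + ‖x‖ ^ 2 : ℝ) : ℂ) ^ m * g x‖ ^ 2 =
      (1 + ‖x‖ ^ 2) ^ (2 * m) * ‖g x‖ ^ 2 := fun x => by
    rw [norm_mul, norm_pow, Complex.norm_real, Real.norm_of_nonneg (by positivity), mul_pow,
      ← pow_mul, mul_comm m]
  refine ⟨hm.norm.pow 2, ?_⟩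
  rw [hasFiniteIntegral_iff_ofReal (.of_forall fun x => sq_nonneg _)]
  set ε : ℕ → ℝ := fun k => 1 / ((k : ℝ) + 1)
  have hε : ∀ k, 0 < ε k := fun k => by positivity
  have hε1 : ∀ k, ε k ≤ 1 := fun k => by
    refine (div_le_one (by positivity)).2 ?_
    have : (0 : ℝ) ≤ k := by positivity
    linarith
  have hlim : ∀ x, Tendsto (fun k => ENNReal.ofReal (cutWeight (ε k) x ^ (2 * m) * ‖g x‖ ^ 2))
      atTop (𝓝 (ENNReal.ofReal (‖((1 + ‖x‖ ^ 2 : ℝ) : ℂ) ^ m * g x‖ ^ 2))) := fun x => by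
    rw [hn]
    refine (ENNReal.continuous_ofReal.tendsto _).comp ?_
    refine (Tendsto.pow ?_ _).mul_const _
    have : ContinuousAt (fun e : ℝ => cutWeight e x) 0 := by
      unfold cutWeight
      refine continuousAt_const.mul (ContinuousAt.inv₀ (by fun_prop) (by simp))
    have h' := this.tendsto.comp (tendsto_one_div_add_atTop_nhds_zero_nat (𝕜 := ℝ))
    simpa [cutWeight, Function.comp_def, ε] using h'
  have hmeas : ∀ k, AEMeasurable
      (fun x => ENNReal.ofReal (cutWeight (ε k) x ^ (2 * m) * ‖g x‖ ^ 2)) volume := fun k => by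
    refine AEMeasurable.ennreal_ofReal (AEMeasurable.mul ?_ ?_)
    · exact ((cutWeight_temperate (hε k)).1.continuous.pow _).measurable.aemeasurable
    · exact ((Lp.aestronglyMeasurable g).norm.pow 2).aemeasurable
  calc ∫⁻ x, ENNReal.ofReal (‖((1 + ‖x‖ ^ 2 : ℝ) : ℂ) ^ m * g x‖ ^ 2)
      = ∫⁻ x, liminf (fun k => ENNReal.ofReal (cutWeight (ε k) x ^ (2 * m) * ‖g x‖ ^ 2)) atTop := by
        congr 1; ext x; exact (hlim x).liminf_eq.symm
    _ ≤ liminf (fun k => ∫⁻ x, ENNReal.ofReal (cutWeight (ε k) x ^ (2 * m) * ‖g x‖ ^ 2)) atTop :=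
        lintegral_liminf_le' hmeas
    _ ≤ ENNReal.ofReal (((2 * m : ℕ) * ‖g‖ + ‖h‖) * ‖U‖) := by
        refine (liminf_le_liminf (.of_forall fun k =>
          integral_cutWeight_le h1 h2 (2 * m) hU (hε k) (hε1 k))).trans ?_
        simp
    _ < ⊤ := ENNReal.ofReal_lt_top

lemma fourier_iterD (l : List (Fin 3)) (T : 𝓢'(E3, ℂ)) :
    (l.map dsym).prod.HasTemperateGrowth ∧
    𝓕 (iterD l T) = TemperedDistribution.smulLeftCLM ℂ (l.map dsym).prod (𝓕 T) := by
  induction l with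
  | nil =>
    refine ⟨Function.HasTemperateGrowth.const 1, ?_⟩
    have : (List.map dsym []).prod = fun _ => (1 : ℂ) := rfl
    rw [this, TemperedDistribution.smulLeftCLM_const]
    simp [iterD]
  | cons a l ih =>
    refine ⟨by simpa using (dsym_temperate a).mul ih.1, ?_⟩
    have e : iterD (a :: l) T = ∂_{stdVec a} (iterD l T) := rfl
    rw [e, fourier_lineDeriv, ih.2,
      TemperedDistribution.smulLeftCLM_smulLeftCLM_apply ih.1 (dsym_temperate a)]
    simp [mul_comm]

lemma prod_map_dsym (l : List (Fin 3)) :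
    (l.map dsym).prod = dsym 0 ^ l.count 0 * dsym 1 ^ l.count 1 * dsym 2 ^ l.count 2 := by
  induction l with
  | nil => simp
  | cons a l ih =>
    rw [List.map_cons, List.prod_cons, ih]
    fin_cases a <;> simp [pow_succ] <;> ring

lemma sum_count_fin (l : List (Fin 3)) : ∑ i, l.count i = l.length := by
  induction l with
  | nil => simp
  | cons a l ih =>
    rw [List.length_cons, ← ih]
    simp only [Fin.sum_univ_three]
    fin_cases a <;> simp <;> ring

/-- The class in `L²` of an element of `Σ_n`. -/
def sigL2 {n : ℕ} : Sig n →L[ℂ] L2 :=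
  (PiLp.proj 2 (fun _ : Bool × MultiIdx n => L2) (true, MultiIdx.zero n)).comp (Sig n).subtypeL

lemma sigL2_coe {n : ℕ} (U : Sig n) : (sigL2 U : E3 → ℂ) = sigFn U := rfl

lemma monomial_temperate {n : ℕ} (α : MultiIdx n) : (monomial α).HasTemperateGrowth := by
  have h : ∀ i : Fin 3, Function.HasTemperateGrowth fun x : E3 => (x i : ℂ) := fun i =>
    (Complex.ofRealCLM ∘L (EuclideanSpace.proj i : E3 →L[ℝ] ℝ)).hasTemperateGrowth
  have e : monomial α = fun x : E3 => (x 0 : ℂ) ^ (α.1 0 : ℕ) * (x 1 : ℂ) ^ (α.1 1 : ℕ) *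
      (x 2 : ℂ) ^ (α.1 2 : ℕ) := by
    ext x; simp [monomial, Fin.prod_univ_three]
  rw [e]
  exact (((h 0).pow _).mul ((h 1).pow _)).mul ((h 2).pow _)

instance sigComplete (n : ℕ) : CompleteSpace (Sig n) := by
  have hc : IsClosed ((Sig n : Submodule ℂ _) :
      Set (PiLp 2 fun _ : Bool × MultiIdx n => L2)) := by
    have : ((Sig n : Submodule ℂ _) : Set (PiLp 2 fun _ : Bool × MultiIdx n => L2)) =
        (⋂ α, {U | toTD (U (false, α)) = TemperedDistribution.smulLeftCLM ℂ (monomial α)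
          (toTD (U (true, MultiIdx.zero n)))}) ∩
        ⋂ α, {U | toTD (U (true, α)) = partialOp α (toTD (U (true, MultiIdx.zero n)))} := by
      ext U
      simp only [mem_inter_iff, mem_iInter, Set.mem_ofPred_eq,
        smulLeft_toTD_iff (monomial_temperate _)]
      rfl
    rw [this]
    refine (isClosed_iInter fun α => isClosed_eq ?_ ?_).inter
      (isClosed_iInter fun α => isClosed_eq ?_ ?_)
    · exact toTD.continuous.comp (PiLp.continuous_apply 2 _ _)
    · exact (TemperedDistribution.smulLeftCLM ℂ (monomial α)).continuous.comp
        (toTD.continuous.comp (PiLp.continuous_apply 2 _ _))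
    · exact toTD.continuous.comp (PiLp.continuous_apply 2 _ _)
    · exact (partialOp α).continuous.comp (toTD.continuous.comp (PiLp.continuous_apply 2 _ _))
  exact hc.completeSpace_coe

lemma exists_iterD {n : ℕ} (U : Sig n) (l : List (Fin 3)) (hl : l.length ≤ n) :
    ∃ h : L2, toTD h = iterD l (toTD (sigL2 U)) := by
  have hle : ∀ i, l.count i ≤ n := fun i => List.count_le_length.trans hl
  let α : MultiIdx n := ⟨fun i => ⟨l.count i, Nat.lt_succ_of_le (hle i)⟩,
    by simpa [sum_count_fin] using hl⟩
  refine ⟨U.1 (true, α), td_fourier_injective ?_⟩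
  have h := U.2.2 α
  rw [IsWeakDeriv] at h
  rw [h, fourier_partialOp, (fourier_iterD l _).2, prod_map_dsym]
  rfl

lemma one_add_pow_le (a b c : ℝ) (ha : 0 ≤ a) (hb : 0 ≤ b) (hc : 0 ≤ c) (m : ℕ) :
    (1 + a + b + c) ^ m ≤ 4 ^ m * (1 + a ^ m + b ^ m + c ^ m) := by
  rcases m with _ | m
  · norm_num
  have h := pow_sum_div_card_le_sum_pow (s := Finset.univ) (f := ![1, a, b, c])
    (by intro i _; fin_cases i <;> simp [ha, hb, hc]) m
  simp only [Fin.sum_univ_four, Finset.card_univ, Fintype.card_fin] at h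
  rw [div_le_iff₀ (by positivity)] at h
  simp at h
  refine h.trans ?_
  rw [mul_comm, pow_succ (4 : ℝ) m]
  have : 0 ≤ 1 + a ^ (m + 1) + b ^ (m + 1) + c ^ (m + 1) := by positivity
  have h4 : (0 : ℝ) ≤ 4 ^ m := by positivity
  nlinarith [mul_nonneg h4 this]

lemma exists_weight {n : ℕ} (U : Sig n) (m : ℕ) (hm : 2 * m ≤ n) :
    MemLp (fun x => ((1 + ‖x‖ ^ 2 : ℝ) : ℂ) ^ m * sigL2 U x) 2 (volume : Measure E3) := by
  let α : Fin 3 → MultiIdx n := fun a => ⟨Pi.single a ⟨2 * m, by omega⟩, by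
    fin_cases a <;> simp [Fin.sum_univ_three, Pi.single_apply, hm]⟩
  have hα : ∀ a, ∀ᵐ x, U.1 (false, α a) x = (x a : ℂ) ^ (2 * m) * sigL2 U x := fun a => by
    filter_upwards [U.2.1 (α a)] with x hx
    rw [hx]
    congr 1
    fin_cases a <;> simp [monomial, Fin.prod_univ_three, α, Pi.single_apply]
  have hmeas : AEStronglyMeasurable (fun x => ((1 + ‖x‖ ^ 2 : ℝ) : ℂ) ^ m * sigL2 U x) volume :=
    (by fun_prop : Continuous fun x : E3 => ((1 + ‖x‖ ^ 2 : ℝ) : ℂ) ^ m).aestronglyMeasurable.mul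
      (Lp.aestronglyMeasurable _)
  have hF := fun a => (Lp.memLp (U.1 (false, α a))).norm
  refine MemLp.mono' (((((Lp.memLp (sigL2 U)).norm.add (hF 0)).add (hF 1)).add (hF 2)).const_mul
    (4 ^ m)) hmeas ?_
  filter_upwards [hα 0, hα 1, hα 2] with x h0 h1 h2
  simp only [Pi.add_apply, h0, h1, h2, norm_mul, norm_pow, Complex.norm_real]
  rw [Real.norm_of_nonneg (by positivity), EuclideanSpace.real_norm_sq_eq, Fin.sum_univ_three,
    ← add_assoc, ← add_assoc]
  have h := one_add_pow_le (x 0 ^ 2) (x 1 ^ 2) (x 2 ^ 2) (sq_nonneg _) (sq_nonneg _)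
    (sq_nonneg _) m
  have e : ∀ a : Fin 3, ‖x a‖ ^ (2 * m) = (x a ^ 2) ^ m := fun a => by
    rw [pow_mul, Real.norm_eq_abs, sq_abs]
  rw [e, e, e]
  calc _ ≤ (4 ^ m * (1 + (x 0 ^ 2) ^ m + (x 1 ^ 2) ^ m + (x 2 ^ 2) ^ m)) * ‖sigL2 U x‖ := by gcongr
    _ = _ := by ring

lemma exists_iterD_weight (l : List (Fin 3)) : ∀ m : ℕ, ∃ N₀, ∀ N ≥ N₀, ∀ U : Sig N,
    ∃ h : L2, toTD h = iterD l (toTD (sigL2 U)) ∧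
      MemLp (fun x => ((1 + ‖x‖ ^ 2 : ℝ) : ℂ) ^ m * h x) 2 (volume : Measure E3) := by
  induction l with
  | nil => exact fun m => ⟨2 * m, fun N hN U => ⟨sigL2 U, rfl, exists_weight U m hN⟩⟩
  | cons a l ih =>
    intro m
    obtain ⟨N₀, h⟩ := ih (2 * m)
    refine ⟨max N₀ (l.length + 2), fun N hN U => ?_⟩
    obtain ⟨u, hu, hw⟩ := h N (le_of_max_le_left hN) U
    have hl := le_of_max_le_right hN
    obtain ⟨g, hg⟩ := exists_iterD U (a :: l) (by simp; omega)
    obtain ⟨k, hk⟩ := exists_iterD U (a :: a :: l) (by simp; omega)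
    refine ⟨g, hg, memLp_weight_deriv (a := a) (u := u) (h := k) (U := hw.toLp _) ?_ ?_ m
      hw.coeFn_toLp⟩
    · rw [WD, hu]; exact hg
    · rw [WD, hg]; exact hk

lemma exists_diffOp {A : 𝓢'(E3, ℂ) →L[ℂ] 𝓢'(E3, ℂ)} (hA : A ∈ diffOps) :
    ∃ N₀, ∀ N ≥ N₀, ∀ U : Sig N, ∃ h : L2, toTD h = A (toTD (sigL2 U)) := by
  induction hA using Submodule.span_induction with
  | mem A h =>
    obtain ⟨p, l, hp, rfl⟩ := h
    obtain ⟨k, C, hb⟩ := hp.2 0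
    obtain ⟨N₀, h⟩ := exists_iterD_weight l k
    refine ⟨N₀, fun N hN U => ?_⟩
    obtain ⟨g, hg, hw⟩ := h N hN U
    have hC : 0 ≤ C := by
      have := (norm_nonneg _).trans (hb 0)
      simpa using this
    have hm : MemLp (fun x => p x * g x) 2 (volume : Measure E3) := by
      refine MemLp.of_le_mul (c := C * 2 ^ k) hw
        (hp.1.continuous.aestronglyMeasurable.mul (Lp.aestronglyMeasurable g)) (.of_forall fun x => ?_)
      have h1 := hb x
      rw [norm_iteratedFDeriv_zero] at h1
      have h2 : 1 + ‖x‖ ≤ 2 * (1 + ‖x‖ ^ 2) := by nlinarith [sq_nonneg (‖x‖ - 1), sq_nonneg ‖x‖]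
      rw [norm_mul, norm_mul, norm_pow, Complex.norm_real, Real.norm_of_nonneg (by positivity),
        ← mul_assoc, mul_assoc C, ← mul_pow]
      gcongr
      exact h1.trans (by gcongr)
    refine ⟨hm.toLp _, ?_⟩
    rw [(smulLeft_toTD_iff hp g _).2 hm.coeFn_toLp, hg]
    rfl
  | zero => exact ⟨0, fun N _ U => ⟨0, by simp⟩⟩
  | add A B _ _ hA hB =>
    obtain ⟨N, h⟩ := hA
    obtain ⟨N', h'⟩ := hB
    refine ⟨max N N', fun M hM U => ?_⟩
    obtain ⟨g, hg⟩ := h M (le_of_max_le_left hM) U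
    obtain ⟨g', hg'⟩ := h' M (le_of_max_le_right hM) U
    exact ⟨g + g', by rw [map_add, hg, hg']; rfl⟩
  | smul c A _ hA =>
    obtain ⟨N, h⟩ := hA
    refine ⟨N, fun M hM U => ?_⟩
    obtain ⟨g, hg⟩ := h M hM U
    exact ⟨c • g, by rw [map_smul, hg]; rfl⟩

lemma exists_diffOp_clm {A : 𝓢'(E3, ℂ) →L[ℂ] 𝓢'(E3, ℂ)} (hA : A ∈ diffOps) :
    ∃ (N : ℕ) (T : Sig N →L[ℂ] L2), ∀ U, toTD (T U) = A (toTD (sigL2 U)) := by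
  obtain ⟨N, h⟩ := exists_diffOp hA
  choose T hT using h N le_rfl
  let T' : Sig N →ₗ[ℂ] L2 :=
    { toFun := T
      map_add' := fun U W => toTD_injective (by simp only [map_add, hT])
      map_smul' := fun c U => toTD_injective (by simp only [map_smul, hT, RingHom.id_apply]) }
  have hc : IsClosed (T'.graph : Set (Sig N × L2)) := by
    have e : (T'.graph : Set (Sig N × L2)) = {z | toTD z.2 = A (toTD (sigL2 z.1))} := by
      ext z
      simp only [SetLike.mem_coe, LinearMap.mem_graph_iff, Set.mem_ofPred_eq]
      exact ⟨fun hz => by rw [hz]; exact hT _, fun hz => toTD_injective (hz.trans (hT _).symm)⟩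
    rw [e]
    exact isClosed_eq (toTD.continuous.comp continuous_snd)
      (A.continuous.comp (toTD.continuous.comp (sigL2.continuous.comp continuous_fst)))
  exact ⟨N, ContinuousLinearMap.ofIsClosedGraph hc, hT⟩

/-! ### Smooth families of rapidly decreasing functions -/

/-- `f` is smooth on `O` with values in every `Σ_n`. -/
def SmoothFam (O : Set ℝ) (f : ℝ → L2) : Prop :=
  ∀ n : ℕ, ∃ Ψ : ℝ → Sig n, ContDiffOn ℝ ∞ Ψ O ∧ ∀ s ∈ O, sigL2 (Ψ s) = f s

lemma SmoothFam.contDiffOn {O : Set ℝ} {f : ℝ → L2} (hf : SmoothFam O f) :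
    ContDiffOn ℝ ∞ f O := by
  obtain ⟨Ψ, h, h'⟩ := hf 0
  refine ContDiffOn.congr (((sigL2 (n := 0)).restrictScalars ℝ).contDiff.comp_contDiffOn h)
    fun s hs => (h' s hs).symm

lemma SmoothFam.deriv {O : Set ℝ} (hO : IsOpen O) {f : ℝ → L2} (hf : SmoothFam O f) :
    SmoothFam O (deriv f) := by
  intro n
  obtain ⟨Ψ, h, h'⟩ := hf n
  refine ⟨_root_.deriv Ψ, (h.deriv_of_isOpen hO (by simp)), fun s hs => ?_⟩
  have hd : HasDerivAt Ψ (_root_.deriv Ψ s) s :=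
    ((h.contDiffAt (hO.mem_nhds hs)).differentiableAt (by simp)).hasDerivAt
  have h2 := ((sigL2 (n := n)).restrictScalars ℝ).hasFDerivAt.comp_hasDerivAt s hd
  have h3 : HasDerivAt f (sigL2 (_root_.deriv Ψ s)) s := by
    refine h2.congr_of_eventuallyEq ?_
    filter_upwards [hO.mem_nhds hs] with r hr
    exact (h' r hr).symm
  exact h3.deriv.symm

lemma SmoothFam.hasDerivAt {O : Set ℝ} (hO : IsOpen O) {f : ℝ → L2} (hf : SmoothFam O f) {s : ℝ}
    (hs : s ∈ O) : HasDerivAt f (_root_.deriv f s) s :=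
  ((hf.contDiffOn.contDiffAt (hO.mem_nhds hs)).differentiableAt (by simp)).hasDerivAt

/-- The families obtained from smooth families by differential operators. -/
def DiffFam (O : Set ℝ) (g : ℝ → L2) : Prop :=
  ∃ f, SmoothFam O f ∧ ∃ A ∈ diffOps, ∀ s ∈ O, toTD (g s) = A (toTD (f s))

lemma SmoothFam.diffFam {O : Set ℝ} {f : ℝ → L2} (hf : SmoothFam O f) : DiffFam O f :=
  ⟨f, hf, _, id_mem_diffOps, fun _ _ => rfl⟩

lemma SmoothFam.exists_diffFam {O : Set ℝ} {f : ℝ → L2} (hf : SmoothFam O f)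
    {A : 𝓢'(E3, ℂ) →L[ℂ] 𝓢'(E3, ℂ)} (hA : A ∈ diffOps) :
    ∃ g, DiffFam O g ∧ ∀ s ∈ O, toTD (g s) = A (toTD (f s)) := by
  obtain ⟨N, T, hT⟩ := exists_diffOp_clm hA
  obtain ⟨Ψ, h, h'⟩ := hf N
  have e : ∀ s ∈ O, toTD (T (Ψ s)) = A (toTD (f s)) := fun s hs => by rw [hT, h' s hs]
  exact ⟨fun s => T (Ψ s), ⟨f, hf, A, hA, e⟩, e⟩

lemma DiffFam.wd {O : Set ℝ} {g : ℝ → L2} (hg : DiffFam O g) (a : Fin 3) :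
    ∃ k, DiffFam O k ∧ ∀ s ∈ O, WD a (g s) (k s) := by
  obtain ⟨f, hf, A, hA, h⟩ := hg
  obtain ⟨k, hk, hk'⟩ := hf.exists_diffFam (lineDeriv_comp_mem_diffOps a hA)
  exact ⟨k, hk, fun s hs => by rw [WD, hk' s hs, h s hs]; rfl⟩

lemma DiffFam.mul {O : Set ℝ} {g : ℝ → L2} (hg : DiffFam O g) {p : E3 → ℂ}
    (hp : p.HasTemperateGrowth) :
    ∃ k, DiffFam O k ∧ ∀ s ∈ O, k s =ᵐ[volume] fun x => p x * g s x := by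
  obtain ⟨f, hf, A, hA, h⟩ := hg
  obtain ⟨k, hk, hk'⟩ := hf.exists_diffFam (smulLeft_comp_mem_diffOps hp hA)
  refine ⟨k, hk, fun s hs => (smulLeft_toTD_iff hp _ _).1 ?_⟩
  rw [hk' s hs, h s hs]; rfl

lemma DiffFam.deriv {O : Set ℝ} (hO : IsOpen O) {g : ℝ → L2} (hg : DiffFam O g) :
    DiffFam O (deriv g) ∧ ∀ s ∈ O, HasDerivAt g (_root_.deriv g s) s := by
  obtain ⟨f, hf, A, hA, h⟩ := hg
  obtain ⟨N, T, hT⟩ := exists_diffOp_clm hA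
  obtain ⟨Ψ, hΨ, h'⟩ := hf N
  have hTg : ∀ s ∈ O, T (Ψ s) = g s := fun s hs =>
    toTD_injective (by rw [hT, h' s hs, h s hs])
  have key : ∀ s ∈ O, HasDerivAt g (T (_root_.deriv Ψ s)) s ∧
      sigL2 (_root_.deriv Ψ s) = _root_.deriv f s := fun s hs => by
    have hd : HasDerivAt Ψ (_root_.deriv Ψ s) s :=
      ((hΨ.contDiffAt (hO.mem_nhds hs)).differentiableAt (by simp)).hasDerivAt
    have h2 := (T.restrictScalars ℝ).hasFDerivAt.comp_hasDerivAt s hd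
    have h3 := ((sigL2 (n := N)).restrictScalars ℝ).hasFDerivAt.comp_hasDerivAt s hd
    refine ⟨h2.congr_of_eventuallyEq ?_, (h3.congr_of_eventuallyEq ?_).deriv.symm⟩
    · filter_upwards [hO.mem_nhds hs] with r hr
      exact (hTg r hr).symm
    · filter_upwards [hO.mem_nhds hs] with r hr
      exact (h' r hr).symm
  refine ⟨⟨_, hf.deriv hO, A, hA, fun s hs => ?_⟩, fun s hs => ?_⟩
  · rw [(key s hs).1.deriv, hT, (key s hs).2]
  · rw [(key s hs).1.deriv]; exact (key s hs).1

/-! ### Smoothness of the group action on smooth families -/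

lemma norm_exp_I_sub_le (s : ℝ) :
    ‖Complex.exp (Complex.I * s) - 1 - Complex.I * s‖ ≤ 3 * s ^ 2 := by
  have e : ‖Complex.I * (s : ℂ)‖ = |s| := by simp
  rcases le_total |s| 1 with h | h
  · have := Complex.norm_exp_sub_one_sub_id_le (x := Complex.I * s) (by rw [e]; exact h)
    rw [e, sq_abs] at this
    nlinarith [sq_nonneg s]
  · have h1 : ‖Complex.exp (Complex.I * s) - 1 - Complex.I * s‖ ≤ 1 + 1 + |s| := by
      refine (norm_sub_le _ _).trans (add_le_add ((norm_sub_le _ _).trans ?_) e.le)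
      rw [norm_exp_phase]; simp
    rw [← sq_abs]
    nlinarith

/-- `h = x_a f`. -/
def IsMulX (a : Fin 3) (f h : L2) : Prop := h =ᵐ[volume] fun x => (x a : ℂ) * f x

lemma coord_temperate (a : Fin 3) : Function.HasTemperateGrowth fun x : E3 => (x a : ℂ) :=
  (Complex.ofRealCLM ∘L (EuclideanSpace.proj a : E3 →L[ℝ] ℝ)).hasTemperateGrowth

lemma IsMulX.trans {a : Fin 3} {f h : L2} (hf : IsMulX a f h) (d : E3) :
    IsMulX a (trans d f) (trans d h - (d a : ℂ) • trans d f) := by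
  filter_upwards [ae_comp_add d hf, trans_coe d f, trans_coe d h,
    Lp.coeFn_sub (SolitonPotential.trans d h) ((d a : ℂ) • SolitonPotential.trans d f),
    Lp.coeFn_smul (d a : ℂ) (SolitonPotential.trans d f)] with x h1 h2 h3 h4 h5
  rw [h4, Pi.sub_apply, h5, Pi.smul_apply, h2, h3, h1, PiLp.add_apply]
  push_cast
  rw [smul_eq_mul]; ring

lemma IsMulX.sub_smul {a : Fin 3} {f h f' h' : L2} (hf : IsMulX a f h) (hf' : IsMulX a f' h')
    (c : ℂ) : IsMulX a (f - c • f') (h - c • h') := by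
  filter_upwards [hf, hf', Lp.coeFn_sub f (c • f'), Lp.coeFn_sub h (c • h'),
    Lp.coeFn_smul c f', Lp.coeFn_smul c h'] with x h1 h2 h3 h4 h5 h6
  rw [h3, h4, Pi.sub_apply, Pi.sub_apply, h5, h6, Pi.smul_apply, Pi.smul_apply, h1, h2,
    smul_eq_mul, smul_eq_mul]
  ring

lemma IsMulX.smul {a : Fin 3} {f h : L2} (hf : IsMulX a f h) (c : ℂ) :
    IsMulX a (c • f) (c • h) := by
  filter_upwards [hf, Lp.coeFn_smul c f, Lp.coeFn_smul c h] with x h1 h2 h3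
  rw [h2, h3, Pi.smul_apply, Pi.smul_apply, h1, smul_eq_mul, smul_eq_mul]
  ring

lemma hasFDerivAt_modul {f : L2} {h k : Fin 3 → L2} (hh : ∀ a, IsMulX a f (h a))
    (hk : ∀ a, IsMulX a (h a) (k a)) (v : E3) :
    HasFDerivAt (fun y => modul y f)
      (∑ a, (EuclideanSpace.proj a : E3 →L[ℝ] ℝ).smulRight (Complex.I • modul v (h a))) v := by
  refine hasFDerivAt_of_quadratic (ρ := 1) (K := 3 * ‖∑ a, k a‖) one_pos fun y _ => ?_
  have hs : ((∑ a, (EuclideanSpace.proj a : E3 →L[ℝ] ℝ).smulRight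
      (Complex.I • modul v (h a))) (y - v) : L2) = ∑ a, (((y - v) a : ℝ) : ℂ) •
        (Complex.I • modul v (h a)) := by
    simp only [sum_apply, ContinuousLinearMap.smulRight_apply,
      PiLp.proj_apply, Complex.coe_smul]
    rfl
  rw [hs, mul_right_comm]
  refine Lp.norm_le_mul_norm_of_ae_le_mul ?_
  simp only [Fin.sum_univ_three]
  have hcs := fun a : Fin 3 => Lp.coeFn_smul (((y - v) a : ℝ) : ℂ) (Complex.I • modul v (h a))
  have hcI := fun a : Fin 3 => Lp.coeFn_smul Complex.I (modul v (h a))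
  filter_upwards [modul_coe y f, modul_coe v f, modul_coe v (h 0), modul_coe v (h 1),
    modul_coe v (h 2), hh 0, hh 1, hh 2, hk 0, hk 1, hk 2, hcs 0, hcs 1, hcs 2, hcI 0, hcI 1, hcI 2,
    Lp.coeFn_add (k 0 + k 1) (k 2), Lp.coeFn_add (k 0) (k 1),
    Lp.coeFn_sub (modul y f - modul v f) ((((y - v) 0 : ℝ) : ℂ) • (Complex.I • modul v (h 0)) +
      (((y - v) 1 : ℝ) : ℂ) • (Complex.I • modul v (h 1)) +
      (((y - v) 2 : ℝ) : ℂ) • (Complex.I • modul v (h 2))), Lp.coeFn_sub (modul y f) (modul v f),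
    Lp.coeFn_add ((((y - v) 0 : ℝ) : ℂ) • (Complex.I • modul v (h 0)) +
      (((y - v) 1 : ℝ) : ℂ) • (Complex.I • modul v (h 1)))
      ((((y - v) 2 : ℝ) : ℂ) • (Complex.I • modul v (h 2))),
    Lp.coeFn_add ((((y - v) 0 : ℝ) : ℂ) • (Complex.I • modul v (h 0)))
      ((((y - v) 1 : ℝ) : ℂ) • (Complex.I • modul v (h 1)))]
    with x a1 a2 b0 b1 b2 c0 c1 c2 d0 d1 d2 e0 e1 e2 f0 f1 f2 g0 g1 g2 g3 g4 g5
  rw [g2, Pi.sub_apply, g3, Pi.sub_apply, g4, Pi.add_apply, g5, Pi.add_apply, e0, e1, e2,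
    Pi.smul_apply, Pi.smul_apply, Pi.smul_apply, f0, f1, f2, Pi.smul_apply, Pi.smul_apply,
    Pi.smul_apply, a1, a2, b0, b1, b2, g0, Pi.add_apply, g1, Pi.add_apply, d0, d1, d2, c0, c1, c2]
  set s : ℝ := inner ℝ (y - v) x with hsdef
  have hsx : s = (y - v) 0 * x 0 + (y - v) 1 * x 1 + (y - v) 2 * x 2 := by
    simp [s, PiLp.inner_apply, Fin.sum_univ_three]
    ring
  have hy : inner ℝ y x = inner ℝ v x + s := by rw [hsdef, inner_sub_left]; ring
  have h1 : Complex.exp (Complex.I * ((inner ℝ y x : ℝ) : ℂ)) =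
      Complex.exp (Complex.I * ((inner ℝ v x : ℝ) : ℂ)) * Complex.exp (Complex.I * s) := by
    rw [← Complex.exp_add, hy]; push_cast; ring_nf
  have h2 : Complex.exp (Complex.I * ((inner ℝ y x : ℝ) : ℂ)) * f x -
      Complex.exp (Complex.I * ((inner ℝ v x : ℝ) : ℂ)) * f x -
      ((((y - v) 0 : ℝ) : ℂ) • Complex.I • (Complex.exp (Complex.I * ((inner ℝ v x : ℝ) : ℂ)) *
        ((x 0 : ℂ) * f x)) + (((y - v) 1 : ℝ) : ℂ) • Complex.I •
        (Complex.exp (Complex.I * ((inner ℝ v x : ℝ) : ℂ)) * ((x 1 : ℂ) * f x)) +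
      (((y - v) 2 : ℝ) : ℂ) • Complex.I • (Complex.exp (Complex.I * ((inner ℝ v x : ℝ) : ℂ)) *
        ((x 2 : ℂ) * f x))) =
      Complex.exp (Complex.I * ((inner ℝ v x : ℝ) : ℂ)) *
        ((Complex.exp (Complex.I * s) - 1 - Complex.I * s) * f x) := by
    rw [h1, hsx]
    simp only [smul_eq_mul]
    push_cast
    ring
  have h3 : (x 0 : ℂ) * ((x 0 : ℂ) * f x) + (x 1 : ℂ) * ((x 1 : ℂ) * f x) +
      (x 2 : ℂ) * ((x 2 : ℂ) * f x) = ((‖x‖ ^ 2 : ℝ) : ℂ) * f x := by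
    rw [EuclideanSpace.real_norm_sq_eq, Fin.sum_univ_three]; push_cast; ring
  rw [h2, h3, norm_mul, norm_exp_phase, one_mul, norm_mul, norm_mul, Complex.norm_real,
    Real.norm_of_nonneg (sq_nonneg _), ← mul_assoc]
  gcongr
  refine (norm_exp_I_sub_le s).trans ?_
  have : s ^ 2 ≤ (‖y - v‖ * ‖x‖) ^ 2 := by
    rw [← sq_abs]
    exact pow_le_pow_left₀ (abs_nonneg _) (abs_real_inner_le_norm _ _) 2
  calc 3 * s ^ 2 ≤ 3 * (‖y - v‖ * ‖x‖) ^ 2 := by gcongr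
    _ = _ := by ring

lemma isMulX_FT {a : Fin 3} {f h : L2} (hf : WD a f h) :
    IsMulX a (FT f) ((2 * Real.pi * Complex.I)⁻¹ • FT h) := by
  filter_upwards [(wd_iff a f h).1 hf, Lp.coeFn_smul (2 * Real.pi * Complex.I)⁻¹ (FT h)]
    with ξ h1 h2
  rw [h2, Pi.smul_apply, h1, smul_eq_mul, dsym]
  have : (2 * Real.pi * Complex.I : ℂ) ≠ 0 := Complex.two_pi_I_ne_zero
  field_simp

lemma hasFDerivAt_trans {f : L2} {h k : Fin 3 → L2} (hh : ∀ a, WD a f (h a))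
    (hk : ∀ a, WD a (h a) (k a)) (d : E3) :
    HasFDerivAt (fun y => trans y f)
      (∑ a, (EuclideanSpace.proj a : E3 →L[ℝ] ℝ).smulRight (trans d (h a))) d := by
  have h1 := hasFDerivAt_modul (f := FT f) (fun a => isMulX_FT (hh a))
    (fun a => (isMulX_FT (hk a)).smul (2 * Real.pi * Complex.I)⁻¹) ((2 * Real.pi) • d)
  have h2 := h1.comp d
    ((2 * Real.pi) • ContinuousLinearMap.id ℝ E3 : E3 →L[ℝ] E3).hasFDerivAt
  have h3 := ((FT.symm.toContinuousLinearEquiv : L2 →L[ℂ] L2).restrictScalars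
    ℝ).hasFDerivAt.comp d h2
  have e : (fun y => trans y f) = fun y => FT.symm (modul ((2 * Real.pi) • y) (FT f)) := by
    ext1 y; rw [← FT_trans]; simp
  rw [e]
  convert! h3 using 1
  refine ContinuousLinearMap.ext fun y => ?_
  have hpi : (2 * Real.pi : ℂ) ≠ 0 := by exact_mod_cast Real.two_pi_pos.ne'
  have e2 : ∀ a, trans d (h a) = FT.symm (modul ((2 * Real.pi) • d) (FT (h a))) := fun a => by
    rw [← FT_trans]; simp
  simp only [sum_apply, ContinuousLinearMap.smulRight_apply, PiLp.proj_apply,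
    ContinuousLinearMap.comp_apply, smul_apply, ContinuousLinearMap.id_apply,
    ContinuousLinearMap.coe_restrictScalars']
  simp only [e2]
  have e3 : ∀ z : L2, ((FT.symm.toContinuousLinearEquiv : L2 →L[ℂ] L2)) z = FT.symm z :=
    fun _ => rfl
  rw [e3, map_sum]
  refine Finset.sum_congr rfl fun a _ => ?_
  have e4 : FT.symm (Complex.I • modul ((2 * Real.pi) • d)
      ((2 * Real.pi * Complex.I : ℂ)⁻¹ • FT (h a))) = (2 * Real.pi : ℂ)⁻¹ •
      FT.symm (modul ((2 * Real.pi) • d) (FT (h a))) := by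
    rw [map_smul (modul ((2 * Real.pi) • d)), smul_smul, map_smul FT.symm]
    congr 1
    have hI := Complex.I_ne_zero
    field_simp
  have e5 : ∀ (r : ℝ) (z : L2), r • z = (r : ℂ) • z := fun r z => (Complex.coe_smul r z).symm
  rw [PiLp.smul_apply, e5, e5, map_smul FT.symm, e4, smul_smul]
  congr 1
  rw [smul_eq_mul]
  push_cast
  field_simp

lemma hasFDerivAt_strong {X Y F : Type*} [NormedAddCommGroup X] [NormedSpace ℝ X]
    [FiniteDimensional ℝ X] [NormedAddCommGroup Y] [NormedSpace ℝ Y] [NormedAddCommGroup F]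
    [NormedSpace ℝ F] {A : Y → F →L[ℝ] F} (hA : ∀ y f, ‖A y f‖ ≤ ‖f‖) {y₀ : Y}
    (hc : ∀ f, ContinuousAt (fun y => A y f) y₀) {g : X → F} {g' : X →L[ℝ] F} {x₀ : X}
    (hg : HasFDerivAt g g' x₀) {D : Y →L[ℝ] F} (hD : HasFDerivAt (fun y => A y (g x₀)) D y₀) :
    HasFDerivAt (fun z : Y × X => A z.1 (g z.2))
      (D ∘L ContinuousLinearMap.fst ℝ Y X + (A y₀ ∘L g') ∘L ContinuousLinearMap.snd ℝ Y X)
      (y₀, x₀) := by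
  have hop : Tendsto (fun y => (A y - A y₀) ∘L g') (𝓝 y₀) (𝓝 0) := by
    have : ContinuousAt (fun y => (A y - A y₀) ∘L g') y₀ := by
      rw [continuousAt_clm_apply]
      intro x
      exact (hc (g' x)).sub continuousAt_const
    have h := this.tendsto
    simpa using h
  have hfst : Tendsto (Prod.fst : Y × X → Y) (𝓝 (y₀, x₀)) (𝓝 y₀) := continuousAt_fst
  have hsnd : Tendsto (Prod.snd : Y × X → X) (𝓝 (y₀, x₀)) (𝓝 x₀) := continuousAt_snd
  rw [hasFDerivAt_iff_isLittleO] at hg hD ⊢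
  have n1 : (fun z : Y × X => z.1 - y₀) =O[𝓝 (y₀, x₀)] fun z => z - (y₀, x₀) :=
    Asymptotics.IsBigO.of_bound 1 (.of_forall fun z => by rw [one_mul]; exact norm_fst_le (z - (y₀, x₀)))
  have n2 : (fun z : Y × X => z.2 - x₀) =O[𝓝 (y₀, x₀)] fun z => z - (y₀, x₀) :=
    Asymptotics.IsBigO.of_bound 1 (.of_forall fun z => by rw [one_mul]; exact norm_snd_le (z - (y₀, x₀)))
  have t1 := (hD.comp_tendsto hfst).trans_isBigO n1
  have t2 : (fun z : Y × X => A z.1 (g z.2 - g x₀ - g' (z.2 - x₀))) =o[𝓝 (y₀, x₀)]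
      fun z => z - (y₀, x₀) :=
    (Asymptotics.IsBigO.of_bound 1 (.of_forall fun z => by
      rw [one_mul]; exact hA _ _)).trans_isLittleO ((hg.comp_tendsto hsnd).trans_isBigO n2)
  have t3 : (fun z : Y × X => ((A z.1 - A y₀) ∘L g') (z.2 - x₀)) =o[𝓝 (y₀, x₀)]
      fun z => z - (y₀, x₀) := by
    refine Asymptotics.IsLittleO.trans_isBigO ?_ n2
    rw [Asymptotics.isLittleO_iff]
    intro c hc0
    have := (hop.comp hfst).norm.eventually_lt_const (u := c) (by simpa using hc0)
    filter_upwards [this] with z hz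
    exact (ContinuousLinearMap.le_opNorm _ _).trans (by gcongr; exact hz.le)
  refine ((t1.add t2).add t3).congr_left fun z => ?_
  simp only [Function.comp_apply, map_sub, ContinuousLinearMap.comp_apply,
    sub_apply, add_apply, ContinuousLinearMap.coe_fst', ContinuousLinearMap.coe_snd']
  abel

/-- The orbit map `(v, d, s) ↦ e^{iv·x} g_s(x + d)`. -/
def orbit (g : ℝ → L2) (z : E3 × E3 × ℝ) : L2 := modul z.1 (trans z.2.1 (g z.2.2))

/-- The derivative of `orbit g`, where `m`, `k` and `g'` are the families `x_a g`, `∂_a g` and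
`dg/ds`. -/
def orbitDeriv (g : ℝ → L2) (m k : Fin 3 → ℝ → L2) (g' : ℝ → L2) (z : E3 × E3 × ℝ) :
    E3 × E3 × ℝ →L[ℝ] L2 :=
  ∑ a, ((EuclideanSpace.proj a : E3 →L[ℝ] ℝ) ∘L ContinuousLinearMap.fst ℝ _ _).smulRight
      (Complex.I • (orbit (m a) z - z.2.1 a • orbit g z)) +
  ∑ a, ((EuclideanSpace.proj a : E3 →L[ℝ] ℝ) ∘L ContinuousLinearMap.fst ℝ _ _ ∘L
      ContinuousLinearMap.snd ℝ _ _).smulRight (orbit (k a) z) +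
  (ContinuousLinearMap.snd ℝ _ _ ∘L ContinuousLinearMap.snd ℝ _ _ :
      E3 × E3 × ℝ →L[ℝ] ℝ).smulRight (orbit g' z)

lemma hasFDerivAt_orbit {O : Set ℝ} (hO : IsOpen O) {g : ℝ → L2} (hg : DiffFam O g)
    {m k : Fin 3 → ℝ → L2} (hm : ∀ a, DiffFam O (m a)) (hm' : ∀ a, ∀ s ∈ O, IsMulX a (g s) (m a s))
    (hk : ∀ a, DiffFam O (k a)) (hk' : ∀ a, ∀ s ∈ O, WD a (g s) (k a s)) {z : E3 × E3 × ℝ}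
    (hz : z.2.2 ∈ O) :
    HasFDerivAt (orbit g) (orbitDeriv g m k (deriv g) z) z := by
  obtain ⟨v, d, s⟩ := z
  have hz' : s ∈ O := hz
  choose m2 hm2 hm2' using fun a => (hm a).mul (coord_temperate a)
  choose k2 hk2 hk2' using fun a => (hk a).wd a
  have h1 := hasFDerivAt_trans (fun a => hk' a s hz') (fun a => hk2' a s hz') d
  have h2 := hasFDerivAt_strong (A := fun d => ((trans d).toContinuousLinearMap.restrictScalars ℝ))
    (fun y f => ((trans y).norm_map f).le)
    (fun f => (continuous_trans.comp (Continuous.prodMk_left f)).continuousAt)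
    ((hg.deriv hO).2 s hz').hasFDerivAt h1
  have h3 := hasFDerivAt_modul (fun a => (hm' a s hz').trans d)
    (fun a => ((show IsMulX a (m a s) (m2 a s) from hm2' a s hz').trans d).sub_smul
      ((hm' a s hz').trans d) (d a : ℂ)) v
  have h4 := hasFDerivAt_strong (A := fun v => ((modul v).restrictScalars ℝ))
    (fun y f => (norm_modul y f).le)
    (fun f => (continuous_modul.comp (Continuous.prodMk_left f)).continuousAt) h2 h3
  refine h4.congr_fderiv ?_
  refine ContinuousLinearMap.ext fun y => ?_
  obtain ⟨y1, y2, y3⟩ := y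
  simp only [orbitDeriv, orbit, add_apply, sum_apply, ContinuousLinearMap.comp_apply,
    ContinuousLinearMap.smulRight_apply, ContinuousLinearMap.coe_fst',
    ContinuousLinearMap.coe_snd', ContinuousLinearMap.coe_restrictScalars', map_add, map_sum,
    map_sub, add_assoc]
  refine congrArg₂ (· + ·) ?_ (congrArg₂ (· + ·) ?_ ?_)
  · refine Finset.sum_congr rfl fun a _ => ?_
    rw [(modul v).map_smul, Complex.coe_smul]
    rfl
  · refine Finset.sum_congr rfl fun a _ => ?_
    exact (modul v).map_smul_of_tower (y2 a) _
  · rw [ContinuousLinearMap.toSpanSingleton_apply]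
    have : (trans d).toContinuousLinearMap (y3 • _root_.deriv g s) =
        y3 • trans d (_root_.deriv g s) := (trans d).toContinuousLinearMap.map_smul_of_tower y3 _
    rw [this]
    exact (modul v).map_smul_of_tower y3 _

lemma contDiffOn_orbit {O : Set ℝ} (hO : IsOpen O) {g : ℝ → L2} (hg : DiffFam O g) :
    ContDiffOn ℝ ∞ (orbit g) (univ ×ˢ univ ×ˢ O) := by
  have hU : IsOpen (univ ×ˢ univ ×ˢ O : Set (E3 × E3 × ℝ)) :=
    isOpen_univ.prod (isOpen_univ.prod hO)
  rw [contDiffOn_infty]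
  intro n
  induction n generalizing g with
  | zero =>
    choose m hm hm' using fun a => hg.mul (coord_temperate a)
    choose k hk hk' using fun a => hg.wd a
    rw [Nat.cast_zero, contDiffOn_zero]
    exact fun z hz => (hasFDerivAt_orbit hO hg hm hm' hk hk'
      hz.2.2).continuousAt.continuousWithinAt
  | succ n ih =>
    choose m hm hm' using fun a => hg.mul (coord_temperate a)
    choose k hk hk' using fun a => hg.wd a
    have hd := fun z hz => hasFDerivAt_orbit (z := z) hO hg hm hm' hk hk' hz
    rw [Nat.cast_succ, contDiffOn_succ_iff_fderiv_of_isOpen hU]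
    refine ⟨fun z hz => (hd z hz.2.2).differentiableAt.differentiableWithinAt, by simp, ?_⟩
    refine ContDiffOn.congr (f := orbitDeriv g m k (deriv g)) ?_ fun z hz => (hd z hz.2.2).fderiv
    have hs : ∀ (ℓ : E3 × E3 × ℝ →L[ℝ] ℝ) {f : E3 × E3 × ℝ → L2},
        ContDiffOn ℝ n f (univ ×ˢ univ ×ˢ O) →
        ContDiffOn ℝ n (fun z => ℓ.smulRight (f z)) (univ ×ˢ univ ×ˢ O) := fun ℓ f hf =>
      (ContinuousLinearMap.smulRightL ℝ (E3 × E3 × ℝ) L2 ℓ).contDiff.comp_contDiffOn hf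
    unfold orbitDeriv
    refine ContDiffOn.add (ContDiffOn.add ?_ ?_) (hs _ (ih (hg.deriv hO).1))
    · refine ContDiffOn.sum fun a _ => hs _ ?_
      refine ContDiffOn.const_smul _ ((ih (hm a)).sub (ContDiffOn.fun_smul ?_ (ih hg)))
      exact ((EuclideanSpace.proj a : E3 →L[ℝ] ℝ) ∘L ContinuousLinearMap.fst ℝ _ _ ∘L
        ContinuousLinearMap.snd ℝ _ _ : E3 × E3 × ℝ →L[ℝ] ℝ).contDiff.contDiffOn
    · exact ContDiffOn.sum fun a _ => hs _ (ih (hk a))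

/-! ### An implicit function theorem uniform in an operator parameter -/

lemma exists_uniform_zero {X H P Y : Type*} [NormedAddCommGroup X] [NormedSpace ℝ X]
    [FiniteDimensional ℝ X] [NormedAddCommGroup H] [NormedSpace ℝ H] [NormedAddCommGroup P]
    [NormedSpace ℝ P] [NormedAddCommGroup Y] [NormedSpace ℝ Y] [FiniteDimensional ℝ Y]
    (hdim : Module.finrank ℝ X = Module.finrank ℝ Y) {f : X × H → P →L[ℝ] Y}
    {f' : X × H →L[ℝ] P →L[ℝ] Y} {x₀ : X} {b₀ : H} (hf : HasStrictFDerivAt f f' (x₀, b₀))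
    {N : X →L[ℝ] Y} (hN : Function.Injective N) :
    ∃ η > 0, ∃ r₀ > 0, ∃ ε₀ > 0, (∀ σ : P, ‖σ‖ ≤ 1 → (∀ h, ‖f' (h, 0) σ - N h‖ ≤ η * ‖h‖) →
      ∀ b, ‖b - b₀‖ < ε₀ → InjOn (fun x => f (x, b) σ) (Metric.ball x₀ r₀) ∧
        ∀ x ∈ Metric.ball x₀ r₀, ∀ A : X →L[ℝ] Y, HasFDerivAt (fun x => f (x, b) σ) A x →
          Function.Injective A) ∧
      ∀ r > 0, ∃ ε > 0, ∀ σ : P, ‖σ‖ ≤ 1 → (∀ h, ‖f' (h, 0) σ - N h‖ ≤ η * ‖h‖) →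
        f (x₀, b₀) σ = 0 → ∀ b, ‖b - b₀‖ < ε → ∃ x ∈ Metric.ball x₀ r, f (x, b) σ = 0 := by
  let Ne : X ≃L[ℝ] Y :=
    (LinearEquiv.ofInjectiveOfFinrankEq (N : X →ₗ[ℝ] Y) hN hdim).toContinuousLinearEquiv
  have hNe : ∀ x, Ne x = N x := fun x => rfl
  obtain ⟨c, hc, hcN⟩ : ∃ c > 0, ∀ h, c * ‖h‖ ≤ ‖N h‖ := by
    refine ⟨(‖(Ne.symm : Y →L[ℝ] X)‖ + 1)⁻¹, by positivity, fun h => ?_⟩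
    rw [inv_mul_le_iff₀ (by positivity)]
    have h1 := (Ne.symm : Y →L[ℝ] X).le_opNorm (N h)
    have h2 : (Ne.symm : Y →L[ℝ] X) (N h) = h := by
      rw [← hNe]; exact Ne.symm_apply_apply h
    rw [h2] at h1
    nlinarith [norm_nonneg (N h)]
  have hs : ∃ ρ > 0, ∀ z ∈ Metric.ball (x₀, b₀) ρ, ∀ z' ∈ Metric.ball (x₀, b₀) ρ,
      ‖f z - f z' - f' (z - z')‖ ≤ c / 4 * ‖z - z'‖ := by
    have h := (hasStrictFDerivAt_iff_isLittleO.1 hf).def (c := c / 4) (by positivity)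
    rw [Metric.eventually_nhds_iff_ball] at h
    obtain ⟨ρ, hρ, h⟩ := h
    refine ⟨ρ, hρ, fun z hz z' hz' => h (z, z') ?_⟩
    rw [← ball_prod_same]
    exact ⟨hz, hz'⟩
  obtain ⟨ρ, hρ, hs⟩ := hs
  have hmem : ∀ x ∈ Metric.ball x₀ ρ, ∀ b, ‖b - b₀‖ < ρ → (x, b) ∈ Metric.ball (x₀, b₀) ρ :=
    fun x hx b hb => by
      rw [← ball_prod_same]
      exact ⟨hx, by rwa [Metric.mem_ball, dist_eq_norm]⟩
  have key : ∀ σ : P, ‖σ‖ ≤ 1 → (∀ h, ‖f' (h, 0) σ - N h‖ ≤ c / 4 * ‖h‖) →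
      ∀ b, ‖b - b₀‖ < ρ → ∀ x ∈ Metric.ball x₀ ρ, ∀ y ∈ Metric.ball x₀ ρ,
        ‖f (x, b) σ - f (y, b) σ - N (x - y)‖ ≤ c / 2 * ‖x - y‖ := by
    intro σ hσ hS b hb x hx y hy
    have h1 := hs _ (hmem x hx b hb) _ (hmem y hy b hb)
    have e1 : (x, b) - (y, b) = (x - y, (0 : H)) := by simp
    have e2 : ‖((x - y, (0 : H)) : X × H)‖ = ‖x - y‖ := by simp [Prod.norm_def]
    rw [e1, e2] at h1
    have h2 : ‖(f (x, b) - f (y, b) - f' (x - y, 0)) σ‖ ≤ c / 4 * ‖x - y‖ := by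
      refine (ContinuousLinearMap.le_opNorm _ _).trans ?_
      calc _ ≤ (c / 4 * ‖x - y‖) * 1 := by gcongr
        _ = _ := mul_one _
    have e3 : f (x, b) σ - f (y, b) σ - N (x - y) = (f (x, b) - f (y, b) - f' (x - y, 0)) σ +
        (f' (x - y, 0) σ - N (x - y)) := by
      simp only [sub_apply]; abel
    rw [e3]
    refine (norm_add_le _ _).trans ?_
    linarith [hS (x - y)]
  refine ⟨c / 4, by positivity, ρ, hρ, ρ, hρ, ?_, ?_⟩
  · intro σ hσ hS b hb
    have hk := key σ hσ hS b hb
    refine ⟨fun x hx y hy hxy => ?_, fun x hx A hA => ?_⟩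
    · have h := hk x hx y hy
      simp only at hxy
      rw [hxy, sub_self, zero_sub, norm_neg] at h
      have h2 := hcN (x - y)
      have : ‖x - y‖ ≤ 0 := by nlinarith [norm_nonneg (x - y)]
      exact sub_eq_zero.1 (norm_le_zero_iff.1 this)
    · have hd : HasFDerivAt (fun x => f (x, b) σ - N x) (A - N) x := hA.sub N.hasFDerivAt
      have hle : ‖A - N‖ ≤ c / 2 := by
        refine hd.le_of_lip' (by positivity) ?_
        filter_upwards [Metric.isOpen_ball.mem_nhds hx] with y hy
        have := hk y hy x hx
        convert this using 2
        rw [map_sub]; abel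
      rw [injective_iff_map_eq_zero]
      intro h hh
      have h1 := (A - N).le_opNorm h
      rw [sub_apply, hh, zero_sub, norm_neg] at h1
      have h2 := hcN h
      have : ‖h‖ ≤ 0 := by nlinarith [norm_nonneg h]
      exact norm_le_zero_iff.1 this
  · intro r hr
    set s : ℝ := min (ρ / 2) (r / 2)
    have hs0 : 0 < s := by positivity
    have hsρ : s < ρ := lt_of_le_of_lt (min_le_left _ _) (by linarith)
    have hsr : s < r := lt_of_le_of_lt (min_le_right _ _) (by linarith)
    set K : ℝ := ‖f'‖ + c / 4
    have hK : 0 < K := by positivity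
    refine ⟨min ρ (c / 2 * s / K), by positivity, fun σ hσ hS h0 b hb => ?_⟩
    have hb1 : ‖b - b₀‖ < ρ := hb.trans_le (min_le_left _ _)
    have hb2 : K * ‖b - b₀‖ ≤ c / 2 * s := by
      have := (hb.trans_le (min_le_right _ _)).le
      rw [le_div_iff₀ hK] at this; linarith
    have hk := key σ hσ hS b hb1
    have hsmall : ‖f (x₀, b) σ‖ ≤ c / 2 * s := by
      have h1 := hs _ (hmem x₀ (Metric.mem_ball_self hρ) b hb1) _ (Metric.mem_ball_self hρ)
      have e1 : (x₀, b) - (x₀, b₀) = ((0 : X), b - b₀) := by simp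
      have e2 : ‖((0, b - b₀) : X × H)‖ = ‖b - b₀‖ := by simp [Prod.norm_def]
      rw [e1, e2] at h1
      have h2 := f'.le_opNorm ((0 : X), b - b₀)
      rw [e2] at h2
      have h3 : ‖f (x₀, b) - f (x₀, b₀)‖ ≤ K * ‖b - b₀‖ := by
        have : f (x₀, b) - f (x₀, b₀) = (f (x₀, b) - f (x₀, b₀) - f' (0, b - b₀)) +
          f' (0, b - b₀) := by abel
        rw [this]
        refine (norm_add_le _ _).trans ?_
        simp only [K]; linarith
      have h4 := (f (x₀, b) - f (x₀, b₀)).le_opNorm σ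
      rw [sub_apply, h0, sub_zero] at h4
      calc _ ≤ _ := h4
        _ ≤ (K * ‖b - b₀‖) * 1 := by gcongr
        _ ≤ _ := by linarith
    by_cases hX : Subsingleton X
    · have : Subsingleton Y := Ne.symm.injective.subsingleton
      exact ⟨x₀, Metric.mem_ball_self hr, Subsingleton.elim _ _⟩
    have : Nontrivial X := not_subsingleton_iff_nontrivial.1 hX
    have : Nontrivial Y := Ne.injective.nontrivial
    have happ : ApproximatesLinearOn (fun x => f (x, b) σ) (Ne : X →L[ℝ] Y)
        (Metric.closedBall x₀ s) (c / 2).toNNReal := by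
      intro x hx y hy
      rw [Real.coe_toNNReal _ (by positivity)]
      exact hk x (Metric.closedBall_subset_ball hsρ hx) y (Metric.closedBall_subset_ball hsρ hy)
    have hsurj := happ.surjOn_closedBall_of_nonlinearRightInverse Ne.toNonlinearRightInverse
      hs0.le subset_rfl
    have hsymm : ‖(Ne.symm : Y →L[ℝ] X)‖ ≤ c⁻¹ := by
      refine ContinuousLinearMap.opNorm_le_bound _ (by positivity) fun y => ?_
      have := hcN (Ne.symm y)
      rw [← hNe, Ne.apply_symm_apply] at this
      rw [inv_mul_eq_div, le_div_iff₀ hc, mul_comm]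
      exact this
    obtain ⟨x, hx, hx0⟩ := hsurj (show (0 : Y) ∈ _ from by
      rw [Metric.mem_closedBall, dist_zero_left]
      refine hsmall.trans ?_
      gcongr
      rw [Real.coe_toNNReal _ (by positivity)]
      have hp : 0 < ‖(Ne.symm : Y →L[ℝ] X)‖ := Ne.symm.norm_pos
      have : c ≤ ‖(Ne.symm : Y →L[ℝ] X)‖⁻¹ := by
        rw [le_inv_comm₀ hc hp]; exact hsymm
      change c / 2 ≤ ‖(Ne.symm : Y →L[ℝ] X)‖⁻¹ - c / 2
      linarith)
    exact ⟨x, Metric.closedBall_subset_ball hsr hx, hx0⟩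

/-! ### Decay of the interaction -/

lemma FT_modul (s : E3) (f : L2) : FT (modul ((2 * Real.pi) • s) f) = trans (-s) (FT f) := by
  apply Lp.ext
  refine (ae_eq_of_integral_test (l2_locallyIntegrable _) (l2_locallyIntegrable _)
    fun k hk => ?_)
  rw [← toTD_apply, toTD_FT, toTD_apply]
  have hc : HasCompactSupport (fun x => k (x + s)) :=
    hk.comp_homeomorph (Homeomorph.addRight s)
  have hs : ContDiff ℝ ∞ (fun x => k (x + s)) := (k.smooth _).comp (contDiff_id.add contDiff_const)
  set k' : 𝓢(E3, ℂ) := hc.toSchwartzMap hs with hk'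
  have hk'a : ∀ x, k' x = k (x + s) := fun x => rfl
  have hF : ∀ x, (𝓕 k' : 𝓢(E3, ℂ)) x =
      Complex.exp (Complex.I * ((inner ℝ ((2 * Real.pi) • s) x : ℝ) : ℂ)) *
        (𝓕 k : 𝓢(E3, ℂ)) x := by
    intro x
    rw [SchwartzMap.fourier_coe, SchwartzMap.fourier_coe, Real.fourier_eq', Real.fourier_eq',
      ← integral_const_mul, ← integral_add_right_eq_self
        (fun y => Complex.exp (Complex.I * ((inner ℝ ((2 * Real.pi) • s) x : ℝ) : ℂ)) *
          Complex.exp (((-2 * Real.pi * inner ℝ y x : ℝ) : ℂ) * Complex.I) • k y) s]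
    refine integral_congr_ae (.of_forall fun y => ?_)
    simp only [hk'a, smul_eq_mul]
    rw [← mul_assoc, ← Complex.exp_add]
    congr 2
    rw [inner_add_left, inner_smul_left]
    simp only [conj_trivial]
    push_cast
    ring
  have h1 : ∫ x, (𝓕 k : 𝓢(E3, ℂ)) x * (modul ((2 * Real.pi) • s) f) x = toTD f (𝓕 k') := by
    rw [toTD_apply]
    refine integral_congr_ae ?_
    filter_upwards [modul_coe ((2 * Real.pi) • s) f] with x hx
    rw [hx, hF]; ring
  rw [h1, ← toTD_FT, toTD_apply]
  rw [← integral_add_right_eq_self (fun x => k x * trans (-s) (FT f) x) s]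
  refine integral_congr_ae ?_
  filter_upwards [ae_comp_add s (trans_coe (-s) (FT f))] with x hx
  rw [hx, hk'a, add_neg_cancel_right]

lemma trans_modul (w a : E3) (f : L2) : trans w (modul a f) =
    Complex.exp (Complex.I * ((inner ℝ a w : ℝ) : ℂ)) • modul a (trans w f) := by
  apply Lp.ext
  filter_upwards [trans_coe w (modul a f), ae_comp_add w (modul_coe a f),
    Lp.coeFn_smul (Complex.exp (Complex.I * ((inner ℝ a w : ℝ) : ℂ))) (modul a (trans w f)),
    modul_coe a (trans w f), trans_coe w f] with x h1 h2 h3 h4 h5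
  rw [h1, h2, h3, Pi.smul_apply, h4, h5, inner_add_right, smul_eq_mul, ← mul_assoc,
    ← Complex.exp_add]
  congr 2
  push_cast; ring

lemma exists_trans_small (f g : L2) {η : ℝ} (hη : 0 < η) :
    ∃ ρ : ℝ, ∀ v z : E3, ρ ≤ ‖z‖ → ‖inner ℂ f (modul v (trans z g))‖ ≤ η := by
  have h : Tendsto (fun n => ‖f - trunc n f‖ * ‖g‖ + ‖trunc n f‖ * ‖g - trunc n g‖) atTop
      (𝓝 (‖f - f‖ * ‖g‖ + ‖f‖ * ‖g - g‖)) :=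
    (((tendsto_const_nhds.sub (trunc_tendsto f)).norm).mul_const _).add
      ((trunc_tendsto f).norm.mul (tendsto_const_nhds.sub (trunc_tendsto g)).norm)
  obtain ⟨n, hn⟩ := (h.eventually_lt_const (u := η) (by simpa using hη)).exists
  refine ⟨2 * n, fun v z hz => ?_⟩
  have h0 : inner ℂ (trunc n f) (modul v (trans z (trunc n g))) = 0 := by
    rw [l2_inner_eq]
    refine integral_eq_zero_of_ae ?_
    filter_upwards [trunc_coe n f, modul_coe v (trans z (trunc n g)), trans_coe z (trunc n g),
      ae_comp_add z (trunc_coe n g)] with x h1 h2 h3 h4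
    rw [h2, h3, h4, h1]
    by_cases hx : x ∈ Metric.ball (0 : E3) n
    · have : x + z ∉ Metric.ball (0 : E3) n := by
        rw [mem_ball_zero_iff] at hx ⊢
        have := norm_sub_le (x + z) x
        rw [add_sub_cancel_left] at this
        linarith
      simp [this]
    · simp [hx]
  have e : inner ℂ f (modul v (trans z g)) = inner ℂ (f - trunc n f) (modul v (trans z g)) +
      inner ℂ (trunc n f) (modul v (trans z (g - trunc n g))) := by
    rw [inner_sub_left, map_sub, map_sub, inner_sub_right, h0]; ring
  rw [e]
  refine (norm_add_le _ _).trans ((add_le_add (norm_inner_le_norm _ _)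
    (norm_inner_le_norm _ _)).trans ?_)
  simp only [norm_modul, LinearIsometry.norm_map]
  exact hn.le

lemma exists_modul_small (f g : L2) {η : ℝ} (hη : 0 < η) :
    ∃ ρ : ℝ, ∀ v z : E3, ρ ≤ ‖v‖ → ‖inner ℂ f (modul v (trans z g))‖ ≤ η := by
  obtain ⟨ρ, h⟩ := exists_trans_small (FT f) (FT g) hη
  refine ⟨2 * Real.pi * ρ, fun v z hv => ?_⟩
  have hpi := Real.two_pi_pos
  have e1 : v = (2 * Real.pi) • ((2 * Real.pi)⁻¹ • v) := by
    rw [smul_smul, mul_inv_cancel₀ hpi.ne', one_smul]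
  have h2 := h ((2 * Real.pi) • z) (-((2 * Real.pi)⁻¹ • v)) (by
    rw [norm_neg, norm_smul, Real.norm_of_nonneg (by positivity), ← div_eq_inv_mul,
      le_div_iff₀ hpi]
    linarith)
  rw [← FT.inner_map_map, e1, FT_modul, FT_trans, trans_modul, inner_smul_right, norm_mul,
    norm_exp_phase, one_mul]
  exact h2

lemma exists_phase_small (f g : L2) {η : ℝ} (hη : 0 < η) :
    ∃ ρ : ℝ, ∀ v z : E3, ρ ≤ ‖v‖ ∨ ρ ≤ ‖z‖ → ‖inner ℂ f (modul v (trans z g))‖ ≤ η := by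
  obtain ⟨ρ, h⟩ := exists_trans_small f g hη
  obtain ⟨ρ', h'⟩ := exists_modul_small f g hη
  refine ⟨max ρ ρ', fun v z hvz => ?_⟩
  rcases hvz with hv | hz
  · exact h' v z ((le_max_right _ _).trans hv)
  · exact h v z ((le_max_left _ _).trans hz)

lemma interaction_ge {ε₁ : ℝ} {v y₀ e : E3} {s ρ : ℝ} (hv : 0 < ‖v‖) (hρ : ‖v‖ ≤ ρ) (he : ‖e‖ = 1)
    (ha : InnerProductGeometry.angle e (‖v‖⁻¹ • v) ≤ ε₁) (hs : 0 ≤ s)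
    (h : ‖(‖v‖ * s) • e + y₀‖ ≤ ρ + 1) :
    ENNReal.ofReal ((ρ * (1 + (ρ + 2) ^ 2))⁻¹) ≤ interaction ε₁ v y₀ := by
  have hρ0 : 0 < ρ := hv.trans_le hρ
  have h1 : ENNReal.ofReal ((ρ * (1 + (ρ + 2) ^ 2))⁻¹) ≤
      ∫⁻ t in Ioi (0 : ℝ), ENNReal.ofReal ((1 + ‖(‖v‖ * t) • e + y₀‖ ^ 2)⁻¹) := by
    have hsub : Ioc s (s + ‖v‖⁻¹) ⊆ Ioi 0 := fun t ht => lt_of_le_of_lt hs ht.1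
    calc _ ≤ ENNReal.ofReal ((1 + (ρ + 2) ^ 2)⁻¹) * volume (Ioc s (s + ‖v‖⁻¹)) := by
          rw [Real.volume_Ioc, add_sub_cancel_left, ← ENNReal.ofReal_mul (by positivity),
            mul_inv, mul_comm]
          refine ENNReal.ofReal_le_ofReal ?_
          gcongr
      _ = ∫⁻ t in Ioc s (s + ‖v‖⁻¹), ENNReal.ofReal ((1 + (ρ + 2) ^ 2)⁻¹) := by
          rw [setLIntegral_const]
      _ ≤ ∫⁻ t in Ioc s (s + ‖v‖⁻¹), ENNReal.ofReal ((1 + ‖(‖v‖ * t) • e + y₀‖ ^ 2)⁻¹) := by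
          refine setLIntegral_mono' measurableSet_Ioc fun t ht => ENNReal.ofReal_le_ofReal ?_
          have h2 : ‖(‖v‖ * t) • e + y₀‖ ≤ ρ + 2 := by
            have e1 : (‖v‖ * t) • e + y₀ = ((‖v‖ * s) • e + y₀) + (‖v‖ * (t - s)) • e := by
              rw [mul_sub, sub_smul]; abel
            rw [e1]
            refine (norm_add_le _ _).trans ?_
            rw [norm_smul, he, mul_one, Real.norm_of_nonneg
              (mul_nonneg hv.le (sub_nonneg.2 ht.1.le))]
            have : ‖v‖ * (t - s) ≤ 1 := by
              have := ht.2
              calc ‖v‖ * (t - s) ≤ ‖v‖ * ‖v‖⁻¹ := by gcongr; linarith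
                _ = 1 := mul_inv_cancel₀ hv.ne'
            linarith
          gcongr
      _ ≤ _ := lintegral_mono_set hsub
  refine h1.trans ?_
  exact le_iSup₂ (f := fun (e : E3) (_ : e ∈ {e : E3 | ‖e‖ = 1 ∧
    InnerProductGeometry.angle e (‖v‖⁻¹ • v) ≤ ε₁}) =>
    ∫⁻ t in Ioi (0 : ℝ), ENNReal.ofReal ((1 + ‖(‖v‖ * t) • e + y₀‖ ^ 2)⁻¹)) e ⟨he, ha⟩

lemma exists_angle_small {ε₁ : ℝ} (hε : 0 < ε₁) : ∃ κ > 0, κ < 1 ∧ ∀ a d : E3, a ≠ 0 →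
    ‖d‖ ≤ κ * ‖a‖ → InnerProductGeometry.angle (a + d) a ≤ ε₁ := by
  have hc : ContinuousAt (fun κ : ℝ => Real.arccos ((1 - κ) / (1 + κ))) 0 :=
    Real.continuous_arccos.continuousAt.comp (by
      exact ContinuousAt.div (by fun_prop) (by fun_prop) (by simp))
  have h0 := hc.tendsto
  simp only [sub_zero, add_zero, div_one, Real.arccos_one] at h0
  have h1 := h0.eventually_lt_const hε
  rw [Metric.eventually_nhds_iff_ball] at h1
  obtain ⟨r, hr, h1⟩ := h1
  set κ := min (r / 2) (1 / 2) with hκd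
  have hκ : 0 < κ := by positivity
  have hκ1 : κ < 1 := lt_of_le_of_lt (min_le_right _ _) (by norm_num)
  have h2 := h1 κ (by
    rw [mem_ball_zero_iff, Real.norm_of_nonneg hκ.le]
    exact lt_of_le_of_lt (min_le_left _ _) (by linarith))
  refine ⟨κ, hκ, hκ1, fun a d ha hd => ?_⟩
  refine le_trans (Real.arccos_le_arccos ?_) h2.le
  have hna : 0 < ‖a‖ := norm_pos_iff.2 ha
  have hpos : 0 < ‖a + d‖ := by
    have := norm_sub_le (a + d) d
    rw [add_sub_cancel_right] at this
    nlinarith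
  rw [div_le_div_iff₀ (by linarith) (by positivity), inner_add_left, real_inner_self_eq_norm_sq]
  have i1 : -(κ * ‖a‖ * ‖a‖) ≤ inner ℝ d a := by
    have := (abs_le.1 (abs_real_inner_le_norm d a)).1
    have : ‖d‖ * ‖a‖ ≤ κ * ‖a‖ * ‖a‖ := by gcongr
    linarith
  have i2 : ‖a + d‖ ≤ (1 + κ) * ‖a‖ := (norm_add_le _ _).trans (by linarith)
  have i3 : 0 ≤ ‖a‖ ^ 2 + inner ℝ d a - (1 - κ) * ‖a‖ ^ 2 := by nlinarith
  have i4 : (1 - κ) * (‖a + d‖ * ‖a‖) ≤ (1 - κ) * ((1 + κ) * ‖a‖ * ‖a‖) := by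
    have : 0 ≤ 1 - κ := by linarith
    gcongr
  nlinarith

lemma exists_separation {ε₁ M₀ : ℝ} (hε₁ : 0 < ε₁) (hM : 0 < M₀) (ρ : ℝ) :
    ∃ ε > 0, ∀ v y₀ : E3, M₀ < ‖v‖ → interaction ε₁ v y₀ < ENNReal.ofReal ε →
      ∀ (t : ℝ) (d : E3), 0 ≤ t → ‖d‖ < ε * japanese t → ρ ≤ ‖v‖ ∨ ρ ≤ ‖t • v + y₀ + d‖ := by
  obtain ⟨κ, hκ, hκ1, hang⟩ := exists_angle_small hε₁
  set ρ' := max ρ 1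
  have hρ' : 0 < ρ' := by positivity
  set ε := min ((ρ' * (1 + (ρ' + 2) ^ 2))⁻¹) (min (1 / 2) (κ * M₀ / 2))
  have hε : 0 < ε := by positivity
  refine ⟨ε, hε, fun v y₀ hv hint t d ht hd => ?_⟩
  by_contra! hcon
  have hv0 : 0 < ‖v‖ := hM.trans hv
  have hvρ : ‖v‖ ≤ ρ' := hcon.1.le.trans (le_max_left _ _)
  have hz : ‖t • v + y₀ + d‖ ≤ ρ' := hcon.2.le.trans (le_max_left _ _)
  have hlt : interaction ε₁ v y₀ < ENNReal.ofReal ((ρ' * (1 + (ρ' + 2) ^ 2))⁻¹) :=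
    hint.trans_le (ENNReal.ofReal_le_ofReal (min_le_left _ _))
  have e1 : ε ≤ 1 / 2 := (min_le_right _ _).trans (min_le_left _ _)
  have e2 : ε ≤ κ * M₀ / 2 := (min_le_right _ _).trans (min_le_right _ _)
  have hj : japanese t ≤ 1 + t := by
    rw [japanese, Real.sqrt_le_left (by linarith)]; nlinarith
  have hd' : ‖d‖ ≤ ε * (1 + t) := hd.le.trans (by gcongr)
  refine absurd hlt (not_lt.2 ?_)
  rcases le_total 1 t with h1 | h1
  · have ha : t • v ≠ 0 := smul_ne_zero (by linarith) (norm_pos_iff.1 hv0)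
    have hdk : ‖d‖ ≤ κ * ‖t • v‖ := by
      rw [norm_smul, Real.norm_of_nonneg ht]
      calc ‖d‖ ≤ ε * (1 + t) := hd'
        _ ≤ (κ * M₀ / 2) * (2 * t) := by gcongr; linarith
        _ = κ * (t * M₀) := by ring
        _ ≤ κ * (t * ‖v‖) := by gcongr
    have hb : 0 < ‖t • v + d‖ := by
      have := norm_sub_le (t • v + d) d
      rw [add_sub_cancel_right] at this
      have := norm_pos_iff.2 ha
      nlinarith
    refine interaction_ge (e := ‖t • v + d‖⁻¹ • (t • v + d)) (s := ‖t • v + d‖ / ‖v‖) hv0 hvρ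
      ?_ ?_ (by positivity) ?_
    · rw [norm_smul, norm_inv, norm_norm, inv_mul_cancel₀ hb.ne']
    · rw [InnerProductGeometry.angle_smul_left_of_pos _ _ (by positivity),
        InnerProductGeometry.angle_smul_right_of_pos _ _ (by positivity)]
      have := hang _ _ ha hdk
      rwa [InnerProductGeometry.angle_smul_right_of_pos _ _ (by linarith)] at this
    · rw [mul_div_cancel₀ _ hv0.ne', smul_smul, mul_inv_cancel₀ hb.ne', one_smul]
      have : t • v + d + y₀ = t • v + y₀ + d := by abel
      rw [this]; linarith
  · refine interaction_ge (e := ‖v‖⁻¹ • v) (s := t) hv0 hvρ ?_ ?_ ht ?_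
    · rw [norm_smul, norm_inv, norm_norm, inv_mul_cancel₀ hv0.ne']
    · rw [InnerProductGeometry.angle_self]
      · exact hε₁.le
      · exact smul_ne_zero (by positivity) (norm_pos_iff.1 hv0)
    · have : (‖v‖ * t) • ‖v‖⁻¹ • v + y₀ = (t • v + y₀ + d) - d := by
        rw [smul_smul, mul_right_comm, mul_inv_cancel₀ hv0.ne', one_mul]; abel
      rw [this]
      refine (norm_sub_le _ _).trans ?_
      have : ‖d‖ ≤ 1 := by nlinarith
      linarith

/-! ### The symmetry groups on `L²` -/

/-- The real inner product `Re ⟨f, g⟩` of `L²`. -/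
def rin : L2 →L[ℝ] L2 →L[ℝ] ℝ :=
  LinearMap.mkContinuous₂ (LinearMap.mk₂ ℝ (fun f g : L2 => (inner ℂ f g).re)
    (fun f f' g => by rw [inner_add_left, Complex.add_re])
    (fun c f g => by
      rw [show c • f = (c : ℂ) • f from (Complex.coe_smul c f).symm, inner_smul_left,
        Complex.conj_ofReal, Complex.re_ofReal_mul, smul_eq_mul])
    (fun f g g' => by rw [inner_add_right, Complex.add_re])
    (fun c f g => by
      rw [show c • g = (c : ℂ) • g from (Complex.coe_smul c g).symm, inner_smul_right,
        Complex.re_ofReal_mul, smul_eq_mul])) 1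
    (fun f g => by
      rw [one_mul]
      exact (Complex.abs_re_le_norm _).trans (norm_inner_le_norm f g))

lemma rin_apply (f g : L2) : rin f g = (inner ℂ f g).re := rfl

lemma rin_comm (f g : L2) : rin f g = rin g f := by
  rw [rin_apply, rin_apply, ← inner_conj_symm, Complex.conj_re]

lemma rin_self (f : L2) : rin f f = ‖f‖ ^ 2 := by
  rw [rin_apply, inner_self_eq_norm_sq_to_K]
  norm_cast

lemma abs_rin_le (f g : L2) : |rin f g| ≤ ‖inner ℂ f g‖ := Complex.abs_re_le_norm _

lemma pair_eq {F G : E3 → ℂ} {f g : L2} (hF : F =ᵐ[volume] f) (hG : G =ᵐ[volume] g) :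
    pair F G = rin g f := by
  rw [pair, rin_apply, l2_inner_eq]
  congr 1
  refine integral_congr_ae ?_
  filter_upwards [hF, hG] with x h1 h2
  rw [h1, h2]

lemma toL2_eq {F : E3 → ℂ} {f : L2} (hF : F =ᵐ[volume] f) : toL2 F = f := by
  have h : MemLp F 2 (volume : Measure E3) := (memLp_congr_ae hF).2 (Lp.memLp f)
  rw [toL2, dif_pos h]
  exact Lp.ext (h.coeFn_toLp.trans hF)

/-- `e^{Jτ·◇}` on `L²`. -/
def actL (D : E3) (ζ : Circle) : L2 →L[ℂ] L2 := (ζ : ℂ) • (trans (-D)).toContinuousLinearMap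

lemma actL_apply (D : E3) (ζ : Circle) (f : L2) : actL D ζ f = (ζ : ℂ) • trans (-D) f := rfl

lemma act_ae {F : E3 → ℂ} {f : L2} (h : F =ᵐ[volume] f) (D : E3) (ζ : Circle) :
    act D ζ F =ᵐ[volume] actL D ζ f := by
  filter_upwards [ae_comp_add (-D) h, trans_coe (-D) f, Lp.coeFn_smul (ζ : ℂ) (trans (-D) f)]
    with x h1 h2 h3
  rw [actL_apply, h3, Pi.smul_apply, h2, ← h1, act, smul_eq_mul, sub_eq_add_neg]

lemma actL_add (D D' : E3) (ζ ζ' : Circle) (f : L2) :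
    actL (D + D') (ζ * ζ') f = actL D ζ (actL D' ζ' f) := by
  rw [actL_apply, actL_apply, actL_apply, map_smul, smul_smul, ← trans_add, neg_add,
    Circle.coe_mul]

lemma actL_zero_one (f : L2) : actL 0 1 f = f := by
  rw [actL_apply, neg_zero, trans_zero, Circle.coe_one, one_smul]

lemma norm_actL (D : E3) (ζ : Circle) (f : L2) : ‖actL D ζ f‖ = ‖f‖ := by
  rw [actL_apply, norm_smul, Circle.norm_coe, one_mul, LinearIsometry.norm_map]

lemma inner_trans_trans (s : E3) (f g : L2) : inner ℂ (trans s f) (trans s g) = inner ℂ f g :=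
  (trans s).inner_map_map f g

lemma rin_actL (D : E3) (ζ : Circle) (f g : L2) : rin (actL D ζ f) (actL D ζ g) = rin f g := by
  rw [rin_apply, rin_apply, actL_apply, actL_apply, inner_smul_left, inner_smul_right,
    inner_trans_trans, ← mul_assoc, ← Complex.normSq_eq_conj_mul_self, Circle.normSq_coe]
  simp

lemma actL_inv_left (D : E3) (ζ : Circle) (f : L2) : actL (-D) ζ⁻¹ (actL D ζ f) = f := by
  rw [← actL_add, neg_add_cancel, inv_mul_cancel, actL_zero_one]

lemma actL_inv_right (D : E3) (ζ : Circle) (f : L2) : actL D ζ (actL (-D) ζ⁻¹ f) = f := by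
  rw [← actL_add, add_neg_cancel, mul_inv_cancel, actL_zero_one]

/-- The Galilei transformation on `L²`. -/
def galL (v y₀ : E3) (t : ℝ) : L2 →L[ℂ] L2 :=
  Complex.exp (Complex.I * ((-(t / 4 * ‖v‖ ^ 2) : ℝ) : ℂ)) •
    (modul (-(1 / 2 : ℝ) • v) ∘L (trans (t • v + y₀)).toContinuousLinearMap)

lemma galL_apply (v y₀ : E3) (t : ℝ) (f : L2) : galL v y₀ t f =
    Complex.exp (Complex.I * ((-(t / 4 * ‖v‖ ^ 2) : ℝ) : ℂ)) •
      modul (-(1 / 2 : ℝ) • v) (trans (t • v + y₀) f) := rfl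

lemma galilei_ae {F : E3 → ℂ} {f : L2} (h : F =ᵐ[volume] f) (v y₀ : E3) (t : ℝ) :
    galilei v y₀ t F =ᵐ[volume] galL v y₀ t f := by
  filter_upwards [ae_comp_add (t • v + y₀) h, trans_coe (t • v + y₀) f,
    modul_coe (-(1 / 2 : ℝ) • v) (trans (t • v + y₀) f),
    Lp.coeFn_smul (Complex.exp (Complex.I * ((-(t / 4 * ‖v‖ ^ 2) : ℝ) : ℂ)))
      (modul (-(1 / 2 : ℝ) • v) (trans (t • v + y₀) f))] with x h1 h2 h3 h4
  rw [galL_apply, h4, Pi.smul_apply, h3, h2, ← h1, galilei, smul_eq_mul, ← mul_assoc,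
    ← Complex.exp_add, inner_smul_left, add_assoc]
  congr 2
  simp only [conj_trivial]
  push_cast
  ring

lemma inner_modul_modul (s : E3) (f g : L2) : inner ℂ (modul s f) (modul s g) = inner ℂ f g := by
  rw [l2_inner_eq, l2_inner_eq]
  refine integral_congr_ae ?_
  filter_upwards [modul_coe s f, modul_coe s g] with x h1 h2
  rw [h1, h2, map_mul, mul_mul_mul_comm, Complex.mul_conj, Complex.normSq_eq_norm_sq,
    norm_exp_phase]
  simp

lemma rin_galL (v y₀ : E3) (t : ℝ) (f g : L2) : rin (galL v y₀ t f) (galL v y₀ t g) = rin f g := by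
  rw [rin_apply, rin_apply, galL_apply, galL_apply, inner_smul_left, inner_smul_right,
    inner_modul_modul, inner_trans_trans, ← mul_assoc, ← Complex.normSq_eq_conj_mul_self,
    Complex.normSq_eq_norm_sq, norm_exp_phase]
  simp

/-! ### The ground states as a smooth family -/

/-- `φ_ω` as an element of `L²`. -/
def gsL2 (φ : ℝ → E3 → ℝ) (s : ℝ) : L2 := toL2 fun x => (φ s x : ℂ)

section
variable {β : ℝ → ℝ} {O : Set ℝ} {φ : ℝ → E3 → ℝ}

lemma sigL2_eq {n : ℕ} {Ψ : ℝ → Sig n}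
    (hΨ : ∀ s ∈ O, ∀ᵐ x, sigFn (Ψ s) x = (φ s x : ℂ)) {s : ℝ} (hs : s ∈ O) :
    sigL2 (Ψ s) = gsL2 φ s := by
  refine (toL2_eq ?_).symm
  filter_upwards [hΨ s hs] with x hx
  rw [sigL2_coe, hx]

lemma GroundStates.smoothFam (h : GroundStates β O φ) : SmoothFam O (gsL2 φ) := by
  intro n
  obtain ⟨Ψ, h1, h2⟩ := h.smooth n
  exact ⟨Ψ, h1, fun s hs => sigL2_eq h2 hs⟩

lemma GroundStates.coe (h : GroundStates β O φ) {s : ℝ} (hs : s ∈ O) :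
    (fun x => (φ s x : ℂ)) =ᵐ[volume] gsL2 φ s := by
  obtain ⟨Ψ, -, h2⟩ := h.smooth 0
  rw [← sigL2_eq h2 hs]
  filter_upwards [h2 s hs] with x hx
  rw [sigL2_coe, hx]

lemma GroundStates.norm_sq (h : GroundStates β O φ) {s : ℝ} (hs : s ∈ O) :
    ‖gsL2 φ s‖ ^ 2 = ∫ x, φ s x ^ 2 := by
  rw [l2_norm_sq]
  refine integral_congr_ae ?_
  filter_upwards [h.coe hs] with x hx
  rw [← hx, Complex.norm_real, Real.norm_eq_abs, sq_abs]

lemma GroundStates.hasDerivAt_mass (h : GroundStates β O φ) {s : ℝ} (hs : s ∈ O) :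
    HasDerivAt (fun s => ‖gsL2 φ s‖ ^ 2) (2 * rin (deriv (gsL2 φ) s) (gsL2 φ s)) s := by
  have hd := h.smoothFam.hasDerivAt h.isOpen hs
  have h1 := (rin.hasFDerivAt.comp_hasDerivAt s hd).clm_apply hd
  have e : (fun s => ‖gsL2 φ s‖ ^ 2) = fun s => rin (gsL2 φ s) (gsL2 φ s) := by
    ext s; rw [rin_self]
  rw [e]
  convert! h1 using 1
  simp only [Function.comp_apply]
  rw [rin_comm (gsL2 φ s)]; ring

lemma GroundStates.rin_deriv_pos (h : GroundStates β O φ) {s : ℝ} (hs : s ∈ O) :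
    0 < rin (deriv (gsL2 φ) s) (gsL2 φ s) := by
  have h1 := h.mass_deriv_pos s hs
  have h2 : HasDerivAt (fun s => ∫ x, φ s x ^ 2) (2 * rin (deriv (gsL2 φ) s) (gsL2 φ s)) s := by
    refine (h.hasDerivAt_mass hs).congr_of_eventuallyEq ?_
    filter_upwards [h.isOpen.mem_nhds hs] with r hr
    exact (h.norm_sq hr).symm
  rw [h2.deriv] at h1
  linarith

lemma GroundStates.mass_strictMonoOn (h : GroundStates β O φ) :
    StrictMonoOn (fun s => ‖gsL2 φ s‖ ^ 2) O := by
  refine strictMonoOn_of_deriv_pos h.interval.convex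
    (fun s hs => (h.hasDerivAt_mass hs).continuousAt.continuousWithinAt) fun s hs => ?_
  rw [(h.hasDerivAt_mass (interior_subset hs)).deriv]
  linarith [h.rin_deriv_pos (interior_subset hs)]

lemma GroundStates.mass_pos (h : GroundStates β O φ) {s : ℝ} (hs : s ∈ O) :
    0 < ‖gsL2 φ s‖ ^ 2 := by
  have h1 := h.rin_deriv_pos hs
  have : gsL2 φ s ≠ 0 := fun h0 => by rw [h0, map_zero] at h1; exact lt_irrefl _ h1
  positivity

/-- The weak derivatives of `φ_ω` are the classical ones. -/
lemma GroundStates.wd_ae (h : GroundStates β O φ) {s : ℝ} (hs : s ∈ O) {a : Fin 3} {k : L2}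
    (hk : WD a (gsL2 φ s) k) :
    (fun x => ((fderiv ℝ (φ s) x (stdVec a) : ℝ) : ℂ)) =ᵐ[volume] k := by
  have hc := h.contDiff s hs
  have hcd : Continuous fun x => fderiv ℝ (φ s) x (stdVec a) :=
    (hc.continuous_fderiv (by simp)).clm_apply continuous_const
  have hcd' : Continuous fun x => ((fderiv ℝ (φ s) x (stdVec a) : ℝ) : ℂ) :=
    Complex.continuous_ofReal.comp hcd
  refine ae_eq_of_integral_test hcd'.locallyIntegrable (l2_locallyIntegrable k) fun j hj => ?_
  rw [← toTD_apply, hk, TemperedDistribution.lineDerivOp_apply_apply, toTD_apply]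
  have hφd : ∀ x, HasFDerivAt (fun x => (φ s x : ℂ))
      (Complex.ofRealCLM ∘L fderiv ℝ (φ s) x) x := fun x =>
    Complex.ofRealCLM.hasFDerivAt.comp x ((hc.differentiable (by simp) x).hasFDerivAt)
  have hφc : Continuous fun x => (φ s x : ℂ) := Complex.continuous_ofReal.comp hc.continuous
  have hjd : Continuous fun x => fderiv ℝ j x (stdVec a) :=
    ((j.smooth 1).continuous_fderiv (by simp)).clm_apply continuous_const
  have hjs : HasCompactSupport fun x => fderiv ℝ j x (stdVec a) := hj.fderiv_apply ℝ _
  have key := integral_mul_fderiv_eq_neg_fderiv_mul_of_integrable (𝕜 := ℂ) (μ := volume)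
    (f := fun x => j x) (g := fun x => (φ s x : ℂ)) (v := stdVec a)
    ((hjd.mul hφc).integrable_of_hasCompactSupport hjs.mul_right) (by
      have : (fun x => j x * fderiv ℝ (fun x => (φ s x : ℂ)) x (stdVec a)) =
        fun x => j x * ((fderiv ℝ (φ s) x (stdVec a) : ℝ) : ℂ) := by
          ext x; rw [(hφd x).fderiv]; rfl
      rw [this]
      exact (j.continuous.mul hcd').integrable_of_hasCompactSupport hj.mul_right)
    ((j.continuous.mul hφc).integrable_of_hasCompactSupport hj.mul_right)
    (fun x _ => j.differentiableAt) (fun x _ => (hφd x).differentiableAt)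
  have e1 : ∀ x, fderiv ℝ (fun x => (φ s x : ℂ)) x (stdVec a) =
      ((fderiv ℝ (φ s) x (stdVec a) : ℝ) : ℂ) := fun x => by rw [(hφd x).fderiv]; rfl
  simp only [e1] at key
  rw [key, ← integral_neg]
  refine integral_congr_ae ?_
  filter_upwards [h.coe hs] with x hx
  rw [← hx, neg_apply, SchwartzMap.lineDerivOp_apply_eq_fderiv]
  ring

/-- The families `x_a φ_ω`, `i ∂_ω φ_ω`, `i ∂_a φ_ω`, `φ_ω` which span the generators of the
modulation, with index `(a, false)`, `(none, false)`, `(a, true)`, `(none, true)`. -/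
structure IsLabels (O : Set ℝ) (f : ℝ → L2) (lab : Option (Fin 3) × Bool → ℝ → L2) : Prop where
  diffFam : ∀ k, DiffFam O (lab k)
  mulX : ∀ a, ∀ s ∈ O, IsMulX a (f s) (lab (some a, false) s)
  deriv : ∀ s ∈ O, lab (none, false) s = Complex.I • _root_.deriv f s
  grad : ∀ a, ∀ s ∈ O, WD a (f s) (-Complex.I • lab (some a, true) s)
  id : ∀ s, lab (none, true) s = f s

lemma DiffFam.const_smul {g : ℝ → L2} (hg : DiffFam O g) (c : ℂ) : DiffFam O fun s => c • g s := by
  obtain ⟨f, hf, A, hA, h⟩ := hg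
  exact ⟨f, hf, c • A, Submodule.smul_mem _ c hA, fun s hs => by
    rw [map_smul, h s hs]; rfl⟩

lemma SmoothFam.exists_labels {f : ℝ → L2} (hO : IsOpen O) (hf : SmoothFam O f) :
    ∃ lab, IsLabels O f lab := by
  have hd := hf.diffFam
  choose m hm hm' using fun a => hd.mul (coord_temperate a)
  choose k hk hk' using fun a => hd.wd a
  refine ⟨fun j => match j with
    | (some a, false) => m a
    | (none, false) => fun s => Complex.I • _root_.deriv f s
    | (some a, true) => fun s => Complex.I • k a s
    | (none, true) => f, ?_, hm', fun _ _ => rfl, fun a s hs => ?_, fun _ => rfl⟩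
  · rintro ⟨_ | a, _ | _⟩
    · exact (hf.deriv hO).diffFam.const_smul _
    · exact hd
    · exact hm a
    · exact (hk a).const_smul _
  · have := hk' a s hs
    simpa [smul_smul] using this

end

/-! ### The parameters `p` -/

section
variable {β : ℝ → ℝ} {O : Set ℝ} {φ : ℝ → E3 → ℝ}

lemma orbit_zero (g : ℝ → L2) (v : E3) (s : ℝ) : orbit g (v, 0, s) = modul v (g s) := by
  rw [orbit, trans_zero]

lemma rin_modul (v : E3) (f g : L2) : rin (modul v f) (modul v g) = rin f g := by
  rw [rin_apply, rin_apply, inner_modul_modul]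

lemma GroundStates.boosted_ae (h : GroundStates β O φ) {s : ℝ} (hs : s ∈ O) (v : E3) :
    boosted φ (s, v) =ᵐ[volume] modul ((1 / 2 : ℝ) • v) (gsL2 φ s) := by
  filter_upwards [modul_coe ((1 / 2 : ℝ) • v) (gsL2 φ s), h.coe hs] with x h1 h2
  rw [h1, ← h2, boosted, inner_smul_left]
  congr 3
  simp only [conj_trivial]
  congr 1
  ring

lemma diamond_last (f : E3 → ℂ) : diamond 3 f = f := by
  rw [diamond, dif_neg (by decide)]

lemma GroundStates.diamond_ae (h : GroundStates β O φ) {lab : Option (Fin 3) × Bool → ℝ → L2}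
    (hl : IsLabels O (gsL2 φ) lab) {s : ℝ} (hs : s ∈ O) (v : E3) (a : Fin 3) :
    diamond a.castSucc (boosted φ (s, v)) =ᵐ[volume]
      modul ((1 / 2 : ℝ) • v) (((v a / 2 : ℝ) : ℂ) • gsL2 φ s - lab (some a, true) s) := by
  have hg := h.wd_ae hs (hl.grad a s hs)
  have hlt : ((a.castSucc : Fin 4) : ℕ) < 3 := by simp
  filter_upwards [modul_coe ((1 / 2 : ℝ) • v) (((v a / 2 : ℝ) : ℂ) • gsL2 φ s -
    lab (some a, true) s), h.coe hs, hg, Lp.coeFn_smul (-Complex.I) (lab (some a, true) s),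
    Lp.coeFn_sub (((v a / 2 : ℝ) : ℂ) • gsL2 φ s) (lab (some a, true) s),
    Lp.coeFn_smul ((v a / 2 : ℝ) : ℂ) (gsL2 φ s)] with x h1 h2 h3 h4 h5 h6
  rw [h1, h5, Pi.sub_apply, h6, Pi.smul_apply, ← h2, diamond, dif_pos hlt]
  rw [h4, Pi.smul_apply] at h3
  have hφd : HasFDerivAt (fun x => (φ s x : ℂ)) (Complex.ofRealCLM ∘L fderiv ℝ (φ s) x) x :=
    Complex.ofRealCLM.hasFDerivAt.comp x
      (((h.contDiff s hs).differentiable (by simp) x).hasFDerivAt)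
  have hin : HasFDerivAt (fun x : E3 => inner ℝ v x / 2) ((2 : ℝ)⁻¹ • innerSL ℝ v) x := by
    have := ((innerSL ℝ v).hasFDerivAt (x := x)).const_mul (2 : ℝ)⁻¹
    refine this.congr_of_eventuallyEq (.of_forall fun y => ?_)
    simp only [innerSL_apply_apply]
    ring
  have hex : HasFDerivAt
      (fun x : E3 => Complex.exp (Complex.I * ((inner ℝ v x / 2 : ℝ) : ℂ))) _ x :=
    ((Complex.ofRealCLM.hasFDerivAt.comp x hin).const_mul Complex.I).cexp
  have hb : HasFDerivAt (boosted φ (s, v)) _ x := hex.mul hφd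
  rw [hb.fderiv]
  have e1 : (⟨((a.castSucc : Fin 4) : ℕ), hlt⟩ : Fin 3) = a := by ext; simp
  have e2 : Complex.exp (Complex.I * ((inner ℝ ((1 / 2 : ℝ) • v) x : ℝ) : ℂ)) =
      Complex.exp (Complex.I * ((inner ℝ v x / 2 : ℝ) : ℂ)) := by
    rw [inner_smul_left]; congr 3; simp only [conj_trivial]; ring
  have e3 : inner ℝ v (stdVec a) = v a := by simp [stdVec, EuclideanSpace.inner_single_right]
  have e4 : lab (some a, true) s x = Complex.I * ((fderiv ℝ (φ s) x (stdVec a) : ℝ) : ℂ) := by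
    rw [h3, smul_eq_mul, ← mul_assoc]; simp
  rw [e1, e2, e4]
  simp only [add_apply, smul_apply, ContinuousLinearMap.comp_apply, innerSL_apply_apply, e3,
    Complex.ofRealCLM_apply, smul_eq_mul, Function.comp_apply]
  push_cast
  ring_nf
  simp only [Complex.I_sq]
  ring

lemma GroundStates.rin_grad (h : GroundStates β O φ) {lab : Option (Fin 3) × Bool → ℝ → L2}
    (hl : IsLabels O (gsL2 φ) lab) {s : ℝ} (hs : s ∈ O) (a : Fin 3) :
    rin (gsL2 φ s) (lab (some a, true) s) = 0 := by
  have hg := h.wd_ae hs (hl.grad a s hs)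
  rw [rin_apply, l2_inner_eq]
  have : ∫ x, lab (some a, true) s x * conj (gsL2 φ s x) =
      Complex.I * ((∫ x, fderiv ℝ (φ s) x (stdVec a) * φ s x : ℝ) : ℂ) := by
    rw [← integral_complex_ofReal, ← integral_const_mul]
    refine integral_congr_ae ?_
    filter_upwards [hg, Lp.coeFn_smul (-Complex.I) (lab (some a, true) s), h.coe hs]
      with x h1 h2 h3
    rw [h2, Pi.smul_apply, smul_eq_mul] at h1
    rw [← h3, Complex.conj_ofReal]
    push_cast
    rw [h1, ← mul_assoc, ← mul_assoc]
    simp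
  rw [this]
  simp

/-- The explicit form of `paramMap`. -/
def paramForm (f : ℝ → L2) (z : ℝ × E3) : E4 :=
  WithLp.toLp 2 (Fin.snoc (α := fun _ => ℝ) (fun a : Fin 3 => z.2 a * ‖f z.1‖ ^ 2 / 4)
    (‖f z.1‖ ^ 2 / 2))

lemma paramForm_castSucc (f : ℝ → L2) (z : ℝ × E3) (a : Fin 3) :
    paramForm f z a.castSucc = z.2 a * ‖f z.1‖ ^ 2 / 4 := by
  simp [paramForm]

lemma paramForm_last (f : ℝ → L2) (z : ℝ × E3) : paramForm f z 3 = ‖f z.1‖ ^ 2 / 2 := by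
  exact Fin.snoc_last (n := 3) (α := fun _ => ℝ) (‖f z.1‖ ^ 2 / 2)
    (fun a : Fin 3 => z.2 a * ‖f z.1‖ ^ 2 / 4)

lemma GroundStates.paramMap_eq (h : GroundStates β O φ) {s : ℝ} (hs : s ∈ O) (v : E3) :
    paramMap φ (s, v) = paramForm (gsL2 φ) (s, v) := by
  obtain ⟨lab, hl⟩ := h.smoothFam.exists_labels h.isOpen
  ext j
  have hb := h.boosted_ae hs v
  refine Fin.lastCases ?_ (fun a => ?_) j
  · rw [show Fin.last 3 = (3 : Fin 4) from rfl, paramForm_last]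
    change 1 / 2 * pair (diamond 3 (boosted φ (s, v))) (boosted φ (s, v)) = _
    rw [diamond_last, pair_eq hb hb, rin_modul, rin_self]
    ring
  · rw [paramForm_castSucc]
    change 1 / 2 * pair (diamond a.castSucc (boosted φ (s, v))) (boosted φ (s, v)) = _
    rw [pair_eq (h.diamond_ae hl hs v a) hb, rin_modul, map_sub, h.rin_grad hl hs,
      Complex.coe_smul, map_smul, rin_self, smul_eq_mul]
    ring

lemma GroundStates.paramMap_injOn (h : GroundStates β O φ) :
    InjOn (paramMap φ) (O ×ˢ univ) := by
  rintro ⟨s, v⟩ ⟨hs, -⟩ ⟨s', v'⟩ ⟨hs', -⟩ he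
  rw [h.paramMap_eq hs, h.paramMap_eq hs'] at he
  have e3 := congrArg (fun p : E4 => p 3) he
  simp only [paramForm_last] at e3
  have es : s = s' := h.mass_strictMonoOn.injOn hs hs' (by simp only; linarith)
  subst es
  congr 1
  ext a
  have ea := congrArg (fun p : E4 => p a.castSucc) he
  simp only [paramForm_castSucc] at ea
  have := h.mass_pos hs
  exact mul_right_cancel₀ this.ne' (by linarith)

lemma GroundStates.contDiffAt_mass (h : GroundStates β O φ) {s : ℝ} (hs : s ∈ O) :
    ContDiffAt ℝ ∞ (fun s => ‖gsL2 φ s‖ ^ 2) s := by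
  have h1 := h.smoothFam.contDiffOn.contDiffAt (h.isOpen.mem_nhds hs)
  have h2 : ContDiffAt ℝ ∞ (fun s => rin (gsL2 φ s) (gsL2 φ s)) s :=
    (rin.contDiff.contDiffAt.comp s h1).clm_apply h1
  simpa only [rin_self] using h2

lemma GroundStates.contDiffAt_paramForm (h : GroundStates β O φ) {z : ℝ × E3} (hz : z.1 ∈ O) :
    ContDiffAt ℝ ∞ (paramForm (gsL2 φ)) z := by
  have hm : ContDiffAt ℝ ∞ (fun z : ℝ × E3 => ‖gsL2 φ z.1‖ ^ 2) z :=
    ContDiffAt.comp z (h.contDiffAt_mass hz) contDiffAt_fst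
  rw [contDiffAt_euclidean]
  intro j
  refine Fin.lastCases ?_ (fun a => ?_) j
  · simp only [show Fin.last 3 = (3 : Fin 4) from rfl, paramForm_last]
    exact hm.div_const _
  · simp only [paramForm_castSucc]
    refine (ContDiffAt.mul ?_ hm).div_const _
    exact ((EuclideanSpace.proj a : E3 →L[ℝ] ℝ) ∘L
      ContinuousLinearMap.snd ℝ ℝ E3).contDiff.contDiffAt

lemma GroundStates.fderiv_paramForm_injective (h : GroundStates β O φ) {z : ℝ × E3}
    (hz : z.1 ∈ O) {L : ℝ × E3 →L[ℝ] E4} (hL : HasFDerivAt (paramForm (gsL2 φ)) L z) :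
    Function.Injective L := by
  rw [injective_iff_map_eq_zero]
  rintro ⟨s, k⟩ hsk
  have hm := (h.hasDerivAt_mass hz).hasFDerivAt.comp z (hasFDerivAt_fst (𝕜 := ℝ) (E := ℝ)
    (F := E3) (p := z))
  have hp : ∀ j : Fin 4, HasFDerivAt (fun z => paramForm (gsL2 φ) z j)
      ((EuclideanSpace.proj j : E4 →L[ℝ] ℝ) ∘L L) z := fun j =>
    (EuclideanSpace.proj j : E4 →L[ℝ] ℝ).hasFDerivAt.comp z hL
  have h0 : ∀ j : Fin 4, ((EuclideanSpace.proj j : E4 →L[ℝ] ℝ) ∘L L) (s, k) = 0 := fun j => by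
    rw [ContinuousLinearMap.comp_apply, hsk, map_zero]
  have h3 := hp 3
  simp only [paramForm_last] at h3
  have e3 := h3.unique (hm.mul_const (2 : ℝ)⁻¹)
  have := h0 3
  rw [e3] at this
  have hs0 : s = 0 := by
    have hp := h.rin_deriv_pos hz
    simp at this
    rcases this with h | h
    · exact h
    · exact absurd h hp.ne'
  subst hs0
  congr 1
  ext a
  have ha := hp a.castSucc
  simp only [paramForm_castSucc] at ha
  have hx : HasFDerivAt (fun z : ℝ × E3 => z.2 a) ((EuclideanSpace.proj a : E3 →L[ℝ] ℝ) ∘L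
      ContinuousLinearMap.snd ℝ ℝ E3) z := ((EuclideanSpace.proj a : E3 →L[ℝ] ℝ) ∘L
      ContinuousLinearMap.snd ℝ ℝ E3).hasFDerivAt
  have ea := ha.unique ((hx.mul hm).mul_const (4 : ℝ)⁻¹)
  have := h0 a.castSucc
  rw [ea] at this
  have hmp := h.mass_pos hz
  have hne : gsL2 φ z.1 ≠ 0 := fun h0 => by rw [h0] at hmp; simp at hmp
  simpa [hne] using this

/-- The inverse of `paramMap`. -/
def paramInv (O : Set ℝ) (φ : ℝ → E3 → ℝ) : E4 → ℝ × E3 :=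
  Function.invFunOn (paramMap φ) (O ×ˢ univ)

lemma GroundStates.paramInv_paramMap (h : GroundStates β O φ) {s : ℝ} (hs : s ∈ O) (v : E3) :
    paramInv O φ (paramMap φ (s, v)) = (s, v) := by
  have hex : ∃ z ∈ O ×ˢ (univ : Set E3), paramMap φ z = paramMap φ (s, v) :=
    ⟨(s, v), ⟨hs, mem_univ _⟩, rfl⟩
  exact h.paramMap_injOn (Function.invFunOn_mem hex) ⟨hs, mem_univ _⟩ (Function.invFunOn_eq hex)

lemma GroundStates.paramInv_local (h : GroundStates β O φ) {s : ℝ} (hs : s ∈ O) (v : E3) :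
    ContDiffAt ℝ ∞ (paramInv O φ) (paramMap φ (s, v)) ∧
    (∀ᶠ p in 𝓝 (paramMap φ (s, v)), p ∈ paramSet O φ) ∧
    Function.Surjective (fderiv ℝ (paramInv O φ) (paramMap φ (s, v))) := by
  have hc := h.contDiffAt_paramForm (z := (s, v)) hs
  have hd := (hc.differentiableAt (by simp)).hasFDerivAt
  have hi := h.fderiv_paramForm_injective (z := (s, v)) hs hd
  let e : (ℝ × E3) ≃L[ℝ] E4 := (LinearEquiv.ofInjectiveOfFinrankEq
    (fderiv ℝ (paramForm (gsL2 φ)) (s, v) : ℝ × E3 →ₗ[ℝ] E4) hi (by simp)).toContinuousLinearEquiv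
  have he : HasFDerivAt (paramForm (gsL2 φ)) (e : ℝ × E3 →L[ℝ] E4) (s, v) := hd
  have hst := hc.hasStrictFDerivAt' he (by simp)
  have hinv := hc.to_localInverse he (by simp)
  have hat : hc.localInverse he (by simp) (paramForm (gsL2 φ) (s, v)) = (s, v) :=
    hc.localInverse_apply_image he (by simp)
  have hr := hst.eventually_right_inverse
  have hO : ∀ᶠ p in 𝓝 (paramForm (gsL2 φ) (s, v)),
      (hc.localInverse he (by simp) p).1 ∈ O := by
    have := (continuous_fst.continuousAt (x := (s, v))).tendsto
    have h2 : Tendsto (hc.localInverse he (by simp)) (𝓝 (paramForm (gsL2 φ) (s, v)))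
        (𝓝 (s, v)) := by
      have := hinv.continuousAt.tendsto
      rwa [hat] at this
    exact (this.comp h2).eventually (h.isOpen.mem_nhds hs)
  have hev : ∀ᶠ p in 𝓝 (paramForm (gsL2 φ) (s, v)), p ∈ paramSet O φ ∧
      paramInv O φ p = hc.localInverse he (by simp) p := by
    filter_upwards [hr, hO] with p h1 h2
    have e1 : paramMap φ (hc.localInverse he (by simp) p) = p := by
      rw [← Prod.mk.eta (p := hc.localInverse he (by simp) p), h.paramMap_eq h2]
      exact h1
    refine ⟨⟨_, ⟨h2, mem_univ _⟩, e1⟩, ?_⟩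
    have := h.paramInv_paramMap h2 (hc.localInverse he (by simp) p).2
    rwa [Prod.mk.eta, e1] at this
  rw [h.paramMap_eq hs]
  have heq : paramInv O φ =ᶠ[𝓝 (paramForm (gsL2 φ) (s, v))] hc.localInverse he (by simp) :=
    hev.mono fun p hp => hp.2
  refine ⟨hinv.congr_of_eventuallyEq heq, hev.mono fun p hp => hp.1, ?_⟩
  have hfd : HasFDerivAt (hc.localInverse he (by simp)) (e.symm : E4 →L[ℝ] ℝ × E3)
    (paramForm (gsL2 φ) (s, v)) := hst.to_localInverse.hasFDerivAt
  rw [heq.fderiv_eq, hfd.fderiv]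
  exact e.symm.surjective

lemma orbitDeriv_apply (g : ℝ → L2) (m k : Fin 3 → ℝ → L2) (g' : ℝ → L2) (z h : E3 × E3 × ℝ) :
    orbitDeriv g m k g' z h = ∑ a, h.1 a • Complex.I • (orbit (m a) z - z.2.1 a • orbit g z) +
      ∑ a, h.2.1 a • orbit (k a) z + h.2.2 • orbit g' z := by
  simp only [orbitDeriv, add_apply, sum_apply, ContinuousLinearMap.smulRight_apply,
    ContinuousLinearMap.comp_apply, ContinuousLinearMap.coe_fst', ContinuousLinearMap.coe_snd',
    PiLp.proj_apply]

lemma IsLabels.hasFDerivAt_orbit {f : ℝ → L2} {lab : Option (Fin 3) × Bool → ℝ → L2}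
    (hO : IsOpen O) (hf : SmoothFam O f) (hl : IsLabels O f lab) {z : E3 × E3 × ℝ}
    (hz : z.2.2 ∈ O) :
    HasFDerivAt (orbit f) (orbitDeriv f (fun a => lab (some a, false))
      (fun a s => -Complex.I • lab (some a, true) s) (_root_.deriv f) z) z :=
  SolitonPotential.hasFDerivAt_orbit hO hf.diffFam (fun _ => hl.diffFam _) hl.mulX
    (fun _ => (hl.diffFam _).const_smul _) hl.grad hz

lemma GroundStates.dSolitonP_eq (h : GroundStates β O φ)
    {lab : Option (Fin 3) × Bool → ℝ → L2} (hl : IsLabels O (gsL2 φ) lab) {s : ℝ} (hs : s ∈ O)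
    (v : E3) : ∃ L : E4 →L[ℝ] ℝ × E3, Function.Surjective L ∧ ∀ j,
      dSolitonP O φ (paramMap φ (s, v)) j =
        ((L (EuclideanSpace.single j 1)).1 • modul ((1 / 2 : ℝ) • v) (deriv (gsL2 φ) s) +
        ∑ a, ((L (EuclideanSpace.single j 1)).2 a / 2) •
          Complex.I • modul ((1 / 2 : ℝ) • v) (lab (some a, false) s) : L2) := by
  obtain ⟨h1, h2, h3⟩ := h.paramInv_local hs v
  refine ⟨_, h3, fun j => ?_⟩
  have hev : (fun q => toL2 (solitonP O φ q)) =ᶠ[𝓝 (paramMap φ (s, v))]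
      (fun z : ℝ × E3 => orbit (gsL2 φ) ((1 / 2 : ℝ) • z.2, 0, z.1)) ∘ paramInv O φ := by
    filter_upwards [h2] with p hp
    obtain ⟨⟨s', v'⟩, ⟨hs', -⟩, rfl⟩ := hp
    have e : solitonP O φ (paramMap φ (s', v')) =
        boosted φ (paramInv O φ (paramMap φ (s', v'))) := rfl
    rw [Function.comp_apply, e, h.paramInv_paramMap hs' v', orbit_zero]
    exact toL2_eq (h.boosted_ae hs' v')
  let B : ℝ × E3 →L[ℝ] E3 × E3 × ℝ := ((1 / 2 : ℝ) • ContinuousLinearMap.snd ℝ ℝ E3).prod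
    ((0 : ℝ × E3 →L[ℝ] E3).prod (ContinuousLinearMap.fst ℝ ℝ E3))
  have hB : ∀ z : ℝ × E3, B z = ((1 / 2 : ℝ) • z.2, 0, z.1) := fun z => rfl
  have hd := IsLabels.hasFDerivAt_orbit h.isOpen h.smoothFam hl (z := B (s, v)) hs
  have hi := h.paramInv_paramMap hs v
  have hd1 : HasFDerivAt (fun z : ℝ × E3 => orbit (gsL2 φ) ((1 / 2 : ℝ) • z.2, 0, z.1))
      (orbitDeriv (gsL2 φ) (fun a => lab (some a, false))
        (fun a s => -Complex.I • lab (some a, true) s) (deriv (gsL2 φ)) (B (s, v)) ∘L B)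
      (paramInv O φ (paramMap φ (s, v))) := by
    rw [hi]
    exact hd.comp (s, v) B.hasFDerivAt
  have hd2 := hd1.comp (paramMap φ (s, v)) (h1.differentiableAt (by simp)).hasFDerivAt
  have e : dSolitonP O φ (paramMap φ (s, v)) j =
      (fderiv ℝ (fun q => toL2 (solitonP O φ q)) (paramMap φ (s, v))
        (EuclideanSpace.single j 1) : L2) := rfl
  rw [e, hev.fderiv_eq, hd2.fderiv]
  congr 2
  generalize fderiv ℝ (paramInv O φ) (paramMap φ (s, v)) = L
  rw [ContinuousLinearMap.comp_apply, ContinuousLinearMap.comp_apply, orbitDeriv_apply, add_comm]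
  generalize L (EuclideanSpace.single j 1) = y
  simp only [hB, PiLp.zero_apply, zero_smul, sub_zero, Finset.sum_const_zero, add_zero, orbit_zero]
  congr 1
  refine Finset.sum_congr rfl fun a _ => ?_
  rw [PiLp.smul_apply, smul_eq_mul]
  congr 1
  ring

end

/-! ### The modulation equations in `L²` -/

section
variable {β : ℝ → ℝ} {O : Set ℝ} {φ : ℝ → E3 → ℝ}

lemma E4_forall_iff (L : E4 →L[ℝ] ℝ) : (∀ j, L (EuclideanSpace.single j 1) = 0) ↔ L = 0 := by
  refine ⟨fun h => ?_, fun h j => by rw [h, zero_apply]⟩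
  refine ContinuousLinearMap.ext fun x => ?_
  have e : x = ∑ j, x j • EuclideanSpace.single j (1 : ℝ) := by
    ext i
    simp [Finset.sum_apply, Pi.single_apply]
  rw [e, map_sum]
  simp [h]

lemma rin_real_smul_left (r : ℝ) (f g : L2) : rin ((r : ℂ) • f) g = r * rin f g := by
  rw [Complex.coe_smul, map_smul, smul_apply, smul_eq_mul]

lemma GroundStates.modulationEqs_iff (h : GroundStates β O φ)
    {lab : Option (Fin 3) × Bool → ℝ → L2} (hl : IsLabels O (gsL2 φ) lab) {s : ℝ} (hs : s ∈ O)
    (Q : ℂ → Sob 2) (c : ℂ) (v y₀ : E3) (t : ℝ) (u : Sob 1) (D : E3) (ζ : Circle) (k : E3)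
    (w : ℂ) {R : L2} (hR : R = sobL2 u - actL D ζ (modul ((1 / 2 : ℝ) • k) (gsL2 φ s)) -
      galL v y₀ t (sobL2 (Q w))) :
    ModulationEqs O φ Q c v y₀ t u D ζ (paramMap φ (s, k)) w ↔
      (∀ j, rin (actL D ζ (modul ((1 / 2 : ℝ) • k) (lab j s))) R = 0) ∧
      ∀ e ∈ ({1, Complex.I} : Set ℂ),
        rin (c • galL v y₀ t (sobL2 (fderiv ℝ Q w e))) R = 0 := by
  have hsol : solitonP O φ (paramMap φ (s, k)) = boosted φ (s, k) := by
    have e : solitonP O φ (paramMap φ (s, k)) = boosted φ (paramInv O φ (paramMap φ (s, k))) := rfl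
    rw [e, h.paramInv_paramMap hs]
  have hrem : remainder O φ Q v y₀ t u D ζ (paramMap φ (s, k)) w =ᵐ[volume] R := by
    have h1 : sobFn u =ᵐ[volume] sobL2 u := by rw [sobL2_coe]
    have h2 := act_ae (h.boosted_ae hs k) D ζ
    have h3 : galilei v y₀ t (sobFn (Q w)) =ᵐ[volume] galL v y₀ t (sobL2 (Q w)) :=
      galilei_ae (by rw [sobL2_coe]) v y₀ t
    rw [hR]
    filter_upwards [h1, h2, h3, Lp.coeFn_sub (sobL2 u - actL D ζ (modul ((1 / 2 : ℝ) • k)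
      (gsL2 φ s))) (galL v y₀ t (sobL2 (Q w))), Lp.coeFn_sub (sobL2 u)
      (actL D ζ (modul ((1 / 2 : ℝ) • k) (gsL2 φ s)))] with x e1 e2 e3 e4 e5
    rw [e4, Pi.sub_apply, e5, Pi.sub_apply, ← e1, ← e2, ← e3, remainder, hsol]
  obtain ⟨L, hL, hd⟩ := h.dSolitonP_eq hl hs k
  have hF : ∀ j, pair (remainder O φ Q v y₀ t u D ζ (paramMap φ (s, k)) w)
      (act D ζ fun x => Complex.I * dSolitonP O φ (paramMap φ (s, k)) j x) =
      (L (EuclideanSpace.single j 1)).1 *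
        rin (actL D ζ (modul ((1 / 2 : ℝ) • k) (lab (none, false) s))) R -
      ∑ a, (L (EuclideanSpace.single j 1)).2 a / 2 *
        rin (actL D ζ (modul ((1 / 2 : ℝ) • k) (lab (some a, false) s))) R := by
    intro j
    have e1 : (fun x => Complex.I * dSolitonP O φ (paramMap φ (s, k)) j x) =ᵐ[volume]
        (Complex.I • ((L (EuclideanSpace.single j 1)).1 •
          modul ((1 / 2 : ℝ) • k) (deriv (gsL2 φ) s) +
        ∑ a, ((L (EuclideanSpace.single j 1)).2 a / 2) •
          Complex.I • modul ((1 / 2 : ℝ) • k) (lab (some a, false) s)) : L2) := by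
      rw [hd j]
      filter_upwards [Lp.coeFn_smul Complex.I ((L (EuclideanSpace.single j 1)).1 •
          modul ((1 / 2 : ℝ) • k) (deriv (gsL2 φ) s) +
        ∑ a, ((L (EuclideanSpace.single j 1)).2 a / 2) •
          Complex.I • modul ((1 / 2 : ℝ) • k) (lab (some a, false) s))] with x hx
      rw [hx, Pi.smul_apply, smul_eq_mul]
    rw [pair_eq hrem (act_ae e1 D ζ)]
    generalize L (EuclideanSpace.single j 1) = y
    have e5 : ∀ (r : ℝ) (z : L2), r • z = (r : ℂ) • z := fun r z => (Complex.coe_smul r z).symm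
    have e6 : Complex.I • (y.1 • modul ((1 / 2 : ℝ) • k) (deriv (gsL2 φ) s) +
        ∑ a, (y.2 a / 2) • Complex.I • modul ((1 / 2 : ℝ) • k) (lab (some a, false) s)) =
        (y.1 : ℂ) • modul ((1 / 2 : ℝ) • k) (lab (none, false) s) -
        ∑ a, ((y.2 a / 2 : ℝ) : ℂ) • modul ((1 / 2 : ℝ) • k) (lab (some a, false) s) := by
      simp only [e5, hl.deriv s hs, map_smul]
      rw [smul_add, Finset.smul_sum, smul_comm, sub_eq_add_neg, ← Finset.sum_neg_distrib]
      congr 1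
      refine Finset.sum_congr rfl fun a _ => ?_
      rw [smul_comm, smul_smul Complex.I, Complex.I_mul_I, neg_one_smul, smul_neg]
    rw [e6, map_sub, map_sub, map_smul, map_sum, map_sum, sub_apply, sum_apply,
      rin_real_smul_left]
    congr 1
    refine Finset.sum_congr rfl fun a _ => ?_
    rw [map_smul, rin_real_smul_left]
  have hGa : ∀ a : Fin 3, pair (remainder O φ Q v y₀ t u D ζ (paramMap φ (s, k)) w)
      (act D ζ (diamond a.castSucc (solitonP O φ (paramMap φ (s, k))))) =
      k a / 2 * rin (actL D ζ (modul ((1 / 2 : ℝ) • k) (lab (none, true) s))) R -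
      rin (actL D ζ (modul ((1 / 2 : ℝ) • k) (lab (some a, true) s))) R := by
    intro a
    rw [hsol, pair_eq hrem (act_ae (h.diamond_ae hl hs k a) D ζ), map_sub, map_sub, map_sub,
      map_smul, map_smul, sub_apply, rin_real_smul_left, hl.id]
  have hG3 : pair (remainder O φ Q v y₀ t u D ζ (paramMap φ (s, k)) w)
      (act D ζ (diamond 3 (solitonP O φ (paramMap φ (s, k))))) =
      rin (actL D ζ (modul ((1 / 2 : ℝ) • k) (lab (none, true) s))) R := by
    rw [hsol, diamond_last, pair_eq hrem (act_ae (h.boosted_ae hs k) D ζ), hl.id]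
  have hLj : ∀ e, pair (remainder O φ Q v y₀ t u D ζ (paramMap φ (s, k)) w)
      (fun x => c * galilei v y₀ t (sobFn (fderiv ℝ Q w e)) x) =
      rin (c • galL v y₀ t (sobL2 (fderiv ℝ Q w e))) R := by
    intro e
    refine pair_eq hrem ?_
    filter_upwards [galilei_ae (f := sobL2 (fderiv ℝ Q w e)) (by rw [sobL2_coe]) v y₀ t,
      Lp.coeFn_smul c (galL v y₀ t (sobL2 (fderiv ℝ Q w e)))] with x h1 h2
    rw [h2, Pi.smul_apply, h1, smul_eq_mul]
  let M : ℝ × E3 →L[ℝ] ℝ :=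
    rin (actL D ζ (modul ((1 / 2 : ℝ) • k) (lab (none, false) s))) R • ContinuousLinearMap.fst ℝ ℝ E3
    - ∑ a, (rin (actL D ζ (modul ((1 / 2 : ℝ) • k) (lab (some a, false) s))) R / 2) •
      ((EuclideanSpace.proj a : E3 →L[ℝ] ℝ) ∘L ContinuousLinearMap.snd ℝ ℝ E3)
  have hM : ∀ y, M y = y.1 * rin (actL D ζ (modul ((1 / 2 : ℝ) • k) (lab (none, false) s))) R -
      ∑ a, y.2 a / 2 * rin (actL D ζ (modul ((1 / 2 : ℝ) • k) (lab (some a, false) s))) R := by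
    intro y
    simp only [M, sub_apply, smul_apply, sum_apply, ContinuousLinearMap.comp_apply,
      ContinuousLinearMap.coe_fst', ContinuousLinearMap.coe_snd', PiLp.proj_apply, smul_eq_mul]
    rw [mul_comm]
    congr 1
    exact Finset.sum_congr rfl fun a _ => by ring
  constructor
  · rintro ⟨h1, h2, h3⟩
    refine ⟨?_, fun e he => by rw [← hLj]; exact h3 e he⟩
    have hML : M ∘L L = 0 := (E4_forall_iff _).1 fun j => by
      rw [ContinuousLinearMap.comp_apply, hM, ← hF, h1]
    have hM0 : ∀ y, M y = 0 := fun y => by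
      obtain ⟨x, rfl⟩ := hL y
      exact congrArg (fun A : E4 →L[ℝ] ℝ => A x) hML
    have g3 : rin (actL D ζ (modul ((1 / 2 : ℝ) • k) (lab (none, true) s))) R = 0 := by
      rw [← hG3]; exact h2 3
    rintro ⟨_ | a, _ | _⟩
    · have := hM0 (1, 0)
      rw [hM] at this
      simpa using this
    · exact g3
    · have := hM0 (0, stdVec a)
      rw [hM] at this
      simpa [stdVec, Pi.single_apply, ite_div, ite_mul] using this
    · have := h2 a.castSucc
      rw [hGa, g3] at this
      linarith
  · rintro ⟨h1, h2⟩
    refine ⟨fun j => ?_, fun j => ?_, fun e he => by rw [hLj]; exact h2 e he⟩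
    · rw [hF, h1, Finset.sum_eq_zero fun a _ => by rw [h1, mul_zero]]
      simp
    · refine Fin.lastCases ?_ (fun a => ?_) j
      · exact hG3.trans (h1 _)
      · rw [hGa, h1, h1]
        simp

end

/-! ### Nondegeneracy of the modulation equations -/

section
variable {β : ℝ → ℝ} {O : Set ℝ} {φ : ℝ → E3 → ℝ}

lemma rin_I_I (f g : L2) : rin (Complex.I • f) (Complex.I • g) = rin f g := by
  rw [rin_apply, rin_apply, inner_smul_left, inner_smul_right, ← mul_assoc]
  simp

lemma rin_I_left (f g : L2) : rin (Complex.I • f) g = -rin f (Complex.I • g) := by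
  rw [← rin_I_I f, smul_smul, Complex.I_mul_I, neg_one_smul, map_neg, neg_neg]

lemma rin_I_of_real {f g : L2} (hf : ∀ᵐ x, (f x).im = 0) (hg : ∀ᵐ x, (g x).im = 0) :
    rin f (Complex.I • g) = 0 := by
  rw [rin_apply, inner_smul_right, l2_inner_eq]
  have : ∫ x, g x * conj (f x) = ((∫ x, (g x).re * (f x).re : ℝ) : ℂ) := by
    rw [← integral_complex_ofReal]
    refine integral_congr_ae ?_
    filter_upwards [hf, hg] with x h1 h2
    apply Complex.ext <;> simp [h1, h2]
  rw [this]
  simp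

lemma IsMulX.inner_swap {a : Fin 3} {f g f' g' : L2} (h : IsMulX a f f') (h' : IsMulX a g g') :
    inner ℂ f' g = inner ℂ f g' := by
  rw [l2_inner_eq, l2_inner_eq]
  refine integral_congr_ae ?_
  filter_upwards [h, h'] with x h1 h2
  rw [h1, h2, map_mul, Complex.conj_ofReal]
  ring

lemma IsMulX.real {a : Fin 3} {f f' : L2} (h : IsMulX a f f') (hf : ∀ᵐ x, (f x).im = 0) :
    ∀ᵐ x, (f' x).im = 0 := by
  filter_upwards [h, hf] with x h1 h2
  rw [h1]
  simp [h2]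

lemma WD.rin_self {a : Fin 3} {u u' : L2} (h : WD a u u') : rin u u' = 0 := by
  have h1 := congrArg Complex.re (wd_antisymm h h)
  rw [Complex.neg_re] at h1
  have h2 := rin_comm u u'
  rw [rin_apply, rin_apply] at h2
  rw [rin_apply]
  linarith

lemma wd_mulX {a b : Fin 3} {f f' x xf' : L2} (h : WD b f f') (hx : IsMulX a f x)
    (hx' : IsMulX a f' xf') : WD b x ((if a = b then (1 : ℂ) else 0) • f + xf') := by
  refine wd_mul (coord_temperate a) h hx ?_ xf' hx'
  filter_upwards [Lp.coeFn_add ((if a = b then (1 : ℂ) else 0) • f) xf', hx',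
    Lp.coeFn_smul (if a = b then (1 : ℂ) else 0) f] with y h1 h2 h3
  rw [h1, Pi.add_apply, h3, h2, Pi.smul_apply, smul_eq_mul]
  have : HasFDerivAt (fun x : E3 => (x a : ℂ))
      (Complex.ofRealCLM ∘L (EuclideanSpace.proj a : E3 →L[ℝ] ℝ)) y :=
    (Complex.ofRealCLM ∘L (EuclideanSpace.proj a : E3 →L[ℝ] ℝ)).hasFDerivAt
  rw [this.fderiv]
  congr 2
  simp [stdVec]
  split_ifs <;> simp

lemma rin_mulX_wd {a b : Fin 3} {f f' x xf' : L2} (h : WD b f f') (hx : IsMulX a f x)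
    (hx' : IsMulX a f' xf') : rin x f' = if a = b then -(‖f‖ ^ 2 / 2) else 0 := by
  have h1 := congrArg Complex.re (wd_antisymm h (wd_mulX h hx hx'))
  rw [inner_add_left, hx'.inner_swap hx, Complex.neg_re, Complex.add_re, inner_smul_left] at h1
  have h2 := rin_comm x f'
  rw [rin_apply, rin_apply] at h2
  have h3 := SolitonPotential.rin_self f
  rw [rin_apply] at h3
  rw [rin_apply]
  split_ifs at h1 ⊢ with hab
  · rw [map_one, one_mul] at h1
    linarith
  · rw [map_zero, zero_mul, Complex.zero_re] at h1
    linarith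

lemma GroundStates.im_eq_zero (h : GroundStates β O φ) {s : ℝ} (hs : s ∈ O) :
    ∀ᵐ x, (gsL2 φ s x).im = 0 := by
  filter_upwards [h.coe hs] with x hx
  rw [← hx, Complex.ofReal_im]

/-- The pairings of the generators with the tangent vectors of the soliton manifold at
`v = 0`, `D = 0`, `ϑ = 0` form an invertible matrix. -/
lemma GroundStates.eq_zero_of_rin_labels (h : GroundStates β O φ)
    {lab : Option (Fin 3) × Bool → ℝ → L2} (hl : IsLabels O (gsL2 φ) lab) {s : ℝ} (hs : s ∈ O)
    {k d : E3} {r θ : ℝ}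
    (h0 : ∀ j, rin (lab j s) (∑ a, (k a / 2) • Complex.I • lab (some a, false) s +
      ∑ a, d a • Complex.I • lab (some a, true) s + r • deriv (gsL2 φ) s +
      θ • Complex.I • gsL2 φ s) = 0) : k = 0 ∧ d = 0 ∧ r = 0 ∧ θ = 0 := by
  have hF := h.im_eq_zero hs
  have hX : ∀ a, ∀ᵐ x, (lab (some a, false) s x).im = 0 := fun a => (hl.mulX a s hs).real hF
  have hm := h.mass_pos hs
  have hp := h.rin_deriv_pos hs
  have hXD : ∀ a b, rin (lab (some a, false) s) (Complex.I • lab (some b, true) s) =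
      if a = b then ‖gsL2 φ s‖ ^ 2 / 2 else 0 := by
    intro a b
    obtain ⟨m, -, hm'⟩ := ((hl.diffFam (some b, true)).const_smul (-Complex.I)).mul
      (coord_temperate a)
    have := rin_mulX_wd (hl.grad b s hs) (hl.mulX a s hs) (hm' s hs)
    rw [neg_smul, map_neg] at this
    rw [← neg_inj, this]
    split_ifs <;> simp
  have hFD : ∀ a, rin (gsL2 φ s) (Complex.I • lab (some a, true) s) = 0 := by
    intro a
    have := (hl.grad a s hs).rin_self
    rwa [neg_smul, map_neg, neg_eq_zero] at this
  have key : ∀ j, ∑ a, (k a / 2) * rin (lab j s) (Complex.I • lab (some a, false) s) +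
      ∑ a, d a * rin (lab j s) (Complex.I • lab (some a, true) s) +
      r * rin (lab j s) (deriv (gsL2 φ) s) + θ * rin (lab j s) (Complex.I • gsL2 φ s) = 0 := by
    intro j
    have := h0 j
    simpa only [map_add, map_sum, map_smul, smul_eq_mul] using this
  have hr : r = 0 := by
    have := key (none, true)
    rw [hl.id] at this
    simp only [rin_I_of_real hF (hX _), rin_I_of_real hF hF, hFD, mul_zero, Finset.sum_const_zero,
      zero_add, add_zero] at this
    rw [rin_comm] at this
    exact (mul_eq_zero.1 this).resolve_right hp.ne'
  subst hr
  have hd : d = 0 := by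
    ext a
    have := key (some a, false)
    simp only [rin_I_of_real (hX a) (hX _), rin_I_of_real (hX a) hF, hXD, mul_zero,
      Finset.sum_const_zero, zero_add, add_zero, zero_mul, mul_ite, Finset.sum_ite_eq,
      Finset.mem_univ, if_true] at this
    rw [PiLp.zero_apply]
    exact (mul_eq_zero.1 this).resolve_right (by positivity)
  subst hd
  have hk : k = 0 := by
    ext a
    have := key (some a, true)
    have e1 : ∀ b, rin (lab (some a, true) s) (Complex.I • lab (some b, false) s) =
        if b = a then -(‖gsL2 φ s‖ ^ 2 / 2) else 0 := by
      intro b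
      rw [rin_comm, rin_I_left, hXD]
      split_ifs <;> simp
    have e2 : rin (lab (some a, true) s) (Complex.I • gsL2 φ s) = 0 := by
      rw [rin_comm, rin_I_left, hFD, neg_zero]
    simp only [e1, e2, mul_zero, PiLp.zero_apply, zero_mul,
      Finset.sum_const_zero, add_zero, mul_ite, Finset.sum_ite_eq',
      Finset.mem_univ, if_true] at this
    rw [PiLp.zero_apply]
    have h2 := (mul_eq_zero.1 this).resolve_right (neg_ne_zero.2 (by positivity))
    linarith
  subst hk
  have hθ : θ = 0 := by
    have := key (none, false)
    rw [hl.deriv s hs, rin_I_I] at this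
    simp only [PiLp.zero_apply, zero_div, zero_mul, Finset.sum_const_zero, zero_add] at this
    exact (mul_eq_zero.1 this).resolve_right hp.ne'
  exact ⟨rfl, rfl, rfl, hθ⟩

end

/-! ### The modulated generators -/

/-- The parameters `(D, ϑ, v, ω, w)`. -/
abbrev ModPar : Type := E3 × ℝ × E3 × ℝ × ℂ

/-- The indices of the ten modulation equations. -/
abbrev ModIdx : Type := (Option (Fin 3) × Bool) ⊕ Bool

/-- The coordinate `D`. -/
def modParD : ModPar →L[ℝ] E3 := ContinuousLinearMap.fst ℝ _ _

/-- The coordinate `ϑ`. -/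
def modParT : ModPar →L[ℝ] ℝ := ContinuousLinearMap.fst ℝ _ _ ∘L ContinuousLinearMap.snd ℝ _ _

/-- The coordinate `v`. -/
def modParV : ModPar →L[ℝ] E3 := ContinuousLinearMap.fst ℝ _ _ ∘L ContinuousLinearMap.snd ℝ _ _ ∘L
  ContinuousLinearMap.snd ℝ _ _

/-- The coordinate `ω`. -/
def modParS : ModPar →L[ℝ] ℝ := ContinuousLinearMap.fst ℝ _ _ ∘L ContinuousLinearMap.snd ℝ _ _ ∘L
  ContinuousLinearMap.snd ℝ _ _ ∘L ContinuousLinearMap.snd ℝ _ _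

/-- The coordinate `w`. -/
def modParW : ModPar →L[ℝ] ℂ := ContinuousLinearMap.snd ℝ _ _ ∘L ContinuousLinearMap.snd ℝ _ _ ∘L
  ContinuousLinearMap.snd ℝ _ _ ∘L ContinuousLinearMap.snd ℝ _ _

lemma modParD_apply (x : ModPar) : modParD x = x.1 := rfl
lemma modParT_apply (x : ModPar) : modParT x = x.2.1 := rfl

lemma finrank_modPar : Module.finrank ℝ ModPar = Module.finrank ℝ (ModIdx → ℝ) := by
  simp

/-- The function `e^{iϑ} e^{iv·(x-D)/2} f_ω(x-D)`. -/
def gen (f : ℝ → L2) (x : ModPar) : L2 :=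
  Complex.exp (Complex.I * ((x.2.1 - inner ℝ x.2.2.1 x.1 / 2 : ℝ) : ℂ)) •
    orbit f ((1 / 2 : ℝ) • x.2.2.1, -x.1, x.2.2.2.1)

lemma gen_eq (f : ℝ → L2) (x : ModPar) :
    gen f x = actL x.1 (Circle.exp x.2.1) (modul ((1 / 2 : ℝ) • x.2.2.1) (f x.2.2.2.1)) := by
  rw [gen, actL_apply, trans_modul, smul_smul, Circle.coe_exp, ← Complex.exp_add, orbit]
  congr 2
  rw [inner_neg_right, inner_smul_left]
  simp only [conj_trivial]
  push_cast
  ring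

section
variable {O : Set ℝ}

lemma modul_zero (f : L2) : modul 0 f = f := by
  apply Lp.ext
  filter_upwards [modul_coe 0 f] with x hx
  rw [hx]
  simp

lemma contDiffAt_gen (hO : IsOpen O) {g : ℝ → L2} (hg : DiffFam O g) {x : ModPar}
    (hx : x.2.2.2.1 ∈ O) : ContDiffAt ℝ ∞ (gen g) x := by
  have hU : IsOpen (univ ×ˢ univ ×ˢ O : Set (E3 × E3 × ℝ)) :=
    isOpen_univ.prod (isOpen_univ.prod hO)
  have h1 : ContDiffAt ℝ ∞ (orbit g) ((1 / 2 : ℝ) • x.2.2.1, -x.1, x.2.2.2.1) :=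
    (contDiffOn_orbit hO hg).contDiffAt (hU.mem_nhds ⟨mem_univ _, mem_univ _, hx⟩)
  have h2 : ContDiff ℝ ∞ fun x : ModPar => (((1 / 2 : ℝ) • x.2.2.1, -x.1, x.2.2.2.1) :
      E3 × E3 × ℝ) := by fun_prop
  have h3 : ContDiff ℝ ∞ fun x : ModPar =>
      Complex.exp (Complex.I * ((x.2.1 - inner ℝ x.2.2.1 x.1 / 2 : ℝ) : ℂ)) := by
    have h5 : ContDiff ℝ ∞ fun x : ModPar => x.2.1 - inner ℝ x.2.2.1 x.1 / 2 := by
      have h6 : ContDiff ℝ ∞ fun x : ModPar => inner ℝ x.2.2.1 x.1 :=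
        ContDiff.inner ℝ (by fun_prop) (by fun_prop)
      exact (by fun_prop : ContDiff ℝ ∞ fun x : ModPar => x.2.1).sub (h6.div_const _)
    exact (contDiff_const.mul (Complex.ofRealCLM.contDiff.comp h5)).cexp
  exact h3.contDiffAt.smul (ContDiffAt.comp (g := orbit g)
    (f := fun x : ModPar => ((1 / 2 : ℝ) • x.2.2.1, -x.1, x.2.2.2.1)) x h1 h2.contDiffAt)

lemma IsLabels.hasFDerivAt_gen (hO : IsOpen O) {f : ℝ → L2} (hf : SmoothFam O f)
    {lab : Option (Fin 3) × Bool → ℝ → L2} (hl : IsLabels O f lab) {s : ℝ} (hs : s ∈ O) :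
    ∃ A : ModPar →L[ℝ] L2, HasFDerivAt (gen f) A (0, 0, 0, s, 0) ∧ ∀ h : ModPar, A h =
      ∑ a, (h.2.2.1 a / 2) • Complex.I • lab (some a, false) s +
      ∑ a, h.1 a • Complex.I • lab (some a, true) s + h.2.2.2.1 • _root_.deriv f s +
      h.2.1 • Complex.I • f s := by
  let x₀ : ModPar := (0, 0, 0, s, 0)
  let B : ModPar →L[ℝ] E3 × E3 × ℝ := ((1 / 2 : ℝ) • modParV).prod ((-modParD).prod modParS)
  have hB : ∀ x : ModPar, B x = ((1 / 2 : ℝ) • x.2.2.1, -x.1, x.2.2.2.1) := fun x => rfl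
  have hB0 : B x₀ = (0, 0, s) := by rw [hB]; simp [x₀]
  have h1 := hl.hasFDerivAt_orbit hO hf (z := B x₀) (by rw [hB0]; exact hs)
  have h2 := h1.comp x₀ B.hasFDerivAt
  have h5 : HasFDerivAt (fun x : ModPar => x.2.1 - inner ℝ x.2.2.1 x.1 / 2)
      modParT x₀ := by
    have h6 : HasFDerivAt (fun x : ModPar => x.2.2.1) modParV x₀ := modParV.hasFDerivAt
    have h7 := h6.inner ℝ (modParD.hasFDerivAt (x := x₀))
    have h8 : HasFDerivAt (fun x : ModPar => x.2.1) modParT x₀ := modParT.hasFDerivAt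
    have h9 := h8.sub (h7.mul_const (2 : ℝ)⁻¹)
    simp only [← div_eq_mul_inv] at h9
    convert! h9 using 1
    refine ContinuousLinearMap.ext fun z => ?_
    simp [x₀, fderivInnerCLM_apply, modParD_apply]
  have h3 := ((Complex.ofRealCLM.hasFDerivAt.comp x₀ h5).const_mul Complex.I).cexp
  refine ⟨_, h3.smul h2, fun h => ?_⟩
  simp only [add_apply, smul_apply, ContinuousLinearMap.comp_apply,
    ContinuousLinearMap.smulRight_apply, orbitDeriv_apply, hB0, hB, Function.comp_apply,
    orbit_zero, modul_zero]
  simp only [x₀, modParT_apply, inner_zero_left, zero_div, sub_self, Complex.ofReal_zero, mul_zero,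
    Complex.exp_zero, one_smul, zero_smul, sub_zero, one_mul, PiLp.zero_apply, PiLp.smul_apply,
    PiLp.neg_apply, smul_eq_mul, Complex.ofRealCLM_apply, smul_zero, neg_zero]
  have e1 : orbit f (0, 0, s) = f s := by rw [orbit_zero, modul_zero]
  have e2 : (Complex.I * (h.2.1 : ℂ)) • f s = h.2.1 • Complex.I • f s := by
    rw [mul_comm, ← smul_smul]
    exact Complex.coe_smul _ _
  rw [e1, e2]
  congr 2
  congr 1
  · exact Finset.sum_congr rfl fun a _ => by rw [show 1 / 2 * h.2.2.1 a = h.2.2.1 a / 2 by ring]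
  · exact Finset.sum_congr rfl fun a _ => by rw [neg_smul, neg_smul, smul_neg, neg_neg]

end

/-! ### The modulation equations as a functional -/

section
variable {X F J K : Type*} [NormedAddCommGroup X] [NormedSpace ℝ X] [NormedAddCommGroup F]
  [NormedSpace ℝ F] [Fintype J] [Fintype K] [DecidableEq J] [DecidableEq K]
  (B : F →L[ℝ] F →L[ℝ] ℝ) (e : J → X → F) (g q : X → F) (qd : K → X → F)

variable {B} in
lemma contDiffAt_bilin {a b : X → F} {x : X} (ha : ContDiffAt ℝ ∞ a x)
    (hb : ContDiffAt ℝ ∞ b x) : ContDiffAt ℝ ∞ (fun x => B (a x) (b x)) x :=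
  (B.contDiff.contDiffAt.comp x ha).clm_apply hb

variable {B} in
lemma contDiffAt_pairT {a b : X → F} {x : X} (ha : ContDiffAt ℝ ∞ a x)
    (hb : ContDiffAt ℝ ∞ b x) : ContDiffAt ℝ ∞ (fun x => (B (a x) ∘L
      ContinuousLinearMap.apply ℝ F (b x)) ∘L ContinuousLinearMap.fst ℝ (F →L[ℝ] F) ℝ) x := by
  have h1 : ContDiffAt ℝ ∞ (fun x => B (a x)) x := B.contDiff.contDiffAt.comp x ha
  have h2 : ContDiffAt ℝ ∞ (fun x => ContinuousLinearMap.apply ℝ F (b x)) x := by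
    have h := (ContinuousLinearMap.apply ℝ F (E := F)).contDiff (n := ∞)
    exact h.contDiffAt.comp x hb
  exact (h1.clm_comp h2).clm_comp contDiffAt_const

lemma contDiffAt_smul_const {a : X → ℝ} {x : X} (ha : ContDiffAt ℝ ∞ a x) (b : F) :
    ContDiffAt ℝ ∞ (fun x => a x • b) x :=
  ha.smul contDiffAt_const

/-- The modulation equations `B (e_j) (b - g - U q) = 0` and `B (b - g - U q) (U qd_k) = 0` for an
isometry `U`. They are homogenized in the pair `(U, r)`. -/
def modRow (z : X × F) : J ⊕ K → ((F →L[ℝ] F) × ℝ →L[ℝ] ℝ)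
  | .inl j => B (e j z.1) (z.2 - g z.1) • ContinuousLinearMap.snd ℝ _ ℝ -
      (B (e j z.1) ∘L ContinuousLinearMap.apply ℝ F (q z.1)) ∘L ContinuousLinearMap.fst ℝ _ _
  | .inr j => (B (z.2 - g z.1) ∘L ContinuousLinearMap.apply ℝ F (qd j z.1)) ∘L
      ContinuousLinearMap.fst ℝ _ _ - B (q z.1) (qd j z.1) • ContinuousLinearMap.snd ℝ _ ℝ

/-- The modulation equations as a map with values in a finite dimensional space. -/
def modFun (z : X × F) : (F →L[ℝ] F) × ℝ →L[ℝ] J ⊕ K → ℝ :=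
  ∑ i, ContinuousLinearMap.single ℝ (fun _ : J ⊕ K => ℝ) i ∘L modRow B e g q qd z i

variable {B e g q qd}

lemma modFun_apply (z : X × F) (σ : (F →L[ℝ] F) × ℝ) (i : J ⊕ K) :
    modFun B e g q qd z σ i = modRow B e g q qd z i σ := by
  rw [modFun, sum_apply, Finset.sum_apply, Finset.sum_eq_single i]
  · simp
  · intro j _ hj
    simp [hj.symm]
  · simp

lemma modFun_inl (z : X × F) (U : F →L[ℝ] F) (j : J) :
    modFun B e g q qd z (U, 1) (.inl j) = B (e j z.1) (z.2 - g z.1 - U (q z.1)) := by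
  rw [modFun_apply, modRow, sub_apply, smul_apply, map_sub (B (e j z.1)) _ (U (q z.1))]
  simp

lemma modFun_inr (z : X × F) (U : F →L[ℝ] F) (j : K) :
    modFun B e g q qd z (U, 1) (.inr j) =
      B (z.2 - g z.1) (U (qd j z.1)) - B (q z.1) (qd j z.1) := by
  rw [modFun_apply, modRow, sub_apply, smul_apply]
  simp

lemma contDiffAt_modFun {z : X × F} (he : ∀ j, ContDiffAt ℝ ∞ (e j) z.1)
    (hg : ContDiffAt ℝ ∞ g z.1) (hq : ContDiffAt ℝ ∞ q z.1)
    (hqd : ∀ j, ContDiffAt ℝ ∞ (qd j) z.1) : ContDiffAt ℝ ∞ (modFun B e g q qd) z := by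
  have e1 : ∀ j, ContDiffAt ℝ ∞ (fun z : X × F => e j z.1) z := fun j =>
    ContDiffAt.comp z (he j) contDiffAt_fst
  have e2 : ContDiffAt ℝ ∞ (fun z : X × F => z.2 - g z.1) z :=
    contDiffAt_snd.sub (ContDiffAt.comp z hg contDiffAt_fst)
  have e4 : ContDiffAt ℝ ∞ (fun z : X × F => q z.1) z := ContDiffAt.comp z hq contDiffAt_fst
  have e5 : ∀ j, ContDiffAt ℝ ∞ (fun z : X × F => qd j z.1) z :=
    fun j => ContDiffAt.comp z (hqd j) contDiffAt_fst
  have hsum : modFun B e g q qd = fun z => ∑ i,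
      ContinuousLinearMap.single ℝ (fun _ : J ⊕ K => ℝ) i ∘L modRow B e g q qd z i := rfl
  rw [hsum]
  refine ContDiffAt.sum fun i _ => contDiffAt_const.clm_comp ?_
  rcases i with j | j
  · exact (contDiffAt_smul_const (contDiffAt_bilin (e1 j) e2) _).sub (contDiffAt_pairT (e1 j) e4)
  · exact (contDiffAt_pairT e2 (e5 j)).sub (contDiffAt_smul_const (contDiffAt_bilin e4 (e5 j)) _)

/-- The derivative of the modulation equations at a trivial solution. -/
lemma fderiv_modFun_apply {x : X} (he : ∀ j, ContDiffAt ℝ ∞ (e j) x)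
    (hg : ContDiffAt ℝ ∞ g x) (hq : ContDiffAt ℝ ∞ q x)
    (hqd : ∀ j, ContDiffAt ℝ ∞ (qd j) x) {A q' : X →L[ℝ] F}
    (hA : HasFDerivAt g A x) (hq' : HasFDerivAt q q' x) (hq0 : q x = 0) (U : F →L[ℝ] F) (h : X) :
    (∀ j, fderiv ℝ (modFun B e g q qd) (x, g x) (h, 0) (U, 1) (.inl j) =
      -B (e j x) (A h) - B (e j x) (U (q' h))) ∧
    ∀ j, fderiv ℝ (modFun B e g q qd) (x, g x) (h, 0) (U, 1) (.inr j) =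
      -B (A h) (U (qd j x)) - B (q' h) (qd j x) := by
  have hc := contDiffAt_modFun (B := B) (z := (x, g x)) he hg hq hqd
  have hd := (hc.differentiableAt (by simp)).hasFDerivAt
  have hd1 : ∀ i, HasFDerivAt (fun y => modFun B e g q qd (y, g x) (U, 1) i)
      (ContinuousLinearMap.proj (R := ℝ) (φ := fun _ : J ⊕ K => ℝ) i ∘L
        ContinuousLinearMap.apply ℝ (J ⊕ K → ℝ) ((U, 1) : (F →L[ℝ] F) × ℝ) ∘L
        fderiv ℝ (modFun B e g q qd) (x, g x) ∘L ContinuousLinearMap.inl ℝ X F) x := by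
    intro i
    have h1 := hd.comp x ((hasFDerivAt_id (𝕜 := ℝ) x).prodMk (hasFDerivAt_const (g x) x))
    have h2 := (ContinuousLinearMap.apply ℝ (J ⊕ K → ℝ)
      ((U, 1) : (F →L[ℝ] F) × ℝ)).hasFDerivAt.comp x h1
    exact (ContinuousLinearMap.proj (R := ℝ) (φ := fun _ : J ⊕ K => ℝ) i).hasFDerivAt.comp x h2
  have hy : HasFDerivAt (fun y => g x - g y) (-A) x := by
    convert! (hasFDerivAt_const (g x) x).sub hA using 1
    simp
  have hB : ∀ {a b : X → F} {a' b' : X →L[ℝ] F}, HasFDerivAt a a' x → HasFDerivAt b b' x →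
      HasFDerivAt (fun x => B (a x) (b x)) (B (a x) ∘L b' + B.flip (b x) ∘L a') x := by
    intro a b a' b' ha hb
    convert! (B.hasFDerivAt.comp x ha).clm_apply hb using 1
  constructor
  · intro j
    have hj := ((he j).differentiableAt (by simp)).hasFDerivAt
    have h2 := hB hj (hy.sub (U.hasFDerivAt.comp x hq'))
    have h3 := hd1 (.inl j)
    simp only [modFun_inl] at h3
    have := congrArg (fun B : X →L[ℝ] ℝ => B h) (h3.unique h2)
    simpa [hq0] using this
  · intro j
    have hqj := ((hqd j).differentiableAt (by simp)).hasFDerivAt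
    have h2 := (hB hy (U.hasFDerivAt.comp x hqj)).sub (hB hq' hqj)
    have h3 := hd1 (.inr j)
    simp only [modFun_inr] at h3
    have := congrArg (fun B : X →L[ℝ] ℝ => B h) (h3.unique h2)
    simpa [hq0] using this

end

/-! ### Uniform solvability of the modulation equations -/

/-- `f ↦ κ e^{iv·x} f(x + z)`. -/
def twist (κ : ℂ) (v z : E3) : L2 →L[ℂ] L2 := κ • (modul v ∘L (trans z).toContinuousLinearMap)

lemma twist_apply (κ : ℂ) (v z : E3) (f : L2) : twist κ v z f = κ • modul v (trans z f) := rfl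

lemma norm_twist_apply {κ : ℂ} (hκ : ‖κ‖ = 1) (v z : E3) (f : L2) : ‖twist κ v z f‖ = ‖f‖ := by
  rw [twist_apply, norm_smul, hκ, one_mul, norm_modul, LinearIsometry.norm_map]

lemma norm_twist_le {κ : ℂ} (hκ : ‖κ‖ = 1) (v z : E3) :
    ‖(twist κ v z).restrictScalars ℝ‖ ≤ 1 := by
  refine ContinuousLinearMap.opNorm_le_bound _ zero_le_one fun f => ?_
  rw [one_mul]
  exact (norm_twist_apply hκ v z f).le

lemma exists_twist_eq (v y₀ : E3) (t : ℝ) (D : E3) (ζ : Circle) : ∃ κ : ℂ, ‖κ‖ = 1 ∧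
    ∀ f, actL (-D) ζ⁻¹ (galL v y₀ t f) =
      twist κ (-(1 / 2 : ℝ) • v) (t • v + y₀ + D) f := by
  refine ⟨((ζ⁻¹ : Circle) : ℂ) * (Complex.exp (Complex.I * ((-(t / 4 * ‖v‖ ^ 2) : ℝ) : ℂ)) *
    Complex.exp (Complex.I * ((inner ℝ (-(1 / 2 : ℝ) • v) D : ℝ) : ℂ))), ?_, fun f => ?_⟩
  · rw [norm_mul, norm_mul, norm_exp_phase, norm_exp_phase, Circle.norm_coe]
    norm_num
  · rw [actL_apply, galL_apply, map_smul, neg_neg, trans_modul, ← trans_add, twist_apply,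
      smul_smul, smul_smul, add_comm D, mul_assoc]

/-- A linear functional on a finite dimensional space is controlled by its values on a finite
set. -/
lemma exists_finite_bound (X : Type*) [NormedAddCommGroup X] [NormedSpace ℝ X]
    [FiniteDimensional ℝ X] : ∃ C > 0, ∃ S : Finset X, ∀ (T : X →L[ℝ] ℝ) (η : ℝ), 0 ≤ η →
      (∀ x ∈ S, |T x| ≤ η) → ∀ h, |T h| ≤ C * η * ‖h‖ := by
  classical
  let b := Module.finBasis ℝ X
  let e := b.equivFunL
  refine ⟨(Module.finrank ℝ X : ℝ) * ‖(e : X →L[ℝ] Fin (Module.finrank ℝ X) → ℝ)‖ + 1, by positivity,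
    Finset.univ.image b, fun T η hη hT h => ?_⟩
  have h1 : h = ∑ i, e h i • b i := (b.sum_equivFun h).symm
  have h2 : T h = ∑ i, e h i * T (b i) := by
    conv_lhs => rw [h1]
    rw [map_sum]
    simp
  have h3 : ∀ i, |e h i| ≤ ‖(e : X →L[ℝ] Fin (Module.finrank ℝ X) → ℝ)‖ * ‖h‖ := fun i =>
    (norm_le_pi_norm (e h) i).trans ((e : X →L[ℝ] Fin (Module.finrank ℝ X) → ℝ).le_opNorm h)
  rw [h2]
  calc |∑ i, e h i * T (b i)| ≤ ∑ i, |e h i * T (b i)| := Finset.abs_sum_le_sum_abs _ _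
    _ ≤ ∑ _i : Fin (Module.finrank ℝ X), ‖(e : X →L[ℝ] Fin (Module.finrank ℝ X) → ℝ)‖ * ‖h‖ * η := by
      refine Finset.sum_le_sum fun i _ => ?_
      rw [abs_mul]
      exact mul_le_mul (h3 i) (hT _ (by simp)) (abs_nonneg _) (by positivity)
    _ ≤ _ := by
      rw [Finset.sum_const, Finset.card_univ, Fintype.card_fin, nsmul_eq_mul]
      nlinarith [mul_nonneg hη (norm_nonneg h)]

lemma exists_twist_small (f g : L2) {η : ℝ} (hη : 0 < η) : ∃ ρ : ℝ, ∀ (κ : ℂ) (v z : E3),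
    ‖κ‖ = 1 → ρ ≤ ‖v‖ ∨ ρ ≤ ‖z‖ → |rin f (twist κ v z g)| ≤ η := by
  obtain ⟨ρ, h⟩ := exists_phase_small f g hη
  refine ⟨ρ, fun κ v z hκ hvz => ?_⟩
  refine (abs_rin_le _ _).trans ?_
  rw [twist_apply, inner_smul_right, norm_mul, hκ, one_mul]
  exact h v z hvz

lemma exists_uniform_bound {ι : Type*} (S : Finset ι) {p : ι → ℝ → Prop}
    (hp : ∀ i ρ ρ', ρ ≤ ρ' → p i ρ → p i ρ') (h : ∀ i, ∃ ρ, p i ρ) : ∃ ρ, ∀ i ∈ S, p i ρ := by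
  choose r hr using h
  refine ⟨∑ i ∈ S, |r i|, fun i hi => hp i _ _ ?_ (hr i)⟩
  exact (le_abs_self _).trans (Finset.single_le_sum (f := fun i => |r i|)
    (fun _ _ => abs_nonneg _) hi)

section
variable {X : Type*} [NormedAddCommGroup X] [NormedSpace ℝ X] [FiniteDimensional ℝ X]

lemma exists_twist_small_right (f : L2) (A : X →L[ℝ] L2) {η : ℝ} (hη : 0 < η) : ∃ ρ : ℝ,
    ∀ (κ : ℂ) (v z : E3), ‖κ‖ = 1 → ρ ≤ ‖v‖ ∨ ρ ≤ ‖z‖ →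
      ∀ h, |rin f (twist κ v z (A h))| ≤ η * ‖h‖ := by
  obtain ⟨C, hC, S, hS⟩ := exists_finite_bound X
  obtain ⟨ρ, hρ⟩ := exists_uniform_bound S (p := fun x ρ => ∀ (κ : ℂ) (v z : E3), ‖κ‖ = 1 →
    ρ ≤ ‖v‖ ∨ ρ ≤ ‖z‖ → |rin f (twist κ v z (A x))| ≤ η / C)
    (fun i r r' hr h κ v z hκ hvz => h κ v z hκ (hvz.imp hr.trans hr.trans))
    (fun x => exists_twist_small f (A x) (div_pos hη hC))
  refine ⟨ρ, fun κ v z hκ hvz h => ?_⟩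
  have := hS (rin f ∘L (twist κ v z).restrictScalars ℝ ∘L A) (η / C) (by positivity)
    (fun x hx => hρ x hx κ v z hκ hvz) h
  rwa [mul_div_cancel₀ _ hC.ne'] at this

lemma exists_twist_small_left (f : L2) (A : X →L[ℝ] L2) {η : ℝ} (hη : 0 < η) : ∃ ρ : ℝ,
    ∀ (κ : ℂ) (v z : E3), ‖κ‖ = 1 → ρ ≤ ‖v‖ ∨ ρ ≤ ‖z‖ →
      ∀ h, |rin (A h) (twist κ v z f)| ≤ η * ‖h‖ := by
  obtain ⟨C, hC, S, hS⟩ := exists_finite_bound X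
  obtain ⟨ρ, hρ⟩ := exists_uniform_bound S (p := fun x ρ => ∀ (κ : ℂ) (v z : E3), ‖κ‖ = 1 →
    ρ ≤ ‖v‖ ∨ ρ ≤ ‖z‖ → |rin (A x) (twist κ v z f)| ≤ η / C)
    (fun i r r' hr h κ v z hκ hvz => h κ v z hκ (hvz.imp hr.trans hr.trans))
    (fun x => exists_twist_small (A x) f (div_pos hη hC))
  refine ⟨ρ, fun κ v z hκ hvz h => ?_⟩
  have := hS (rin (twist κ v z f) ∘L A) (η / C) (by positivity)
    (fun x hx => by rw [ContinuousLinearMap.comp_apply, rin_comm]; exact hρ x hx κ v z hκ hvz) h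
  rwa [mul_div_cancel₀ _ hC.ne', ContinuousLinearMap.comp_apply, rin_comm] at this

end

section
variable {X F J K : Type*} [NormedAddCommGroup X] [NormedSpace ℝ X] [FiniteDimensional ℝ X]
  [NormedAddCommGroup F] [NormedSpace ℝ F] [Fintype J] [Fintype K] [DecidableEq J] [DecidableEq K]
  {B : F →L[ℝ] F →L[ℝ] ℝ} {e : J → X → F} {g q : X → F} {qd : K → X → F}

lemma exists_uniform_modFun (hdim : Module.finrank ℝ X = Module.finrank ℝ (J ⊕ K → ℝ)) {x₀ : X}
    (he : ∀ j, ContDiffAt ℝ ∞ (e j) x₀) (hg : ContDiffAt ℝ ∞ g x₀) (hq : ContDiffAt ℝ ∞ q x₀)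
    (hqd : ∀ j, ContDiffAt ℝ ∞ (qd j) x₀) {A q' : X →L[ℝ] F} (hA : HasFDerivAt g A x₀)
    (hq' : HasFDerivAt q q' x₀) (hq0 : q x₀ = 0)
    (hN : ∀ h, (∀ j, B (e j x₀) (A h) = 0) → (∀ j, B (q' h) (qd j x₀) = 0) → h = 0) :
    ∃ η > 0, ∃ r₀ > 0, ∃ ε₀ > 0, (∀ U : F →L[ℝ] F, ‖U‖ ≤ 1 →
      (∀ j h, |B (e j x₀) (U (q' h))| ≤ η * ‖h‖) → (∀ j h, |B (A h) (U (qd j x₀))| ≤ η * ‖h‖) →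
      ∀ b, ‖b - g x₀‖ < ε₀ →
        InjOn (fun x => modFun B e g q qd (x, b) (U, 1)) (Metric.ball x₀ r₀) ∧
        ∀ x ∈ Metric.ball x₀ r₀, ∀ A : X →L[ℝ] J ⊕ K → ℝ,
          HasFDerivAt (fun x => modFun B e g q qd (x, b) (U, 1)) A x → Function.Injective A) ∧
      ∀ r > 0, ∃ ε > 0, ∀ U : F →L[ℝ] F, ‖U‖ ≤ 1 →
        (∀ j h, |B (e j x₀) (U (q' h))| ≤ η * ‖h‖) → (∀ j h, |B (A h) (U (qd j x₀))| ≤ η * ‖h‖) →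
        ∀ b, ‖b - g x₀‖ < ε → ∃ x ∈ Metric.ball x₀ r, modFun B e g q qd (x, b) (U, 1) = 0 := by
  have hder := fderiv_modFun_apply (B := B) he hg hq hqd hA hq' hq0
  have hst : HasStrictFDerivAt (modFun B e g q qd) (fderiv ℝ (modFun B e g q qd) (x₀, g x₀))
      (x₀, g x₀) :=
    (contDiffAt_modFun (z := (x₀, g x₀)) he hg hq hqd).hasStrictFDerivAt (by simp)
  let N : X →L[ℝ] J ⊕ K → ℝ := ContinuousLinearMap.pi (Sum.elim
    (fun j => -(B (e j x₀) ∘L A)) (fun j => -(B.flip (qd j x₀) ∘L q')))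
  have hNl : ∀ k j, N k (.inl j) = -B (e j x₀) (A k) := fun _ _ => rfl
  have hNr : ∀ k j, N k (.inr j) = -B (q' k) (qd j x₀) := fun _ _ => rfl
  have hNi : Function.Injective N := by
    rw [injective_iff_map_eq_zero]
    refine fun k hk => hN k (fun j => ?_) fun j => ?_
    · rw [← neg_eq_zero, ← hNl, hk]; rfl
    · rw [← neg_eq_zero, ← hNr, hk]; rfl
  obtain ⟨η, hη, r₀, hr₀, ε₀, hε₀, H1, H2⟩ := exists_uniform_zero hdim hst hNi
  have hσ : ∀ U : F →L[ℝ] F, ‖U‖ ≤ 1 → ‖((U, 1) : (F →L[ℝ] F) × ℝ)‖ ≤ 1 := fun U hU => by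
    rw [Prod.norm_def]
    exact max_le hU (by simp)
  have hsm : ∀ U : F →L[ℝ] F, (∀ j h, |B (e j x₀) (U (q' h))| ≤ η * ‖h‖) →
      (∀ j h, |B (A h) (U (qd j x₀))| ≤ η * ‖h‖) → ∀ k,
      ‖fderiv ℝ (modFun B e g q qd) (x₀, g x₀) (k, 0) (U, 1) - N k‖ ≤ η * ‖k‖ := by
    intro U h1 h2 k
    refine (pi_norm_le_iff_of_nonneg (by positivity)).2 fun i => ?_
    rw [Real.norm_eq_abs, Pi.sub_apply]
    rcases i with j | j
    · rw [(hder U k).1 j, hNl, sub_sub_cancel_left, abs_neg]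
      exact h1 j k
    · rw [(hder U k).2 j, hNr, sub_neg_eq_add, sub_add_cancel, abs_neg]
      exact h2 j k
  have hz : ∀ U : F →L[ℝ] F, modFun B e g q qd (x₀, g x₀) (U, 1) = 0 := by
    intro U
    funext i
    rcases i with j | j
    · rw [modFun_inl]
      simp [hq0]
    · rw [modFun_inr]
      simp [hq0]
  refine ⟨η, hη, r₀, hr₀, ε₀, hε₀, fun U hU h1 h2 => H1 _ (hσ U hU) (hsm U h1 h2), fun r hr => ?_⟩
  obtain ⟨ε, hε, H3⟩ := H2 r hr
  exact ⟨ε, hε, fun U hU h1 h2 => H3 _ (hσ U hU) (hsm U h1 h2) (hz U)⟩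

end

section
variable {V : 𝓢(E3, ℝ)} {β : ℝ → ℝ} {e₀ : ℝ} {φ₀ : Sob 2} {a : ℝ} {Q : ℂ → Sob 2} {E : ℂ → ℝ}

lemma SmallBoundStates.apply_zero (h : SmallBoundStates V β e₀ φ₀ a Q E) (ha : 0 < a) :
    Q 0 = 0 := by
  obtain ⟨C, hC⟩ := h.remainder_bound
  have := hC 0 (by simpa using ha)
  simpa using this

lemma SmallBoundStates.contDiffAt (h : SmallBoundStates V β e₀ φ₀ a Q E) {w : ℂ} (hw : ‖w‖ < a) :
    ContDiffAt ℝ ∞ Q w :=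
  h.smooth.contDiffAt (Metric.isOpen_ball.mem_nhds (by simpa using hw))

lemma SmallBoundStates.contDiffAt_fderiv (h : SmallBoundStates V β e₀ φ₀ a Q E) {w : ℂ}
    (hw : ‖w‖ < a) (e : ℂ) : ContDiffAt ℝ ∞ (fun w => fderiv ℝ Q w e) w :=
  ((h.contDiffAt hw).fderiv_right (m := ∞) (by simp)).clm_apply contDiffAt_const

lemma SmallBoundStates.fderiv_zero (h : SmallBoundStates V β e₀ φ₀ a Q E) (ha : 0 < a) (e : ℂ) :
    fderiv ℝ Q 0 e = e • φ₀ := by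
  obtain ⟨C, hC⟩ := h.remainder_bound
  have hd : HasFDerivAt Q ((ContinuousLinearMap.id ℝ ℂ).smulRight φ₀) 0 := by
    refine hasFDerivAt_of_quadratic (K := |C| * (a / 2)) (half_pos ha) fun w hw => ?_
    rw [sub_zero] at hw ⊢
    rw [h.apply_zero ha, sub_zero, ContinuousLinearMap.smulRight_apply,
      ContinuousLinearMap.id_apply]
    have h1 : C * ‖w‖ ^ 3 ≤ |C| * ‖w‖ ^ 3 :=
      mul_le_mul_of_nonneg_right (le_abs_self C) (by positivity)
    have h2 : |C| * ‖w‖ ^ 3 ≤ |C| * (a / 2) * ‖w‖ ^ 2 := by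
      rw [pow_succ', ← mul_assoc]
      gcongr
    exact (hC w (by linarith)).trans (h1.trans h2)
  rw [hd.fderiv]
  rfl

variable {O : Set ℝ} {φ : ℝ → E3 → ℝ}

/-- The modulation equations in the coordinates `(D, ϑ, v, ω, w)` for the datum `b`. -/
def modSys (φ : ℝ → E3 → ℝ) (lab : Option (Fin 3) × Bool → ℝ → L2) (Q : ℂ → Sob 2) (c : ℂ) :
    ModPar × L2 → (L2 →L[ℝ] L2) × ℝ →L[ℝ] ModIdx → ℝ :=
  modFun rin (fun j x => gen (lab j) x) (gen (gsL2 φ)) (fun x => sobL2 (Q x.2.2.2.2))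
    (fun b x => c • sobL2 (fderiv ℝ Q x.2.2.2.2 (cond b Complex.I 1)))

lemma gen_base (f : ℝ → L2) (s : ℝ) (w : ℂ) : gen f (0, 0, 0, s, w) = f s := by
  rw [gen_eq]
  simp only [smul_zero, modul_zero, Circle.exp_zero, actL_zero_one]

lemma modSys_inl (c : ℂ) (lab : Option (Fin 3) × Bool → ℝ → L2) (x : ModPar) (b : L2)
    (U : L2 →L[ℝ] L2) (j : Option (Fin 3) × Bool) : modSys φ lab Q c (x, b) (U, 1) (.inl j) =
      rin (gen (lab j) x) (b - gen (gsL2 φ) x - U (sobL2 (Q x.2.2.2.2))) :=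
  modFun_inl _ _ _

lemma modSys_inr (c : ℂ) (lab : Option (Fin 3) × Bool → ℝ → L2) (x : ModPar) (b : L2)
    (U : L2 →L[ℝ] L2) (j : Bool) : modSys φ lab Q c (x, b) (U, 1) (.inr j) =
      rin (b - gen (gsL2 φ) x) (U (c • sobL2 (fderiv ℝ Q x.2.2.2.2 (cond j Complex.I 1)))) -
        rin (sobL2 (Q x.2.2.2.2)) (c • sobL2 (fderiv ℝ Q x.2.2.2.2 (cond j Complex.I 1))) :=
  modFun_inr _ _ _

lemma SmallBoundStates.contDiffAt_sobL2 (h : SmallBoundStates V β e₀ φ₀ a Q E) {x : ModPar}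
    (hx : ‖x.2.2.2.2‖ < a) :
    ContDiffAt ℝ ∞ (fun x : ModPar => sobL2 (Q x.2.2.2.2)) x ∧
    ∀ c e : ℂ, ContDiffAt ℝ ∞ (fun x : ModPar => c • sobL2 (fderiv ℝ Q x.2.2.2.2 e)) x := by
  have hW : ContDiffAt ℝ ∞ (fun x : ModPar => x.2.2.2.2) x := modParW.contDiff.contDiffAt
  refine ⟨?_, fun c e => ?_⟩
  · have h1 : ContDiffAt ℝ ∞ (fun x : ModPar => Q x.2.2.2.2) x :=
      ContDiffAt.comp (g := Q) x (h.contDiffAt hx) hW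
    have h2 : ContDiff ℝ ∞ (sobL2 (n := 2)) :=
      ((sobL2 (n := 2)).restrictScalars ℝ).contDiff
    exact h2.contDiffAt.comp x h1
  · have h1 : ContDiffAt ℝ ∞ (fun x : ModPar => fderiv ℝ Q x.2.2.2.2 e) x :=
      ContDiffAt.comp (g := fun w => fderiv ℝ Q w e) x (h.contDiffAt_fderiv hx e) hW
    have h2 : ContDiff ℝ ∞ (c • sobL2 (n := 2) : Sob 2 →L[ℂ] L2) :=
      ((c • sobL2 (n := 2) : Sob 2 →L[ℂ] L2).restrictScalars ℝ).contDiff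
    exact h2.contDiffAt.comp x h1

lemma exists_uniform_modulation (hO : GroundStates β O φ)
    {lab : Option (Fin 3) × Bool → ℝ → L2} (hl : IsLabels O (gsL2 φ) lab) {s : ℝ} (hs : s ∈ O)
    (h : SmallBoundStates V β e₀ φ₀ a Q E) (hφ₀ : LinearGroundState V e₀ φ₀) (ha : 0 < a) {c : ℂ}
    (hc : c ≠ 0) :
    ∃ ρ : ℝ, ∃ r₀ > 0, ∃ ε₀ > 0, (∀ (κ : ℂ) (v z : E3), ‖κ‖ = 1 → ρ ≤ ‖v‖ ∨ ρ ≤ ‖z‖ →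
      ∀ b, ‖b - gsL2 φ s‖ < ε₀ → InjOn (fun x => modSys φ lab Q c (x, b)
          ((twist κ v z).restrictScalars ℝ, 1)) (Metric.ball (0, 0, 0, s, 0) r₀) ∧
        ∀ x ∈ Metric.ball (0, 0, 0, s, 0) r₀, ∀ A : ModPar →L[ℝ] ModIdx → ℝ,
          HasFDerivAt (fun x => modSys φ lab Q c (x, b)
            ((twist κ v z).restrictScalars ℝ, 1)) A x → Function.Injective A) ∧
      ∀ r > 0, ∃ ε > 0, ∀ (κ : ℂ) (v z : E3), ‖κ‖ = 1 → ρ ≤ ‖v‖ ∨ ρ ≤ ‖z‖ →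
        ∀ b, ‖b - gsL2 φ s‖ < ε → ∃ x ∈ Metric.ball (0, 0, 0, s, 0) r,
          modSys φ lab Q c (x, b) ((twist κ v z).restrictScalars ℝ, 1) = 0 := by
  set x₀ : ModPar := (0, 0, 0, s, 0) with hx₀
  obtain ⟨A, hA, hA'⟩ := hl.hasFDerivAt_gen hO.isOpen hO.smoothFam hs
  rw [← hx₀] at hA
  have hw0 : ‖(0 : ℂ)‖ < a := by simpa using ha
  have he : ∀ j, ContDiffAt ℝ ∞ (fun x => gen (lab j) x) x₀ := fun j =>
    contDiffAt_gen hO.isOpen (hl.diffFam j) hs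
  have hg : ContDiffAt ℝ ∞ (gen (gsL2 φ)) x₀ := contDiffAt_gen hO.isOpen hO.smoothFam.diffFam hs
  have hq := (h.contDiffAt_sobL2 (x := x₀) hw0).1
  have hqd : ∀ b : Bool, ContDiffAt ℝ ∞ (fun x : ModPar =>
      c • sobL2 (fderiv ℝ Q x.2.2.2.2 (cond b Complex.I 1))) x₀ := fun b =>
    (h.contDiffAt_sobL2 (x := x₀) hw0).2 c _
  have hQd : HasFDerivAt Q (fderiv ℝ Q 0) (0 : ℂ) :=
    ((h.contDiffAt hw0).differentiableAt (by simp)).hasFDerivAt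
  have hq' : HasFDerivAt (fun x : ModPar => sobL2 (Q x.2.2.2.2))
      (sobL2.restrictScalars ℝ ∘L fderiv ℝ Q 0 ∘L modParW) x₀ :=
    (sobL2.restrictScalars ℝ).hasFDerivAt.comp x₀
      (HasFDerivAt.comp x₀ (g := Q) hQd modParW.hasFDerivAt)
  have hq'a : ∀ k : ModPar, (sobL2.restrictScalars ℝ ∘L fderiv ℝ Q 0 ∘L modParW) k =
      k.2.2.2.2 • sobL2 φ₀ := fun k => by
    change sobL2 (fderiv ℝ Q 0 k.2.2.2.2) = _
    rw [h.fderiv_zero ha, map_smul]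
  have hq0 : sobL2 (Q x₀.2.2.2.2) = 0 := by
    change sobL2 (Q 0) = 0
    rw [h.apply_zero ha, map_zero]
  have hg0 : gen (gsL2 φ) x₀ = gsL2 φ s := gen_base _ _ _
  have he0 : ∀ j, gen (lab j) x₀ = lab j s := fun j => gen_base _ _ _
  have hqd0 : ∀ b : Bool, c • sobL2 (fderiv ℝ Q x₀.2.2.2.2 (cond b Complex.I 1)) =
      (c * cond b Complex.I 1) • sobL2 φ₀ := fun b => by
    change c • sobL2 (fderiv ℝ Q 0 _) = _
    rw [h.fderiv_zero ha, map_smul, smul_smul]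
  have hN : ∀ k : ModPar, (∀ j, rin (gen (lab j) x₀) (A k) = 0) →
      (∀ b : Bool, rin ((sobL2.restrictScalars ℝ ∘L fderiv ℝ Q 0 ∘L modParW) k)
        (c • sobL2 (fderiv ℝ Q x₀.2.2.2.2 (cond b Complex.I 1))) = 0) → k = 0 := by
    intro k h1 h2
    simp only [hA', he0] at h1
    obtain ⟨e1, e2, e3, e4⟩ := hO.eq_zero_of_rin_labels hl hs h1
    simp only [hqd0, hq'a] at h2
    simp only [rin_apply, inner_smul_left, inner_smul_right, hφ₀.inner_self, mul_one] at h2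
    have e5 : k.2.2.2.2 = 0 := by
      have h3 := h2 false
      have h4 := h2 true
      simp at h3 h4
      have h5 : conj c * k.2.2.2.2 = 0 := by
        apply Complex.ext
        · simp; linarith
        · simp; linarith
      exact (mul_eq_zero.1 h5).resolve_left (by simpa using hc)
    exact Prod.ext e2 (Prod.ext e4 (Prod.ext e1 (Prod.ext e3 e5)))
  obtain ⟨η, hη, r₀, hr₀, ε₀, hε₀, H1, H2⟩ := exists_uniform_modFun finrank_modPar he hg hq hqd
    hA hq' hq0 hN
  rw [hg0] at H1 H2
  obtain ⟨ρ₁, hρ₁⟩ := exists_uniform_bound Finset.univ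
    (p := fun j ρ => ∀ (κ : ℂ) (v z : E3), ‖κ‖ = 1 → ρ ≤ ‖v‖ ∨ ρ ≤ ‖z‖ → ∀ k,
      |rin (gen (lab j) x₀) (twist κ v z
        ((sobL2.restrictScalars ℝ ∘L fderiv ℝ Q 0 ∘L modParW) k))| ≤ η * ‖k‖)
    (fun i r r' hr h κ v z hκ hvz => h κ v z hκ (hvz.imp hr.trans hr.trans))
    (fun j => exists_twist_small_right _ _ hη)
  obtain ⟨ρ₂, hρ₂⟩ := exists_uniform_bound Finset.univ
    (p := fun b ρ => ∀ (κ : ℂ) (v z : E3), ‖κ‖ = 1 → ρ ≤ ‖v‖ ∨ ρ ≤ ‖z‖ → ∀ k,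
      |rin (A k) (twist κ v z (c • sobL2 (fderiv ℝ Q x₀.2.2.2.2 (cond b Complex.I 1))))| ≤
        η * ‖k‖)
    (fun i r r' hr h κ v z hκ hvz => h κ v z hκ (hvz.imp hr.trans hr.trans))
    (fun b => exists_twist_small_left _ _ hη)
  have g1 : ∀ {v z : E3}, max ρ₁ ρ₂ ≤ ‖v‖ ∨ max ρ₁ ρ₂ ≤ ‖z‖ → ρ₁ ≤ ‖v‖ ∨ ρ₁ ≤ ‖z‖ := fun h =>
    h.imp (le_max_left _ _).trans (le_max_left _ _).trans
  have g2 : ∀ {v z : E3}, max ρ₁ ρ₂ ≤ ‖v‖ ∨ max ρ₁ ρ₂ ≤ ‖z‖ → ρ₂ ≤ ‖v‖ ∨ ρ₂ ≤ ‖z‖ := fun h =>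
    h.imp (le_max_right _ _).trans (le_max_right _ _).trans
  refine ⟨max ρ₁ ρ₂, r₀, hr₀, ε₀, hε₀, fun κ v z hκ hvz => H1 _ (norm_twist_le hκ v z)
    (fun j => hρ₁ j (Finset.mem_univ _) κ v z hκ (g1 hvz))
    (fun j => hρ₂ j (Finset.mem_univ _) κ v z hκ (g2 hvz)), fun r hr => ?_⟩
  obtain ⟨ε, hε, H3⟩ := H2 r hr
  exact ⟨ε, hε, fun κ v z hκ hvz => H3 _ (norm_twist_le hκ v z)
    (fun j => hρ₁ j (Finset.mem_univ _) κ v z hκ (g1 hvz))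
    (fun j => hρ₂ j (Finset.mem_univ _) κ v z hκ (g2 hvz))⟩

end

/-! ### The modulation equations in coordinates -/

section
variable {V : 𝓢(E3, ℝ)} {β : ℝ → ℝ} {e₀ : ℝ} {φ₀ : Sob 2} {a : ℝ} {Q : ℂ → Sob 2} {E : ℂ → ℝ}
variable {O : Set ℝ} {φ : ℝ → E3 → ℝ}

lemma GroundStates.modulationEqs_iff_modSys (h : GroundStates β O φ)
    {lab : Option (Fin 3) × Bool → ℝ → L2} (hl : IsLabels O (gsL2 φ) lab) {x : ModPar}
    (hx : x.2.2.2.1 ∈ O) (Q : ℂ → Sob 2) (c : ℂ) (v y₀ : E3) (t : ℝ) (u : Sob 1) (D : E3)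
    (ζ : Circle) {U : L2 →L[ℂ] L2} (hU : ∀ f, actL (-D) ζ⁻¹ (galL v y₀ t f) = U f) :
    ModulationEqs O φ Q c v y₀ t u (D + x.1) (ζ * Circle.exp x.2.1)
      (paramMap φ (x.2.2.2.1, x.2.2.1)) x.2.2.2.2 ↔
    modSys φ lab Q c (x, actL (-D) ζ⁻¹ (sobL2 u)) (U.restrictScalars ℝ, 1) = 0 := by
  have hgen : ∀ f : ℝ → L2, actL (D + x.1) (ζ * Circle.exp x.2.1)
      (modul ((1 / 2 : ℝ) • x.2.2.1) (f x.2.2.2.1)) = actL D ζ (gen f x) := fun f => by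
    rw [actL_add, gen_eq]
  have hgal : ∀ f, galL v y₀ t f = actL D ζ (U f) := fun f => by rw [← hU, actL_inv_right]
  have hUU : ∀ f g, rin (U f) (U g) = rin f g := fun f g => by
    rw [← hU, ← hU, rin_actL, rin_galL]
  have hR : actL D ζ (actL (-D) ζ⁻¹ (sobL2 u) - gen (gsL2 φ) x - U (sobL2 (Q x.2.2.2.2))) =
      sobL2 u - actL (D + x.1) (ζ * Circle.exp x.2.1)
      (modul ((1 / 2 : ℝ) • x.2.2.1) (gsL2 φ x.2.2.2.1)) - galL v y₀ t (sobL2 (Q x.2.2.2.2)) := by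
    rw [map_sub, map_sub, actL_inv_right, hgen, hgal]
  rw [h.modulationEqs_iff hl hx Q c v y₀ t u _ _ _ _ hR]
  have e1 : ∀ j, rin (actL (D + x.1) (ζ * Circle.exp x.2.1)
      (modul ((1 / 2 : ℝ) • x.2.2.1) (lab j x.2.2.2.1)))
      (actL D ζ (actL (-D) ζ⁻¹ (sobL2 u) - gen (gsL2 φ) x - U (sobL2 (Q x.2.2.2.2)))) =
      modSys φ lab Q c (x, actL (-D) ζ⁻¹ (sobL2 u)) (U.restrictScalars ℝ, 1) (.inl j) :=
    fun j => by rw [hgen, rin_actL, modSys_inl]; rfl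
  have e2 : ∀ b : Bool, rin (c • galL v y₀ t (sobL2 (fderiv ℝ Q x.2.2.2.2 (cond b Complex.I 1))))
      (actL D ζ (actL (-D) ζ⁻¹ (sobL2 u) - gen (gsL2 φ) x - U (sobL2 (Q x.2.2.2.2)))) =
      modSys φ lab Q c (x, actL (-D) ζ⁻¹ (sobL2 u)) (U.restrictScalars ℝ, 1) (.inr b) := by
    intro b
    rw [modSys_inr, hgal, ← map_smul, ← map_smul, rin_actL, rin_comm, map_sub, sub_apply,
      hUU]
    rfl
  constructor
  · rintro ⟨h1, h2⟩
    funext i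
    rcases i with j | b
    · rw [← e1, h1, Pi.zero_apply]
    · rw [← e2, Pi.zero_apply]
      cases b
      · exact h2 1 (by simp)
      · exact h2 Complex.I (by simp)
  · intro h0
    refine ⟨fun j => by rw [e1, h0, Pi.zero_apply], ?_⟩
    rintro e (rfl | rfl)
    · exact (e2 false).trans (by rw [h0, Pi.zero_apply])
    · exact (e2 true).trans (by rw [h0, Pi.zero_apply])

/-! ### The modulation parameters of nearby orbits -/

lemma trans_nsmul_eq {f : L2} {D : E3} (h : trans D f = f) (n : ℕ) : trans ((n : ℝ) • D) f = f := by
  induction n with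
  | zero => rw [Nat.cast_zero, zero_smul, trans_zero]
  | succ n ih => rw [Nat.cast_succ, add_smul, one_smul, trans_add, h, ih]

lemma trans_ne_self {f : L2} (hf : f ≠ 0) {D : E3} (hD : D ≠ 0) : trans D f ≠ f := by
  intro h
  have hp : 0 < ‖f‖ ^ 2 := by positivity
  obtain ⟨ρ, hρ⟩ := exists_trans_small f f (half_pos hp)
  obtain ⟨n, hn⟩ := exists_nat_ge (ρ / ‖D‖)
  have hn' : ρ ≤ ‖(n : ℝ) • D‖ := by
    rw [norm_smul, Real.norm_natCast]
    exact (div_le_iff₀ (norm_pos_iff.2 hD)).1 hn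
  have h1 := hρ 0 _ hn'
  rw [modul_zero, trans_nsmul_eq h, inner_self_eq_norm_sq_to_K] at h1
  have h2 : ‖((‖f‖ : ℝ) : ℂ) ^ 2‖ ≤ ‖f‖ ^ 2 / 2 := h1
  rw [norm_pow, Complex.norm_real, norm_norm] at h2
  linarith

lemma exists_trans_stability {f : L2} (hf : f ≠ 0) {δ : ℝ} (hδ : 0 < δ) :
    ∃ μ > 0, ∀ D : E3, ‖trans D f - f‖ < μ → ‖D‖ < δ := by
  have hp : 0 < ‖f‖ ^ 2 := by positivity
  obtain ⟨ρ, hρ⟩ := exists_trans_small f f (half_pos hp)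
  have hfar : ∀ D : E3, ρ ≤ ‖D‖ → ‖f‖ / 2 ≤ ‖trans D f - f‖ := by
    intro D hD
    have h1 := hρ 0 D hD
    rw [modul_zero] at h1
    have h2 : ‖inner ℂ f (trans D f - f)‖ ≤ ‖f‖ * ‖trans D f - f‖ := norm_inner_le_norm _ _
    rw [inner_sub_right, norm_sub_rev] at h2
    have h3 := (norm_sub_norm_le (inner ℂ f f) (inner ℂ f (trans D f))).trans h2
    rw [inner_self_eq_norm_sq_to_K] at h3
    have h4 : ‖((‖f‖ : ℝ) : ℂ) ^ 2‖ - ‖inner ℂ f (trans D f)‖ ≤ ‖f‖ * ‖trans D f - f‖ := h3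
    rw [norm_pow, Complex.norm_real, norm_norm] at h4
    have h5 : 0 < ‖f‖ := norm_pos_iff.2 hf
    have h6 : ‖f‖ * (‖f‖ / 2) ≤ ‖f‖ * ‖trans D f - f‖ := by nlinarith
    exact le_of_mul_le_mul_left h6 h5
  have hK : IsCompact (Metric.closedBall (0 : E3) ρ \ Metric.ball 0 δ) :=
    (isCompact_closedBall 0 ρ).diff Metric.isOpen_ball
  have hc : Continuous fun D : E3 => ‖trans D f - f‖ := by
    have h1 : Continuous fun D : E3 => trans D f :=
      Continuous.comp (g := fun z : E3 × L2 => trans z.1 z.2) (f := fun D => (D, f))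
        continuous_trans (Continuous.prodMk_left f)
    exact (h1.sub continuous_const).norm
  obtain ⟨μ, hμ, hμ'⟩ : ∃ μ > 0, ∀ D ∈ Metric.closedBall (0 : E3) ρ \ Metric.ball 0 δ,
      μ ≤ ‖trans D f - f‖ := by
    rcases (Metric.closedBall (0 : E3) ρ \ Metric.ball 0 δ).eq_empty_or_nonempty with h0 | h0
    · exact ⟨1, one_pos, fun D hD => by rw [h0] at hD; exact hD.elim⟩
    · obtain ⟨D₀, hD₀, hm⟩ := hK.exists_isMinOn h0 hc.continuousOn
      refine ⟨‖trans D₀ f - f‖, norm_pos_iff.2 (sub_ne_zero.2 (trans_ne_self hf ?_)),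
        fun D hD => hm hD⟩
      rintro rfl
      exact hD₀.2 (Metric.mem_ball_self hδ)
  refine ⟨min μ (‖f‖ / 2), lt_min hμ (half_pos (norm_pos_iff.2 hf)), fun D hD => ?_⟩
  by_contra hDδ
  rcases le_total ρ ‖D‖ with h1 | h1
  · exact absurd (hfar D h1) (not_le.2 (hD.trans_le (min_le_right _ _)))
  · exact absurd (hμ' D ⟨by simpa using h1, by simpa using hDδ⟩)
      (not_le.2 (hD.trans_le (min_le_left _ _)))

/-- The translations and phases which almost fix a positive function are small. -/
lemma exists_stability {f : L2} (hf : f ≠ 0) (hr : ∀ᵐ x, 0 ≤ (f x).re ∧ (f x).im = 0) {δ : ℝ}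
    (hδ : 0 < δ) : ∃ ε > 0, ∀ (D : E3) (ζ : Circle), ‖actL D ζ f - f‖ < ε →
      ‖D‖ < δ ∧ ‖(ζ : ℂ) - 1‖ < δ := by
  obtain ⟨μ, hμ, hμ'⟩ := exists_trans_stability hf hδ
  have hf0 : 0 < ‖f‖ := norm_pos_iff.2 hf
  refine ⟨min (μ / 3) (‖f‖ * δ / 2), by positivity, fun D ζ h => ?_⟩
  obtain ⟨g, hg, hg'⟩ : ∃ g : ℝ, 0 ≤ g ∧ inner ℂ f (trans (-D) f) = (g : ℂ) := by
    refine ⟨∫ x, (trans (-D) f x).re * (f x).re, integral_nonneg_of_ae ?_, ?_⟩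
    · filter_upwards [hr, trans_coe (-D) f, ae_comp_add (-D) hr] with x h1 h2 h3
      rw [h2]
      exact mul_nonneg h3.1 h1.1
    · rw [l2_inner_eq, ← integral_complex_ofReal]
      refine integral_congr_ae ?_
      filter_upwards [hr, trans_coe (-D) f, ae_comp_add (-D) hr] with x h1 h2 h3
      rw [h2]
      apply Complex.ext <;> simp [h1.2, h3.2]
  set ε := ‖actL D ζ f - f‖ with hε
  have h1 : ‖(ζ : ℂ) * g - (‖f‖ ^ 2 : ℝ)‖ ≤ ‖f‖ * ε := by
    have h2 := norm_inner_le_norm (𝕜 := ℂ) f (actL D ζ f - f)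
    rw [inner_sub_right, actL_apply, inner_smul_right, hg', inner_self_eq_norm_sq_to_K] at h2
    rw [hε, Complex.ofReal_pow]
    exact h2
  have h2 : |g - ‖f‖ ^ 2| ≤ ‖f‖ * ε := by
    have h3 := (abs_norm_sub_norm_le ((ζ : ℂ) * g) (‖f‖ ^ 2 : ℝ)).trans h1
    rwa [norm_mul, Circle.norm_coe, one_mul, Complex.norm_real, Complex.norm_real,
      Real.norm_of_nonneg hg, Real.norm_of_nonneg (by positivity)] at h3
  have h3 : ‖f‖ * ‖(ζ : ℂ) - 1‖ ≤ 2 * ε := by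
    have e1 : ((ζ : ℂ) - 1) * (‖f‖ ^ 2 : ℝ) =
        (ζ : ℂ) * (((‖f‖ ^ 2 - g : ℝ)) : ℂ) + ((ζ : ℂ) * g - (‖f‖ ^ 2 : ℝ)) := by
      push_cast; ring
    have e2 := congrArg norm e1
    rw [norm_mul, Complex.norm_real, Real.norm_of_nonneg (by positivity : 0 ≤ ‖f‖ ^ 2)] at e2
    have e3 := norm_add_le ((ζ : ℂ) * (((‖f‖ ^ 2 - g : ℝ)) : ℂ)) ((ζ : ℂ) * g - (‖f‖ ^ 2 : ℝ))
    rw [norm_mul, Circle.norm_coe, one_mul, Complex.norm_real, Real.norm_eq_abs, abs_sub_comm]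
      at e3
    have e4 : ‖f‖ * (‖f‖ * ‖(ζ : ℂ) - 1‖) ≤ ‖f‖ * (2 * ε) := by nlinarith
    exact le_of_mul_le_mul_left e4 hf0
  have h4 : ‖trans (-D) f - f‖ ≤ 3 * ε := by
    have e1 : (ζ : ℂ) • (trans (-D) f - f) = (actL D ζ f - f) - ((ζ : ℂ) - 1) • f := by
      rw [actL_apply, smul_sub, sub_smul, one_smul]; abel
    have e2 := congrArg norm e1
    rw [norm_smul, Circle.norm_coe, one_mul] at e2
    have e3 := norm_sub_le (actL D ζ f - f) (((ζ : ℂ) - 1) • f)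
    rw [norm_smul, mul_comm] at e3
    linarith
  have h5 : ε < μ / 3 := h.trans_le (min_le_left _ _)
  have h6 : ε < ‖f‖ * δ / 2 := h.trans_le (min_le_right _ _)
  refine ⟨?_, ?_⟩
  · have := hμ' (-D) (by linarith)
    rwa [norm_neg] at this
  · refine lt_of_mul_lt_mul_left (a := ‖f‖) ?_ hf0.le
    linarith

/-! ### Coordinates for the modulation parameters -/

lemma exists_arg_small {r : ℝ} (hr : 0 < r) :
    ∃ δ > 0, ∀ ζ ζ₀ : Circle, ‖(ζ : ℂ) - ζ₀‖ < δ → ∃ θ : ℝ, |θ| < r ∧ ζ = ζ₀ * Circle.exp θ := by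
  have hc : ContinuousAt Complex.arg 1 := Complex.continuousAt_arg (by simp)
  obtain ⟨δ, hδ, h⟩ := Metric.continuousAt_iff.1 hc r hr
  refine ⟨δ, hδ, fun ζ ζ₀ hζ => ⟨Complex.arg (ζ₀⁻¹ * ζ : Circle), ?_, ?_⟩⟩
  · have h1 := h (x := ((ζ₀⁻¹ * ζ : Circle) : ℂ)) (by
      rw [dist_eq_norm]
      have e : ((ζ₀⁻¹ * ζ : Circle) : ℂ) - 1 = ((ζ₀⁻¹ : Circle) : ℂ) * ((ζ : ℂ) - ζ₀) := by
        rw [mul_sub, ← Circle.coe_mul, ← Circle.coe_mul, inv_mul_cancel, Circle.coe_one]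
      rw [e, norm_mul, Circle.norm_coe, one_mul]
      exact hζ)
    rwa [Complex.arg_one, Real.dist_eq, sub_zero] at h1
  · rw [Circle.exp_arg, mul_inv_cancel_left]

/-- The parameters near the base point are given by coordinates near the base point. -/
lemma GroundStates.exists_coords (h : GroundStates β O φ) {s : ℝ} (hs : s ∈ O) {r : ℝ}
    (hr : 0 < r) : ∃ δ > 0, ∀ (D D₀ : E3) (ζ ζ₀ : Circle) (p : E4) (w : ℂ), ‖D - D₀‖ < δ →
      ‖(ζ : ℂ) - ζ₀‖ < δ → ‖p - paramMap φ (s, 0)‖ < δ → ‖w‖ < δ → p ∈ paramSet O φ →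
      ∃ x ∈ Metric.ball ((0, 0, 0, s, 0) : ModPar) r, x.2.2.2.1 ∈ O ∧ D = D₀ + x.1 ∧
        ζ = ζ₀ * Circle.exp x.2.1 ∧ p = paramMap φ (x.2.2.2.1, x.2.2.1) ∧ w = x.2.2.2.2 := by
  obtain ⟨δ₁, hδ₁, h1⟩ := exists_arg_small hr
  have hc := (h.paramInv_local hs 0).1.continuousAt
  obtain ⟨δ₂, hδ₂, h2⟩ := Metric.continuousAt_iff.1 hc r hr
  refine ⟨min r (min δ₁ δ₂), by positivity, fun D D₀ ζ ζ₀ p w hD hζ hp hw hpO => ?_⟩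
  obtain ⟨θ, hθ, hθ'⟩ := h1 ζ ζ₀ (hζ.trans_le ((min_le_right _ _).trans (min_le_left _ _)))
  have h3 := h2 (x := p) (by
    rw [dist_eq_norm]; exact hp.trans_le ((min_le_right _ _).trans (min_le_right _ _)))
  obtain ⟨⟨s', v'⟩, ⟨hs', -⟩, rfl⟩ := hpO
  rw [h.paramInv_paramMap hs, h.paramInv_paramMap hs', Prod.dist_eq, max_lt_iff] at h3
  refine ⟨(D - D₀, θ, v', s', w), ?_, hs', (add_sub_cancel _ _).symm, hθ', rfl, rfl⟩
  rw [Metric.mem_ball, Prod.dist_eq, Prod.dist_eq, Prod.dist_eq, Prod.dist_eq]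
  simp only [max_lt_iff]
  refine ⟨?_, ?_, h3.2, h3.1, ?_⟩
  · simpa using hD.trans_le (min_le_left _ _)
  · simpa [Real.dist_eq] using hθ
  · simpa using hw.trans_le (min_le_left _ _)

/-- Coordinates near the base point give parameters near the base point. -/
lemma GroundStates.coords_close (h : GroundStates β O φ) {s : ℝ} (hs : s ∈ O) {δ : ℝ}
    (hδ : 0 < δ) : ∃ r > 0, ∀ x ∈ Metric.ball ((0, 0, 0, s, 0) : ModPar) r, x.2.2.2.1 ∈ O ∧
      ‖x.1‖ < δ ∧ (∀ ζ₀ : Circle, ‖((ζ₀ * Circle.exp x.2.1 : Circle) : ℂ) - ζ₀‖ < δ) ∧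
      ‖paramMap φ (x.2.2.2.1, x.2.2.1) - paramMap φ (s, 0)‖ < δ ∧ ‖x.2.2.2.2‖ < δ := by
  obtain ⟨r₁, hr₁, h1⟩ := Metric.isOpen_iff.1 h.isOpen s hs
  have hc := (h.contDiffAt_paramForm (z := (s, (0 : E3))) hs).continuousAt
  obtain ⟨r₂, hr₂, h2⟩ := Metric.continuousAt_iff.1 hc δ hδ
  refine ⟨min δ (min r₁ r₂), by positivity, ?_⟩
  rintro ⟨d, θ, v, s', w⟩ hx
  rw [Metric.mem_ball, Prod.dist_eq, Prod.dist_eq, Prod.dist_eq, Prod.dist_eq] at hx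
  simp only [max_lt_iff] at hx
  obtain ⟨hd, hθ, hv, hs', hw⟩ := hx
  rw [lt_min_iff, lt_min_iff] at hd hθ hv hs' hw
  have hsO : s' ∈ O := h1 hs'.2.1
  refine ⟨hsO, by simpa using hd.1, fun ζ₀ => ?_, ?_, by simpa using hw.1⟩
  · have e : ((ζ₀ * Circle.exp θ : Circle) : ℂ) - ζ₀ =
        (ζ₀ : ℂ) * (Complex.exp (Complex.I * θ) - 1) := by
      rw [Circle.coe_mul, Circle.coe_exp, mul_comm (θ : ℂ)]; ring
    rw [e, norm_mul, Circle.norm_coe, one_mul]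
    refine Real.norm_exp_I_mul_ofReal_sub_one_le.trans_lt ?_
    simpa [Real.dist_eq] using hθ.1
  · rw [h.paramMap_eq hsO, h.paramMap_eq hs, ← dist_eq_norm]
    refine h2 ?_
    rw [Prod.dist_eq]
    exact max_lt hs'.2.2 hv.2.2

end

/-! ### Smooth dependence of the modulation parameters -/

section
variable {V : 𝓢(E3, ℝ)} {β : ℝ → ℝ} {e₀ : ℝ} {φ₀ : Sob 2} {a : ℝ} {Q : ℂ → Sob 2} {E : ℂ → ℝ}
variable {O : Set ℝ} {φ : ℝ → E3 → ℝ}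

lemma contDiffAt_galL_sobL2
    (hT : ContDiffOn ℝ ∞ (fun z : E3 × ℂ => transSob z.1 (Q z.2)) (univ ×ˢ Metric.ball 0 a))
    (v y₀ : E3) {z : ℝ × ℂ} (hz : ‖z.2‖ < a) :
    ContDiffAt ℝ ∞ (fun z : ℝ × ℂ => galL v y₀ z.1 (sobL2 (Q z.2))) z := by
  have h1 : ContDiffAt ℝ ∞ (fun z : E3 × ℂ => transSob z.1 (Q z.2)) (z.1 • v + y₀, z.2) :=
    hT.contDiffAt ((isOpen_univ.prod Metric.isOpen_ball).mem_nhds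
      ⟨mem_univ _, by simpa using hz⟩)
  have h2 : ContDiffAt ℝ ∞ (fun z : ℝ × ℂ => transSob (z.1 • v + y₀) (Q z.2)) z :=
    ContDiffAt.comp (g := fun z : E3 × ℂ => transSob z.1 (Q z.2))
      (f := fun z : ℝ × ℂ => (z.1 • v + y₀, z.2)) z h1 (by fun_prop)
  have h3 : ContDiff ℝ ∞ (modul (-(1 / 2 : ℝ) • v) ∘L sobL2 (n := 2) : Sob 2 →L[ℂ] L2) :=
    ((modul (-(1 / 2 : ℝ) • v) ∘L sobL2 (n := 2) : Sob 2 →L[ℂ] L2).restrictScalars ℝ).contDiff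
  have h4 : ContDiff ℝ ∞ fun z : ℝ × ℂ =>
      Complex.exp (Complex.I * ((-(z.1 / 4 * ‖v‖ ^ 2) : ℝ) : ℂ)) := by
    have h5 : ContDiff ℝ ∞ fun z : ℝ × ℂ => -(z.1 / 4 * ‖v‖ ^ 2) := by fun_prop
    exact (contDiff_const.mul (Complex.ofRealCLM.contDiff.comp h5)).cexp
  exact h4.contDiffAt.smul (h3.contDiffAt.comp z h2)

lemma contDiffAt_galL_fderiv (h : SmallBoundStates V β e₀ φ₀ a Q E)
    (hT : ContDiffOn ℝ ∞ (fun z : E3 × ℂ => transSob z.1 (Q z.2)) (univ ×ˢ Metric.ball 0 a))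
    (v y₀ : E3) {z : ℝ × ℂ} (hz : ‖z.2‖ < a) (e : ℂ) :
    ContDiffAt ℝ ∞ (fun z : ℝ × ℂ => galL v y₀ z.1 (sobL2 (fderiv ℝ Q z.2 e))) z := by
  have h1 : ContDiffAt ℝ ∞ (fun z : ℝ × ℂ =>
      fderiv ℝ (fun z : ℝ × ℂ => galL v y₀ z.1 (sobL2 (Q z.2))) z (0, e)) z :=
    ((contDiffAt_galL_sobL2 hT v y₀ hz).fderiv_right (m := ∞) (by simp)).clm_apply
      contDiffAt_const
  refine h1.congr_of_eventuallyEq ?_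
  have hev : ∀ᶠ z' : ℝ × ℂ in 𝓝 z, ‖z'.2‖ < a :=
    (continuous_snd.norm.continuousAt).eventually_lt continuousAt_const hz
  filter_upwards [hev] with z' hz'
  have h2 := ((contDiffAt_galL_sobL2 hT v y₀ hz').differentiableAt (by simp)).hasFDerivAt
  have h3 := HasFDerivAt.comp (f := fun w : ℂ => (z'.1, w)) z'.2 h2
    (hasFDerivAt_prodMk_right z'.1 z'.2)
  have h4 : HasFDerivAt (fun w : ℂ => galL v y₀ z'.1 (sobL2 (Q w)))
      ((galL v y₀ z'.1 ∘L sobL2 (n := 2)).restrictScalars ℝ ∘L fderiv ℝ Q z'.2) z'.2 :=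
    ((galL v y₀ z'.1 ∘L sobL2 (n := 2)).restrictScalars ℝ).hasFDerivAt.comp z'.2
      ((h.contDiffAt hz').differentiableAt (by simp)).hasFDerivAt
  have h5 := congrArg (fun L : ℂ →L[ℝ] L2 => L e) (h4.unique h3)
  simpa using h5

/-- The Galilei transformation in the frame of the soliton. -/
def relGal (v y₀ : E3) (D : E3) (ζ : Circle) (t : ℝ) : L2 →L[ℂ] L2 :=
  actL (-D) ζ⁻¹ ∘L galL v y₀ t

lemma relGal_apply (v y₀ : E3) (D : E3) (ζ : Circle) (t : ℝ) (f : L2) :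
    relGal v y₀ D ζ t f = actL (-D) ζ⁻¹ (galL v y₀ t f) := rfl

/-- The modulation equations as a function of time, the datum and the coordinates. -/
def flowSys (φ : ℝ → E3 → ℝ) (lab : Option (Fin 3) × Bool → ℝ → L2) (Q : ℂ → Sob 2) (c : ℂ)
    (v y₀ : E3) (D : E3) (ζ : Circle) (z : (ℝ × Sob 1) × ModPar) : ModIdx → ℝ :=
  modSys φ lab Q c (z.2, actL (-D) ζ⁻¹ (sobL2 z.1.2))
    ((relGal v y₀ D ζ z.1.1).restrictScalars ℝ, 1)

attribute [local irreducible] modSys relGal in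
lemma contDiffAt_flowSys (hO : GroundStates β O φ)
    {lab : Option (Fin 3) × Bool → ℝ → L2} (hl : IsLabels O (gsL2 φ) lab)
    (h : SmallBoundStates V β e₀ φ₀ a Q E)
    (hT : ContDiffOn ℝ ∞ (fun z : E3 × ℂ => transSob z.1 (Q z.2)) (univ ×ˢ Metric.ball 0 a))
    (c : ℂ) (v y₀ : E3) (D : E3) (ζ : Circle) {z : (ℝ × Sob 1) × ModPar}
    (hz : z.2.2.2.2.1 ∈ O) (hz' : ‖z.2.2.2.2.2‖ < a) :
    ContDiffAt ℝ ∞ (flowSys φ lab Q c v y₀ D ζ) z := by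
  have hx : ContDiffAt ℝ ∞ (fun z : (ℝ × Sob 1) × ModPar => z.2) z := contDiffAt_snd
  have hgen : ∀ g, DiffFam O g →
      ContDiffAt ℝ ∞ (fun z : (ℝ × Sob 1) × ModPar => gen g z.2) z := fun g hg =>
    ContDiffAt.comp (g := gen g) z (contDiffAt_gen hO.isOpen hg hz) hx
  have hL : ContDiff ℝ ∞ (actL (-D) ζ⁻¹) := ((actL (-D) ζ⁻¹).restrictScalars ℝ).contDiff
  have hS : ContDiff ℝ ∞ (sobL2 (n := 1)) := ((sobL2 (n := 1)).restrictScalars ℝ).contDiff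
  have hb : ContDiffAt ℝ ∞ (fun z : (ℝ × Sob 1) × ModPar => actL (-D) ζ⁻¹ (sobL2 z.1.2)) z :=
    (hL.comp (hS.comp (contDiff_snd.comp contDiff_fst))).contDiffAt
  have htw : ContDiffAt ℝ ∞ (fun z : (ℝ × Sob 1) × ModPar => (z.1.1, z.2.2.2.2.2)) z :=
    (by fun_prop : ContDiff ℝ ∞ fun z : (ℝ × Sob 1) × ModPar =>
      (z.1.1, z.2.2.2.2.2)).contDiffAt
  have hQ : ContDiffAt ℝ ∞ (fun z : (ℝ × Sob 1) × ModPar =>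
      relGal v y₀ D ζ z.1.1 (sobL2 (Q z.2.2.2.2.2))) z :=
    by
    have h1 : ContDiffAt ℝ ∞ (fun z : (ℝ × Sob 1) × ModPar =>
        galL v y₀ z.1.1 (sobL2 (Q z.2.2.2.2.2))) z :=
      ContDiffAt.comp (g := fun z : ℝ × ℂ => galL v y₀ z.1 (sobL2 (Q z.2)))
        (f := fun z : (ℝ × Sob 1) × ModPar => (z.1.1, z.2.2.2.2.2)) z
        (contDiffAt_galL_sobL2 hT v y₀ hz') htw
    simp only [relGal_apply]
    exact hL.contDiffAt.comp z h1
  have hQ' : ∀ e : ℂ, ContDiffAt ℝ ∞ (fun z : (ℝ × Sob 1) × ModPar =>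
      relGal v y₀ D ζ z.1.1 (c • sobL2 (fderiv ℝ Q z.2.2.2.2.2 e))) z := fun e => by
    have h1 : ContDiffAt ℝ ∞ (fun z : (ℝ × Sob 1) × ModPar =>
        galL v y₀ z.1.1 (sobL2 (fderiv ℝ Q z.2.2.2.2.2 e))) z :=
      ContDiffAt.comp (g := fun z : ℝ × ℂ => galL v y₀ z.1 (sobL2 (fderiv ℝ Q z.2 e)))
        (f := fun z : (ℝ × Sob 1) × ModPar => (z.1.1, z.2.2.2.2.2)) z
        (contDiffAt_galL_fderiv h hT v y₀ (z := (z.1.1, z.2.2.2.2.2)) hz' e) htw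
    simp only [relGal_apply, map_smul]
    exact (hL.contDiffAt.comp z h1).const_smul c
  have hq : ContDiffAt ℝ ∞ (fun z : (ℝ × Sob 1) × ModPar => sobL2 (Q z.2.2.2.2.2)) z :=
    ContDiffAt.comp (g := fun x : ModPar => sobL2 (Q x.2.2.2.2)) z
      (h.contDiffAt_sobL2 (x := z.2) hz').1 hx
  have hqd : ∀ e : ℂ, ContDiffAt ℝ ∞ (fun z : (ℝ × Sob 1) × ModPar =>
      c • sobL2 (fderiv ℝ Q z.2.2.2.2.2 e)) z := fun e =>
    ContDiffAt.comp (g := fun x : ModPar => c • sobL2 (fderiv ℝ Q x.2.2.2.2 e)) z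
      ((h.contDiffAt_sobL2 (x := z.2) hz').2 c e) hx
  rw [contDiffAt_pi]
  rintro (j | j)
  · simp only [flowSys, modSys_inl]
    exact contDiffAt_bilin (B := rin) (hgen _ (hl.diffFam j))
      ((hb.sub (hgen _ hO.smoothFam.diffFam)).sub hQ)
  · simp only [flowSys, modSys_inr]
    exact (contDiffAt_bilin (B := rin) (hb.sub (hgen _ hO.smoothFam.diffFam)) (hQ' _)).sub
      (contDiffAt_bilin (B := rin) hq (hqd _))

lemma exists_local_solution (hO : GroundStates β O φ)
    {lab : Option (Fin 3) × Bool → ℝ → L2} (hl : IsLabels O (gsL2 φ) lab)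
    (h : SmallBoundStates V β e₀ φ₀ a Q E)
    (hT : ContDiffOn ℝ ∞ (fun z : E3 × ℂ => transSob z.1 (Q z.2)) (univ ×ˢ Metric.ball 0 a))
    (c : ℂ) (v y₀ : E3) (D : E3) (ζ : Circle) {z₁ : ℝ × Sob 1} {x₁ : ModPar}
    (hx : x₁.2.2.2.1 ∈ O) (hx' : ‖x₁.2.2.2.2‖ < a) (h0 : flowSys φ lab Q c v y₀ D ζ (z₁, x₁) = 0)
    (hinj : ∀ A : ModPar →L[ℝ] ModIdx → ℝ,
      HasFDerivAt (fun x => flowSys φ lab Q c v y₀ D ζ (z₁, x)) A x₁ → Function.Injective A) :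
    ∃ ψ : ℝ × Sob 1 → ModPar, ContDiffAt ℝ ∞ ψ z₁ ∧ ψ z₁ = x₁ ∧
      ∀ᶠ z in 𝓝 z₁, flowSys φ lab Q c v y₀ D ζ (z, ψ z) = 0 := by
  let W : Set ((ℝ × Sob 1) × ModPar) := {z | z.2.2.2.2.1 ∈ O ∧ ‖z.2.2.2.2.2‖ < a}
  have hW : IsOpen W :=
    (hO.isOpen.preimage (by fun_prop : Continuous fun z : (ℝ × Sob 1) × ModPar =>
      z.2.2.2.2.1)).inter (isOpen_lt (by fun_prop : Continuous fun z : (ℝ × Sob 1) × ModPar =>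
      ‖z.2.2.2.2.2‖) continuous_const)
  have hc : ContDiffOn ℝ ∞ (flowSys φ lab Q c v y₀ D ζ) W := fun z hz =>
    (contDiffAt_flowSys hO hl h hT c v y₀ D ζ hz.1 hz.2).contDiffWithinAt
  have hd := ((contDiffAt_flowSys hO hl h hT c v y₀ D ζ (z := (z₁, x₁)) hx hx').differentiableAt
    (by simp)).hasFDerivAt
  have hd2 : HasFDerivAt (fun x => flowSys φ lab Q c v y₀ D ζ (z₁, x))
      (fderiv ℝ (flowSys φ lab Q c v y₀ D ζ) (z₁, x₁) ∘L .inr ℝ (ℝ × Sob 1) ModPar) x₁ :=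
    HasFDerivAt.comp (f := fun x : ModPar => (z₁, x)) x₁ hd (hasFDerivAt_prodMk_right z₁ x₁)
  have hi : (fderiv ℝ (flowSys φ lab Q c v y₀ D ζ) (z₁, x₁) ∘L
      .inr ℝ (ℝ × Sob 1) ModPar).IsInvertible :=
    ⟨(LinearEquiv.ofInjectiveOfFinrankEq _ (hinj _ hd2) finrank_modPar).toContinuousLinearEquiv,
      rfl⟩
  obtain ⟨ψ, U, hU, hzU, hψ, hψc, hψ0, -⟩ := exists_contDiffOn_implicit hW hc
    (u := (z₁, x₁)) ⟨hx, hx'⟩ hi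
  refine ⟨ψ, hψc.contDiffAt (hU.mem_nhds hzU), hψ, ?_⟩
  filter_upwards [hU.mem_nhds hzU] with z hz
  rw [hψ0 z hz, h0]

end

/-! ### Tubular neighbourhoods of the orbit of a ground state -/

section

/-- `e^{-Jτ·◇}` on `H^n`. -/
def pullSob {n : ℕ} (D : E3) (ζ : Circle) (u : Sob n) : Sob n :=
  ((ζ⁻¹ : Circle) : ℂ) • transSob D u

lemma sobL2_pullSob {n : ℕ} (D : E3) (ζ : Circle) (u : Sob n) :
    sobL2 (pullSob D ζ u) = actL (-D) ζ⁻¹ (sobL2 u) := by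
  rw [pullSob, map_smul, sobL2_transSob, actL_apply, neg_neg]

lemma continuous_pullSob {n : ℕ} (D : E3) (ζ : Circle) :
    Continuous (pullSob D ζ : Sob n → Sob n) := by
  have h : Continuous fun u : Sob n => ((ζ⁻¹ : Circle) : ℂ) • transSob D u :=
    Continuous.comp (g := fun f : Sob n => ((ζ⁻¹ : Circle) : ℂ) • f)
      (continuous_const_smul _) (transSob D).continuous
  exact h

lemma ae_act_iff {u b : Sob 1} (D : E3) (ζ : Circle) :
    (∀ᵐ x, sobFn u x = act D ζ (sobFn b) x) ↔ b = pullSob D ζ u := by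
  have hb : act D ζ (sobFn b) =ᵐ[volume] actL D ζ (sobL2 b) :=
    act_ae (by rw [sobL2_coe]) D ζ
  constructor
  · intro h
    have h1 : sobL2 u = actL D ζ (sobL2 b) := by
      apply Lp.ext
      filter_upwards [h, hb] with x h1 h2
      rw [sobL2_coe, h1, h2]
    exact sobL2_injective (by rw [sobL2_pullSob, h1, actL_inv_left])
  · intro h
    have h1 : sobL2 u = actL D ζ (sobL2 b) := by rw [h, sobL2_pullSob, actL_inv_right]
    rw [h1.symm] at hb
    filter_upwards [hb] with x h2
    rw [h2, sobL2_coe]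

lemma inMovedBall_iff {Φ : E3 → ℂ} {ε : ℝ} {D : E3} {ζ : Circle} {u : Sob 1} :
    InMovedBall Φ ε D ζ u ↔
      ∃ Ψ : Sob 1, (∀ᵐ x, sobFn Ψ x = Φ x) ∧ ‖pullSob D ζ u - Ψ‖ < ε := by
  constructor
  · rintro ⟨Ψ, b, h1, h2, h3⟩
    rw [ae_act_iff] at h3
    exact ⟨Ψ, h1, h3 ▸ h2⟩
  · rintro ⟨Ψ, h1, h2⟩
    exact ⟨Ψ, _, h1, h2, (ae_act_iff D ζ).2 rfl⟩

lemma InMovedBall.eventually {Φ : E3 → ℂ} {ε : ℝ} {D : E3} {ζ : Circle} {u : Sob 1}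
    (h : InMovedBall Φ ε D ζ u) : ∀ᶠ u' in 𝓝 u, InMovedBall Φ ε D ζ u' := by
  obtain ⟨Ψ, h1, h2⟩ := inMovedBall_iff.1 h
  have hc : Continuous fun u : Sob 1 => ‖pullSob D ζ u - Ψ‖ :=
    ((continuous_pullSob D ζ).sub continuous_const).norm
  filter_upwards [hc.continuousAt.eventually_lt continuousAt_const h2] with u' hu'
  exact inMovedBall_iff.2 ⟨Ψ, h1, hu'⟩

variable {β : ℝ → ℝ} {O : Set ℝ} {φ : ℝ → E3 → ℝ}

lemma GroundStates.dist_of_inMovedBall (hO : GroundStates β O φ) {s : ℝ} (hs : s ∈ O) {ε : ℝ}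
    {D : E3} {ζ : Circle} {u : Sob 1} (h : InMovedBall (fun x => (φ s x : ℂ)) ε D ζ u) :
    ‖actL (-D) ζ⁻¹ (sobL2 u) - gsL2 φ s‖ < ε := by
  obtain ⟨Ψ, h1, h2⟩ := inMovedBall_iff.1 h
  have h3 : sobL2 Ψ = gsL2 φ s := by
    apply Lp.ext
    filter_upwards [h1, hO.coe hs] with x e1 e2
    rw [sobL2_coe, e1, e2]
  rw [← h3, ← sobL2_pullSob, ← map_sub]
  exact (norm_sobL2_le _).trans_lt h2

lemma inMovedBall_of_orbit {Φ : E3 → ℂ} {ε : ℝ} (hε : 0 < ε) {D : E3} {ζ : Circle} {u : Sob 1}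
    (h : ∀ᵐ x, sobFn u x = act D ζ Φ x) : InMovedBall Φ ε D ζ u := by
  refine inMovedBall_iff.2 ⟨pullSob D ζ u, ?_, by simpa using hε⟩
  have h1 : ∀ᵐ x, sobFn u (x + D) = act D ζ Φ (x + D) := ae_comp_add D h
  filter_upwards [h1, trans_coe D (sobL2 u), Lp.coeFn_smul ((ζ⁻¹ : Circle) : ℂ)
    (trans D (sobL2 u))] with x h2 h3 h4
  have h5 : sobL2 (pullSob D ζ u) = ((ζ⁻¹ : Circle) : ℂ) • trans D (sobL2 u) := by
    rw [sobL2_pullSob, actL_apply, neg_neg]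
  rw [← sobL2_coe, h5, h4, Pi.smul_apply, h3, sobL2_coe, h2, act, smul_eq_mul, ← mul_assoc,
    ← Circle.coe_mul, inv_mul_cancel, Circle.coe_one, one_mul, add_sub_cancel_right]

lemma GroundStates.modulationEqs_orbit (hO : GroundStates β O φ) {s : ℝ} (hs : s ∈ O)
    {Q : ℂ → Sob 2} (hQ : Q 0 = 0) (c : ℂ) (v y₀ : E3) (t : ℝ) {D : E3} {ζ : Circle} {u : Sob 1}
    (h : ∀ᵐ x, sobFn u x = act D ζ (fun y => (φ s y : ℂ)) x) :
    ModulationEqs O φ Q c v y₀ t u D ζ (paramMap φ (s, 0)) 0 := by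
  obtain ⟨lab, hl⟩ := hO.smoothFam.exists_labels hO.isOpen
  have h1 : sobL2 u = actL D ζ (gsL2 φ s) := by
    apply Lp.ext
    filter_upwards [h, act_ae (hO.coe hs) D ζ] with x e1 e2
    rw [sobL2_coe, e1, e2]
  have hR : (0 : L2) = sobL2 u - actL D ζ (modul ((1 / 2 : ℝ) • (0 : E3)) (gsL2 φ s)) -
      galL v y₀ t (sobL2 (Q 0)) := by
    rw [hQ, map_zero, map_zero, smul_zero, modul_zero, h1, sub_self, sub_zero]
  rw [hO.modulationEqs_iff hl hs Q c v y₀ t u D ζ 0 0 hR]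
  simp

/-- The parameters `(D, ζ)` of a point of the tube are determined up to a small error. -/
lemma GroundStates.exists_orbit_close (hO : GroundStates β O φ) {s : ℝ} (hs : s ∈ O) {δ : ℝ}
    (hδ : 0 < δ) : ∃ ε > 0, ∀ (D D' : E3) (ζ ζ' : Circle) (u : Sob 1),
      ‖actL (-D) ζ⁻¹ (sobL2 u) - gsL2 φ s‖ < ε → ‖actL (-D') ζ'⁻¹ (sobL2 u) - gsL2 φ s‖ < ε →
      ‖D - D'‖ < δ ∧ ‖(ζ : ℂ) - ζ'‖ < δ := by
  have hf : gsL2 φ s ≠ 0 := fun h0 => by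
    have := hO.mass_pos hs
    simp [h0] at this
  have hr : ∀ᵐ x, 0 ≤ (gsL2 φ s x).re ∧ (gsL2 φ s x).im = 0 := by
    filter_upwards [hO.coe hs] with x hx
    rw [← hx]
    exact ⟨by simpa using (hO.pos s hs x).le, by simp⟩
  obtain ⟨ε, hε, h⟩ := exists_stability hf hr hδ
  refine ⟨ε / 2, half_pos hε, fun D D' ζ ζ' u h1 h2 => ?_⟩
  have e1 : actL (D - D') (ζ * ζ'⁻¹) (gsL2 φ s) - gsL2 φ s =
      (actL (-D') ζ'⁻¹ (sobL2 u) - gsL2 φ s) -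
      actL (-D') ζ'⁻¹ (actL D ζ (actL (-D) ζ⁻¹ (sobL2 u) - gsL2 φ s)) := by
    rw [map_sub, actL_inv_right, map_sub, ← actL_add, neg_add_eq_sub, mul_comm]
    abel
  have h3 := h (D - D') (ζ * ζ'⁻¹) (by
    rw [e1]
    refine (norm_sub_le _ _).trans_lt ?_
    rw [norm_actL, norm_actL]
    linarith)
  refine ⟨h3.1, ?_⟩
  have e2 : ((ζ * ζ'⁻¹ : Circle) : ℂ) - 1 = ((ζ'⁻¹ : Circle) : ℂ) * ((ζ : ℂ) - ζ') := by
    rw [mul_sub, ← Circle.coe_mul, ← Circle.coe_mul, inv_mul_cancel, Circle.coe_one, mul_comm]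
  have := h3.2
  rwa [e2, norm_mul, Circle.norm_coe, one_mul] at this

end

/-! ### Gluing local solutions -/

section
variable {Φ : E3 → ℂ} {ε δ : ℝ} {p₀ : E4}

/-- `(t, u)` lies in the tube around the orbit, with `τ` given by `(D, ζ)`. -/
def InTube (Φ : E3 → ℂ) (ε : ℝ) (z : ℝ × Sob 1) (D : E3) (ζ : Circle) : Prop :=
  0 ≤ z.1 ∧ ‖D‖ < ε * japanese z.1 ∧ InMovedBall Φ ε D ζ z.2

/-- `(D, ζ, p, w)` is `δ`-close to `(D₀, ζ₀, p₀, 0)`. -/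
def ParClose (p₀ : E4) (δ : ℝ) (D₀ : E3) (ζ₀ : Circle) (D : E3) (ζ : Circle) (p : E4) (w : ℂ) :
    Prop :=
  ‖D - D₀‖ < δ ∧ ‖(ζ : ℂ) - ζ₀‖ < δ ∧ ‖p - p₀‖ < δ ∧ ‖w‖ < δ

lemma ParClose.mono {δ' : ℝ} (hδ : δ' ≤ δ) {D₀ : E3} {ζ₀ : Circle} {D : E3} {ζ : Circle} {p : E4}
    {w : ℂ} (h : ParClose p₀ δ' D₀ ζ₀ D ζ p w) : ParClose p₀ δ D₀ ζ₀ D ζ p w :=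
  ⟨h.1.trans_le hδ, h.2.1.trans_le hδ, h.2.2.1.trans_le hδ, h.2.2.2.trans_le hδ⟩

lemma ParClose.move {D₀ D₁ : E3} {ζ₀ ζ₁ : Circle} {D : E3} {ζ : Circle} {p : E4}
    {w : ℂ} (h : ParClose p₀ (δ / 2) D₀ ζ₀ D ζ p w) (hD : ‖D₀ - D₁‖ < δ / 2)
    (hζ : ‖(ζ₀ : ℂ) - ζ₁‖ < δ / 2) : ParClose p₀ δ D₁ ζ₁ D ζ p w := by
  obtain ⟨h1, h2, h3, h4⟩ := h
  refine ⟨?_, ?_, by linarith [norm_nonneg w], by linarith [norm_nonneg w]⟩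
  · have := norm_sub_le_norm_sub_add_norm_sub D D₀ D₁
    linarith
  · have := norm_sub_le_norm_sub_add_norm_sub (ζ : ℂ) ζ₀ ζ₁
    linarith

lemma InTube.eventually {z₁ : ℝ × Sob 1} {D : E3} {ζ : Circle} (h : InTube Φ ε z₁ D ζ) :
    ∀ᶠ z in 𝓝 z₁, 0 ≤ z.1 → InTube Φ ε z D ζ := by
  have hj : Continuous fun z : ℝ × Sob 1 => ε * japanese z.1 := by
    unfold japanese
    fun_prop
  filter_upwards [continuousAt_const.eventually_lt hj.continuousAt h.2.1,
    (continuous_snd.continuousAt (x := z₁)).eventually h.2.2.eventually] with z h1 h2 h3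
  exact ⟨h3, h1, h2⟩

/-- Local solutions of a system of equations which are unique among nearby parameters form a
smooth family on the tube. -/
lemma exists_glued {S : ℝ × Sob 1 → E3 → Circle → E4 → ℂ → Prop} (hδ : 0 < δ)
    (huniq : ∀ z D₀ ζ₀, InTube Φ ε z D₀ ζ₀ → ∀ D ζ p w D' ζ' p' w',
      ParClose p₀ δ D₀ ζ₀ D ζ p w → ParClose p₀ δ D₀ ζ₀ D' ζ' p' w' → S z D ζ p w →
      S z D' ζ' p' w' → D' = D ∧ ζ' = ζ ∧ p' = p ∧ w' = w)
    (hstab : ∀ z D₀ ζ₀ D₁ ζ₁, InTube Φ ε z D₀ ζ₀ → InTube Φ ε z D₁ ζ₁ →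
      ‖D₀ - D₁‖ < δ / 2 ∧ ‖(ζ₀ : ℂ) - ζ₁‖ < δ / 2)
    (hloc : ∀ z₁ D₀ ζ₀, InTube Φ ε z₁ D₀ ζ₀ → ∃ (D : ℝ × Sob 1 → E3) (ζ : ℝ × Sob 1 → Circle)
      (p : ℝ × Sob 1 → E4) (w : ℝ × Sob 1 → ℂ), (ContDiffAt ℝ ∞ D z₁ ∧
        ContDiffAt ℝ ∞ (fun z => (ζ z : ℂ)) z₁ ∧ ContDiffAt ℝ ∞ p z₁ ∧ ContDiffAt ℝ ∞ w z₁) ∧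
      ∀ᶠ z in 𝓝 z₁, S z (D z) (ζ z) (p z) (w z) ∧
        ParClose p₀ (δ / 2) D₀ ζ₀ (D z) (ζ z) (p z) (w z)) :
    ∃ (D : ℝ × Sob 1 → E3) (ζ : ℝ × Sob 1 → Circle) (p : ℝ × Sob 1 → E4) (w : ℝ × Sob 1 → ℂ),
      (ContDiffOn ℝ ∞ D (tube Φ ε) ∧ ContDiffOn ℝ ∞ (fun z => (ζ z : ℂ)) (tube Φ ε) ∧
        ContDiffOn ℝ ∞ p (tube Φ ε) ∧ ContDiffOn ℝ ∞ w (tube Φ ε)) ∧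
      (∀ z ∈ tube Φ ε, S z (D z) (ζ z) (p z) (w z)) ∧
      ∀ z D₀ ζ₀, InTube Φ ε z D₀ ζ₀ → ParClose p₀ δ D₀ ζ₀ (D z) (ζ z) (p z) (w z) ∧
        ∀ D' ζ' p' w', ParClose p₀ δ D₀ ζ₀ D' ζ' p' w' → S z D' ζ' p' w' →
          D' = D z ∧ ζ' = ζ z ∧ p' = p z ∧ w' = w z := by
  have htube : ∀ z ∈ tube Φ ε, ∃ D ζ, InTube Φ ε z D ζ := fun z hz => by
    obtain ⟨h0, D, ζ, h1, h2⟩ := hz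
    exact ⟨D, ζ, h0, h1, h2⟩
  have hmem : ∀ {z D₀ ζ₀}, InTube Φ ε z D₀ ζ₀ → z ∈ tube Φ ε := fun h =>
    ⟨h.1, _, _, h.2.1, h.2.2⟩
  have hex : ∀ z, ∃ (D : E3) (ζ : Circle) (p : E4) (w : ℂ), z ∈ tube Φ ε → S z D ζ p w ∧
      ∃ D₀ ζ₀, InTube Φ ε z D₀ ζ₀ ∧ ParClose p₀ (δ / 2) D₀ ζ₀ D ζ p w := by
    intro z
    by_cases hz : z ∈ tube Φ ε
    · obtain ⟨D₀, ζ₀, h0⟩ := htube z hz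
      obtain ⟨D, ζ, p, w, -, h1⟩ := hloc z D₀ ζ₀ h0
      obtain ⟨h2, h3⟩ := h1.self_of_nhds
      exact ⟨D z, ζ z, p z, w z, fun _ => ⟨h2, D₀, ζ₀, h0, h3⟩⟩
    · exact ⟨0, 1, 0, 0, fun h => absurd h hz⟩
  choose D ζ p w hm using hex
  have hclose : ∀ z D₀ ζ₀, InTube Φ ε z D₀ ζ₀ → ParClose p₀ δ D₀ ζ₀ (D z) (ζ z) (p z) (w z) := by
    intro z D₁ ζ₁ h
    obtain ⟨-, D₀, ζ₀, h0, h1⟩ := hm z (hmem h)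
    obtain ⟨h2, h3⟩ := hstab z D₀ ζ₀ D₁ ζ₁ h0 h
    exact h1.move h2 h3
  have hsm : ∀ z₁ ∈ tube Φ ε, ContDiffWithinAt ℝ ∞ D (tube Φ ε) z₁ ∧
      ContDiffWithinAt ℝ ∞ (fun z => (ζ z : ℂ)) (tube Φ ε) z₁ ∧
      ContDiffWithinAt ℝ ∞ p (tube Φ ε) z₁ ∧ ContDiffWithinAt ℝ ∞ w (tube Φ ε) z₁ := by
    intro z₁ hz₁
    obtain ⟨D₀, ζ₀, h0⟩ := htube z₁ hz₁
    obtain ⟨D', ζ', p', w', ⟨c1, c2, c3, c4⟩, h1⟩ := hloc z₁ D₀ ζ₀ h0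
    have hev : ∀ᶠ z in 𝓝[tube Φ ε] z₁, D z = D' z ∧ ζ z = ζ' z ∧ p z = p' z ∧ w z = w' z := by
      filter_upwards [nhdsWithin_le_nhds h1, nhdsWithin_le_nhds h0.eventually,
        self_mem_nhdsWithin] with z h2 h3 h4
      have h5 := h3 h4.1
      exact huniq z D₀ ζ₀ h5 _ _ _ _ _ _ _ _ (h2.2.mono (by linarith)) (hclose z D₀ ζ₀ h5) h2.1
        (hm z h4).1
    exact ⟨c1.contDiffWithinAt.congr_of_eventuallyEq_of_mem (hev.mono fun z h => h.1) hz₁,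
      c2.contDiffWithinAt.congr_of_eventuallyEq_of_mem
        (hev.mono fun z h => congrArg (fun ζ : Circle => (ζ : ℂ)) h.2.1) hz₁,
      c3.contDiffWithinAt.congr_of_eventuallyEq_of_mem (hev.mono fun z h => h.2.2.1) hz₁,
      c4.contDiffWithinAt.congr_of_eventuallyEq_of_mem (hev.mono fun z h => h.2.2.2) hz₁⟩
  refine ⟨D, ζ, p, w, ⟨fun z hz => (hsm z hz).1, fun z hz => (hsm z hz).2.1,
    fun z hz => (hsm z hz).2.2.1, fun z hz => (hsm z hz).2.2.2⟩, fun z hz => (hm z hz).1,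
    fun z D₀ ζ₀ h => ⟨hclose z D₀ ζ₀ h, fun D' ζ' p' w' h1 h2 => ?_⟩⟩
  exact huniq z D₀ ζ₀ h _ _ _ _ _ _ _ _ (hclose z D₀ ζ₀ h) h1 (hm z (hmem h)).1 h2

end

/-! ### The modulation of the soliton -/

section
variable {V : 𝓢(E3, ℝ)} {β : ℝ → ℝ} {e₀ : ℝ} {φ₀ : Sob 2} {a : ℝ} {Q : ℂ → Sob 2} {E : ℂ → ℝ}
variable {O : Set ℝ} {φ : ℝ → E3 → ℝ}

lemma exists_relGal_eq_twist (v y₀ : E3) (D : E3) (ζ : Circle) (t : ℝ) : ∃ κ : ℂ, ‖κ‖ = 1 ∧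
    relGal v y₀ D ζ t = twist κ (-(1 / 2 : ℝ) • v) (t • v + y₀ + D) := by
  obtain ⟨κ, hκ, h⟩ := exists_twist_eq v y₀ t D ζ
  exact ⟨κ, hκ, ContinuousLinearMap.ext fun f => h f⟩

/-- The equations together with the admissibility of the parameters. -/
def IsModulated (O : Set ℝ) (φ : ℝ → E3 → ℝ) (a : ℝ) (Q : ℂ → Sob 2) (c : ℂ) (v y₀ : E3)
    (z : ℝ × Sob 1) (D : E3) (ζ : Circle) (p : E4) (w : ℂ) : Prop :=
  p ∈ paramSet O φ ∧ ‖w‖ < a ∧ ModulationEqs O φ Q c v y₀ z.1 z.2 D ζ p w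

lemma GroundStates.isModulated_iff (hO : GroundStates β O φ)
    {lab : Option (Fin 3) × Bool → ℝ → L2} (hl : IsLabels O (gsL2 φ) lab) {x : ModPar}
    (hx : x.2.2.2.1 ∈ O) (hx' : ‖x.2.2.2.2‖ < a) (c : ℂ) (v y₀ : E3) (z : ℝ × Sob 1) (D : E3)
    (ζ : Circle) :
    IsModulated O φ a Q c v y₀ z (D + x.1) (ζ * Circle.exp x.2.1)
      (paramMap φ (x.2.2.2.1, x.2.2.1)) x.2.2.2.2 ↔ flowSys φ lab Q c v y₀ D ζ (z, x) = 0 := by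
  have h := hO.modulationEqs_iff_modSys hl hx Q c v y₀ z.1 z.2 D ζ
    (U := relGal v y₀ D ζ z.1) (fun f => rfl)
  refine Iff.trans ⟨fun h => h.2.2, fun h => ⟨⟨_, ⟨hx, mem_univ _⟩, rfl⟩, hx', h⟩⟩ h

/-- Smooth coordinates give smooth parameters. -/
lemma GroundStates.contDiffAt_coords (hO : GroundStates β O φ) {ψ : ℝ × Sob 1 → ModPar}
    {z : ℝ × Sob 1} (hψ : ContDiffAt ℝ ∞ ψ z) (hz : (ψ z).2.2.2.1 ∈ O) (D : E3) (ζ : Circle) :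
    ContDiffAt ℝ ∞ (fun z => D + (ψ z).1) z ∧
    ContDiffAt ℝ ∞ (fun z => ((ζ * Circle.exp (ψ z).2.1 : Circle) : ℂ)) z ∧
    ContDiffAt ℝ ∞ (fun z => paramMap φ ((ψ z).2.2.2.1, (ψ z).2.2.1)) z ∧
    ContDiffAt ℝ ∞ (fun z => (ψ z).2.2.2.2) z := by
  have h1 : ContDiffAt ℝ ∞ (fun z => (ψ z).1) z := modParD.contDiff.contDiffAt.comp z hψ
  have h2 : ContDiffAt ℝ ∞ (fun z => (ψ z).2.1) z := modParT.contDiff.contDiffAt.comp z hψ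
  have h3 : ContDiffAt ℝ ∞ (fun z => (ψ z).2.2.1) z := modParV.contDiff.contDiffAt.comp z hψ
  have h4 : ContDiffAt ℝ ∞ (fun z => (ψ z).2.2.2.1) z := modParS.contDiff.contDiffAt.comp z hψ
  have h5 : ContDiffAt ℝ ∞ (fun z => (ψ z).2.2.2.2) z := modParW.contDiff.contDiffAt.comp z hψ
  refine ⟨contDiffAt_const.add h1, ?_, ?_, h5⟩
  · simp only [Circle.coe_mul, Circle.coe_exp]
    exact contDiffAt_const.mul
      (((Complex.ofRealCLM.contDiff.contDiffAt.comp z h2).mul contDiffAt_const).cexp)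
  · have h6 : ContDiffAt ℝ ∞ (fun z => paramForm (gsL2 φ) ((ψ z).2.2.2.1, (ψ z).2.2.1)) z :=
      ContDiffAt.comp (g := paramForm (gsL2 φ)) (f := fun z => ((ψ z).2.2.2.1, (ψ z).2.2.1)) z
        (hO.contDiffAt_paramForm hz) (h4.prodMk h3)
    refine h6.congr_of_eventuallyEq ?_
    filter_upwards [h4.continuousAt.eventually_mem (hO.isOpen.mem_nhds hz)] with z hz
    exact hO.paramMap_eq hz _

/-- The modulation parameters exist for all small radii of the tube and all small `δ`. -/
lemma exists_modulation (hO : GroundStates β O φ) {s : ℝ} (hs : s ∈ O)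
    (h : SmallBoundStates V β e₀ φ₀ a Q E) (hφ₀ : LinearGroundState V e₀ φ₀) (ha : 0 < a)
    (hT : ContDiffOn ℝ ∞ (fun z : E3 × ℂ => transSob z.1 (Q z.2)) (univ ×ˢ Metric.ball 0 a))
    {c : ℂ} (hc : c ≠ 0) {ε₁ M₀ : ℝ} (hε₁ : 0 < ε₁) (hM₀ : 0 < M₀) :
    ∃ δ₀ > 0, ∀ δ, 0 < δ → δ ≤ δ₀ → ∃ ε₀ > 0, ∀ ε, 0 < ε → ε ≤ ε₀ → ∀ v y₀ : E3, M₀ < ‖v‖ →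
      interaction ε₁ v y₀ < ENNReal.ofReal ε →
      ∃ (D : ℝ × Sob 1 → E3) (ζ : ℝ × Sob 1 → Circle) (p : ℝ × Sob 1 → E4) (w : ℝ × Sob 1 → ℂ),
      (ContDiffOn ℝ ∞ D (tube (fun x => (φ s x : ℂ)) ε) ∧
        ContDiffOn ℝ ∞ (fun z => (ζ z : ℂ)) (tube (fun x => (φ s x : ℂ)) ε) ∧
        ContDiffOn ℝ ∞ p (tube (fun x => (φ s x : ℂ)) ε) ∧
        ContDiffOn ℝ ∞ w (tube (fun x => (φ s x : ℂ)) ε)) ∧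
      (∀ z ∈ tube (fun x => (φ s x : ℂ)) ε,
        IsModulated O φ a Q c v y₀ z (D z) (ζ z) (p z) (w z)) ∧
      ∀ z D₀ ζ₀, InTube (fun x => (φ s x : ℂ)) ε z D₀ ζ₀ →
        ParClose (paramMap φ (s, 0)) δ D₀ ζ₀ (D z) (ζ z) (p z) (w z) ∧
        ∀ D' ζ' p' w', ParClose (paramMap φ (s, 0)) δ D₀ ζ₀ D' ζ' p' w' →
          IsModulated O φ a Q c v y₀ z D' ζ' p' w' →
          D' = D z ∧ ζ' = ζ z ∧ p' = p z ∧ w' = w z := by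
  obtain ⟨lab, hl⟩ := hO.smoothFam.exists_labels hO.isOpen
  obtain ⟨ρ, r₀, hr₀, ε₂, hε₂, H1, H2⟩ := exists_uniform_modulation hO hl hs h hφ₀ ha hc
  obtain ⟨δ₀, hδ₀, hδ⟩ := hO.exists_coords hs hr₀
  refine ⟨δ₀, hδ₀, fun δ hδ0 hδle => ?_⟩
  obtain ⟨r₁, hr₁, hcl⟩ := hO.coords_close hs (lt_min (half_pos hδ0) ha)
  obtain ⟨ε₃, hε₃, hex⟩ := H2 (min r₀ r₁) (lt_min hr₀ hr₁)
  obtain ⟨ε₄, hε₄, hst⟩ := hO.exists_orbit_close hs (half_pos hδ0)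
  obtain ⟨ε₅, hε₅, hsep⟩ := exists_separation hε₁ hM₀ (2 * max ρ 0)
  refine ⟨min (min ε₂ ε₃) (min ε₄ ε₅), by positivity, fun ε hε0 hεle v y₀ hv hint => ?_⟩
  have l2 : ε ≤ ε₂ := hεle.trans ((min_le_left _ _).trans (min_le_left _ _))
  have l3 : ε ≤ ε₃ := hεle.trans ((min_le_left _ _).trans (min_le_right _ _))
  have l4 : ε ≤ ε₄ := hεle.trans ((min_le_right _ _).trans (min_le_left _ _))
  have l5 : ε ≤ ε₅ := hεle.trans ((min_le_right _ _).trans (min_le_right _ _))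
  have hfar : ∀ {z : ℝ × Sob 1} {D₀ : E3} {ζ₀ : Circle},
      InTube (fun x => (φ s x : ℂ)) ε z D₀ ζ₀ →
      ρ ≤ ‖-(1 / 2 : ℝ) • v‖ ∨ ρ ≤ ‖z.1 • v + y₀ + D₀‖ := by
    intro z D₀ ζ₀ hz
    have h1 := hsep v y₀ hv (hint.trans_le (ENNReal.ofReal_le_ofReal l5)) z.1 D₀ hz.1
      (hz.2.1.trans_le (mul_le_mul_of_nonneg_right l5 (Real.sqrt_nonneg _)))
    have h2 := le_max_left ρ 0
    have h3 := le_max_right ρ 0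
    refine h1.imp (fun h => ?_) (fun h => by linarith)
    rw [norm_smul, norm_neg, Real.norm_of_nonneg (by norm_num)]
    linarith
  have hdist : ∀ {z : ℝ × Sob 1} {D₀ : E3} {ζ₀ : Circle},
      InTube (fun x => (φ s x : ℂ)) ε z D₀ ζ₀ →
      ‖actL (-D₀) ζ₀⁻¹ (sobL2 z.2) - gsL2 φ s‖ < ε := fun hz => hO.dist_of_inMovedBall hs hz.2.2
  have hU : ∀ {z : ℝ × Sob 1} {D₀ : E3} {ζ₀ : Circle},
      InTube (fun x => (φ s x : ℂ)) ε z D₀ ζ₀ →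
      InjOn (fun x => flowSys φ lab Q c v y₀ D₀ ζ₀ (z, x)) (Metric.ball (0, 0, 0, s, 0) r₀) ∧
      (∀ x ∈ Metric.ball ((0, 0, 0, s, 0) : ModPar) r₀, ∀ A : ModPar →L[ℝ] ModIdx → ℝ,
        HasFDerivAt (fun x => flowSys φ lab Q c v y₀ D₀ ζ₀ (z, x)) A x → Function.Injective A) ∧
      ∃ x ∈ Metric.ball ((0, 0, 0, s, 0) : ModPar) (min r₀ r₁),
        flowSys φ lab Q c v y₀ D₀ ζ₀ (z, x) = 0 := by
    intro z D₀ ζ₀ hz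
    obtain ⟨κ, hκ, hκ'⟩ := exists_relGal_eq_twist v y₀ D₀ ζ₀ z.1
    have h1 := H1 κ _ _ hκ (hfar hz) _ ((hdist hz).trans_le l2)
    have h2 := hex κ _ _ hκ (hfar hz) _ ((hdist hz).trans_le l3)
    rw [← hκ'] at h1 h2
    exact ⟨h1.1, h1.2, h2⟩
  refine exists_glued hδ0 ?_ ?_ ?_
  · intro z D₀ ζ₀ hz D ζ p w D' ζ' p' w' h1 h2 h3 h4
    have h1 := h1.mono hδle
    have h2 := h2.mono hδle
    obtain ⟨x, hx, hxO, rfl, rfl, rfl, rfl⟩ := hδ D D₀ ζ ζ₀ p w h1.1 h1.2.1 h1.2.2.1 h1.2.2.2 h3.1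
    obtain ⟨x', hx', hxO', rfl, rfl, rfl, rfl⟩ := hδ D' D₀ ζ' ζ₀ p' w' h2.1 h2.2.1 h2.2.2.1
      h2.2.2.2 h4.1
    have e1 := (hO.isModulated_iff hl hxO h3.2.1 c v y₀ z D₀ ζ₀).1 h3
    have e2 := (hO.isModulated_iff hl hxO' h4.2.1 c v y₀ z D₀ ζ₀).1 h4
    have e3 : x' = x := (hU hz).1 hx' hx (e2.trans e1.symm)
    subst e3
    exact ⟨rfl, rfl, rfl, rfl⟩
  · intro z D₀ ζ₀ D₁ ζ₁ h0 h1
    exact hst D₀ D₁ ζ₀ ζ₁ z.2 ((hdist h0).trans_le l4) ((hdist h1).trans_le l4)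
  · intro z₁ D₀ ζ₀ hz
    obtain ⟨-, hi, x₁, hx₁, h0⟩ := hU hz
    have hx₀ := Metric.ball_subset_ball (min_le_left r₀ r₁) hx₁
    have hx₁' := Metric.ball_subset_ball (min_le_right r₀ r₁) hx₁
    obtain ⟨c1, -, -, -, c5⟩ := hcl x₁ hx₁'
    obtain ⟨ψ, hψ, hψ1, hψ0⟩ := exists_local_solution hO hl h hT c v y₀ D₀ ζ₀ c1
      (c5.trans_le (min_le_right _ _)) h0 (hi x₁ hx₀)
    refine ⟨fun z => D₀ + (ψ z).1, fun z => ζ₀ * Circle.exp (ψ z).2.1,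
      fun z => paramMap φ ((ψ z).2.2.2.1, (ψ z).2.2.1), fun z => (ψ z).2.2.2.2,
      hO.contDiffAt_coords hψ (by rw [hψ1]; exact c1) D₀ ζ₀, ?_⟩
    have hb : ∀ᶠ z in 𝓝 z₁, ψ z ∈ Metric.ball ((0, 0, 0, s, 0) : ModPar) r₁ :=
      hψ.continuousAt.eventually_mem (Metric.isOpen_ball.mem_nhds (by rw [hψ1]; exact hx₁'))
    filter_upwards [hψ0, hb] with z h1 h2
    obtain ⟨d1, d2, d3, d4, d5⟩ := hcl _ h2
    refine ⟨(hO.isModulated_iff hl d1 (d5.trans_le (min_le_right _ _)) c v y₀ z D₀ ζ₀).2 h1,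
      ?_, (d3 ζ₀).trans_le (min_le_left _ _), d4.trans_le (min_le_left _ _),
      d5.trans_le (min_le_left _ _)⟩
    rw [add_sub_cancel_left]
    exact d2.trans_le (min_le_left _ _)

end

end SolitonPotential

end

end

theorem proposition2p2
    (V : 𝓢(E3, ℝ)) (e₀ : ℝ) (hV : TrappingPotential V e₀)
    (φ₀ : Sob 2) (hφ₀ : LinearGroundState V e₀ φ₀)
    (β : ℝ → ℝ) (hβ : Nonlinearity β) :
    ∃ (a : ℝ) (Q : ℂ → Sob 2) (E : ℂ → ℝ), 0 < a ∧ SmallBoundStates V β e₀ φ₀ a Q E ∧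
      ∀ (O : Set ℝ) (φ : ℝ → E3 → ℝ), GroundStates β O φ →
      ∀ ω₁ ∈ O, ∀ ε₁ : ℝ, 0 < ε₁ → ∀ M₀ : ℝ, 0 < M₀ →
      ∃ ε₂ δ : ℝ, 0 < ε₂ ∧ 0 < δ ∧
        ∀ v y₀ : E3, M₀ < ‖v‖ → interaction ε₁ v y₀ < ENNReal.ofReal ε₂ →
        ∀ c : ℂ, c = 1 ∨ c = -Complex.I →
        ∃ (D : ℝ × Sob 1 → E3) (ζ : ℝ × Sob 1 → Circle) (p : ℝ × Sob 1 → E4)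
          (w : ℝ × Sob 1 → ℂ),
          -- smoothness of the parameters on the tube
          (ContDiffOn ℝ (⊤ : ℕ∞) D (tube (fun x => (φ ω₁ x : ℂ)) ε₂) ∧
            ContDiffOn ℝ (⊤ : ℕ∞) (fun z => (ζ z : ℂ)) (tube (fun x => (φ ω₁ x : ℂ)) ε₂) ∧
            ContDiffOn ℝ (⊤ : ℕ∞) p (tube (fun x => (φ ω₁ x : ℂ)) ε₂) ∧
            ContDiffOn ℝ (⊤ : ℕ∞) w (tube (fun x => (φ ω₁ x : ℂ)) ε₂)) ∧
          -- admissible values and the orthogonality conditions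
          (∀ t u, (t, u) ∈ tube (fun x => (φ ω₁ x : ℂ)) ε₂ →
            p (t, u) ∈ paramSet O φ ∧ ‖w (t, u)‖ < a ∧
            ModulationEqs O φ Q c v y₀ t u (D (t, u)) (ζ (t, u)) (p (t, u)) (w (t, u))) ∧
          -- the values on the orbit of the ground state
          (∀ (t : ℝ) (u : Sob 1) (D₀ : E3) (ζ₀ : Circle), 0 ≤ t → ‖D₀‖ < ε₂ * japanese t →
            (∀ᵐ x, sobFn u x = act D₀ ζ₀ (fun y => (φ ω₁ y : ℂ)) x) →
            p (t, u) = paramMap φ (ω₁, 0) ∧ D (t, u) = D₀ ∧ ζ (t, u) = ζ₀ ∧ w (t, u) = 0) ∧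
          -- closeness to `(τ₀, ϰ, 0)`, and uniqueness among all parameters that are so close
          (∀ (t : ℝ) (u : Sob 1) (D₀ : E3) (ζ₀ : Circle), 0 ≤ t → ‖D₀‖ < ε₂ * japanese t →
            InMovedBall (fun x => (φ ω₁ x : ℂ)) ε₂ D₀ ζ₀ u →
            (‖D (t, u) - D₀‖ < δ ∧ ‖(ζ (t, u) : ℂ) - ζ₀‖ < δ ∧
              ‖p (t, u) - paramMap φ (ω₁, 0)‖ < δ ∧ ‖w (t, u)‖ < δ) ∧
            ∀ (D' : E3) (ζ' : Circle) (p' : E4) (w' : ℂ),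
              ‖D' - D₀‖ < δ → ‖(ζ' : ℂ) - ζ₀‖ < δ → ‖p' - paramMap φ (ω₁, 0)‖ < δ →
              ‖w'‖ < δ → p' ∈ paramSet O φ → ‖w'‖ < a →
              ModulationEqs O φ Q c v y₀ t u D' ζ' p' w' →
              D' = D (t, u) ∧ ζ' = ζ (t, u) ∧ p' = p (t, u) ∧ w' = w (t, u)) := by
  obtain ⟨a, Q, E, ha, hQ, hT⟩ := exists_smallBoundStates hV.neg hφ₀ hβ.smooth hβ.zero
  refine ⟨a, Q, E, ha, hQ, fun O φ hO ω₁ hω₁ ε₁ hε₁ M₀ hM₀ => ?_⟩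
  have hmod := fun (c : ℂ) (hc : c ≠ 0) =>
    exists_modulation hO hω₁ hQ hφ₀ ha hT hc hε₁ hM₀
  choose δ₀ hδ₀ hmod using hmod
  choose ε₀ hε₀ hmod using hmod
  have hI : -Complex.I ≠ 0 := neg_ne_zero.2 Complex.I_ne_zero
  set δ := min (δ₀ 1 one_ne_zero) (δ₀ _ hI)
  have hδ : 0 < δ := lt_min (hδ₀ _ _) (hδ₀ _ _)
  set ε₂ := min (ε₀ 1 one_ne_zero δ hδ (min_le_left _ _)) (ε₀ _ hI δ hδ (min_le_right _ _))
  have hε : 0 < ε₂ := lt_min (hε₀ _ _ _ _ _) (hε₀ _ _ _ _ _)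
  refine ⟨ε₂, δ, hε, hδ, fun v y₀ hv hint c hc => ?_⟩
  obtain ⟨hc0, hle, hle'⟩ : ∃ (hc0 : c ≠ 0) (hle : δ ≤ δ₀ c hc0), ε₂ ≤ ε₀ c hc0 δ hδ hle := by
    rcases hc with rfl | rfl
    · exact ⟨one_ne_zero, min_le_left _ _, min_le_left _ _⟩
    · exact ⟨hI, min_le_right _ _, min_le_right _ _⟩
  obtain ⟨D, ζ, p, w, hsm, hsol, huniq⟩ := hmod c hc0 δ hδ hle ε₂ hε hle' v y₀ hv hint
  refine ⟨D, ζ, p, w, hsm, fun t u htu => hsol (t, u) htu, fun t u D₀ ζ₀ ht hD₀ hu => ?_,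
    fun t u D₀ ζ₀ ht hD₀ hu => ?_⟩
  · have h5 := (huniq (t, u) D₀ ζ₀ ⟨ht, hD₀, inMovedBall_of_orbit hε hu⟩).2 D₀ ζ₀
      (paramMap φ (ω₁, 0)) 0 (by simpa [ParClose] using hδ)
      ⟨⟨_, ⟨hω₁, Set.mem_univ _⟩, rfl⟩, by simpa using ha,
        hO.modulationEqs_orbit hω₁ (hQ.apply_zero ha) c v y₀ t hu⟩
    exact ⟨h5.2.2.1.symm, h5.1.symm, h5.2.1.symm, h5.2.2.2.symm⟩
  · obtain ⟨h5, h6⟩ := huniq (t, u) D₀ ζ₀ ⟨ht, hD₀, hu⟩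
    exact ⟨h5, fun D' ζ' p' w' a1 a2 a3 a4 a5 a6 a7 =>
      h6 D' ζ' p' w' ⟨a1, a2, a3, a4⟩ ⟨a5, a6, a7⟩⟩
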